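/- **Setting.** Let $\omega_h=\mathbf T\times\mathbf R$ with $\mathbf T=\mathbf R/\mathbf Z$, $x_h=(x,y)\in\omega_h$, $\omega=\omega_h\times(0,1)$, and $a^\perp=(-a_2,a_1)$, $\operatorname{rot}_h a=\partial_xa_2-\partial_ya_1$. *Coriolis factor.* $b=b(y)\in W^{2,\infty}_{loc}(\mathbf R)$ with $b(y)\ne0$ for $y\neq 0$, $|b|\ge C>0$ for $|y|\ge1$, $c^{-1}\le b'\le c$ for some $c>0$, and $b(y)\sim\beta y$ as $y\to0$ for some $\beta>0$. *Wind stress.* $\sigma=(\sigma_1,\sigma_2)\in H^s(\omega_h)$ (identified with its $C^2$ representative), $\int_{\mathbf T}\sigma_1(x,y)\,dx=0$ for all $y$, and for some $C$, $|\sigma(x,y)|\le C|y|^k$, $|\nabla\sigma(x,y)|\le C|y|^{k-1}$ on $\omega_h$. *Boundary layer flow.* For $\varepsilon>0$ put $\lambda^\pm=\frac{1\mp i\,\mathrm{sign}(b)}{\sqrt2}|b|^{1/2}$ and $u^{BL}(x_h,z)=U^{BL}(x_h,\frac{1-z}\varepsilon)$, where $$U^{BL}_h(x_h,\zeta)=\frac1{2\varepsilon}\sum_\pm\frac{\sigma\pm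 i\sigma^\perp}{\lambda^\pm}e^{-\lambda^\pm\zeta},$$ $$U^{BL}_3(x_h,\zeta)=-\frac12\sum_\pm\frac{\operatorname{div}_h\sigma\mp i\operatorname{rot}_h\sigma}{(\lambda^\pm)^2}e^{-\lambda^\pm\zeta}+\frac12\sum_\pm(\sigma\pm i\sigma^\perp)\cdot\frac{\nabla_h\lambda^\pm}{(\lambda^\pm)^3}(2+\zeta\lambda^\pm)e^{-\lambda^\pm\zeta}.$$ *Interior flow.* Let $w=\frac{\partial_x\sigma_2}b-\partial_y\frac{\sigma_1}b$, $S_1(x,y)=\int_0^x\sigma_1(x',y)\,dx'$, and $$u^{int}_1=-\partial_y\frac{\sigma_2}{b'}-\frac{\sigma_2}b+\partial_y\frac{\partial_yS_1}{b'},\qquad u^{int}_2=\frac b{b'}w,\qquad u^{int}_3=zw.$$ *Stationary flow.* $u^{stat}=u^{BL}+u^{int}+v^{int}$, where, with $\varphi_h=\partial_zu^{BL}_h|_{z=0}$ and $\varphi_3=-u^{BL}_3|_{z=0}$, $$v^{int}_h=\tfrac{(1-z)^2}2\varphi_h+\nabla_h\chi,\qquad v^{int}_3=\int_z^1\operatorname{div}_hv^{int}_h\,dz',\qquad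 \Delta_h\chi=\varphi_3-\tfrac16\operatorname{div}_h\varphi_h,\quad \nabla_h\chi\in H^1(\omega_h).$$ Thus $u^{stat}$ is divergence free, with $\partial_zu^{stat}_h=0$ at $z=0$, $\partial_zu_h^{stat}=\varepsilon^{-2}\sigma$ at $z=1$, and $u^{stat}_3=0$ at $z=0$ and $z=1$. **Proposition.** There are integers $k_0,s_0\ge2$ such that the following holds for all integers $k\ge k_0$, $s\ge s_0$, all $\lambda>0$, all $b,\sigma$ as above with $$\|\nabla_hu^{int}_h\|_{L^\infty(\omega)}\le\frac\lambda4$$ (each entry of the matrix being bounded by $\lambda/4$), and all $\theta_1\in H^2(\omega_h)$. For $\varepsilon>0$ let $\theta=\theta^\varepsilon\in H^1(\omega)$ be a weak solution of $$u^{stat}\cdot\nabla\theta-\varepsilon^2\lambda\Delta_h\theta-\lambda\partial_{zz}\theta=0\ \text{ in }\omega,\qquad\theta|_{z=1}=\theta_1,\quad\partial_z\theta|_{z=0}=0.$$ Let $\bar\theta\in L^2(\omega_h,H^1(0,1))$ be a weak solution of $$-\lambda\partial_{zz}\bar\theta+u^{int}\cdot\nabla\bar\theta=0\ \text{ in }\omega,\qquad\bar\theta|_{z=1}=\theta_1,\quad\partial_z\bar\theta|_{z=0}=0,$$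 and let $\theta^{BL}$ be the solution of $$-\lambda\partial_{\zeta\zeta}\theta^{BL}(x_h,\zeta)+\varepsilon u^{BL}_h(x_h,1-\varepsilon\zeta)\cdot\nabla_h\theta_1(x_h)=0\ \ (\zeta>0),\qquad\theta^{BL}(x_h,\zeta)\to0\ \text{ as }\zeta\to\infty.$$ Put $\theta^{app}(x_h,z)=\bar\theta(x_h,z)+\varepsilon\,\theta^{BL}\bigl(x_h,\frac{1-z}\varepsilon\bigr)$. Then $\theta-\theta^{app}$ and its weak derivative $\partial_z(\theta-\theta^{app})$ belong to $L^2(\omega)$ for every $\varepsilon>0$, and $$\|\theta-\theta^{app}\|_{L^2(\omega)}+\|\partial_z(\theta-\theta^{app})\|_{L^2(\omega)}\to0\quad\text{as }\varepsilon\to0.$$ -/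

import Mathlib

open MeasureTheory Filter Topology Set
open scoped ContDiff

noncomputable section

namespace BetaPlane

/-! ## The domain

`ω_h = 𝕋 × ℝ` with `𝕋 = ℝ/ℤ`, and `ω = ω_h × (0,1)`.  A point of `ω_h` is `p = (x, y)` and a point
of `ω` is `P = ((x, y), z)`.  Integrals over `ω_h` and `ω` are integrals over the fundamental cells
below; the periodicity in `x` is carried by the test functions. -/

/-- Fundamental cell of `ω_h`. -/
def cellH : Set (ℝ × ℝ) := Ioo (0 : ℝ) 1 ×ˢ (univ : Set ℝ)

/-- Fundamental cell of `ω`. -/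
def cell : Set ((ℝ × ℝ) × ℝ) := cellH ×ˢ Ioo (0 : ℝ) 1

/-- Lebesgue measure on `ω_h`. -/
def muH : Measure (ℝ × ℝ) := volume.restrict cellH

/-- Lebesgue measure on `ω`. -/
def muO : Measure ((ℝ × ℝ) × ℝ) := volume.restrict cell

/-- Classical partial derivatives on `ω_h`. -/
def pdx (f : ℝ × ℝ → ℝ) (p : ℝ × ℝ) : ℝ := deriv (fun t => f (t, p.2)) p.1

def pdy (f : ℝ × ℝ → ℝ) (p : ℝ × ℝ) : ℝ := deriv (fun t => f (p.1, t)) p.2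

/-- Classical partial derivatives on `ω`. -/
def dX (f : (ℝ × ℝ) × ℝ → ℝ) (P : (ℝ × ℝ) × ℝ) : ℝ := deriv (fun t => f ((t, P.1.2), P.2)) P.1.1

def dY (f : (ℝ × ℝ) × ℝ → ℝ) (P : (ℝ × ℝ) × ℝ) : ℝ := deriv (fun t => f ((P.1.1, t), P.2)) P.1.2

def dZ (f : (ℝ × ℝ) × ℝ → ℝ) (P : (ℝ × ℝ) × ℝ) : ℝ := deriv (fun t => f (P.1, t)) P.2

/-- Test functions on `ω_h`: smooth, `1`-periodic in `x`, supported in a bounded range of `y`. -/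
structure IsTestH (φ : ℝ × ℝ → ℝ) : Prop where
  smooth : ContDiff ℝ ∞ φ
  periodic : ∀ x y : ℝ, φ (x + 1, y) = φ (x, y)
  support : ∃ R : ℝ, ∀ x y : ℝ, R ≤ |y| → φ (x, y) = 0

/-- Test functions on `ω`, smooth up to the boundary `z = 0`, `z = 1`: `1`-periodic in `x`, supported
in a bounded range of `y`; conditions at `z = 0` or `z = 1` are imposed separately. -/
structure IsTest (φ : (ℝ × ℝ) × ℝ → ℝ) : Prop where
  smooth : ContDiff ℝ ∞ φ
  periodic : ∀ x y z : ℝ, φ ((x + 1, y), z) = φ ((x, y), z)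
  support : ∃ R : ℝ, ∀ x y z : ℝ, R ≤ |y| → φ ((x, y), z) = 0

/-! ## Weak derivatives and Sobolev spaces -/

/-- `g` is the weak derivative `∂_x f` on `ω_h`. -/
structure IsWeakDx (f g : ℝ × ℝ → ℝ) : Prop where
  locInt : LocallyIntegrableOn f (Icc (0 : ℝ) 1 ×ˢ (univ : Set ℝ)) volume
  locInt' : LocallyIntegrableOn g (Icc (0 : ℝ) 1 ×ˢ (univ : Set ℝ)) volume
  eq : ∀ φ, IsTestH φ → ∫ p, f p * pdx φ p ∂muH = -∫ p, g p * φ p ∂muH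

/-- `g` is the weak derivative `∂_y f` on `ω_h`. -/
structure IsWeakDy (f g : ℝ × ℝ → ℝ) : Prop where
  locInt : LocallyIntegrableOn f (Icc (0 : ℝ) 1 ×ˢ (univ : Set ℝ)) volume
  locInt' : LocallyIntegrableOn g (Icc (0 : ℝ) 1 ×ˢ (univ : Set ℝ)) volume
  eq : ∀ φ, IsTestH φ → ∫ p, f p * pdy φ p ∂muH = -∫ p, g p * φ p ∂muH

/-- The Sobolev space `H^n(ω_h)`, `n` a natural number. -/
def MemH : ℕ → (ℝ × ℝ → ℝ) → Prop
  | 0, f => MemLp f 2 muH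
  | n + 1, f => MemLp f 2 muH ∧
      ∃ gx gy : ℝ × ℝ → ℝ, IsWeakDx f gx ∧ IsWeakDy f gy ∧ MemH n gx ∧ MemH n gy

/-- `f, g ∈ L²(ω)` and `g` is the weak derivative `∂_z f` on `ω`. -/
structure IsWeakDz (f g : (ℝ × ℝ) × ℝ → ℝ) : Prop where
  memLp : MemLp f 2 muO
  memLp' : MemLp g 2 muO
  eq : ∀ φ, IsTest φ → (∀ p, φ (p, 0) = 0) → (∀ p, φ (p, 1) = 0) →
    ∫ P, f P * dZ φ P ∂muO = -∫ P, g P * φ P ∂muO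

/-- For `f ∈ L²(ω_h, H¹(0,1))` with `∂_z f = g`: the trace of `f` on `z = 1` is `h`. -/
def HasTopTrace (f g : (ℝ × ℝ) × ℝ → ℝ) (h : ℝ × ℝ → ℝ) : Prop :=
  ∀ φ, IsTest φ → (∀ p, φ (p, 0) = 0) →
    ∫ P, (f P * dZ φ P + g P * φ P) ∂muO = ∫ p, h p * φ (p, 1) ∂muH

/-! ## The Coriolis factor and the wind stress -/

/-- Assumptions on the Coriolis factor `b = b(y)`.  The first two fields say `b ∈ W^{2,∞}_loc(ℝ)`. -/
structure IsCoriolis (b : ℝ → ℝ) : Prop where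
  diff : Differentiable ℝ b
  lip : LocallyLipschitz (deriv b)
  ne_zero : ∀ y, y ≠ 0 → b y ≠ 0
  lower : ∃ C : ℝ, 0 < C ∧ ∀ y, 1 ≤ |y| → C ≤ |b y|
  deriv_bounds : ∃ c : ℝ, 0 < c ∧ ∀ y, c⁻¹ ≤ deriv b y ∧ deriv b y ≤ c
  equiv : ∃ β : ℝ, 0 < β ∧ Asymptotics.IsEquivalent (𝓝 0) b (fun y => β * y)

/-- Assumptions on the wind stress `σ = (σ₁, σ₂)`: it belongs to `H^s(ω_h)` (and is identified with
its `C²` representative, which exists as soon as `s ≥ 4`), it vanishes to order `k` at `y = 0`, and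
`σ₁` has zero zonal average. -/
structure IsWind (k s : ℕ) (σ₁ σ₂ : ℝ × ℝ → ℝ) : Prop where
  smooth₁ : ContDiff ℝ 2 σ₁
  smooth₂ : ContDiff ℝ 2 σ₂
  periodic₁ : ∀ x y : ℝ, σ₁ (x + 1, y) = σ₁ (x, y)
  periodic₂ : ∀ x y : ℝ, σ₂ (x + 1, y) = σ₂ (x, y)
  memH₁ : MemH s σ₁
  memH₂ : MemH s σ₂
  vanish : ∃ C : ℝ, ∀ p : ℝ × ℝ, |σ₁ p| ≤ C * |p.2| ^ k ∧ |σ₂ p| ≤ C * |p.2| ^ k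
  vanish_grad : ∃ C : ℝ, ∀ p : ℝ × ℝ,
    |pdx σ₁ p| ≤ C * |p.2| ^ (k - 1) ∧ |pdy σ₁ p| ≤ C * |p.2| ^ (k - 1) ∧
    |pdx σ₂ p| ≤ C * |p.2| ^ (k - 1) ∧ |pdy σ₂ p| ≤ C * |p.2| ^ (k - 1)
  compat : ∀ y : ℝ, ∫ x in (0 : ℝ)..1, σ₁ (x, y) = 0

/-- A vector field on `ω`. -/
structure Velocity where
  u₁ : (ℝ × ℝ) × ℝ → ℝ
  u₂ : (ℝ × ℝ) × ℝ → ℝ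
  u₃ : (ℝ × ℝ) × ℝ → ℝ

/-! ## The boundary layer part `u^BL`

The sign `±` is a real number `s ∈ {1, -1}`. -/

/-- The decay rates `λ^± = (1 ∓ i sign b) / √2 * |b|^{1/2}`. -/
def rate (b : ℝ → ℝ) (s : ℝ) (y : ℝ) : ℂ :=
  (1 - (s : ℂ) * Complex.I * (Real.sign (b y) : ℂ)) / (Real.sqrt 2 : ℂ) * (Real.sqrt |b y| : ℂ)

/-- Sum over the two signs; the two terms are complex conjugates of each other in all uses. -/
def sumPM (F : ℝ → ℂ) : ℝ := (F 1 + F (-1)).re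

/-- The two components of `σ ± i σ^⊥`, where `σ^⊥ = (-σ₂, σ₁)`. -/
def amp₁ (σ₁ σ₂ : ℝ × ℝ → ℝ) (s : ℝ) (p : ℝ × ℝ) : ℂ :=
  (σ₁ p : ℂ) - (s : ℂ) * Complex.I * (σ₂ p : ℂ)

def amp₂ (σ₁ σ₂ : ℝ × ℝ → ℝ) (s : ℝ) (p : ℝ × ℝ) : ℂ :=
  (σ₂ p : ℂ) + (s : ℂ) * Complex.I * (σ₁ p : ℂ)

/-- `div_h σ` and `rot_h σ`. -/
def divH (f₁ f₂ : ℝ × ℝ → ℝ) (p : ℝ × ℝ) : ℝ := pdx f₁ p + pdy f₂ p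

def rotH (f₁ f₂ : ℝ × ℝ → ℝ) (p : ℝ × ℝ) : ℝ := pdx f₂ p - pdy f₁ p

/-- `U^BL_h(x_h, ζ) = (1/2ε) ∑_± (σ ± i σ^⊥) / λ^± * exp(-λ^± ζ)`. -/
def profile₁ (b : ℝ → ℝ) (σ₁ σ₂ : ℝ × ℝ → ℝ) (ε : ℝ) (p : ℝ × ℝ) (ζ : ℝ) : ℝ :=
  1 / (2 * ε) * sumPM fun s =>
    amp₁ σ₁ σ₂ s p / rate b s p.2 * Complex.exp (-rate b s p.2 * (ζ : ℂ))

def profile₂ (b : ℝ → ℝ) (σ₁ σ₂ : ℝ × ℝ → ℝ) (ε : ℝ) (p : ℝ × ℝ) (ζ : ℝ) : ℝ :=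
  1 / (2 * ε) * sumPM fun s =>
    amp₂ σ₁ σ₂ s p / rate b s p.2 * Complex.exp (-rate b s p.2 * (ζ : ℂ))

/-- `U^BL_3 = -ε ∫_ζ^∞ div_h U^BL_h`, in closed form. -/
def profile₃ (b : ℝ → ℝ) (σ₁ σ₂ : ℝ × ℝ → ℝ) (p : ℝ × ℝ) (ζ : ℝ) : ℝ :=
  sumPM fun s =>
    (-(1 / 2 : ℂ) * ((divH σ₁ σ₂ p : ℂ) - (s : ℂ) * Complex.I * (rotH σ₁ σ₂ p : ℂ))
        / rate b s p.2 ^ 2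
      + (1 / 2 : ℂ) * (amp₂ σ₁ σ₂ s p * deriv (rate b s) p.2 / rate b s p.2 ^ 3)
        * (2 + (ζ : ℂ) * rate b s p.2))
    * Complex.exp (-rate b s p.2 * (ζ : ℂ))

/-- `u^BL(x_h, z) = U^BL(x_h, (1 - z)/ε)`. -/
def uBL (b : ℝ → ℝ) (σ₁ σ₂ : ℝ × ℝ → ℝ) (ε : ℝ) : Velocity where
  u₁ P := profile₁ b σ₁ σ₂ ε P.1 ((1 - P.2) / ε)
  u₂ P := profile₂ b σ₁ σ₂ ε P.1 ((1 - P.2) / ε)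
  u₃ P := profile₃ b σ₁ σ₂ P.1 ((1 - P.2) / ε)

/-! ## The interior part `u^int` -/

/-- The Ekman pumping velocity `w = ∂_x σ₂ / b - ∂_y (σ₁ / b)`. -/
def pump (b : ℝ → ℝ) (σ₁ σ₂ : ℝ × ℝ → ℝ) (p : ℝ × ℝ) : ℝ :=
  pdx σ₂ p / b p.2 - pdy (fun q => σ₁ q / b q.2) p

/-- `S₁(x, y) = ∫_0^x σ₁(x', y) dx'`. -/
def zonalPrimitive (σ₁ : ℝ × ℝ → ℝ) (p : ℝ × ℝ) : ℝ := ∫ t in (0 : ℝ)..p.1, σ₁ (t, p.2)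

/-- `u^int_1 = -∂_y (σ₂ / b') - σ₂ / b + ∂_y (∂_y S₁ / b')`, the solution of
`∂_x u^int_1 = -∂_y u^int_2 - w`. -/
def int₁ (b : ℝ → ℝ) (σ₁ σ₂ : ℝ × ℝ → ℝ) (p : ℝ × ℝ) : ℝ :=
  -pdy (fun q => σ₂ q / deriv b q.2) p - σ₂ p / b p.2
    + pdy (fun q => pdy (zonalPrimitive σ₁) q / deriv b q.2) p

/-- The Sverdrup relation `u^int_2 = (b / b') w`. -/
def int₂ (b : ℝ → ℝ) (σ₁ σ₂ : ℝ × ℝ → ℝ) (p : ℝ × ℝ) : ℝ :=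
  b p.2 / deriv b p.2 * pump b σ₁ σ₂ p

def uInt (b : ℝ → ℝ) (σ₁ σ₂ : ℝ × ℝ → ℝ) : Velocity where
  u₁ P := int₁ b σ₁ σ₂ P.1
  u₂ P := int₂ b σ₁ σ₂ P.1
  u₃ P := P.2 * pump b σ₁ σ₂ P.1

/-- `‖∇_h u^int_h‖_{L^∞(ω)} ≤ M`, entry by entry (`u^int_h` does not depend on `z`). -/
def GradIntBound (b : ℝ → ℝ) (σ₁ σ₂ : ℝ × ℝ → ℝ) (M : ℝ) : Prop :=
  ∃ g₁x g₁y g₂x g₂y : ℝ × ℝ → ℝ,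
    IsWeakDx (int₁ b σ₁ σ₂) g₁x ∧ IsWeakDy (int₁ b σ₁ σ₂) g₁y ∧
    IsWeakDx (int₂ b σ₁ σ₂) g₂x ∧ IsWeakDy (int₂ b σ₁ σ₂) g₂y ∧
    ∀ᵐ p ∂muH, |g₁x p| ≤ M ∧ |g₁y p| ≤ M ∧ |g₂x p| ≤ M ∧ |g₂y p| ≤ M

/-! ## The corrector `v^int` and the stationary flow

`v^int` is divergence free and restores the boundary conditions of `u^BL + u^int` at the bottom:
`v^int_h = (1-z)²/2 φ_h + ∇_h χ`, where `φ_h = ∂_z u^BL_h` and `φ_3 = -u^BL_3` at `z = 0`, and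
`Δ_h χ = φ_3 - div_h φ_h / 6`. -/

/-- `φ_h` and `φ_3`. -/
def bot₁ (b : ℝ → ℝ) (σ₁ σ₂ : ℝ × ℝ → ℝ) (ε : ℝ) (p : ℝ × ℝ) : ℝ := dZ (uBL b σ₁ σ₂ ε).u₁ (p, 0)

def bot₂ (b : ℝ → ℝ) (σ₁ σ₂ : ℝ × ℝ → ℝ) (ε : ℝ) (p : ℝ × ℝ) : ℝ := dZ (uBL b σ₁ σ₂ ε).u₂ (p, 0)

def bot₃ (b : ℝ → ℝ) (σ₁ σ₂ : ℝ × ℝ → ℝ) (ε : ℝ) (p : ℝ × ℝ) : ℝ := -(uBL b σ₁ σ₂ ε).u₃ (p, 0)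

/-- The right-hand side `φ_3 - div_h φ_h / 6` of the Poisson equation for `χ`. -/
def poissonRhs (b : ℝ → ℝ) (σ₁ σ₂ : ℝ × ℝ → ℝ) (ε : ℝ) (p : ℝ × ℝ) : ℝ :=
  bot₃ b σ₁ σ₂ ε p - divH (bot₁ b σ₁ σ₂ ε) (bot₂ b σ₁ σ₂ ε) p / 6

/-- `(gx, gy) = ∇_h χ ∈ H¹(ω_h)`, where `Δ_h χ = f` weakly on `ω_h`.  These conditions determine
`(gx, gy)` almost everywhere. -/
def IsPotentialGradient (f gx gy : ℝ × ℝ → ℝ) : Prop :=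
  (∃ χ : ℝ × ℝ → ℝ, IsWeakDx χ gx ∧ IsWeakDy χ gy) ∧ MemH 1 gx ∧ MemH 1 gy ∧
    ∀ φ, IsTestH φ → ∫ p, (gx p * pdx φ p + gy p * pdy φ p) ∂muH = -∫ p, f p * φ p ∂muH

/-- `v^int`; its third component is `∫_z^1 div_h v^int_h`. -/
def vInt (b : ℝ → ℝ) (σ₁ σ₂ : ℝ × ℝ → ℝ) (ε : ℝ) (gx gy : ℝ × ℝ → ℝ) : Velocity where
  u₁ P := (1 - P.2) ^ 2 / 2 * bot₁ b σ₁ σ₂ ε P.1 + gx P.1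
  u₂ P := (1 - P.2) ^ 2 / 2 * bot₂ b σ₁ σ₂ ε P.1 + gy P.1
  u₃ P := (1 - P.2) ^ 3 / 6 * divH (bot₁ b σ₁ σ₂ ε) (bot₂ b σ₁ σ₂ ε) P.1
    + (1 - P.2) * poissonRhs b σ₁ σ₂ ε P.1

/-- `v` is the stationary flow `u^stat = u^BL + u^int + v^int`. -/
def IsStationaryFlow (b : ℝ → ℝ) (σ₁ σ₂ : ℝ × ℝ → ℝ) (ε : ℝ) (v : Velocity) : Prop :=
  ∃ gx gy : ℝ × ℝ → ℝ, IsPotentialGradient (poissonRhs b σ₁ σ₂ ε) gx gy ∧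
    (∀ P, v.u₁ P =
      (uBL b σ₁ σ₂ ε).u₁ P + (uInt b σ₁ σ₂).u₁ P + (vInt b σ₁ σ₂ ε gx gy).u₁ P) ∧
    (∀ P, v.u₂ P =
      (uBL b σ₁ σ₂ ε).u₂ P + (uInt b σ₁ σ₂).u₂ P + (vInt b σ₁ σ₂ ε gx gy).u₂ P) ∧
    (∀ P, v.u₃ P =
      (uBL b σ₁ σ₂ ε).u₃ P + (uInt b σ₁ σ₂).u₃ P + (vInt b σ₁ σ₂ ε gx gy).u₃ P)

/-! ## The temperature equations -/

/-- `θ ∈ H¹(ω)` is a weak solution of `v · ∇θ - ε² λ Δ_h θ - λ ∂_zz θ = 0` in `ω`, with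
`θ = θ₁` at `z = 1` and `∂_z θ = 0` at `z = 0`. -/
def IsTemperature (lam ε : ℝ) (v : Velocity) (θ₁ : ℝ × ℝ → ℝ) (θ : (ℝ × ℝ) × ℝ → ℝ) : Prop :=
  ∃ θx θy θz : (ℝ × ℝ) × ℝ → ℝ,
    MemLp θx 2 muO ∧ MemLp θy 2 muO ∧ IsWeakDz θ θz ∧
    (∀ φ, IsTest φ → ∫ P, θ P * dX φ P ∂muO = -∫ P, θx P * φ P ∂muO) ∧
    (∀ φ, IsTest φ → ∫ P, θ P * dY φ P ∂muO = -∫ P, θy P * φ P ∂muO) ∧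
    HasTopTrace θ θz θ₁ ∧
    ∀ φ, IsTest φ → (∀ p, φ (p, 1) = 0) →
      ∫ P, ((v.u₁ P * θx P + v.u₂ P * θy P + v.u₃ P * θz P) * φ P
        + ε ^ 2 * lam * (θx P * dX φ P + θy P * dY φ P) + lam * (θz P * dZ φ P)) ∂muO = 0

/-- `θ ∈ L²(ω_h, H¹(0,1))` is a weak solution of `-λ ∂_zz θ + v · ∇θ = 0` in `ω`, with `θ = θ₁` at
`z = 1` and `∂_z θ = 0` at `z = 0`, for a divergence-free field `v` with `v₃ = 0` at `z = 0`. -/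
def IsInteriorTemperature (lam : ℝ) (v : Velocity) (θ₁ : ℝ × ℝ → ℝ) (θ : (ℝ × ℝ) × ℝ → ℝ) : Prop :=
  ∃ θz : (ℝ × ℝ) × ℝ → ℝ, IsWeakDz θ θz ∧ HasTopTrace θ θz θ₁ ∧
    ∀ φ, IsTest φ → (∀ p, φ (p, 1) = 0) →
      ∫ P, (lam * (θz P * dZ φ P)
        - θ P * (v.u₁ P * dX φ P + v.u₂ P * dY φ P + v.u₃ P * dZ φ P)) ∂muO = 0

/-- `Θ(x_h, ζ)` solves `-λ ∂_ζζ Θ + ε u^BL_h(x_h, 1 - εζ) · ∇_h θ₁ = 0` for `ζ > 0` and tends to `0`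
as `ζ → ∞`, for almost every `x_h`; here `vBL` is the boundary layer velocity. -/
def IsLayerTemperature (lam ε : ℝ) (vBL : Velocity) (θ₁ : ℝ × ℝ → ℝ) (Θ : ℝ × ℝ → ℝ → ℝ) : Prop :=
  ∃ gx gy : ℝ × ℝ → ℝ, IsWeakDx θ₁ gx ∧ IsWeakDy θ₁ gy ∧
    ∀ᵐ p ∂muH, Tendsto (Θ p) atTop (𝓝 0) ∧
      ∀ ζ : ℝ, 0 < ζ → DifferentiableAt ℝ (Θ p) ζ ∧ DifferentiableAt ℝ (deriv (Θ p)) ζ ∧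
        -lam * deriv (deriv (Θ p)) ζ
          + ε * (vBL.u₁ (p, 1 - ε * ζ) * gx p + vBL.u₂ (p, 1 - ε * ζ) * gy p) = 0

/-- `θ^app(x_h, z) = θ̄(x_h, z) + ε θ^BL(x_h, (1 - z)/ε)`. -/
def approxTemperature (ε : ℝ) (θbar : (ℝ × ℝ) × ℝ → ℝ) (Θ : ℝ × ℝ → ℝ → ℝ)
    (P : (ℝ × ℝ) × ℝ) : ℝ :=
  θbar P + ε * Θ P.1 ((1 - P.2) / ε)

end BetaPlane

end

open BetaPlane

namespace BetaPlane

open Real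

noncomputable section

notation "ℝ²" => ℝ × ℝ

notation "ℝ³" => (ℝ × ℝ) × ℝ

notation "F²" => ℝ² → ℝ

notation "F³" => ℝ³ → ℝ

abbrev AESM {X Y : Type*} [TopologicalSpace Y] [MeasurableSpace X] (f : X → Y) (μ : Measure X) : Prop :=
  AEStronglyMeasurable f μ

notation "sπ(" t ")" => sin (π * t)

lemma mul_le_left {a b c : ℝ} (h : b ≤ c) (ha : 0 ≤ a) : a * b ≤ a * c :=
  mul_le_mul_of_nonneg_left h ha

lemma mul_le_right {a b c : ℝ} (h : b ≤ c) (ha : 0 ≤ a) : b * a ≤ c * a :=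
  mul_le_mul_of_nonneg_right h ha

/-! ## Calculus for partial derivatives and test functions -/

section PartialDerivatives

variable {f g : F²} {F G : F³}

lemma hasDerivAt_pdx (hf : Differentiable ℝ f) (p : ℝ²) :
    HasDerivAt (fun t => f (t, p.2)) (pdx f p) p.1 :=
  (DifferentiableAt.comp (g := f) p.1 (hf _) (by fun_prop)).hasDerivAt

lemma hasDerivAt_pdy (hf : Differentiable ℝ f) (p : ℝ²) :
    HasDerivAt (fun t => f (p.1, t)) (pdy f p) p.2 :=
  (DifferentiableAt.comp (g := f) p.2 (hf _) (by fun_prop)).hasDerivAt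

lemma hasDerivAt_dX (hF : Differentiable ℝ F) (P : ℝ³) :
    HasDerivAt (fun t => F ((t, P.1.2), P.2)) (dX F P) P.1.1 :=
  (DifferentiableAt.comp (g := F) P.1.1 (hF _) (by fun_prop)).hasDerivAt

lemma hasDerivAt_dY (hF : Differentiable ℝ F) (P : ℝ³) :
    HasDerivAt (fun t => F ((P.1.1, t), P.2)) (dY F P) P.1.2 :=
  (DifferentiableAt.comp (g := F) P.1.2 (hF _) (by fun_prop)).hasDerivAt

lemma hasDerivAt_dZ (hF : Differentiable ℝ F) (P : ℝ³) :
    HasDerivAt (fun t => F (P.1, t)) (dZ F P) P.2 :=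
  (DifferentiableAt.comp (g := F) P.2 (hF _) (by fun_prop)).hasDerivAt

lemma pdx_eq_fderiv (hf : Differentiable ℝ f) (p : ℝ²) : pdx f p = fderiv ℝ f p (1, 0) := by
  have h : HasDerivAt (fun t : ℝ => (t, p.2)) ((1 : ℝ), (0 : ℝ)) p.1 :=
    (hasDerivAt_id _).prodMk (hasDerivAt_const _ _)
  exact (hasDerivAt_pdx hf p).unique (HasFDerivAt.comp_hasDerivAt (l := f) p.1 ((hf _).hasFDerivAt) h)

lemma pdy_eq_fderiv (hf : Differentiable ℝ f) (p : ℝ²) : pdy f p = fderiv ℝ f p (0, 1) := by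
  have h : HasDerivAt (fun t : ℝ => (p.1, t)) ((0 : ℝ), (1 : ℝ)) p.2 :=
    (hasDerivAt_const _ _).prodMk (hasDerivAt_id _)
  exact (hasDerivAt_pdy hf p).unique (HasFDerivAt.comp_hasDerivAt (l := f) p.2 ((hf _).hasFDerivAt) h)

lemma dX_eq_fderiv (hF : Differentiable ℝ F) (P : ℝ³) : dX F P = fderiv ℝ F P ((1, 0), 0) := by
  have h : HasDerivAt (fun t : ℝ => ((t, P.1.2), P.2)) (((1 : ℝ), (0 : ℝ)), (0 : ℝ)) P.1.1 :=
    ((hasDerivAt_id _).prodMk (hasDerivAt_const _ _)).prodMk (hasDerivAt_const _ _)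
  exact (hasDerivAt_dX hF P).unique (HasFDerivAt.comp_hasDerivAt (l := F) P.1.1 ((hF _).hasFDerivAt) h)

lemma dY_eq_fderiv (hF : Differentiable ℝ F) (P : ℝ³) : dY F P = fderiv ℝ F P ((0, 1), 0) := by
  have h : HasDerivAt (fun t : ℝ => ((P.1.1, t), P.2)) (((0 : ℝ), (1 : ℝ)), (0 : ℝ)) P.1.2 :=
    ((hasDerivAt_const _ _).prodMk (hasDerivAt_id _)).prodMk (hasDerivAt_const _ _)
  exact (hasDerivAt_dY hF P).unique (HasFDerivAt.comp_hasDerivAt (l := F) P.1.2 ((hF _).hasFDerivAt) h)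

lemma dZ_eq_fderiv (hF : Differentiable ℝ F) (P : ℝ³) : dZ F P = fderiv ℝ F P ((0, 0), 1) := by
  have h : HasDerivAt (fun t : ℝ => (P.1, t)) (((0 : ℝ), (0 : ℝ)), (1 : ℝ)) P.2 :=
    (hasDerivAt_const _ _).prodMk (hasDerivAt_id _)
  exact (hasDerivAt_dZ hF P).unique (HasFDerivAt.comp_hasDerivAt (l := F) P.2 ((hF _).hasFDerivAt) h)

lemma contDiff_pdx {n m : WithTop ℕ∞} (hf : ContDiff ℝ n f) (hm : m + 1 ≤ n) :
    ContDiff ℝ m (pdx f) := by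
  have h : pdx f = fun p => fderiv ℝ f p (1, 0) :=
    funext (pdx_eq_fderiv (hf.differentiable (fun h => by simp [h] at hm)))
  rw [h]
  exact (hf.fderiv_right hm).clm_apply contDiff_const

lemma contDiff_pdy {n m : WithTop ℕ∞} (hf : ContDiff ℝ n f) (hm : m + 1 ≤ n) :
    ContDiff ℝ m (pdy f) := by
  have h : pdy f = fun p => fderiv ℝ f p (0, 1) :=
    funext (pdy_eq_fderiv (hf.differentiable (fun h => by simp [h] at hm)))
  rw [h]
  exact (hf.fderiv_right hm).clm_apply contDiff_const

lemma contDiff_dX (hF : ContDiff ℝ ∞ F) : ContDiff ℝ ∞ (dX F) := by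
  have h : dX F = fun p => fderiv ℝ F p ((1, 0), 0) :=
    funext (dX_eq_fderiv (hF.differentiable (by simp)))
  rw [h]
  exact (hF.fderiv_right (by simp)).clm_apply contDiff_const

lemma contDiff_dY (hF : ContDiff ℝ ∞ F) : ContDiff ℝ ∞ (dY F) := by
  have h : dY F = fun p => fderiv ℝ F p ((0, 1), 0) :=
    funext (dY_eq_fderiv (hF.differentiable (by simp)))
  rw [h]
  exact (hF.fderiv_right (by simp)).clm_apply contDiff_const

lemma contDiff_dZ (hF : ContDiff ℝ ∞ F) : ContDiff ℝ ∞ (dZ F) := by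
  have h : dZ F = fun p => fderiv ℝ F p ((0, 0), 1) :=
    funext (dZ_eq_fderiv (hF.differentiable (by simp)))
  rw [h]
  exact (hF.fderiv_right (by simp)).clm_apply contDiff_const

lemma pdx_mul (hf : Differentiable ℝ f) (hg : Differentiable ℝ g) (p : ℝ²) :
    pdx (fun q => f q * g q) p = pdx f p * g p + f p * pdx g p :=
  ((hasDerivAt_pdx hf p).mul (hasDerivAt_pdx hg p)).deriv

lemma pdy_mul (hf : Differentiable ℝ f) (hg : Differentiable ℝ g) (p : ℝ²) :
    pdy (fun q => f q * g q) p = pdy f p * g p + f p * pdy g p :=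
  ((hasDerivAt_pdy hf p).mul (hasDerivAt_pdy hg p)).deriv

lemma pdx_periodic (hf : ∀ x y, f (x + 1, y) = f (x, y)) (x y : ℝ) :
    pdx f (x + 1, y) = pdx f (x, y) := by
  have h := deriv_comp_add_const (fun t => f (t, y)) 1 x
  simp only [hf] at h
  exact h.symm

lemma pdy_periodic (hf : ∀ x y, f (x + 1, y) = f (x, y)) (x y : ℝ) :
    pdy f (x + 1, y) = pdy f (x, y) := by
  simp only [pdy, hf]

lemma periodic_add_int (hf : ∀ x y, f (x + 1, y) = f (x, y)) (x y : ℝ) (k : ℤ) :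
    f (x + k, y) = f (x, y) := by
  have h : Function.Periodic (fun t => f (t, y)) 1 := fun t => hf t y
  simpa using h.int_mul k x

end PartialDerivatives

lemma eq_zero_of_le_abs_deriv {f : ℝ → ℝ} {R : ℝ} (hf : ∀ y, R ≤ |y| → f y = 0) {y : ℝ}
    (hy : R + 1 ≤ |y|) : deriv f y = 0 := by
  have h : f =ᶠ[𝓝 y] fun _ => 0 := by
    filter_upwards [continuous_abs.continuousAt.eventually (lt_mem_nhds (show R < |y| by linarith))]
      with t ht using hf t ht.le
  rw [h.deriv_eq]; simp

section Tests

variable {φ ψ : F²} {Φ Ψ : F³}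

lemma IsTestH.diff (h : IsTestH φ) : Differentiable ℝ φ := h.smooth.differentiable (by simp)

lemma IsTest.diff (h : IsTest Φ) : Differentiable ℝ Φ := h.smooth.differentiable (by simp)

lemma IsTestH.pdx (h : IsTestH φ) : IsTestH (pdx φ) where
  smooth := contDiff_pdx h.smooth (by simp)
  periodic := pdx_periodic h.periodic
  support := h.support.imp fun R hR x y hy => by simp [BetaPlane.pdx, hR _ y hy]

lemma IsTestH.pdy (h : IsTestH φ) : IsTestH (pdy φ) where
  smooth := contDiff_pdy h.smooth (by simp)
  periodic := pdy_periodic h.periodic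
  support := by
    obtain ⟨R, hR⟩ := h.support
    exact ⟨R + 1, fun x y hy => eq_zero_of_le_abs_deriv (fun t => hR x t) hy⟩

lemma IsTestH.mul_smooth (h : IsTestH φ) (hs : ContDiff ℝ ∞ ψ)
    (hp : ∀ x y, ψ (x + 1, y) = ψ (x, y)) : IsTestH (fun p => ψ p * φ p) where
  smooth := hs.mul h.smooth
  periodic x y := by simp only [hp, h.periodic]
  support := h.support.imp fun R hR x y hy => by simp [hR x y hy]

lemma IsTestH.reflect (h : IsTestH φ) (p : ℝ²) : IsTestH (fun q => φ (p - q)) where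
  smooth := h.smooth.comp (contDiff_const.sub contDiff_id)
  periodic x y := by
    have := h.periodic (p.1 - (x + 1)) (p.2 - y)
    rw [show p - (x + 1, y) = (p.1 - (x + 1), p.2 - y) from rfl, ← this]
    congr 1; ext <;> simp
    ring
  support := by
    obtain ⟨R, hR⟩ := h.support
    refine ⟨R + |p.2|, fun x y hy => hR (p.1 - x) (p.2 - y) ?_⟩
    have := abs_sub_abs_le_abs_sub y p.2
    rw [abs_sub_comm] at this; linarith

lemma IsTest.slice (h : IsTest Φ) (z : ℝ) : IsTestH (fun p => Φ (p, z)) where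
  smooth := h.smooth.comp (contDiff_id.prodMk contDiff_const)
  periodic x y := h.periodic x y z
  support := h.support.imp fun _ hR x y hy => hR x y z hy

lemma IsTest.dX (h : IsTest Φ) : IsTest (dX Φ) where
  smooth := contDiff_dX h.smooth
  periodic x y z := (h.slice z).pdx.periodic x y
  support := h.support.imp fun R hR x y z hy => by simp [BetaPlane.dX, hR _ y z hy]

lemma IsTest.dY (h : IsTest Φ) : IsTest (dY Φ) where
  smooth := contDiff_dY h.smooth
  periodic x y z := (h.slice z).pdy.periodic x y
  support := by
    obtain ⟨R, hR⟩ := h.support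
    exact ⟨R + 1, fun x y z hy => eq_zero_of_le_abs_deriv (fun t => hR x t z) hy⟩

lemma IsTest.dZ (h : IsTest Φ) : IsTest (dZ Φ) where
  smooth := contDiff_dZ h.smooth
  periodic x y z := by simp only [BetaPlane.dZ, h.periodic]
  support := h.support.imp fun R hR x y z hy => by simp [BetaPlane.dZ, hR x y _ hy]

lemma IsTest.mul_smooth (h : IsTest Φ) (hs : ContDiff ℝ ∞ Ψ)
    (hp : ∀ x y z, Ψ ((x + 1, y), z) = Ψ ((x, y), z)) : IsTest (fun P => Ψ P * Φ P) where
  smooth := hs.mul h.smooth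
  periodic x y z := by simp only [hp, h.periodic]
  support := h.support.imp fun R hR x y z hy => by simp [hR x y z hy]

lemma IsTest.comp (h : IsTest Φ) {T : ℝ → ℝ} (hT : ContDiff ℝ ∞ T) (h0 : T 0 = 0) :
    IsTest (fun P => T (Φ P)) where
  smooth := hT.comp h.smooth
  periodic x y z := by simp only [h.periodic]
  support := h.support.imp fun R hR x y z hy => by simp [hR x y z hy, h0]

lemma IsTestH.exists_bound (h : IsTestH φ) : ∃ C, 0 ≤ C ∧ ∀ p, |φ p| ≤ C := by
  obtain ⟨R, hR⟩ := h.support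
  obtain ⟨C, hC⟩ := (isCompact_Icc.prod isCompact_Icc :
    IsCompact (Icc (0:ℝ) 1 ×ˢ Icc (-R) R)).exists_bound_of_continuousOn h.smooth.continuous.continuousOn
  refine ⟨max C 0, le_max_right _ _, fun ⟨x, y⟩ => ?_⟩
  by_cases hy : R ≤ |y|
  · simp [hR x y hy]
  · have hx := periodic_add_int h.periodic (Int.fract x) y ⌊x⌋
    rw [Int.fract_add_floor] at hx
    rw [hx]
    refine (hC _ ⟨⟨Int.fract_nonneg x, (Int.fract_lt_one x).le⟩, ?_⟩).trans (le_max_left _ _)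
    exact abs_le.1 (not_le.1 hy).le

lemma IsTest.exists_bound (h : IsTest Φ) : ∃ C, 0 ≤ C ∧ ∀ p, ∀ z ∈ Icc (0:ℝ) 1, |Φ (p, z)| ≤ C := by
  obtain ⟨R, hR⟩ := h.support
  obtain ⟨C, hC⟩ := ((isCompact_Icc.prod isCompact_Icc).prod isCompact_Icc :
    IsCompact ((Icc (0:ℝ) 1 ×ˢ Icc (-R) R) ×ˢ Icc (0:ℝ) 1)).exists_bound_of_continuousOn
      h.smooth.continuous.continuousOn
  refine ⟨max C 0, le_max_right _ _, fun ⟨x, y⟩ z hz => ?_⟩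
  by_cases hy : R ≤ |y|
  · simp [hR x y z hy]
  · have hx := periodic_add_int (f := fun p => Φ (p, z)) (h.slice z).periodic (Int.fract x) y ⌊x⌋
    simp only [Int.fract_add_floor] at hx
    rw [hx]
    refine (hC _ ⟨⟨⟨Int.fract_nonneg x, (Int.fract_lt_one x).le⟩, ?_⟩, hz⟩).trans (le_max_left _ _)
    exact abs_le.1 (not_le.1 hy).le

end Tests

/-! ## Integrals over the cells -/

/-- Lebesgue measure on the vertical interval `(0,1)`. -/
def nu : Measure ℝ := volume.restrict (Ioo 0 1)

instance : IsFiniteMeasure nu := ⟨by simp [nu]⟩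

lemma nu_univ : nu univ = 1 := by simp [nu]

instance : IsProbabilityMeasure nu := ⟨nu_univ⟩

lemma muH_eq : muH = nu.prod volume := by
  rw [muH, cellH, nu, ← Measure.restrict_univ (μ := (volume : Measure ℝ)), Measure.prod_restrict]
  simp [Measure.volume_eq_prod]

lemma muO_eq : muO = muH.prod nu := by
  rw [muO, cell, muH, nu, Measure.prod_restrict]
  rfl

instance : SFinite muH := by rw [muH]; infer_instance
instance : SigmaFinite muH := by rw [muH]; infer_instance
instance : SFinite muO := by rw [muO]; infer_instance
instance : SigmaFinite muO := by rw [muO]; infer_instance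
instance : IsLocallyFiniteMeasure muH := by rw [muH]; infer_instance
instance : IsLocallyFiniteMeasure muO := by rw [muO]; infer_instance
instance : IsLocallyFiniteMeasure nu := by rw [nu]; infer_instance

lemma measurableSet_cellH : MeasurableSet cellH := measurableSet_Ioo.prod MeasurableSet.univ

lemma measurableSet_cell : MeasurableSet cell := measurableSet_cellH.prod measurableSet_Ioo

lemma ae_muH_mem : ∀ᵐ p ∂muH, p ∈ cellH := ae_restrict_mem measurableSet_cellH

lemma ae_muO_mem : ∀ᵐ P ∂muO, P ∈ cell := ae_restrict_mem measurableSet_cell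

lemma ae_nu_mem : ∀ᵐ z ∂nu, z ∈ Ioo (0:ℝ) 1 := ae_restrict_mem measurableSet_Ioo

lemma integrable_muH_of_continuous {F : F²} (hF : Continuous F) {R : ℝ}
    (hR : ∀ x y, R ≤ |y| → F (x, y) = 0) : Integrable F muH := by
  have h : IntegrableOn F (Icc (0:ℝ) 1 ×ˢ Icc (-R) R) volume :=
    hF.continuousOn.integrableOn_compact (isCompact_Icc.prod isCompact_Icc)
  refine h.of_forall_sdiff_eq_zero measurableSet_cellH ?_
  rintro ⟨x, y⟩ ⟨⟨hx, -⟩, h2⟩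
  refine hR x y (not_lt.1 fun hy => h2 ⟨Ioo_subset_Icc_self hx, abs_le.1 hy.le⟩)

lemma integrable_muO_of_continuous {F : F³} (hF : Continuous F) {R : ℝ}
    (hR : ∀ x y z, R ≤ |y| → F ((x, y), z) = 0) : Integrable F muO := by
  have h : IntegrableOn F ((Icc (0:ℝ) 1 ×ˢ Icc (-R) R) ×ˢ Icc (0:ℝ) 1) volume :=
    hF.continuousOn.integrableOn_compact ((isCompact_Icc.prod isCompact_Icc).prod isCompact_Icc)
  refine h.of_forall_sdiff_eq_zero measurableSet_cell ?_
  rintro ⟨⟨x, y⟩, z⟩ ⟨⟨⟨hx, -⟩, hz⟩, h2⟩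
  exact hR x y z (not_lt.1 fun hy =>
    h2 ⟨⟨Ioo_subset_Icc_self hx, abs_le.1 hy.le⟩, Ioo_subset_Icc_self hz⟩)

lemma IsTestH.integrable {φ : F²} (h : IsTestH φ) : Integrable φ muH := by
  obtain ⟨R, hR⟩ := h.support
  exact integrable_muH_of_continuous h.smooth.continuous hR

lemma IsTest.integrable {φ : F³} (h : IsTest φ) : Integrable φ muO := by
  obtain ⟨R, hR⟩ := h.support
  exact integrable_muO_of_continuous h.smooth.continuous hR

lemma IsTestH.memLp {φ : F²} (h : IsTestH φ) : MemLp φ 2 muH :=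
  (memLp_two_iff_integrable_sq h.smooth.continuous.aestronglyMeasurable).2 <| by
    simpa [sq] using (h.mul_smooth h.smooth h.periodic).integrable

lemma IsTest.memLp {φ : F³} (h : IsTest φ) : MemLp φ 2 muO :=
  (memLp_two_iff_integrable_sq h.smooth.continuous.aestronglyMeasurable).2 <| by
    simpa [sq] using (h.mul_smooth h.smooth h.periodic).integrable

/-- Functions locally integrable up to the lateral boundary of the cell, against test functions. -/
lemma integrable_mul_of_locallyIntegrable {f g : F²} (hf : LocallyIntegrable f muH)
    (hg : Continuous g) {R : ℝ} (hR : ∀ x y, R ≤ |y| → g (x, y) = 0) :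
    Integrable (fun p => f p * g p) muH := by
  have hK : IsCompact (Icc (0:ℝ) 1 ×ˢ Icc (-R) R) := isCompact_Icc.prod isCompact_Icc
  have h1 : IntegrableOn (fun p => f p * g p) (Icc (0:ℝ) 1 ×ˢ Icc (-R) R) muH :=
    (hf.integrableOn_isCompact hK).mul_continuousOn hg.continuousOn hK
  rw [← integrableOn_univ]
  refine h1.of_ae_sdiff_eq_zero MeasurableSet.univ.nullMeasurableSet ?_
  filter_upwards [ae_muH_mem]
  rintro ⟨x, y⟩ ⟨hx, -⟩ ⟨-, h2⟩
  rw [hR x y (not_lt.1 fun hy => h2 ⟨Ioo_subset_Icc_self hx, abs_le.1 hy.le⟩), mul_zero]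

lemma IsTestH.integrable_mul {φ f : F²} (h : IsTestH φ) (hf : LocallyIntegrable f muH) :
    Integrable (fun p => f p * φ p) muH := by
  obtain ⟨R, hR⟩ := h.support
  exact integrable_mul_of_locallyIntegrable hf h.smooth.continuous hR

lemma locallyIntegrable_muH {f : F²}
    (hf : LocallyIntegrableOn f (Icc (0 : ℝ) 1 ×ˢ (univ : Set ℝ)) volume) :
    LocallyIntegrable f muH := by
  have h := (locallyIntegrableOn_iff_locallyIntegrable_restrict
    (isClosed_Icc.prod isClosed_univ)).1 hf
  exact h.mono_measure (Measure.restrict_mono (prod_mono Ioo_subset_Icc_self subset_rfl) le_rfl)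

/-! ### Integration by parts for periodic functions -/

lemma integral_pdx_eq_zero {F : F²} (hF : ContDiff ℝ 1 F)
    (hp : ∀ x y, F (x + 1, y) = F (x, y)) {R : ℝ} (hR : ∀ x y, R ≤ |y| → F (x, y) = 0) :
    ∫ p, pdx F p ∂muH = 0 := by
  have hc : Continuous (pdx F) := (contDiff_pdx hF (m := 0) (by simp)).continuous
  have hi : Integrable (pdx F) muH :=
    integrable_muH_of_continuous hc (R := R) fun x y hy => by simp [pdx, hR _ y hy]
  rw [muH_eq] at hi ⊢
  rw [integral_prod_symm _ hi]
  refine integral_eq_zero_of_ae (.of_forall fun y => ?_)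
  have h := intervalIntegral.integral_eq_sub_of_hasDerivAt (a := 0) (b := 1)
    (f := fun x => F (x, y)) (f' := fun x => pdx F (x, y))
    (fun x _ => hasDerivAt_pdx (hF.differentiable (by simp)) (x, y))
    (Continuous.intervalIntegrable (by fun_prop) _ _)
  rw [intervalIntegral.integral_of_le zero_le_one, ← integral_Ioc_eq_integral_Ioo.symm] at h
  have h01 := hp 0 y
  simp only [zero_add] at h01
  simpa [nu, h01] using h

lemma integral_pdy_eq_zero {F : F²} (hF : ContDiff ℝ 1 F)
    {R : ℝ} (hR : ∀ x y, R ≤ |y| → F (x, y) = 0) :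
    ∫ p, pdy F p ∂muH = 0 := by
  have hc : Continuous (pdy F) := (contDiff_pdy hF (m := 0) (by simp)).continuous
  have hR' : ∀ x y, R + 1 ≤ |y| → pdy F (x, y) = 0 :=
    fun x y hy => eq_zero_of_le_abs_deriv (fun t => hR x t) hy
  have hi : Integrable (pdy F) muH := integrable_muH_of_continuous hc hR'
  rw [muH_eq] at hi ⊢
  rw [integral_prod _ hi]
  refine integral_eq_zero_of_ae (.of_forall fun x => ?_)
  set S := |R| + 1 with hS
  have hle : -S ≤ S := by simp only [hS]; linarith [abs_nonneg R]
  have hRS : R + 1 ≤ S := by simp only [hS]; linarith [le_abs_self R]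
  have h := intervalIntegral.integral_eq_sub_of_hasDerivAt (a := -S) (b := S)
    (f := fun y => F (x, y)) (f' := fun y => pdy F (x, y))
    (fun y _ => hasDerivAt_pdy (hF.differentiable (by simp)) (x, y))
    (Continuous.intervalIntegrable (by fun_prop) _ _)
  have hS0 : 0 ≤ S := by simp only [hS]; positivity
  rw [hR x S (by rw [abs_of_nonneg hS0]; linarith),
    hR x (-S) (by rw [abs_neg, abs_of_nonneg hS0]; linarith), sub_zero,
    intervalIntegral.integral_of_le hle] at h
  change ∫ y, pdy F (x, y) = 0
  rw [← setIntegral_eq_integral_of_forall_compl_eq_zero (s := Ioc (-S) S)]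
  · simpa using h
  · intro y hy
    refine hR' x y (hRS.trans ?_)
    by_contra hlt
    exact hy ⟨(abs_lt.1 (not_le.1 hlt)).1, (abs_lt.1 (not_le.1 hlt)).2.le⟩

lemma integral_mul_pdx {f : F²} (hf : ContDiff ℝ 1 f)
    (hp : ∀ x y, f (x + 1, y) = f (x, y)) {φ : F²} (hφ : IsTestH φ) :
    ∫ p, f p * pdx φ p ∂muH = -∫ p, pdx f p * φ p ∂muH := by
  obtain ⟨R, hR⟩ := hφ.support
  have hd : Differentiable ℝ f := hf.differentiable (by simp)
  have h0 := integral_pdx_eq_zero (F := fun p => f p * φ p) (hf.mul (hφ.smooth.of_le (by simp)))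
    (fun x y => by simp only [hp, hφ.periodic]) (R := R) (fun x y hy => by simp [hR x y hy])
  simp only [pdx_mul hd hφ.diff] at h0
  have hc : Continuous (pdx f) := (contDiff_pdx hf (m := 0) (by simp)).continuous
  rw [integral_add] at h0
  · linarith
  · exact hφ.integrable_mul hc.locallyIntegrable
  · exact hφ.pdx.integrable_mul hf.continuous.locallyIntegrable

lemma integral_mul_pdy {f : F²} (hf : ContDiff ℝ 1 f) {φ : F²} (hφ : IsTestH φ) :
    ∫ p, f p * pdy φ p ∂muH = -∫ p, pdy f p * φ p ∂muH := by
  obtain ⟨R, hR⟩ := hφ.support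
  have hd : Differentiable ℝ f := hf.differentiable (by simp)
  have h0 := integral_pdy_eq_zero (F := fun p => f p * φ p) (hf.mul (hφ.smooth.of_le (by simp)))
    (R := R) (fun x y hy => by simp [hR x y hy])
  simp only [pdy_mul hd hφ.diff] at h0
  have hc : Continuous (pdy f) := (contDiff_pdy hf (m := 0) (by simp)).continuous
  rw [integral_add] at h0
  · linarith
  · exact hφ.integrable_mul hc.locallyIntegrable
  · exact hφ.pdy.integrable_mul hf.continuous.locallyIntegrable

/-! ### Integrals depending on a parameter -/

section Parametric

variable {E G : Type*} [NormedAddCommGroup E] [NormedSpace ℝ E] [NormedAddCommGroup G]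
  [NormedSpace ℝ G] [MeasurableSpace G] [BorelSpace G] {μ : Measure G}

lemma contDiff_integral_param {h : E → G → ℝ}
    (hh : ContDiff ℝ ∞ (fun z : E × G => h z.1 z.2)) {f : G → ℝ} (hf : LocallyIntegrable f μ)
    (hs : ∀ e, ∃ s : Set E, IsOpen s ∧ e ∈ s ∧ ∃ k : Set G, IsCompact k ∧
      ∀ e' ∈ s, ∀ x, x ∉ k → h e' x = 0) :
    ContDiff ℝ ∞ (fun e => ∫ x, f x * h e x ∂μ) := by
  rw [contDiff_iff_contDiffAt]
  intro e
  obtain ⟨s, hso, hes, k, hk, hz⟩ := hs e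
  have hg : ContDiffOn ℝ ∞ (↿fun (e : E) (t : G) => h e (-t)) (s ×ˢ univ) := by
    have : ContDiff ℝ ∞ (fun z : E × G => h z.1 (-z.2)) :=
      hh.comp (contDiff_fst.prodMk contDiff_snd.neg)
    exact this.contDiffOn
  have key := contDiffOn_convolution_right_with_param_comp (μ := μ) (f := f) (v := fun _ => (0 : G))
    (g := fun (e : E) (t : G) => h e (-t)) (k := -k) (n := ⊤) (ContinuousLinearMap.mul ℝ ℝ)
    contDiffOn_const hso hk.neg (fun e' x he' hx => hz e' he' _ (by simpa using hx)) hf hg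
  have h2 := key.contDiffAt (hso.mem_nhds hes)
  simpa [convolution_def] using h2

lemma hasDerivAt_integral_param {h : ℝ → G → ℝ}
    (hh : ContDiff ℝ ∞ (fun z : ℝ × G => h z.1 z.2)) {f : G → ℝ} (hf : LocallyIntegrable f μ)
    (t0 : ℝ) {k : Set G} (hk : IsCompact k)
    (hs : ∀ t ∈ Icc (t0 - 1) (t0 + 1), ∀ x, x ∉ k → h t x = 0) :
    HasDerivAt (fun t => ∫ x, f x * h t x ∂μ) (∫ x, f x * deriv (fun t => h t x) t0 ∂μ) t0 := by
  have hd : ∀ t x, HasDerivAt (fun t => h t x) (fderiv ℝ (fun z : ℝ × G => h z.1 z.2) (t, x) (1, 0))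
      t := by
    intro t x
    have h1 : HasDerivAt (fun t : ℝ => (t, x)) ((1 : ℝ), (0 : G)) t :=
      (hasDerivAt_id _).prodMk (hasDerivAt_const _ _)
    exact HasFDerivAt.comp_hasDerivAt (l := fun z : ℝ × G => h z.1 z.2) t
      ((hh.differentiable (by simp)) _).hasFDerivAt h1
  have hcont : Continuous fun z : ℝ × G => fderiv ℝ (fun z : ℝ × G => h z.1 z.2) z (1, 0) :=
    ((hh.fderiv_right (m := 0) (by simp)).clm_apply contDiff_const).continuous
  obtain ⟨C, hC⟩ := ((isCompact_Icc (a := t0 - 1) (b := t0 + 1)).prod hk).exists_bound_of_continuousOn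
    hcont.continuousOn
  have hint : ∀ g : G → ℝ, Continuous g → (∀ x, x ∉ k → g x = 0) →
      Integrable (fun x => f x * g x) μ := by
    intro g hg h0
    have := (hf.integrableOn_isCompact hk).mul_continuousOn hg.continuousOn hk
    rw [← integrableOn_univ]
    exact this.of_forall_sdiff_eq_zero MeasurableSet.univ (fun x hx => by simp [h0 x hx.2])
  have hslice : ∀ t, Continuous fun x => h t x := fun t =>
    hh.continuous.comp (Continuous.prodMk continuous_const continuous_id)
  have hk' : ∀ t ∈ Ioo (t0 - 1) (t0 + 1), ∀ x, x ∉ k →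
      fderiv ℝ (fun z : ℝ × G => h z.1 z.2) (t, x) (1, 0) = 0 := by
    intro t ht x hx
    refine (hd t x).unique ?_
    have : (fun t => h t x) =ᶠ[𝓝 t] fun _ => 0 := by
      filter_upwards [Ioo_mem_nhds ht.1 ht.2] with t' ht' using hs t' (Ioo_subset_Icc_self ht') x hx
    exact (hasDerivAt_const t (0 : ℝ)).congr_of_eventuallyEq this
  have hmem : t0 ∈ Ioo (t0 - 1) (t0 + 1) := by constructor <;> linarith
  have key := hasDerivAt_integral_of_dominated_loc_of_deriv_le (μ := μ) (𝕜 := ℝ)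
    (F := fun t x => f x * h t x) (x₀ := t0)
    (F' := fun t x => f x * fderiv ℝ (fun z : ℝ × G => h z.1 z.2) (t, x) (1, 0))
    (s := Ioo (t0 - 1) (t0 + 1)) (bound := fun x => |k.indicator f x| * |C|)
    (Ioo_mem_nhds hmem.1 hmem.2) ?_ ?_ ?_ ?_ ?_ ?_
  · simpa only [(hd t0 _).deriv] using key.2
  · filter_upwards [Ioo_mem_nhds hmem.1 hmem.2] with t ht
    exact (hint _ (hslice t) (hs t (Ioo_subset_Icc_self ht))).aestronglyMeasurable
  · exact hint _ (hslice t0) (hs t0 (Ioo_subset_Icc_self hmem))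
  · exact (hint _ (hcont.comp (Continuous.prodMk continuous_const continuous_id))
      (hk' t0 hmem)).aestronglyMeasurable
  · refine .of_forall fun x t ht => ?_
    by_cases hx : x ∈ k
    · simp only [indicator_of_mem hx, norm_mul, norm_eq_abs]
      exact mul_le_left
        ((hC (t, x) ⟨Ioo_subset_Icc_self ht, hx⟩).trans (le_abs_self C)) (abs_nonneg _)
    · simp [hx, hk' t ht x hx]
  · exact ((hf.integrableOn_isCompact hk).integrable_indicator hk.measurableSet).abs.mul_const _
  · exact .of_forall fun x t _ => (hd t x).const_mul _

end Parametric

/-! ## Square-integrable functions and integral operators -/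

section LTwo

open scoped ENNReal NNReal

variable {X Y : Type*} [MeasurableSpace X] [MeasurableSpace Y] {μ : Measure X} {ν : Measure Y}

lemma eLpNorm_two_sq (f : X → ℝ) : eLpNorm f 2 μ ^ 2 = ∫⁻ x, ‖f x‖ₑ ^ 2 ∂μ := by
  have h := eLpNorm_nnreal_pow_eq_lintegral (μ := μ) (f := f) (p := 2) two_ne_zero
  simpa using h

/-- The norm of `L²(μ)`. -/
def nrm (μ : Measure X) (f : X → ℝ) : ℝ := (eLpNorm f 2 μ).toReal

lemma nrm_nonneg (f : X → ℝ) : 0 ≤ nrm μ f := ENNReal.toReal_nonneg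

lemma nrm_add_le {f g : X → ℝ} (hf : MemLp f 2 μ) (hg : MemLp g 2 μ) :
    nrm μ (fun x => f x + g x) ≤ nrm μ f + nrm μ g := by
  have h := eLpNorm_add_le hf.1 hg.1 (by norm_num : (1:ℝ≥0∞) ≤ 2)
  rw [nrm, nrm, nrm, ← ENNReal.toReal_add hf.2.ne hg.2.ne]
  exact ENNReal.toReal_mono (ENNReal.add_ne_top.2 ⟨hf.2.ne, hg.2.ne⟩) h

lemma nrm_sub_le {f g : X → ℝ} (hf : MemLp f 2 μ) (hg : MemLp g 2 μ) :
    nrm μ (fun x => f x - g x) ≤ nrm μ f + nrm μ g := by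
  have h := nrm_add_le hf hg.neg
  simpa [nrm, sub_eq_add_neg, eLpNorm_neg] using h

lemma nrm_sub_comm (f g : X → ℝ) : nrm μ (fun x => f x - g x) = nrm μ (fun x => g x - f x) := by
  rw [nrm, nrm, ← eLpNorm_neg]
  congr 2; funext x; simp

lemma nrm_mono {f g : X → ℝ} (hg : MemLp g 2 μ) (h : ∀ᵐ x ∂μ, |f x| ≤ |g x|) : nrm μ f ≤ nrm μ g :=
  ENNReal.toReal_mono hg.2.ne (eLpNorm_mono_ae (by simpa using h))

lemma nrm_congr {f g : X → ℝ} (h : f =ᵐ[μ] g) : nrm μ f = nrm μ g := by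
  rw [nrm, nrm, eLpNorm_congr_ae h]

lemma nrm_const_mul (c : ℝ) (f : X → ℝ) : nrm μ (fun x => c * f x) = |c| * nrm μ f := by
  have h := eLpNorm_const_smul c f 2 μ
  rw [nrm, nrm, show (fun x => c * f x) = c • f from rfl, h]
  simp

lemma nrm_sq {f : X → ℝ} (hf : MemLp f 2 μ) : nrm μ f ^ 2 = ∫ x, f x ^ 2 ∂μ := by
  rw [nrm, ← ENNReal.toReal_pow, eLpNorm_two_sq,
    integral_eq_lintegral_of_nonneg_ae (.of_forall fun x => sq_nonneg _) (hf.1.pow 2)]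
  congr 1
  refine lintegral_congr fun x => ?_
  rw [← enorm_of_nonneg (sq_nonneg _), enorm_pow]

lemma int_mul {f g : X → ℝ} (hf : MemLp f 2 μ) (hg : MemLp g 2 μ) :
    Integrable (fun x => f x * g x) μ := hf.integrable_mul hg

lemma abs_integral_mul_le {f g : X → ℝ} (hf : MemLp f 2 μ) (hg : MemLp g 2 μ) :
    |∫ x, f x * g x ∂μ| ≤ nrm μ f * nrm μ g := by
  have h1 : |∫ x, f x * g x ∂μ| ≤ ∫ x, ‖f x‖ * ‖g x‖ ∂μ := by
    rw [← norm_eq_abs]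
    refine (norm_integral_le_integral_norm _).trans (le_of_eq ?_)
    simp
  refine h1.trans ?_
  have h2 := integral_mul_norm_le_Lp_mul_Lq (μ := μ) (f := f) (g := g)
    Real.HolderConjugate.two_two (by simpa using hf) (by simpa using hg)
  refine h2.trans (le_of_eq ?_)
  have h3 : ∀ {u : X → ℝ}, MemLp u 2 μ → (∫ x, ‖u x‖ ^ (2:ℝ) ∂μ) ^ (1 / (2:ℝ)) = nrm μ u := by
    intro u hu
    rw [← sqrt_eq_rpow, ← sqrt_sq (nrm_nonneg (μ := μ) u), nrm_sq hu]
    simp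
  rw [h3 hf, h3 hg]

lemma integral_abs_mul_le {f g : X → ℝ} (hf : MemLp f 2 μ) (hg : MemLp g 2 μ) :
    ∫ x, |f x| * |g x| ∂μ ≤ nrm μ f * nrm μ g := by
  have h := (le_abs_self _).trans (abs_integral_mul_le hf.abs hg.abs)
  have e : ∀ u : X → ℝ, nrm μ |u| = nrm μ u := fun u => by
    rw [nrm, nrm, ← eLpNorm_norm u]; rfl
  rw [e, e] at h
  exact h

lemma memLp_bdd_mul {a f : X → ℝ} {C : ℝ} (ha : AESM a μ)
    (hb : ∀ᵐ x ∂μ, |a x| ≤ C) (hf : MemLp f 2 μ) : MemLp (fun x => a x * f x) 2 μ := by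
  refine MemLp.of_le (hf.const_mul C) (ha.mul hf.1) ?_
  filter_upwards [hb] with x hx
  rw [norm_mul, norm_mul]
  exact mul_le_right (hx.trans (le_abs_self C)) (norm_nonneg _)

lemma nrm_bdd_mul_le {a f : X → ℝ} {C : ℝ} (hC : 0 ≤ C) (hb : ∀ᵐ x ∂μ, |a x| ≤ C)
    (hf : MemLp f 2 μ) : nrm μ (fun x => a x * f x) ≤ C * nrm μ f := by
  rw [← abs_of_nonneg hC, ← nrm_const_mul]
  refine nrm_mono (hf.const_mul C) ?_
  filter_upwards [hb] with x hx
  rw [abs_mul, abs_mul, abs_of_nonneg hC]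
  gcongr

lemma tendsto_eLpNorm_zero_of_dominated {ι : Type*} {l : Filter ι} [l.IsCountablyGenerated]
    {r : ℝ≥0} (hr : r ≠ 0) {F : ι → X → ℝ} {g : X → ℝ} (hg : MemLp g r μ)
    (hF : ∀ᶠ i in l, AESM (F i) μ) (hb : ∀ᶠ i in l, ∀ᵐ x ∂μ, |F i x| ≤ |g x|)
    (hlim : ∀ᵐ x ∂μ, Tendsto (fun i => F i x) l (𝓝 0)) :
    Tendsto (fun i => eLpNorm (F i) r μ) l (𝓝 0) := by
  have hr' : (0:ℝ) < r := by positivity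
  have key : Tendsto (fun i => ∫⁻ x, ‖F i x‖ₑ ^ (r:ℝ) ∂μ) l (𝓝 (∫⁻ x, 0 ∂μ)) := by
    refine tendsto_lintegral_filter_of_dominated_convergence' (fun x => ‖g x‖ₑ ^ (r:ℝ)) ?_ ?_ ?_ ?_
    · filter_upwards [hF] with i hi using hi.enorm.pow_const _
    · filter_upwards [hb] with i hi
      filter_upwards [hi] with x hx
      refine ENNReal.rpow_le_rpow ?_ hr'.le
      exact enorm_le_iff_norm_le.2 hx
    · rw [← eLpNorm_nnreal_pow_eq_lintegral hr]
      exact (ENNReal.rpow_lt_top_of_nonneg hr'.le hg.2.ne).ne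
    · filter_upwards [hlim] with x hx
      have h1 : Tendsto (fun i => ‖F i x‖ₑ) l (𝓝 0) := by
        simpa [Function.comp_def] using (continuous_enorm.tendsto _).comp hx
      simpa [ENNReal.zero_rpow_of_pos hr', Function.comp_def] using
        ((ENNReal.continuous_rpow_const (y := (r:ℝ))).tendsto 0).comp h1
  simp only [lintegral_zero, ← eLpNorm_nnreal_pow_eq_lintegral hr] at key
  have h2 := ((ENNReal.continuous_rpow_const (y := ((r:ℝ)⁻¹))).tendsto 0).comp key
  rw [ENNReal.zero_rpow_of_pos (by positivity)] at h2
  refine h2.congr fun i => ?_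
  simp only [Function.comp]
  rw [← ENNReal.rpow_mul, mul_inv_cancel₀ hr'.ne', ENNReal.rpow_one]

lemma tendsto_nrm_zero {ι : Type*} {l : Filter ι} {F : ι → X → ℝ}
    (h : Tendsto (fun i => eLpNorm (F i) 2 μ) l (𝓝 0)) : Tendsto (fun i => nrm μ (F i)) l (𝓝 0) := by
  simpa [nrm, Function.comp_def] using (ENNReal.tendsto_toReal ENNReal.zero_ne_top).comp h

lemma tendsto_nrm_zero_of_dominated {ι : Type*} {l : Filter ι} [l.IsCountablyGenerated]
    {F : ι → X → ℝ} {g : X → ℝ} (hg : MemLp g 2 μ)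
    (hF : ∀ᶠ i in l, AESM (F i) μ) (hb : ∀ᶠ i in l, ∀ᵐ x ∂μ, |F i x| ≤ |g x|)
    (hlim : ∀ᵐ x ∂μ, Tendsto (fun i => F i x) l (𝓝 0)) :
    Tendsto (fun i => nrm μ (F i)) l (𝓝 0) :=
  tendsto_nrm_zero (by
    simpa using tendsto_eLpNorm_zero_of_dominated (r := 2) two_ne_zero (by simpa using hg) hF hb hlim)

lemma lintegral_mul_sq_le {f g : X → ℝ≥0∞} (hf : AEMeasurable f μ) (hg : AEMeasurable g μ) :
    (∫⁻ x, f x * g x ∂μ) ^ 2 ≤ (∫⁻ x, f x ^ 2 ∂μ) * ∫⁻ x, g x ^ 2 ∂μ := by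
  have h := ENNReal.lintegral_mul_le_Lp_mul_Lq μ Real.HolderConjugate.two_two hf hg
  have h2 := pow_le_pow_left' h 2
  refine h2.trans (le_of_eq ?_)
  rw [mul_pow]
  simp only [← ENNReal.rpow_natCast, ← ENNReal.rpow_mul]
  norm_num

/-- The integral operator with kernel `k`. -/
def kop (μ : Measure X) (k : X → X → ℝ) (f : X → ℝ) (p : X) : ℝ := ∫ q, k p q * f q ∂μ

lemma aestronglyMeasurable_kop [SFinite μ] {k : X → X → ℝ}
    (hk : AESM (fun z : X × X => k z.1 z.2) (μ.prod μ)) {f : X → ℝ}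
    (hf : AESM f μ) : AESM (kop μ k f) μ :=
  (hk.mul hf.comp_snd).integral_prod_right'

/-- Schur's test in `L²`. -/
lemma eLpNorm_two_kop_le [SFinite μ] {k : X → X → ℝ}
    (hk : AESM (fun z : X × X => k z.1 z.2) (μ.prod μ)) {A : ℝ≥0∞}
    (h1 : ∀ᵐ p ∂μ, ∫⁻ q, ‖k p q‖ₑ ∂μ ≤ A) (h2 : ∀ᵐ q ∂μ, ∫⁻ p, ‖k p q‖ₑ ∂μ ≤ A) {f : X → ℝ}
    (hf : AESM f μ) : eLpNorm (kop μ k f) 2 μ ≤ A * eLpNorm f 2 μ := by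
  have hsq : eLpNorm (kop μ k f) 2 μ ^ 2 ≤ (A * eLpNorm f 2 μ) ^ 2 := by
    rw [mul_pow, eLpNorm_two_sq, eLpNorm_two_sq]
    have hpt : ∀ᵐ p ∂μ, ‖kop μ k f p‖ₑ ^ 2 ≤ A * ∫⁻ q, ‖k p q‖ₑ * ‖f q‖ₑ ^ 2 ∂μ := by
      filter_upwards [h1, hk.prodMk_left] with p hp hkp
      have e1 : ‖kop μ k f p‖ₑ ≤ ∫⁻ q, ‖k p q‖ₑ ^ (1/2:ℝ) * (‖k p q‖ₑ ^ (1/2:ℝ) * ‖f q‖ₑ) ∂μ := by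
        refine (enorm_integral_le_lintegral_enorm _).trans (le_of_eq ?_)
        refine lintegral_congr fun q => ?_
        rw [enorm_mul, ← mul_assoc, ← ENNReal.rpow_add_of_nonneg _ _ (by norm_num) (by norm_num)]
        norm_num
      refine (pow_le_pow_left' e1 2).trans ?_
      refine (lintegral_mul_sq_le (hkp.enorm.pow_const _)
        ((hkp.enorm.pow_const _).mul hf.enorm)).trans ?_
      have e2 : ∀ a : ℝ≥0∞, (a ^ (1/2:ℝ)) ^ 2 = a := fun a => by
        rw [← ENNReal.rpow_natCast, ← ENNReal.rpow_mul]; norm_num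
      simp only [Pi.mul_apply, mul_pow, e2]
      gcongr
    refine (lintegral_mono_ae hpt).trans ?_
    have hm : AEMeasurable (fun z : X × X => ‖k z.1 z.2‖ₑ * ‖f z.2‖ₑ ^ 2) (μ.prod μ) :=
      hk.enorm.mul (hf.comp_snd.enorm.pow_const _)
    rw [lintegral_const_mul'' _ hm.lintegral_prod_right', lintegral_lintegral_swap hm, sq, mul_assoc]
    gcongr
    rw [← lintegral_const_mul'' _ (hf.enorm.pow_const _)]
    refine lintegral_mono_ae ?_
    filter_upwards [h2, hk.prod_swap.prodMk_left] with q hq hkq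
    have hkq' : AESM (fun p => k p q) μ := hkq
    rw [lintegral_mul_const'' _ hkq'.enorm]
    gcongr
  exact (ENNReal.pow_le_pow_left_iff two_ne_zero).1 hsq

/-- Schur's test in `L¹`. -/
lemma eLpNorm_one_kop_le [SFinite μ] {k : X → X → ℝ}
    (hk : AESM (fun z : X × X => k z.1 z.2) (μ.prod μ)) {A : ℝ≥0∞}
    (h2 : ∀ᵐ q ∂μ, ∫⁻ p, ‖k p q‖ₑ ∂μ ≤ A) {f : X → ℝ}
    (hf : AESM f μ) : eLpNorm (kop μ k f) 1 μ ≤ A * eLpNorm f 1 μ := by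
  rw [eLpNorm_one_eq_lintegral_enorm, eLpNorm_one_eq_lintegral_enorm]
  have hm : AEMeasurable (fun z : X × X => ‖k z.1 z.2‖ₑ * ‖f z.2‖ₑ) (μ.prod μ) :=
    hk.enorm.mul hf.comp_snd.enorm
  calc ∫⁻ p, ‖kop μ k f p‖ₑ ∂μ ≤ ∫⁻ p, ∫⁻ q, ‖k p q‖ₑ * ‖f q‖ₑ ∂μ ∂μ := by
        refine lintegral_mono fun p => ?_
        refine (enorm_integral_le_lintegral_enorm _).trans (le_of_eq ?_)
        simp only [enorm_mul]
    _ = ∫⁻ q, ∫⁻ p, ‖k p q‖ₑ * ‖f q‖ₑ ∂μ ∂μ := lintegral_lintegral_swap hm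
    _ ≤ ∫⁻ q, A * ‖f q‖ₑ ∂μ := by
        refine lintegral_mono_ae ?_
        filter_upwards [h2, hk.prod_swap.prodMk_left] with q hq hkq
        have hkq' : AESM (fun p => k p q) μ := hkq
        rw [lintegral_mul_const'' _ hkq'.enorm]
        gcongr
    _ = A * ∫⁻ q, ‖f q‖ₑ ∂μ := lintegral_const_mul'' _ hf.enorm

/-- Uniformly bounded operators that tend to zero on a dense class tend to zero. -/
lemma tendsto_eLpNorm_of_dense {r : ℝ≥0∞} (hr : 1 ≤ r) {T : ℕ → (X → ℝ) → X → ℝ}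
    {D : (X → ℝ) → Prop} {A : ℝ≥0∞} (hA : A ≠ ⊤)
    (hD : ∀ f, MemLp f r μ → ∀ e : ℝ≥0∞, e ≠ 0 → ∃ g, D g ∧ MemLp g r μ ∧ eLpNorm (f - g) r μ ≤ e)
    (hmeas : ∀ n f, MemLp f r μ → AESM (T n f) μ)
    (hcontr : ∀ n f, MemLp f r μ → eLpNorm (T n f) r μ ≤ A * eLpNorm f r μ)
    (hsub : ∀ n f g, MemLp f r μ → MemLp g r μ → T n (f - g) =ᵐ[μ] T n f - T n g)
    (hconv : ∀ g, D g → MemLp g r μ → Tendsto (fun n => eLpNorm (T n g) r μ) atTop (𝓝 0))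
    {f : X → ℝ} (hf : MemLp f r μ) : Tendsto (fun n => eLpNorm (T n f) r μ) atTop (𝓝 0) := by
  rw [ENNReal.tendsto_nhds_zero]
  intro e he
  have hA1 : A + 1 ≠ 0 := by simp
  have hA2 : A + 1 ≠ ⊤ := by simp [hA]
  obtain ⟨g, hg, hgm, hfg⟩ := hD f hf (e / 2 / (A + 1))
    (ENNReal.div_ne_zero.2 ⟨ENNReal.div_ne_zero.2 ⟨he.ne', by simp⟩, hA2⟩)
  filter_upwards [(ENNReal.tendsto_nhds_zero.1 (hconv g hg hgm)) (e / 2)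
    (ENNReal.half_pos he.ne')] with n hn
  have h1 : T n f =ᵐ[μ] T n (f - g) + T n g := by
    filter_upwards [hsub n f g hf hgm] with x hx
    simp [hx]
  rw [eLpNorm_congr_ae h1]
  refine (eLpNorm_add_le (hmeas n _ (hf.sub hgm)) (hmeas n _ hgm) hr).trans ?_
  calc _ ≤ (A + 1) * (e / 2 / (A + 1)) + e / 2 := by
        gcongr
        refine (hcontr n _ (hf.sub hgm)).trans ?_
        gcongr
        exact le_self_add
    _ = e := by rw [ENNReal.mul_div_cancel hA1 hA2, ENNReal.add_halves]

/-! ### Operators acting on slices of functions of two variables -/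

lemma ae_memLp_slice [SFinite μ] [SFinite ν] {f : X × Y → ℝ} (hf : MemLp f 2 (μ.prod ν)) :
    ∀ᵐ z ∂ν, MemLp (fun p => f (p, z)) 2 μ := by
  have h1 : ∫⁻ z, ∫⁻ p, ‖f (p, z)‖ₑ ^ 2 ∂μ ∂ν ≠ ⊤ := by
    rw [← lintegral_prod_symm _ (hf.1.enorm.pow_const _), ← eLpNorm_two_sq]
    exact ENNReal.pow_ne_top hf.2.ne
  have hm : AEMeasurable (fun z => ∫⁻ p, ‖f (p, z)‖ₑ ^ 2 ∂μ) ν :=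
    (hf.1.enorm.pow_const 2).lintegral_prod_left'
  filter_upwards [ae_lt_top' hm h1, hf.1.prod_swap.prodMk_left] with z hz hz'
  refine ⟨hz', ?_⟩
  rw [← eLpNorm_two_sq] at hz
  exact (ENNReal.pow_lt_top_iff.1 hz).resolve_right two_ne_zero

lemma ae_memLp_slice_left [SFinite μ] [SFinite ν] {f : X × Y → ℝ} (hf : MemLp f 2 (μ.prod ν)) :
    ∀ᵐ p ∂μ, MemLp (fun z => f (p, z)) 2 ν := by
  have h1 : ∫⁻ p, ∫⁻ z, ‖f (p, z)‖ₑ ^ 2 ∂ν ∂μ ≠ ⊤ := by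
    rw [← lintegral_prod _ (hf.1.enorm.pow_const _), ← eLpNorm_two_sq]
    exact ENNReal.pow_ne_top hf.2.ne
  have hm : AEMeasurable (fun p => ∫⁻ z, ‖f (p, z)‖ₑ ^ 2 ∂ν) μ :=
    (hf.1.enorm.pow_const 2).lintegral_prod_right'
  filter_upwards [ae_lt_top' hm h1, hf.1.prodMk_left] with z hz hz'
  refine ⟨hz', ?_⟩
  rw [← eLpNorm_two_sq] at hz
  exact (ENNReal.pow_lt_top_iff.1 hz).resolve_right two_ne_zero

lemma eLpNorm_two_sq_prod [SFinite μ] [SFinite ν] {f : X × Y → ℝ} (hf : AESM f (μ.prod ν)) :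
    eLpNorm f 2 (μ.prod ν) ^ 2 = ∫⁻ z, eLpNorm (fun p => f (p, z)) 2 μ ^ 2 ∂ν := by
  simp only [eLpNorm_two_sq]
  exact lintegral_prod_symm _ (hf.enorm.pow_const _)

lemma eLpNorm_two_slices_le [SFinite μ] [SFinite ν] {T : (X → ℝ) → X → ℝ} {A : ℝ≥0∞}
    (hT : ∀ h, MemLp h 2 μ → eLpNorm (T h) 2 μ ≤ A * eLpNorm h 2 μ) {f : X × Y → ℝ}
    (hf : MemLp f 2 (μ.prod ν))
    (hm : AESM (fun P : X × Y => T (fun p => f (p, P.2)) P.1) (μ.prod ν)) :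
    eLpNorm (fun P : X × Y => T (fun p => f (p, P.2)) P.1) 2 (μ.prod ν)
      ≤ A * eLpNorm f 2 (μ.prod ν) := by
  refine (ENNReal.pow_le_pow_left_iff two_ne_zero).1 ?_
  rw [mul_pow, eLpNorm_two_sq_prod hm, eLpNorm_two_sq_prod hf.1, ← lintegral_const_mul'']
  · refine lintegral_mono_ae ?_
    filter_upwards [ae_memLp_slice hf] with z hz
    rw [← mul_pow]
    exact pow_le_pow_left' (hT _ hz) 2
  · simp only [eLpNorm_two_sq]
    exact (hf.1.enorm.pow_const 2).lintegral_prod_left'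

lemma tendsto_eLpNorm_two_slices [SFinite μ] [SFinite ν] {T : ℕ → (X → ℝ) → X → ℝ} {A : ℝ≥0∞}
    (hA : A ≠ ⊤) (hT : ∀ n h, MemLp h 2 μ → eLpNorm (T n h) 2 μ ≤ A * eLpNorm h 2 μ)
    (hlim : ∀ h, MemLp h 2 μ → Tendsto (fun n => eLpNorm (T n h) 2 μ) atTop (𝓝 0))
    {f : X × Y → ℝ} (hf : MemLp f 2 (μ.prod ν))
    (hm : ∀ n, AESM (fun P : X × Y => T n (fun p => f (p, P.2)) P.1) (μ.prod ν)) :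
    Tendsto (fun n => eLpNorm (fun P : X × Y => T n (fun p => f (p, P.2)) P.1) 2 (μ.prod ν))
      atTop (𝓝 0) := by
  have key : Tendsto (fun n => eLpNorm (fun P : X × Y => T n (fun p => f (p, P.2)) P.1) 2
      (μ.prod ν) ^ 2) atTop (𝓝 (∫⁻ z, 0 ∂ν)) := by
    simp only [fun n => eLpNorm_two_sq_prod (hm n)]
    refine tendsto_lintegral_filter_of_dominated_convergence'
      (fun z => A ^ 2 * eLpNorm (fun p => f (p, z)) 2 μ ^ 2) ?_ ?_ ?_ ?_
    · refine .of_forall fun n => ?_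
      simp only [eLpNorm_two_sq]
      exact ((hm n).enorm.pow_const 2).lintegral_prod_left'
    · refine .of_forall fun n => ?_
      filter_upwards [ae_memLp_slice hf] with z hz
      rw [← mul_pow]
      exact pow_le_pow_left' (hT n _ hz) 2
    · rw [lintegral_const_mul'', ← eLpNorm_two_sq_prod hf.1]
      · exact ENNReal.mul_ne_top (ENNReal.pow_ne_top hA) (ENNReal.pow_ne_top hf.2.ne)
      · simp only [eLpNorm_two_sq]
        exact (hf.1.enorm.pow_const 2).lintegral_prod_left'
    · filter_upwards [ae_memLp_slice hf] with z hz
      simpa [Function.comp_def] using ((ENNReal.continuous_pow 2).tendsto 0).comp (hlim _ hz)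
  rw [lintegral_zero] at key
  have h2 := ((ENNReal.continuous_rpow_const (y := ((2:ℝ)⁻¹))).tendsto 0).comp key
  rw [ENNReal.zero_rpow_of_pos (by positivity)] at h2
  refine h2.congr fun i => ?_
  simp only [Function.comp]
  rw [← ENNReal.rpow_natCast, ← ENNReal.rpow_mul]
  norm_num

end LTwo

/-! ## Mollifiers -/

/-- A smooth bump supported in `[-1, 1]`. -/
def bump (s : ℝ) : ℝ := expNegInvGlue (1 - s ^ 2)

lemma contDiff_bump : ContDiff ℝ ∞ bump :=
  expNegInvGlue.contDiff.comp (contDiff_const.sub (contDiff_id.pow 2))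

lemma bump_nonneg (s : ℝ) : 0 ≤ bump s := expNegInvGlue.nonneg _

lemma bump_neg (s : ℝ) : bump (-s) = bump s := by simp [bump]

lemma bump_le_one (s : ℝ) : bump s ≤ 1 := by
  unfold bump expNegInvGlue
  split_ifs with h
  · exact zero_le_one
  · rw [exp_le_one_iff]
    have : 0 < 1 - s ^ 2 := not_le.1 h
    have := inv_pos.2 this
    linarith

lemma bump_eq_zero {s : ℝ} (h : 1 ≤ |s|) : bump s = 0 := by
  refine expNegInvGlue.zero_of_nonpos ?_
  have : 1 ≤ s ^ 2 := by rw [← sq_abs]; nlinarith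
  linarith

lemma bump_half_pos : 0 < bump (1 / 2) := expNegInvGlue.pos_of_pos (by norm_num)

lemma bump_half_le {s : ℝ} (h : |s| ≤ 1 / 2) : bump (1 / 2) ≤ bump s := by
  refine expNegInvGlue.monotone ?_
  have : s ^ 2 ≤ (1 / 2) ^ 2 := by rw [← sq_abs]; gcongr
  linarith

lemma deriv_bump_eq_zero {s : ℝ} (h : 1 ≤ |s|) : deriv bump s = 0 := by
  refine IsLocalMin.deriv_eq_zero (.of_forall fun t => ?_)
  rw [bump_eq_zero h]; exact bump_nonneg t

lemma exists_bump_dominates : ∃ C : ℝ, 0 < C ∧ ∀ s, bump s ≤ C * bump (s / 2) ∧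
    |deriv bump s| ≤ C * bump (s / 2) := by
  have hc : Continuous (deriv bump) := contDiff_bump.continuous_deriv (by simp)
  obtain ⟨M, hM⟩ := (isCompact_Icc (a := (-1:ℝ)) (b := 1)).exists_bound_of_continuousOn
    hc.continuousOn
  refine ⟨max 1 M / bump (1 / 2), by have := bump_half_pos; positivity, fun s => ?_⟩
  have hC : 0 ≤ max 1 M / bump (1 / 2) := by have := bump_half_pos; positivity
  rcases le_or_gt 1 |s| with h | h
  · rw [bump_eq_zero h, deriv_bump_eq_zero h, abs_zero]
    exact ⟨mul_nonneg hC (bump_nonneg _), mul_nonneg hC (bump_nonneg _)⟩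
  · have h2 : bump (1 / 2) ≤ bump (s / 2) := bump_half_le (by rw [abs_div]; norm_num; linarith)
    have h3 : max 1 M ≤ max 1 M / bump (1 / 2) * bump (s / 2) := by
      rw [div_mul_eq_mul_div, le_div_iff₀ bump_half_pos]
      gcongr
    refine ⟨((bump_le_one s).trans (le_max_left _ _)).trans h3, ?_⟩
    exact ((hM s (abs_le.1 h.le)).trans (le_max_right _ _)).trans h3

/-- Normalising constants of the mollifiers. -/
def massT (d : ℝ) : ℝ := ∫ t in (0:ℝ)..1, bump (sπ(t) / d)

def massR (d : ℝ) : ℝ := ∫ t, bump (t / d)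

lemma continuous_bump : Continuous bump := contDiff_bump.continuous

section Mollifiers

variable {d : ℝ}

lemma massT_lower (hd : 0 < d) (hd1 : d ≤ 1) : bump (1 / 2) / (2 * π) * d ≤ massT d := by
  have hpi := pi_pos
  have hpi3 := pi_gt_three
  set a := d / (2 * π) with ha
  have ha0 : 0 < a := by positivity
  have ha1 : a ≤ 1 := by rw [ha, div_le_one (by positivity)]; linarith
  have hc : Continuous fun t : ℝ => bump (sπ(t) / d) :=
    continuous_bump.comp (by fun_prop)
  have h1 : ∫ t in (0:ℝ)..a, bump (1 / 2) ≤ ∫ t in (0:ℝ)..a, bump (sπ(t) / d) := by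
    refine intervalIntegral.integral_mono_on ha0.le (by simp) (hc.intervalIntegrable _ _) ?_
    intro t ht
    refine bump_half_le ?_
    rw [abs_div, abs_of_pos hd, div_le_iff₀ hd]
    refine (abs_sin_le_abs).trans ?_
    rw [abs_of_nonneg (mul_nonneg hpi.le ht.1)]
    have := mul_le_left ht.2 hpi.le
    refine this.trans (le_of_eq ?_)
    rw [ha]; field_simp
  have h2 : ∫ t in (0:ℝ)..a, bump (sπ(t) / d) ≤ massT d := by
    refine intervalIntegral.integral_mono_interval le_rfl ha0.le ha1
      (.of_forall fun t => bump_nonneg _) (hc.intervalIntegrable _ _)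
  refine le_trans (le_of_eq ?_) (h1.trans h2)
  rw [intervalIntegral.integral_const, ha]
  simp; field_simp

lemma two_mul_le_abs_sin {t : ℝ} (ht : |t| ≤ 1 / 2) : 2 * |t| ≤ |sπ(t)| := by
  have hpi := pi_pos
  have h := mul_abs_le_abs_sin (x := π * t) (by
    rw [abs_mul, abs_of_pos hpi]; nlinarith)
  refine le_trans (le_of_eq ?_) h
  rw [abs_mul, abs_of_pos hpi]; field_simp

lemma abs_sin_periodic (t : ℝ) (k : ℤ) :
    |sπ(t + k)| = |sπ(t)| := by
  have h : π * (t + k) = π * t + k * π := by ring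
  rw [h, sin_add_int_mul_pi, abs_mul]
  rcases Int.even_or_odd k with hk | hk <;> simp [hk.neg_one_zpow]

lemma massT_upper (hd : 0 < d) (hd1 : d ≤ 1) : massT d ≤ d := by
  have hc : Continuous fun t : ℝ => bump (sπ(t) / d) :=
    continuous_bump.comp (by fun_prop)
  have hi : ∀ a b, IntervalIntegrable (fun t : ℝ => bump (sπ(t) / d)) volume a b :=
    fun a b => hc.intervalIntegrable _ _
  have hle : ∀ a b : ℝ, a ≤ b → ∫ t in a..b, bump (sπ(t) / d) ≤ b - a := by
    intro a b hab
    have := intervalIntegral.integral_mono_on hab (hi a b) (g := fun _ => (1:ℝ)) (by simp)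
      (fun t _ => bump_le_one _)
    simpa using this
  have h2 : ∫ t in (d/2)..(1 - d/2), bump (sπ(t) / d) = 0 := by
    rw [intervalIntegral.integral_congr (g := fun _ => (0:ℝ))]
    · simp
    · intro t ht
      rw [uIcc_of_le (by linarith)] at ht
      refine bump_eq_zero ?_
      rw [abs_div, abs_of_pos hd, le_div_iff₀ hd, one_mul]
      rcases le_or_gt t (1/2) with h | h
      · have := two_mul_le_abs_sin (t := t) (by rw [abs_of_nonneg (by linarith [ht.1])]; exact h)
        rw [abs_of_nonneg (by linarith [ht.1] : 0 ≤ t)] at this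
        linarith [ht.1]
      · have := two_mul_le_abs_sin (t := t + (-1 : ℤ)) (by
          push_cast; rw [abs_le]; constructor <;> linarith [ht.2])
        rw [abs_sin_periodic] at this
        push_cast at this
        rw [abs_of_nonpos (by linarith [ht.2] : t + -1 ≤ 0)] at this
        linarith [ht.2]
  rw [massT, ← intervalIntegral.integral_add_adjacent_intervals (hi 0 (d/2)) (hi _ 1),
    ← intervalIntegral.integral_add_adjacent_intervals (hi (d/2) (1 - d/2)) (hi _ 1), h2]
  have e1 := hle 0 (d/2) (by linarith)
  have e2 := hle (1 - d/2) 1 (by linarith)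
  linarith

lemma massT_pos (hd : 0 < d) (hd1 : d ≤ 1) : 0 < massT d :=
  lt_of_lt_of_le (by have := bump_half_pos; have := pi_pos; positivity) (massT_lower hd hd1)

lemma integrable_bump_div (hd : 0 < d) : Integrable fun t => bump (t / d) := by
  have hc : Continuous fun t : ℝ => bump (t / d) := continuous_bump.comp (by fun_prop)
  refine hc.integrable_of_hasCompactSupport ?_
  refine HasCompactSupport.intro (isCompact_Icc (a := -d) (b := d)) fun t ht => bump_eq_zero ?_
  rw [abs_div, abs_of_pos hd, le_div_iff₀ hd, one_mul]
  by_contra h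
  exact ht (abs_le.1 (not_le.1 h).le)

lemma massR_eq (hd : 0 < d) : massR d = d * massR 1 := by
  have := Measure.integral_comp_div (fun t => bump t) d
  simp only [massR, div_one]
  rw [this, abs_of_pos hd]; rfl

lemma massR_one_pos : 0 < massR 1 := by
  have hi := integrable_bump_div one_pos
  rw [massR, integral_pos_iff_support_of_nonneg (fun t => bump_nonneg _) hi]
  refine lt_of_lt_of_le ?_ (measure_mono (s := Ioo (-(1/2):ℝ) (1/2)) ?_)
  · simp
  · intro t ht
    refine ne_of_gt (bump_half_pos.trans_le (bump_half_le ?_))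
    rw [div_one]; exact (abs_lt.2 ht).le

lemma massR_pos (hd : 0 < d) : 0 < massR d := by
  rw [massR_eq hd]; exact mul_pos hd massR_one_pos

/-- Mollifiers on the torus and on the line. -/
def mollT (d x : ℝ) : ℝ := bump (sπ(x) / d) / massT d

def mollR (d y : ℝ) : ℝ := bump (y / d) / massR d

lemma contDiff_mollT (d : ℝ) : ContDiff ℝ ∞ (mollT d) :=
  (contDiff_bump.comp ((contDiff_sin.comp (contDiff_const.mul contDiff_id)).div_const d)).div_const _

lemma contDiff_mollR (d : ℝ) : ContDiff ℝ ∞ (mollR d) :=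
  (contDiff_bump.comp (contDiff_id.div_const d)).div_const _

lemma mollT_add_one (d x : ℝ) : mollT d (x + 1) = mollT d x := by
  have h : sπ(x + 1) = -sπ(x) := by
    rw [mul_add, mul_one, sin_add_pi]
  rw [mollT, mollT, h, neg_div, bump_neg]

lemma mollT_neg (d x : ℝ) : mollT d (-x) = mollT d x := by
  rw [mollT, mollT, mul_neg, sin_neg, neg_div, bump_neg]

lemma mollR_neg (d y : ℝ) : mollR d (-y) = mollR d y := by
  rw [mollR, mollR, neg_div, bump_neg]

lemma mollT_nonneg (hd : 0 < d) (hd1 : d ≤ 1) (x : ℝ) : 0 ≤ mollT d x :=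
  div_nonneg (bump_nonneg _) (massT_pos hd hd1).le

lemma mollR_nonneg (hd : 0 < d) (y : ℝ) : 0 ≤ mollR d y :=
  div_nonneg (bump_nonneg _) (massR_pos hd).le

lemma mollR_eq_zero (hd : 0 < d) {y : ℝ} (hy : d ≤ |y|) : mollR d y = 0 := by
  rw [mollR, bump_eq_zero, zero_div]
  rwa [abs_div, abs_of_pos hd, le_div_iff₀ hd, one_mul]

lemma mollT_eq_zero (hd : 0 < d) {x : ℝ} (hx : d ≤ |sπ(x)|) : mollT d x = 0 := by
  rw [mollT, bump_eq_zero, zero_div]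
  rwa [abs_div, abs_of_pos hd, le_div_iff₀ hd, one_mul]

lemma integral_mollT (hd : 0 < d) (hd1 : d ≤ 1) (x : ℝ) : ∫ t, mollT d (x - t) ∂nu = 1 := by
  have hper : Function.Periodic (mollT d) 1 := mollT_add_one d
  have h1 : ∫ t in (0:ℝ)..1, mollT d (x - t) = ∫ t in (0:ℝ)..1, mollT d t := by
    rw [intervalIntegral.integral_comp_sub_left (fun t => mollT d t) x]
    have := hper.intervalIntegral_add_eq (x - 1) 0
    simpa using this
  rw [nu, ← integral_Ioc_eq_integral_Ioo, ← intervalIntegral.integral_of_le zero_le_one, h1]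
  simp only [mollT, intervalIntegral.integral_div]
  exact div_self (massT_pos hd hd1).ne'

lemma integrable_mollR (hd : 0 < d) : Integrable (mollR d) :=
  (integrable_bump_div hd).div_const _

lemma integral_mollR (hd : 0 < d) (y : ℝ) : ∫ t, mollR d (y - t) = 1 := by
  rw [integral_sub_left_eq_self (mollR d) volume y]
  simp only [mollR, integral_div]
  exact div_self (massR_pos hd).ne'

/-- The mollifying kernel on `ω_h`. -/
def moll (d : ℝ) (p : ℝ²) : ℝ := mollT d p.1 * mollR d p.2

lemma isTestH_moll (hd : 0 < d) : IsTestH (moll d) where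
  smooth := ((contDiff_mollT d).comp contDiff_fst).mul ((contDiff_mollR d).comp contDiff_snd)
  periodic x y := by simp only [moll, mollT_add_one]
  support := ⟨d, fun x y hy => by simp [moll, mollR_eq_zero hd hy]⟩

lemma moll_neg (d : ℝ) (p : ℝ²) : moll d (-p) = moll d p := by
  simp [moll, mollT_neg, mollR_neg]

lemma moll_nonneg (hd : 0 < d) (hd1 : d ≤ 1) (p : ℝ²) : 0 ≤ moll d p :=
  mul_nonneg (mollT_nonneg hd hd1 _) (mollR_nonneg hd _)

lemma moll_ne_zero (hd : 0 < d) {p : ℝ²} (h : moll d p ≠ 0) :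
    |sπ(p.1)| < d ∧ |p.2| < d := by
  constructor
  · by_contra h'; exact h (by rw [moll, mollT_eq_zero hd (not_lt.1 h'), zero_mul])
  · by_contra h'; exact h (by rw [moll, mollR_eq_zero hd (not_lt.1 h'), mul_zero])

lemma integral_moll (hd : 0 < d) (hd1 : d ≤ 1) (p : ℝ²) : ∫ q, moll d (p - q) ∂muH = 1 := by
  rw [muH_eq]
  have := integral_prod_mul (μ := nu) (ν := (volume : Measure ℝ)) (fun t => mollT d (p.1 - t))
    (fun t => mollR d (p.2 - t))
  rw [integral_mollT hd hd1, integral_mollR hd, mul_one] at this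
  exact this

lemma lintegral_moll (hd : 0 < d) (hd1 : d ≤ 1) (p : ℝ²) :
    ∫⁻ q, ‖moll d (p - q)‖ₑ ∂muH = 1 := by
  have h := ofReal_integral_eq_lintegral_ofReal ((isTestH_moll hd).reflect p).integrable
    (.of_forall fun q => moll_nonneg hd hd1 (p - q))
  rw [integral_moll hd hd1, ENNReal.ofReal_one] at h
  rw [h]
  refine lintegral_congr fun q => ?_
  rw [enorm_of_nonneg (moll_nonneg hd hd1 _)]

lemma lintegral_moll' (hd : 0 < d) (hd1 : d ≤ 1) (q : ℝ²) :
    ∫⁻ p, ‖moll d (p - q)‖ₑ ∂muH = 1 := by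
  rw [← lintegral_moll hd hd1 q]
  refine lintegral_congr fun p => ?_
  rw [← moll_neg, neg_sub]

end Mollifiers

/-- The gradient of a mollifier is controlled by a wider mollifier. -/
lemma exists_moll_dominates : ∃ C : ℝ, 0 < C ∧ ∀ d : ℝ, 0 < d → d ≤ 1 / 2 → ∀ p,
    moll d p ≤ C * moll (2 * d) p ∧ |pdx (moll d) p| ≤ C / d * moll (2 * d) p ∧
      |pdy (moll d) p| ≤ C / d * moll (2 * d) p := by
  obtain ⟨C, hC, hB⟩ := exists_bump_dominates
  have hpi := pi_pos
  have hb := bump_half_pos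
  set A := C * (2 * (2 * π) / bump (1 / 2)) with hA
  have hA0 : 0 < A := by positivity
  have hratio : ∀ d : ℝ, 0 < d → d ≤ 1 / 2 → ∀ a : ℝ, 0 ≤ a →
      C * a / massT d ≤ A * (a / massT (2 * d)) := by
    intro d hd hd2 a ha
    have h1 := massT_lower hd (by linarith)
    have h2 := massT_upper (d := 2 * d) (by linarith) (by linarith)
    have p1 := massT_pos hd (by linarith)
    have p2 := massT_pos (d := 2 * d) (by linarith) (by linarith)
    rw [hA, div_le_iff₀ p1, mul_assoc, mul_assoc]
    refine mul_le_left ?_ hC.le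
    have h3 : 2 * d ≤ 2 * (2 * π) / bump (1/2) * massT d := by
      have := mul_le_left h1 (by positivity : 0 ≤ 2 * (2 * π) / bump (1/2))
      refine le_trans (le_of_eq ?_) this
      field_simp
    have h4 : massT (2 * d) ≤ 2 * (2 * π) / bump (1/2) * massT d := h2.trans h3
    calc a = massT (2 * d) * (a / massT (2 * d)) := by field_simp
      _ ≤ (2 * (2 * π) / bump (1/2) * massT d) * (a / massT (2 * d)) := by gcongr
      _ = _ := by ring
  have hT : ∀ d : ℝ, 0 < d → d ≤ 1 / 2 → ∀ x, mollT d x ≤ A * mollT (2 * d) x := by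
    intro d hd hd2 x
    refine le_trans ?_ (hratio d hd hd2 _ (bump_nonneg _))
    rw [mollT]
    gcongr
    · exact (massT_pos hd (by linarith)).le
    · have := (hB (sπ(x) / d)).1
      rwa [div_div, mul_comm d 2] at this
  have hT' : ∀ d : ℝ, 0 < d → d ≤ 1 / 2 → ∀ x,
      |deriv (mollT d) x| ≤ A * π / d * mollT (2 * d) x := by
    intro d hd hd2 x
    have hder : HasDerivAt (mollT d) (deriv bump (sπ(x) / d) *
        (cos (π * x) * π / d) / massT d) x := by
      have h1 : HasDerivAt (fun x => sπ(x) / d) (cos (π * x) * π / d) x := by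
        have h0 : HasDerivAt (fun x : ℝ => π * x) π x := by
          simpa using (hasDerivAt_id x).const_mul π
        exact (h0.sin).div_const d
      have h2 := (contDiff_bump.differentiable (by simp) (sπ(x) / d)).hasDerivAt
      exact (h2.comp x h1).div_const _
    have p1 := massT_pos hd (by linarith)
    have p2 := mollT_nonneg (d := 2 * d) (by linarith) (by linarith) x
    rw [hder.deriv, abs_div, abs_mul, abs_of_pos p1]
    have h3 := (hB (sπ(x) / d)).2
    rw [div_div, mul_comm d 2] at h3
    have h4 : |cos (π * x) * π / d| ≤ π / d := by
      rw [abs_div, abs_mul, abs_of_pos hpi, abs_of_pos hd]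
      gcongr
      have := abs_cos_le_one (π * x)
      nlinarith
    calc _ ≤ (C * bump (sπ(x) / (2 * d))) * (π / d) / massT d := by
          have := bump_nonneg (sπ(x) / (2 * d))
          gcongr
      _ = π / d * (C * bump (sπ(x) / (2 * d)) / massT d) := by ring
      _ ≤ π / d * (A * mollT (2 * d) x) :=
          mul_le_left (hratio d hd hd2 _ (bump_nonneg _)) (by positivity)
      _ = _ := by ring
  have hR1 := massR_one_pos
  have hR : ∀ d : ℝ, 0 < d → ∀ y, mollR d y ≤ 2 * C * mollR (2 * d) y := by
    intro d hd y
    have h3 := (hB (y / d)).1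
    rw [div_div, mul_comm d 2] at h3
    rw [mollR, mollR, massR_eq hd, massR_eq (by linarith : 0 < 2 * d), div_le_iff₀ (by positivity)]
    refine h3.trans (le_of_eq ?_)
    field_simp
  have hR' : ∀ d : ℝ, 0 < d → ∀ y, |deriv (mollR d) y| ≤ 2 * C / d * mollR (2 * d) y := by
    intro d hd y
    have h3 := (hB (y / d)).2
    rw [div_div, mul_comm d 2] at h3
    have hder : HasDerivAt (mollR d) (deriv bump (y / d) * (1 / d) / massR d) y := by
      have h2 := (contDiff_bump.differentiable (by simp) (y / d)).hasDerivAt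
      exact (h2.comp y ((hasDerivAt_id y).div_const d)).div_const _
    have p1 := massR_pos hd
    rw [hder.deriv, abs_div, abs_mul, abs_of_pos p1, abs_of_pos (by positivity : 0 < 1 / d),
      mollR, massR_eq hd, massR_eq (by linarith : 0 < 2 * d), div_le_iff₀ (by positivity)]
    calc _ ≤ C * bump (y / (2 * d)) * (1 / d) := by gcongr
      _ = _ := by field_simp
  refine ⟨A * (2 * C) * (1 + π), by positivity, fun d hd hd2 p => ?_⟩
  have m1 := mollT_nonneg (d := 2 * d) (by linarith) (by linarith) p.1
  have m2 := mollR_nonneg (d := 2 * d) (by linarith) p.2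
  have m3 := mollT_nonneg hd (by linarith) p.1
  have m4 := mollR_nonneg hd p.2
  have mm : 0 ≤ mollT (2 * d) p.1 * mollR (2 * d) p.2 := mul_nonneg m1 m2
  refine ⟨?_, ?_, ?_⟩
  · calc moll d p ≤ (A * mollT (2 * d) p.1) * (2 * C * mollR (2 * d) p.2) :=
          mul_le_mul (hT d hd hd2 _) (hR d hd _) m4 (by positivity)
      _ = A * (2 * C) * 1 * moll (2 * d) p := by rw [moll]; ring
      _ ≤ _ := by
          have : 0 ≤ moll (2 * d) p := mm
          gcongr
          linarith
  · have : pdx (moll d) p = deriv (mollT d) p.1 * mollR d p.2 := by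
      simp only [pdx, moll]
      rw [deriv_mul_const ((contDiff_mollT d).differentiable (by simp) _)]
    rw [this, abs_mul, abs_of_nonneg m4]
    calc _ ≤ (A * π / d * mollT (2 * d) p.1) * (2 * C * mollR (2 * d) p.2) :=
          mul_le_mul (hT' d hd hd2 _) (hR d hd _) m4 (by positivity)
      _ = A * (2 * C) * π / d * moll (2 * d) p := by rw [moll]; ring
      _ ≤ _ := by
          have : 0 ≤ moll (2 * d) p := mm
          gcongr
          linarith
  · have : pdy (moll d) p = mollT d p.1 * deriv (mollR d) p.2 := by
      simp only [pdy, moll]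
      rw [deriv_const_mul _ ((contDiff_mollR d).differentiable (by simp) _)]
    rw [this, abs_mul, abs_of_nonneg m3]
    calc _ ≤ (A * mollT (2 * d) p.1) * (2 * C / d * mollR (2 * d) p.2) :=
          mul_le_mul (hT d hd hd2 _) (hR' d hd _) (abs_nonneg _) (by positivity)
      _ = A * (2 * C) * 1 / d * moll (2 * d) p := by rw [moll]; ring
      _ ≤ _ := by
          have : 0 ≤ moll (2 * d) p := mm
          gcongr
          linarith

section Slices

variable {X Y : Type*} [MeasurableSpace X] [MeasurableSpace Y] {μ : Measure X} {ν : Measure Y}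

lemma aestronglyMeasurable_kop_slices [SFinite μ] [SFinite ν] {k : X → X → ℝ}
    (hk : AESM (fun z : X × X => k z.1 z.2) (μ.prod μ)) {f : X × Y → ℝ}
    (hf : AESM f (μ.prod ν)) :
    AESM (fun P : X × Y => kop μ k (fun p => f (p, P.2)) P.1) (μ.prod ν) := by
  have hm : StronglyMeasurable
      (fun W : (X × Y) × X => hk.mk _ (W.1.1, W.2) * hf.mk _ (W.2, W.1.2)) :=
    (hk.stronglyMeasurable_mk.comp_measurable (by fun_prop)).mul
      (hf.stronglyMeasurable_mk.comp_measurable (by fun_prop))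
  have h1 : ∀ᵐ p ∂μ, (fun q => k p q) =ᵐ[μ] fun q => hk.mk _ (p, q) :=
    Measure.ae_ae_of_ae_prod (p := fun z : X × X => k z.1 z.2 = hk.mk _ z) hk.ae_eq_mk
  have h2 : ∀ᵐ z ∂ν, (fun q => f (q, z)) =ᵐ[μ] fun q => hf.mk _ (q, z) :=
    Measure.ae_ae_of_ae_prod (p := fun W : Y × X => f W.swap = hf.mk _ W.swap)
      ((Measure.measurePreserving_swap (μ := ν) (ν := μ)).quasiMeasurePreserving.ae hf.ae_eq_mk)
  refine ⟨_, hm.integral_prod_right' (ν := μ), ?_⟩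
  filter_upwards [(Measure.quasiMeasurePreserving_fst (μ := μ) (ν := ν)).ae h1,
    (Measure.quasiMeasurePreserving_snd (μ := μ) (ν := ν)).ae h2] with P hP1 hP2
  refine integral_congr_ae ?_
  filter_upwards [hP1, hP2] with q hq1 hq2
  rw [hq1, hq2]

end Slices

/-! ## Convolution on `ω_h` -/

/-- Convolution with a kernel that is periodic in `x`. -/
def conv (k f : F²) : F² := kop muH (fun p q => k (p - q)) f

lemma conv_apply (k f : F²) (p : ℝ²) : conv k f p = ∫ q, k (p - q) * f q ∂muH := rfl

lemma locInt_muH {f : F²} (hf : MemLp f 2 muH) : LocallyIntegrable f muH :=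
  hf.locallyIntegrable (by norm_num)

section Conv

variable {k f g : F²}

lemma integrable_conv (hk : IsTestH k) (hf : LocallyIntegrable f muH) (p : ℝ²) :
    Integrable (fun q => k (p - q) * f q) muH := by
  simpa only [mul_comm] using (hk.reflect p).integrable_mul hf

lemma conv_sub (hk : IsTestH k) (hf : LocallyIntegrable f muH) (hg : LocallyIntegrable g muH)
    (p : ℝ²) : conv k (f - g) p = conv k f p - conv k g p := by
  simp only [conv_apply, Pi.sub_apply, mul_sub]
  exact integral_sub (integrable_conv hk hf p) (integrable_conv hk hg p)

lemma conv_periodic (hk : IsTestH k) (f : F²) (x y : ℝ) :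
    conv k f (x + 1, y) = conv k f (x, y) := by
  simp only [conv_apply]
  congr 1; funext q
  have := hk.periodic (x - q.1) (y - q.2)
  rw [show ((x + 1, y) - q : ℝ²) = (x - q.1 + 1, y - q.2) by ext <;> simp; ring, this]
  rfl

/-- A smooth cutoff in `x` which equals `1` on the cell. -/
def cutX (x : ℝ) : ℝ := smoothTransition (2 + x) * smoothTransition (3 - x)

lemma contDiff_cutX : ContDiff ℝ ∞ cutX :=
  (smoothTransition.contDiff.comp (contDiff_const.add contDiff_id)).mul
    (smoothTransition.contDiff.comp (contDiff_const.sub contDiff_id))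

lemma cutX_eq_one {x : ℝ} (hx : x ∈ Ioo (0:ℝ) 1) : cutX x = 1 := by
  rw [cutX, smoothTransition.one_of_one_le, smoothTransition.one_of_one_le, one_mul]
  · linarith [hx.2]
  · linarith [hx.1]

lemma cutX_eq_zero {x : ℝ} (hx : x ∉ Icc (-2:ℝ) 3) : cutX x = 0 := by
  rw [mem_Icc, not_and_or, not_le, not_le] at hx
  rcases hx with h | h
  · rw [cutX, smoothTransition.zero_of_nonpos (by linarith), zero_mul]
  · rw [cutX, smoothTransition.zero_of_nonpos (x := 3 - x) (by linarith), mul_zero]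

lemma conv_eq_cut (k f : F²) (p : ℝ²) :
    conv k f p = ∫ q, f q * (cutX q.1 * k (p - q)) ∂muH := by
  refine integral_congr_ae ?_
  filter_upwards [ae_muH_mem] with q hq
  rw [cutX_eq_one hq.1]; ring

lemma contDiff_conv (hk : IsTestH k) (hf : LocallyIntegrable f muH) : ContDiff ℝ ∞ (conv k f) := by
  obtain ⟨R, hR⟩ := hk.support
  rw [funext (conv_eq_cut k f)]
  refine contDiff_integral_param (h := fun p q => cutX q.1 * k (p - q)) ?_ hf ?_
  · exact (contDiff_cutX.comp (contDiff_fst.comp contDiff_snd)).mul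
      (hk.smooth.comp (contDiff_fst.sub contDiff_snd))
  · intro p
    refine ⟨{p' | |p'.2 - p.2| < 1}, ?_, by simp, Icc (-2) 3 ×ˢ Icc (p.2 - 1 - R) (p.2 + 1 + R),
      isCompact_Icc.prod isCompact_Icc, ?_⟩
    · exact isOpen_lt (by fun_prop) continuous_const
    · rintro p' hp' q hq
      rw [mem_prod, not_and_or] at hq
      rcases hq with hq | hq
      · simp [cutX_eq_zero hq]
      · have hp2 := abs_lt.1 (show |p'.2 - p.2| < 1 from hp')
        have : k (p' - q) = 0 := by
          refine hR (p'.1 - q.1) (p'.2 - q.2) ?_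
          by_contra h
          have h' := abs_lt.1 (not_le.1 h)
          exact hq ⟨by linarith [h'.1, h'.2], by linarith [h'.1, h'.2]⟩
        simp [this]

lemma pdx_conv (hk : IsTestH k) (hf : LocallyIntegrable f muH) (p : ℝ²) :
    pdx (conv k f) p = conv (pdx k) f p := by
  obtain ⟨R, hR⟩ := hk.support
  have h := hasDerivAt_integral_param (μ := muH) (f := f)
    (h := fun t q => cutX q.1 * k ((t, p.2) - q)) ?_ hf p.1
    (k := Icc (-2) 3 ×ˢ Icc (p.2 - R) (p.2 + R)) (isCompact_Icc.prod isCompact_Icc) ?_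
  · rw [conv_eq_cut, pdx]
    simp only [conv_eq_cut]
    rw [h.deriv]
    congr 1; funext q
    congr 1
    have hd := (hasDerivAt_pdx hk.diff (p - q)).comp_sub_const (x := p.1) q.1
    exact (hd.const_mul (cutX q.1)).deriv
  · exact (contDiff_cutX.comp (contDiff_fst.comp contDiff_snd)).mul
      (hk.smooth.comp ((contDiff_fst.prodMk contDiff_const).sub contDiff_snd))
  · rintro t - q hq
    rw [mem_prod, not_and_or] at hq
    rcases hq with hq | hq
    · simp [cutX_eq_zero hq]
    · have : k ((t, p.2) - q) = 0 := by
        refine hR (t - q.1) (p.2 - q.2) ?_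
        by_contra h
        have h' := abs_lt.1 (not_le.1 h)
        exact hq ⟨by linarith [h'.1, h'.2], by linarith [h'.1, h'.2]⟩
      simp [this]

lemma pdy_conv (hk : IsTestH k) (hf : LocallyIntegrable f muH) (p : ℝ²) :
    pdy (conv k f) p = conv (pdy k) f p := by
  obtain ⟨R, hR⟩ := hk.support
  have h := hasDerivAt_integral_param (μ := muH) (f := f)
    (h := fun t q => cutX q.1 * k ((p.1, t) - q)) ?_ hf p.2
    (k := Icc (-2) 3 ×ˢ Icc (p.2 - 1 - R) (p.2 + 1 + R)) (isCompact_Icc.prod isCompact_Icc) ?_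
  · rw [conv_eq_cut, pdy]
    simp only [conv_eq_cut]
    rw [h.deriv]
    congr 1; funext q
    congr 1
    have hd := (hasDerivAt_pdy hk.diff (p - q)).comp_sub_const (x := p.2) q.2
    exact (hd.const_mul (cutX q.1)).deriv
  · exact (contDiff_cutX.comp (contDiff_fst.comp contDiff_snd)).mul
      (hk.smooth.comp ((contDiff_const.prodMk contDiff_fst).sub contDiff_snd))
  · rintro t ht q hq
    rw [mem_prod, not_and_or] at hq
    rcases hq with hq | hq
    · simp [cutX_eq_zero hq]
    · have : k ((p.1, t) - q) = 0 := by
        refine hR (p.1 - q.1) (t - q.2) ?_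
        by_contra h
        have h' := abs_lt.1 (not_le.1 h)
        exact hq ⟨by linarith [h'.1, h'.2, ht.1, ht.2], by linarith [h'.1, h'.2, ht.1, ht.2]⟩
      simp [this]

/-- Weak derivatives on `ω_h` (the integral identities of `IsWeakDx` and `IsWeakDy`). -/
def WeakX (f g : F²) : Prop := ∀ φ, IsTestH φ → ∫ p, f p * pdx φ p ∂muH = -∫ p, g p * φ p ∂muH

def WeakY (f g : F²) : Prop := ∀ φ, IsTestH φ → ∫ p, f p * pdy φ p ∂muH = -∫ p, g p * φ p ∂muH

lemma pdx_reflect (hk : IsTestH k) (p q : ℝ²) : pdx (fun q => k (p - q)) q = -pdx k (p - q) := by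
  have h := (hasDerivAt_pdx hk.diff (p - q)).comp_const_sub (x := q.1) p.1
  exact h.deriv

lemma pdy_reflect (hk : IsTestH k) (p q : ℝ²) : pdy (fun q => k (p - q)) q = -pdy k (p - q) := by
  have h := (hasDerivAt_pdy hk.diff (p - q)).comp_const_sub (x := q.2) p.2
  exact h.deriv

lemma conv_pdx (hk : IsTestH k) (h : WeakX f g) : conv (pdx k) f = conv k g := by
  funext p
  have h1 := h _ (hk.reflect p)
  simp only [pdx_reflect hk, mul_neg, integral_neg, neg_inj] at h1
  simpa only [conv_apply, mul_comm] using h1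

lemma conv_pdy (hk : IsTestH k) (h : WeakY f g) : conv (pdy k) f = conv k g := by
  funext p
  have h1 := h _ (hk.reflect p)
  simp only [pdy_reflect hk, mul_neg, integral_neg, neg_inj] at h1
  simpa only [conv_apply, mul_comm] using h1

lemma IsTestH.weakX (h : IsTestH f) : WeakX f (BetaPlane.pdx f) := fun _ hφ =>
  integral_mul_pdx (h.smooth.of_le (by simp)) h.periodic hφ

lemma IsTestH.weakY (h : IsTestH f) : WeakY f (BetaPlane.pdy f) := fun _ hφ =>
  integral_mul_pdy (h.smooth.of_le (by simp)) hφ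

lemma muH_strip (c R : ℝ) : muH {q | |q.2 - c| ≤ R} = ENNReal.ofReal (2 * R) := by
  have : {q : ℝ² | |q.2 - c| ≤ R} = univ ×ˢ Icc (c - R) (c + R) := by
    ext q; simp only [mem_ofPred_eq, abs_le, mem_prod, mem_univ, true_and, mem_Icc]
    constructor <;> rintro ⟨h1, h2⟩ <;> constructor <;> linarith
  rw [this, muH_eq, Measure.prod_prod, nu_univ, one_mul, volume_Icc]
  congr 1; ring

lemma IsTestH.exists_lintegral_bound (hk : IsTestH k) : ∃ A : ENNReal, A ≠ ⊤ ∧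
    (∀ p, ∫⁻ q, ‖k (p - q)‖ₑ ∂muH ≤ A) ∧ ∀ q, ∫⁻ p, ‖k (p - q)‖ₑ ∂muH ≤ A := by
  obtain ⟨C, hC0, hC⟩ := hk.exists_bound
  obtain ⟨R, hR⟩ := hk.support
  have key : ∀ (w : ℝ² → ℝ²) (c : ℝ), (∀ q, |(w q).2| = |q.2 - c|) →
      ∫⁻ q, ‖k (w q)‖ₑ ∂muH ≤ ENNReal.ofReal C * ENNReal.ofReal (2 * R) := by
    intro w c hw
    rw [← muH_strip c R, ← lintegral_indicator_const (by measurability)]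
    refine lintegral_mono fun q => ?_
    by_cases hq : q ∈ {q : ℝ² | |q.2 - c| ≤ R}
    · rw [indicator_of_mem hq, enorm_eq_ofReal_abs]
      exact ENNReal.ofReal_le_ofReal (hC _)
    · have : k (w q) = 0 := by
        refine hR (w q).1 (w q).2 ?_
        rw [hw]; exact (not_le.1 hq).le
      rw [this]; simp
  refine ⟨ENNReal.ofReal C * ENNReal.ofReal (2 * R), ENNReal.mul_ne_top ENNReal.ofReal_ne_top
    ENNReal.ofReal_ne_top, fun p => key _ p.2 fun q => ?_, fun q => key _ q.2 fun p => rfl⟩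
  exact abs_sub_comm _ _

lemma aesm_sub_kernel (hk : IsTestH k) :
    AESM (fun z : (ℝ²) × (ℝ²) => k (z.1 - z.2)) (muH.prod muH) :=
  (hk.smooth.continuous.comp (continuous_fst.sub continuous_snd)).aestronglyMeasurable

lemma IsTestH.exists_conv_bound (hk : IsTestH k) : ∃ A : ENNReal, A ≠ ⊤ ∧
    ∀ f, MemLp f 2 muH → eLpNorm (conv k f) 2 muH ≤ A * eLpNorm f 2 muH := by
  obtain ⟨A, hA, h1, h2⟩ := hk.exists_lintegral_bound
  exact ⟨A, hA, fun f hf => eLpNorm_two_kop_le (aesm_sub_kernel hk)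
    (.of_forall h1) (.of_forall h2) hf.1⟩

lemma aestronglyMeasurable_conv (hk : IsTestH k) (hf : LocallyIntegrable f muH) :
    AESM (conv k f) muH :=
  (contDiff_conv hk hf).continuous.aestronglyMeasurable

lemma memLp_conv (hk : IsTestH k) (hf : MemLp f 2 muH) : MemLp (conv k f) 2 muH := by
  obtain ⟨A, hA, h⟩ := hk.exists_conv_bound
  exact ⟨aestronglyMeasurable_kop (aesm_sub_kernel hk) hf.1,
    (h f hf).trans_lt (ENNReal.mul_lt_top hA.lt_top hf.2)⟩

/-- Convolution maps `L²` to bounded functions. -/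
lemma IsTestH.exists_conv_sup_bound (hk : IsTestH k) : ∃ A : ℝ, 0 ≤ A ∧
    ∀ f, MemLp f 2 muH → ∀ p, |conv k f p| ≤ A * nrm muH f := by
  obtain ⟨A, hA, h1, -⟩ := (hk.mul_smooth hk.smooth hk.periodic).exists_lintegral_bound
  refine ⟨sqrt A.toReal, sqrt_nonneg _, fun f hf p => ?_⟩
  have hr := (hk.reflect p).memLp
  refine (abs_integral_mul_le hr hf).trans ?_
  gcongr
  · exact nrm_nonneg _
  · refine le_sqrt_of_sq_le ?_
    rw [nrm, ← ENNReal.toReal_pow, eLpNorm_two_sq]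
    refine ENNReal.toReal_mono hA (le_trans (le_of_eq ?_) (h1 p))
    refine lintegral_congr fun q => ?_
    rw [enorm_mul, sq]

/-- The adjoint of a convolution. -/
lemma integral_conv_mul (hk : IsTestH k) (hf : MemLp f 2 muH) (hg : MemLp g 2 muH) :
    ∫ p, conv k f p * g p ∂muH = ∫ q, f q * conv (fun r => k (-r)) g q ∂muH := by
  have hk' := aesm_sub_kernel hk
  have hint : Integrable (fun z : (ℝ²) × (ℝ²) => k (z.1 - z.2) * f z.2 * g z.1) (muH.prod muH) := by
    have hm : AESM (fun z : (ℝ²) × (ℝ²) => k (z.1 - z.2) * f z.2 * g z.1)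
        (muH.prod muH) := (hk'.mul hf.1.comp_snd).mul hg.1.comp_fst
    rw [integrable_prod_iff hm]
    constructor
    · exact .of_forall fun p =>
        (integrable_conv hk (locInt_muH hf) p).mul_const (g p)
    · obtain ⟨A, hA, h1, h2⟩ := hk.exists_lintegral_bound
      have habs : AESM (fun z : (ℝ²) × (ℝ²) => |k (z.1 - z.2)|) (muH.prod muH) := hk'.norm
      have hmem : MemLp (kop muH (fun p q => |k (p - q)|) (fun q => |f q|)) 2 muH :=
        ⟨aestronglyMeasurable_kop habs hf.1.norm, (eLpNorm_two_kop_le habs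
          (A := A) (.of_forall (by simpa using h1)) (.of_forall (by simpa using h2))
          hf.1.norm).trans_lt (ENNReal.mul_lt_top hA.lt_top hf.abs.2)⟩
      refine (hmem.integrable_mul hg.abs).congr (.of_forall fun p => ?_)
      simp only [Pi.mul_apply, kop, norm_mul, norm_eq_abs, Pi.abs_apply]
      rw [integral_mul_const]
  have h1 : ∫ p, conv k f p * g p ∂muH = ∫ p, ∫ q, k (p - q) * f q * g p ∂muH ∂muH := by
    congr 1; funext p
    rw [integral_mul_const]; rfl
  rw [h1, integral_integral_swap hint]
  congr 1; funext q
  rw [conv_apply, ← integral_const_mul]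
  congr 1; funext p
  rw [neg_sub]; ring

end Conv

/-! ### Approximation by mollified functions -/

/-- The scale of the `n`-th mollifier. -/
def dl (n : ℕ) : ℝ := 1 / ((n : ℝ) + 4)

lemma dl_pos (n : ℕ) : 0 < dl n := by unfold dl; positivity

lemma dl_le (n : ℕ) : dl n ≤ 1 / 4 := by
  unfold dl
  gcongr
  have : (0:ℝ) ≤ n := Nat.cast_nonneg n
  linarith

lemma tendsto_dl : Tendsto dl atTop (𝓝 0) := by
  have h := (tendsto_one_div_add_atTop_nhds_zero_nat (𝕜 := ℝ)).comp (tendsto_add_atTop_nat 3)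
  refine h.congr fun n => ?_
  simp only [Function.comp, dl]; push_cast; ring_nf

/-- Mollification at scale `dl n`. -/
def mol (n : ℕ) (f : F²) : F² := conv (moll (dl n)) f

lemma testDl (n : ℕ) : IsTestH (moll (dl n)) := isTestH_moll (dl_pos n)

lemma memLp_mol {n : ℕ} {f : F²} (hf : MemLp f 2 muH) : MemLp (mol n f) 2 muH :=
  memLp_conv (testDl n) hf

lemma dl_le_one (n : ℕ) : dl n ≤ 1 := (dl_le n).trans (by norm_num)

lemma eLpNorm_mol_le (n : ℕ) {f : F²} (hf : AESM f muH) :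
    eLpNorm (mol n f) 2 muH ≤ eLpNorm f 2 muH := by
  have := eLpNorm_two_kop_le (aesm_sub_kernel (testDl n)) (A := 1)
    (.of_forall fun p => (lintegral_moll (dl_pos n) (dl_le_one n) p).le)
    (.of_forall fun p => (lintegral_moll' (dl_pos n) (dl_le_one n) p).le) hf
  rwa [one_mul] at this

lemma eLpNorm_one_mol_le (n : ℕ) {f : F²} (hf : AESM f muH) :
    eLpNorm (mol n f) 1 muH ≤ eLpNorm f 1 muH := by
  have := eLpNorm_one_kop_le (aesm_sub_kernel (testDl n)) (A := 1)
    (.of_forall fun p => (lintegral_moll' (dl_pos n) (dl_le_one n) p).le) hf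
  rwa [one_mul] at this

lemma mol_sub_apply {g : F²} (n : ℕ) (hg : LocallyIntegrable g muH) (p : ℝ²) :
    mol n g p - g p = ∫ q, moll (dl n) (p - q) * (g q - g p) ∂muH := by
  simp only [mul_sub]
  rw [integral_sub (integrable_conv (testDl n) hg p)
    (((testDl n).reflect p).integrable.mul_const _), integral_mul_const,
    integral_moll (dl_pos n) (dl_le_one n), one_mul]
  rfl

lemma abs_mol_sub_le {g : F²} (n : ℕ) (hg : LocallyIntegrable g muH) (p : ℝ²) {e : ℝ}
    (h : ∀ q ∈ cellH, moll (dl n) (p - q) ≠ 0 → |g q - g p| ≤ e) : |mol n g p - g p| ≤ e := by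
  rw [mol_sub_apply n hg]
  have h1 : ∀ᵐ q ∂muH, ‖moll (dl n) (p - q) * (g q - g p)‖ ≤ moll (dl n) (p - q) * e := by
    filter_upwards [ae_muH_mem] with q hq
    have h0 := moll_nonneg (dl_pos n) (dl_le_one n) (p - q)
    rw [norm_mul, norm_of_nonneg h0]
    by_cases hz : moll (dl n) (p - q) = 0
    · simp [hz]
    · exact mul_le_left (h q hq hz) h0
  have h2 := norm_integral_le_of_norm_le (((testDl n).reflect p).integrable.mul_const e) h1
  rwa [integral_mul_const, integral_moll (dl_pos n) (dl_le_one n), one_mul] at h2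

lemma abs_sub_lt_of_abs_sin_lt {x x' r d : ℝ} (hx : x ∈ Ioo (0:ℝ) 1) (hx' : x' ∈ Ioo (0:ℝ) 1)
    (h : |sπ(x - x')| < d) (h1 : d ≤ 2 * r) (h2 : d ≤ 2 * x)
    (h3 : d ≤ 2 * (1 - x)) : |x - x'| < r := by
  rcases le_or_gt |x - x'| (1/2) with ht | ht
  · have := two_mul_le_abs_sin ht
    linarith
  · exfalso
    rcases lt_abs.1 ht with ht | ht
    · have := two_mul_le_abs_sin (t := (x - x') + (-1 : ℤ)) (by
        push_cast; rw [abs_le]; constructor <;> linarith [hx.2, hx'.1])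
      rw [abs_sin_periodic] at this
      push_cast at this
      rw [abs_of_nonpos (by linarith [hx.2, hx'.1] : x - x' + -1 ≤ 0)] at this
      linarith [hx'.1]
    · have := two_mul_le_abs_sin (t := (x - x') + (1 : ℤ)) (by
        push_cast; rw [abs_le]; constructor <;> linarith [hx.1, hx'.2])
      rw [abs_sin_periodic] at this
      push_cast at this
      rw [abs_of_nonneg (by linarith [hx.1, hx'.2] : 0 ≤ x - x' + 1)] at this
      linarith [hx'.2]

lemma tendsto_mol_apply {g : F²} (hg : Continuous g) {p : ℝ²} (hp : p ∈ cellH) :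
    Tendsto (fun n => mol n g p) atTop (𝓝 (g p)) := by
  rw [Metric.tendsto_nhds]
  intro e he
  obtain ⟨r, hr, hr2⟩ := Metric.continuousAt_iff.1 hg.continuousAt (e / 2) (half_pos he)
  have hx := hp.1
  have hpos : 0 < min (2 * r) (min (2 * p.1) (2 * (1 - p.1))) := by
    have := hx.1; have := hx.2
    refine lt_min (by linarith) (lt_min (by linarith) (by linarith))
  filter_upwards [tendsto_dl.eventually (gt_mem_nhds (lt_min hpos hr))] with n hn
  have hn1 := (lt_min_iff.1 hn).1
  have hn2 := (lt_min_iff.1 hn).2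
  rw [lt_min_iff, lt_min_iff] at hn1
  rw [dist_eq]
  refine lt_of_le_of_lt (abs_mol_sub_le n hg.locallyIntegrable p fun q hq hne => ?_) (half_lt_self he)
  obtain ⟨h1, h2⟩ := moll_ne_zero (dl_pos n) hne
  have h3 := abs_sub_lt_of_abs_sin_lt hx hq.1 h1 hn1.1.le hn1.2.1.le hn1.2.2.le
  have : dist q p < r := by
    rw [Prod.dist_eq, max_lt_iff, dist_eq, dist_eq, abs_sub_comm, abs_sub_comm q.2]
    exact ⟨h3, lt_trans h2 hn2⟩
  have := hr2 this
  rw [dist_eq] at this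
  exact this.le

lemma tendsto_eLpNorm_mol_sub_of_continuous {r : NNReal} (hr : r ≠ 0) {g : F²}
    (hg : Continuous g) (hs : HasCompactSupport g) :
    Tendsto (fun n => eLpNorm (mol n g - g) r muH) atTop (𝓝 0) := by
  obtain ⟨M, hM⟩ := hg.bounded_above_of_compact_support hs
  obtain ⟨R, hR⟩ := hs.isCompact.isBounded.subset_closedBall (0 : ℝ²)
  have hzero : ∀ q : ℝ², R < |q.2| → g q = 0 := by
    intro q hq
    by_contra hne
    have := hR (subset_tsupport _ hne)
    rw [mem_closedBall_zero_iff, Prod.norm_def, sup_le_iff] at this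
    exact absurd this.2 (not_le.2 hq)
  set S : Set (ℝ²) := {q | |q.2 - 0| ≤ R + 1} with hS
  have hSm : MeasurableSet S := by measurability
  refine tendsto_eLpNorm_zero_of_dominated hr (g := S.indicator fun _ => 2 * M) ?_ ?_ ?_ ?_
  · refine (memLp_indicator_const _ hSm _ (Or.inr ?_))
    rw [hS, muH_strip]; exact ENNReal.ofReal_ne_top
  · exact .of_forall fun n =>
      (aestronglyMeasurable_conv (testDl n) hg.locallyIntegrable).sub hg.aestronglyMeasurable
  · refine .of_forall fun n => .of_forall fun p => ?_
    have hM0 : 0 ≤ M := (norm_nonneg _).trans (hM 0)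
    refine (abs_mol_sub_le (e := |S.indicator (fun _ => 2 * M) p|) n hg.locallyIntegrable p ?_)
    intro q _ hne
    by_cases hp : p ∈ S
    · rw [indicator_of_mem hp, abs_of_nonneg (by linarith : 0 ≤ 2 * M)]
      have h1 := hM q; have h2 := hM p
      rw [norm_eq_abs] at h1 h2
      have h1' := abs_le.1 h1; have h2' := abs_le.1 h2
      rw [abs_le]; constructor <;> linarith [h1'.1, h1'.2, h2'.1, h2'.2]
    · have h2 := (moll_ne_zero (dl_pos n) hne).2
      have hp' : R + 1 < |p.2| := by simpa [hS] using hp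
      have h3 := abs_sub_abs_le_abs_sub p.2 q.2
      have h4 := dl_le_one n
      rw [hzero p (by linarith), hzero q (by
        have : |(p - q).2| = |p.2 - q.2| := rfl
        linarith)]
      simp
  · filter_upwards [ae_muH_mem] with p hp
    have := (tendsto_mol_apply hg hp).sub_const (g p)
    simpa using this

lemma tendsto_mol_sub {f : F²} (hf : MemLp f 2 muH) :
    Tendsto (fun n => eLpNorm (mol n f - f) 2 muH) atTop (𝓝 0) := by
  refine tendsto_eLpNorm_of_dense (T := fun n f => mol n f - f)
    (D := fun g => Continuous g ∧ HasCompactSupport g) (A := 2) (by norm_num) (by simp)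
    ?_ ?_ ?_ ?_ ?_ hf
  · intro f hf e he
    obtain ⟨g, h1, h2, h3, h4⟩ := hf.exists_hasCompactSupport_eLpNorm_sub_le (by simp) he
    exact ⟨g, ⟨h3, h1⟩, h4, h2⟩
  · exact fun n f hf => (aestronglyMeasurable_conv (testDl n)
      (locInt_muH hf)).sub hf.1
  · intro n f hf
    refine (eLpNorm_sub_le (aestronglyMeasurable_conv (testDl n)
      (locInt_muH hf)) hf.1 (by norm_num)).trans ?_
    rw [two_mul]
    gcongr
    exact eLpNorm_mol_le n hf.1
  · intro n f g hf hg
    refine .of_forall fun p => ?_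
    simp only [Pi.sub_apply, mol, conv_sub (testDl n) (locInt_muH hf) (locInt_muH hg)]
    ring
  · intro g hg _
    simpa using tendsto_eLpNorm_mol_sub_of_continuous (r := 2) two_ne_zero hg.1 hg.2

lemma tendsto_eLpNorm_one_mol_sub {f : F²} (hf : Integrable f muH) :
    Tendsto (fun n => eLpNorm (mol n f - f) 1 muH) atTop (𝓝 0) := by
  refine tendsto_eLpNorm_of_dense (T := fun n f => mol n f - f)
    (D := fun g => Continuous g ∧ HasCompactSupport g) (A := 2) le_rfl (by simp)
    ?_ ?_ ?_ ?_ ?_ (memLp_one_iff_integrable.2 hf)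
  · intro f hf e he
    obtain ⟨g, h1, h2, h3, h4⟩ := hf.exists_hasCompactSupport_eLpNorm_sub_le (by simp) he
    exact ⟨g, ⟨h3, h1⟩, h4, h2⟩
  · exact fun n f hf => (aestronglyMeasurable_conv (testDl n)
      (memLp_one_iff_integrable.1 hf).locallyIntegrable).sub hf.1
  · intro n f hf
    refine (eLpNorm_sub_le (aestronglyMeasurable_conv (testDl n)
      (memLp_one_iff_integrable.1 hf).locallyIntegrable) hf.1 le_rfl).trans ?_
    rw [two_mul]
    gcongr
    exact eLpNorm_one_mol_le n hf.1
  · intro n f g hf hg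
    refine .of_forall fun p => ?_
    simp only [Pi.sub_apply, mol, conv_sub (testDl n)
      (memLp_one_iff_integrable.1 hf).locallyIntegrable
      (memLp_one_iff_integrable.1 hg).locallyIntegrable]
    ring
  · intro g hg _
    simpa using tendsto_eLpNorm_mol_sub_of_continuous (r := 1) one_ne_zero hg.1 hg.2

/-- Mollifications converge almost everywhere, along a subsequence and locally. -/
lemma exists_seq_mol_tendsto_ae {f : F²} (hf : LocallyIntegrable f muH) (R : ℝ) :
    ∃ ns : ℕ → ℕ, ∀ᵐ p ∂muH, |p.2| ≤ R → Tendsto (fun i => mol (ns i) f p) atTop (𝓝 (f p)) := by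
  set K : Set (ℝ²) := Icc 0 1 ×ˢ Icc (-(R + 1)) (R + 1) with hK
  have hKc : IsCompact K := isCompact_Icc.prod isCompact_Icc
  have hi : Integrable (K.indicator f) muH :=
    (hf.integrableOn_isCompact hKc).integrable_indicator hKc.measurableSet
  have ht := tendsto_eLpNorm_one_mol_sub hi
  obtain ⟨ns, -, hns⟩ := (tendstoInMeasure_of_tendsto_eLpNorm (p := 1) one_ne_zero
    (fun n => aestronglyMeasurable_conv (testDl n) hi.locallyIntegrable)
    hi.aestronglyMeasurable ht).exists_seq_tendsto_ae
  refine ⟨ns, ?_⟩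
  filter_upwards [hns, ae_muH_mem] with p hp hpc hpR
  have e1 : K.indicator f p = f p := by
    refine indicator_of_mem (s := K) ⟨Ioo_subset_Icc_self hpc.1, ?_⟩ f
    have := abs_le.1 hpR
    exact ⟨by linarith, by linarith⟩
  have e2 : ∀ n, mol n (K.indicator f) p = mol n f p := by
    intro n
    refine integral_congr_ae ?_
    filter_upwards [ae_muH_mem] with q hq
    by_cases hz : moll (dl n) (p - q) = 0
    · simp [hz]
    · have h2 := (moll_ne_zero (dl_pos n) hz).2
      rw [indicator_of_mem (s := K)]
      refine ⟨Ioo_subset_Icc_self hq.1, abs_le.1 ?_⟩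
      have h3 := abs_sub_abs_le_abs_sub q.2 p.2
      have h4 := dl_le_one n
      rw [abs_sub_comm] at h3
      have : |(p - q).2| = |p.2 - q.2| := rfl
      linarith
  rw [e1] at hp
  exact hp.congr fun i => e2 (ns i)

lemma ae_of_forall_abs_le {P : ℝ² → Prop} (h : ∀ R : ℕ, ∀ᵐ p ∂muH, |p.2| ≤ (R : ℝ) → P p) :
    ∀ᵐ p ∂muH, P p := by
  filter_upwards [ae_all_iff.2 h] with p hp
  obtain ⟨n, hn⟩ := exists_nat_ge |p.2|
  exact hp n hn

lemma ae_eq_zero_of_forall_test {f : F²} (hf : LocallyIntegrable f muH)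
    (h : ∀ φ, IsTestH φ → ∫ p, f p * φ p ∂muH = 0) : f =ᵐ[muH] 0 := by
  refine ae_of_forall_abs_le fun R => ?_
  obtain ⟨ns, hns⟩ := exists_seq_mol_tendsto_ae hf R
  filter_upwards [hns] with p hp hR
  have h0 : ∀ n, mol n f p = 0 := fun n => by
    have := h _ ((testDl n).reflect p)
    simpa only [mol, conv_apply, mul_comm] using this
  have := hp hR
  simp only [h0] at this
  exact (tendsto_nhds_unique tendsto_const_nhds this).symm

lemma WeakX.ae_unique {f g g' : F²} (hg : LocallyIntegrable g muH)
    (hg' : LocallyIntegrable g' muH) (h : WeakX f g) (h' : WeakX f g') : g =ᵐ[muH] g' := by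
  have := ae_eq_zero_of_forall_test (hg.sub hg') fun φ hφ => by
    have e := (h φ hφ).symm.trans (h' φ hφ)
    simp only [Pi.sub_apply, sub_mul]
    rw [integral_sub (hφ.integrable_mul hg) (hφ.integrable_mul hg')]
    linarith
  filter_upwards [this] with p hp
  simpa [sub_eq_zero] using hp

lemma WeakY.ae_unique {f g g' : F²} (hg : LocallyIntegrable g muH)
    (hg' : LocallyIntegrable g' muH) (h : WeakY f g) (h' : WeakY f g') : g =ᵐ[muH] g' := by
  have := ae_eq_zero_of_forall_test (hg.sub hg') fun φ hφ => by
    have e := (h φ hφ).symm.trans (h' φ hφ)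
    simp only [Pi.sub_apply, sub_mul]
    rw [integral_sub (hφ.integrable_mul hg) (hφ.integrable_mul hg')]
    linarith
  filter_upwards [this] with p hp
  simpa [sub_eq_zero] using hp

/-! ## Smoothing on `ω` -/

/-- The smoothing kernel on `ω`, shifted upwards so that smoothed functions vanish at `z = 1`. -/
def ker3 (d : ℝ) (P Q : ℝ³) : ℝ := moll d (P.1 - Q.1) * mollR d (P.2 + 2 * d - Q.2)

/-- Smoothing on `ω`. -/
def smooth3 (n : ℕ) (f : F³) : F³ := kop muO (ker3 (dl n)) f

section Smoothing

variable {f g : F³} {d : ℝ}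

lemma contDiff_ker3 (d : ℝ) (hd : 0 < d) : ContDiff ℝ ∞ (fun w : (ℝ³) × (ℝ³) => ker3 d w.1 w.2) :=
  ((isTestH_moll hd).smooth.comp ((contDiff_fst.comp contDiff_fst).sub
    (contDiff_fst.comp contDiff_snd))).mul ((contDiff_mollR d).comp
      (((contDiff_snd.comp contDiff_fst).add contDiff_const).sub (contDiff_snd.comp contDiff_snd)))

lemma isTest_ker3 (hd : 0 < d) (P : ℝ³) : IsTest (ker3 d P) where
  smooth := ((isTestH_moll hd).smooth.comp (contDiff_const.sub contDiff_fst)).mul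
    ((contDiff_mollR d).comp (contDiff_const.sub contDiff_snd))
  periodic x y z := by
    simp only [ker3]
    rw [((isTestH_moll hd).reflect P.1).periodic x y]
  support := by
    obtain ⟨R, hR⟩ := ((isTestH_moll hd).reflect P.1).support
    exact ⟨R, fun x y z hy => by simp only [ker3]; rw [hR x y hy, zero_mul]⟩

lemma ker3_nonneg (hd : 0 < d) (hd1 : d ≤ 1) (P Q : ℝ³) : 0 ≤ ker3 d P Q :=
  mul_nonneg (moll_nonneg hd hd1 _) (mollR_nonneg hd _)

lemma ker3_ne_zero (hd : 0 < d) {P Q : ℝ³} (h : ker3 d P Q ≠ 0) :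
    |sπ(P.1.1 - Q.1.1)| < d ∧ |P.1.2 - Q.1.2| < d ∧ |P.2 + 2 * d - Q.2| < d := by
  have h1 : moll d (P.1 - Q.1) ≠ 0 := fun h' => h (by rw [ker3, h', zero_mul])
  refine ⟨(moll_ne_zero hd h1).1, (moll_ne_zero hd h1).2, ?_⟩
  by_contra h'
  exact h (by rw [ker3, mollR_eq_zero hd (not_lt.1 h'), mul_zero])

lemma measurable_moll (hd : 0 < d) : Measurable (moll d) :=
  (isTestH_moll hd).smooth.continuous.measurable

lemma measurable_mollR (d : ℝ) : Measurable (mollR d) := (contDiff_mollR d).continuous.measurable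

lemma lintegral_mollR (hd : 0 < d) : ∫⁻ t, ‖mollR d t‖ₑ = 1 := by
  have h := ofReal_integral_eq_lintegral_ofReal (integrable_mollR hd)
    (.of_forall fun t => mollR_nonneg hd t)
  have h1 : ∫ t, mollR d t = 1 := by
    have := integral_mollR hd 0
    simp only [zero_sub, mollR_neg] at this
    exact this
  rw [h1, ENNReal.ofReal_one] at h
  rw [h]
  refine lintegral_congr fun t => ?_
  rw [enorm_of_nonneg (mollR_nonneg hd _)]

lemma lintegral_ker3_right (hd : 0 < d) (hd1 : d ≤ 1) (P : ℝ³) :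
    ∫⁻ Q, ‖ker3 d P Q‖ₑ ∂muO ≤ 1 := by
  rw [muO_eq]
  simp only [ker3, enorm_mul]
  rw [lintegral_prod_mul (f := fun q => ‖moll d (P.1 - q)‖ₑ)
    (g := fun t => ‖mollR d (P.2 + 2 * d - t)‖ₑ)
    ((measurable_moll hd).comp (measurable_const.sub measurable_id)).enorm.aemeasurable
    ((measurable_mollR d).comp (measurable_const.sub measurable_id)).enorm.aemeasurable,
    lintegral_moll hd hd1, one_mul]
  refine (lintegral_mono' Measure.restrict_le_self le_rfl).trans (le_of_eq ?_)
  rw [lintegral_sub_left_eq_self (fun t => ‖mollR d t‖ₑ) (P.2 + 2 * d), lintegral_mollR hd]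

lemma lintegral_ker3_left (hd : 0 < d) (hd1 : d ≤ 1) (Q : ℝ³) :
    ∫⁻ P, ‖ker3 d P Q‖ₑ ∂muO ≤ 1 := by
  rw [muO_eq]
  simp only [ker3, enorm_mul]
  rw [lintegral_prod_mul (f := fun p => ‖moll d (p - Q.1)‖ₑ)
    (g := fun t => ‖mollR d (t + 2 * d - Q.2)‖ₑ)
    ((measurable_moll hd).comp (measurable_id.sub measurable_const)).enorm.aemeasurable
    ((measurable_mollR d).comp ((measurable_id.add measurable_const).sub
      measurable_const)).enorm.aemeasurable,
    lintegral_moll' hd hd1, one_mul]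
  refine (lintegral_mono' Measure.restrict_le_self le_rfl).trans (le_of_eq ?_)
  simp only [add_sub_assoc]
  rw [lintegral_add_right_eq_self (fun t => ‖mollR d t‖ₑ) (2 * d - Q.2), lintegral_mollR hd]

lemma aestronglyMeasurable_ker3 (hd : 0 < d) : AESM (fun z : (ℝ³) × (ℝ³) => ker3 d z.1 z.2)
      (muO.prod muO) := (contDiff_ker3 d hd).continuous.aestronglyMeasurable

lemma eLpNorm_smooth3_le (n : ℕ) (hf : AESM f muO) :
    eLpNorm (smooth3 n f) 2 muO ≤ eLpNorm f 2 muO := by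
  have := eLpNorm_two_kop_le (aestronglyMeasurable_ker3 (dl_pos n)) (A := 1)
    (.of_forall fun P => lintegral_ker3_right (dl_pos n) (dl_le_one n) P)
    (.of_forall fun P => lintegral_ker3_left (dl_pos n) (dl_le_one n) P) hf
  rwa [one_mul] at this

lemma aestronglyMeasurable_smooth3 (n : ℕ) (hf : AESM f muO) : AESM (smooth3 n f) muO :=
  aestronglyMeasurable_kop (aestronglyMeasurable_ker3 (dl_pos n)) hf

lemma IsTest.integrable_mul {φ : F³} (hφ : IsTest φ) (hf : LocallyIntegrable f muO) :
    Integrable (fun P => f P * φ P) muO := by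
  obtain ⟨R, hR⟩ := hφ.support
  have hK : IsCompact ((Icc (0:ℝ) 1 ×ˢ Icc (-R) R) ×ˢ Icc (0:ℝ) 1) :=
    (isCompact_Icc.prod isCompact_Icc).prod isCompact_Icc
  have h1 := (hf.integrableOn_isCompact hK).mul_continuousOn hφ.smooth.continuous.continuousOn hK
  rw [← integrableOn_univ]
  refine h1.of_ae_sdiff_eq_zero MeasurableSet.univ.nullMeasurableSet ?_
  filter_upwards [ae_muO_mem]
  rintro ⟨⟨x, y⟩, z⟩ ⟨⟨hx, -⟩, hz⟩ ⟨-, h2⟩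
  rw [hR x y z (not_lt.1 fun hy =>
    h2 ⟨⟨Ioo_subset_Icc_self hx, abs_le.1 hy.le⟩, Ioo_subset_Icc_self hz⟩), mul_zero]

lemma locInt_muO (hf : MemLp f 2 muO) : LocallyIntegrable f muO :=
  hf.locallyIntegrable (by norm_num)

lemma integrable_ker3 (n : ℕ) (hf : LocallyIntegrable f muO) (P : ℝ³) :
    Integrable (fun Q => ker3 (dl n) P Q * f Q) muO := by
  simpa only [mul_comm] using (isTest_ker3 (dl_pos n) P).integrable_mul hf

lemma smooth3_eq_cut (n : ℕ) (f : F³) (P : ℝ³) :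
    smooth3 n f P = ∫ Q, f Q * (cutX Q.1.1 * ker3 (dl n) P Q) ∂muO := by
  refine integral_congr_ae ?_
  filter_upwards [ae_muO_mem] with q hq
  rw [cutX_eq_one hq.1.1]; ring

lemma cut_ker3_eq_zero (hd : 0 < d) (hd1 : d ≤ 1) {P P' Q : ℝ³}
    (hy : |P'.1.2 - P.1.2| ≤ 1) (hz : |P'.2 - P.2| ≤ 1)
    (hQ : Q ∉ (Icc (-2:ℝ) 3 ×ˢ Icc (P.1.2 - 2) (P.1.2 + 2)) ×ˢ Icc (P.2 - 4) (P.2 + 4)) :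
    cutX Q.1.1 * ker3 d P' Q = 0 := by
  by_contra hne
  obtain ⟨-, h2, h3⟩ := ker3_ne_zero hd (right_ne_zero_of_mul hne)
  have h1 : Q.1.1 ∈ Icc (-2:ℝ) 3 := by
    by_contra h; exact left_ne_zero_of_mul hne (cutX_eq_zero h)
  rw [abs_lt] at h2 h3
  rw [abs_le] at hy hz
  refine hQ ⟨⟨h1, ?_, ?_⟩, ?_, ?_⟩ <;> linarith [h2.1, h2.2, h3.1, h3.2, hy.1, hy.2, hz.1, hz.2]

lemma contDiff_smooth3 (n : ℕ) (hf : LocallyIntegrable f muO) : ContDiff ℝ ∞ (smooth3 n f) := by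
  rw [funext (smooth3_eq_cut n f)]
  refine contDiff_integral_param (h := fun P Q => cutX Q.1.1 * ker3 (dl n) P Q) ?_ hf ?_
  · exact (contDiff_cutX.comp (contDiff_fst.comp (contDiff_fst.comp contDiff_snd))).mul
      (contDiff_ker3 _ (dl_pos n))
  · intro P
    refine ⟨{P' | |P'.1.2 - P.1.2| < 1} ∩ {P' | |P'.2 - P.2| < 1},
      (isOpen_lt (by fun_prop) continuous_const).inter (isOpen_lt (by fun_prop) continuous_const),
      by simp, _, (isCompact_Icc.prod isCompact_Icc).prod isCompact_Icc, fun P' hP' Q hQ =>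
        cut_ker3_eq_zero (dl_pos n) (dl_le_one n) (le_of_lt hP'.1) (le_of_lt hP'.2) hQ⟩

lemma smooth3_periodic (n : ℕ) (f : F³) (x y z : ℝ) :
    smooth3 n f ((x + 1, y), z) = smooth3 n f ((x, y), z) := by
  simp only [smooth3, kop, ker3]
  congr 1; funext Q
  have := (testDl n).periodic (x - Q.1.1) (y - Q.1.2)
  rw [show ((x + 1, y) - Q.1 : ℝ²) = (x - Q.1.1 + 1, y - Q.1.2) by ext <;> simp; ring, this]
  rfl

lemma smooth3_top (n : ℕ) (f : F³) (p : ℝ²) : smooth3 n f (p, 1) = 0 := by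
  refine integral_eq_zero_of_ae ?_
  filter_upwards [ae_muO_mem] with Q hQ
  have h : mollR (dl n) (1 + 2 * dl n - Q.2) = 0 := by
    refine mollR_eq_zero (dl_pos n) ?_
    have := dl_pos n
    rw [abs_of_nonneg] <;> linarith [hQ.2.2]
  simp [ker3, h]

/-- Weak horizontal derivatives on `ω`. -/
def WeakOX (f g : F³) : Prop := ∀ φ, IsTest φ → ∫ P, f P * dX φ P ∂muO = -∫ P, g P * φ P ∂muO

def WeakOY (f g : F³) : Prop := ∀ φ, IsTest φ → ∫ P, f P * dY φ P ∂muO = -∫ P, g P * φ P ∂muO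

lemma deriv_ker3_x (hd : 0 < d) (P Q : ℝ³) :
    HasDerivAt (fun t => ker3 d ((t, P.1.2), P.2) Q) (-dX (ker3 d P) Q) P.1.1 := by
  have h1 := (hasDerivAt_pdx (isTestH_moll hd).diff (P.1 - Q.1)).comp_sub_const (x := P.1.1) Q.1.1
  have h2 := (hasDerivAt_pdx (isTestH_moll hd).diff (P.1 - Q.1)).comp_const_sub (x := Q.1.1) P.1.1
  have h3 := h1.mul_const (mollR d (P.2 + 2 * d - Q.2))
  have h4 : dX (ker3 d P) Q = -pdx (moll d) (P.1 - Q.1) * mollR d (P.2 + 2 * d - Q.2) :=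
    (h2.mul_const (mollR d (P.2 + 2 * d - Q.2))).deriv
  rw [h4, neg_mul, neg_neg]
  exact h3

lemma deriv_ker3_y (hd : 0 < d) (P Q : ℝ³) :
    HasDerivAt (fun t => ker3 d ((P.1.1, t), P.2) Q) (-dY (ker3 d P) Q) P.1.2 := by
  have h1 := (hasDerivAt_pdy (isTestH_moll hd).diff (P.1 - Q.1)).comp_sub_const (x := P.1.2) Q.1.2
  have h2 := (hasDerivAt_pdy (isTestH_moll hd).diff (P.1 - Q.1)).comp_const_sub (x := Q.1.2) P.1.2
  have h3 := h1.mul_const (mollR d (P.2 + 2 * d - Q.2))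
  have h4 : dY (ker3 d P) Q = -pdy (moll d) (P.1 - Q.1) * mollR d (P.2 + 2 * d - Q.2) :=
    (h2.mul_const (mollR d (P.2 + 2 * d - Q.2))).deriv
  rw [h4, neg_mul, neg_neg]
  exact h3

lemma deriv_ker3_z (P Q : ℝ³) :
    HasDerivAt (fun t => ker3 d (P.1, t) Q) (-dZ (ker3 d P) Q) P.2 := by
  have h0 := ((contDiff_mollR d).differentiable (by simp) (P.2 + 2 * d - Q.2)).hasDerivAt
  have h1 : HasDerivAt (fun t => mollR d (t + 2 * d - Q.2)) (deriv (mollR d) (P.2 + 2 * d - Q.2)) P.2 := by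
    simp only [add_sub_assoc] at h0 ⊢
    exact h0.comp_add_const
  have h2 := h0.comp_const_sub (x := Q.2) (P.2 + 2 * d)
  have h3 := h1.const_mul (moll d (P.1 - Q.1))
  have h4 : dZ (ker3 d P) Q = moll d (P.1 - Q.1) * -deriv (mollR d) (P.2 + 2 * d - Q.2) :=
    (h2.const_mul (moll d (P.1 - Q.1))).deriv
  rw [h4, mul_neg, neg_neg]
  exact h3

lemma deriv_smooth3 (n : ℕ) (hf : LocallyIntegrable f muO) {c : ℝ → ℝ³} (hc : ContDiff ℝ ∞ c) {s : ℝ}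
    {k : F³} (hb : ∀ t, |t - s| ≤ 1 → |(c t).1.2 - (c s).1.2| ≤ 1 ∧ |(c t).2 - (c s).2| ≤ 1)
    (hk : ∀ Q, HasDerivAt (fun t => ker3 (dl n) (c t) Q) (-k Q) s) :
    deriv (fun t => smooth3 n f (c t)) s = -∫ Q, f Q * k Q ∂muO := by
  have h1 := hasDerivAt_integral_param (μ := muO) (f := f)
    (h := fun t Q => cutX Q.1.1 * ker3 (dl n) (c t) Q) ?_ hf s
    ((isCompact_Icc.prod isCompact_Icc).prod isCompact_Icc) (fun t ht Q hQ =>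
      have h := hb t (abs_le.2 ⟨by linarith [ht.1], by linarith [ht.2]⟩)
      cut_ker3_eq_zero (dl_pos n) (dl_le_one n) h.1 h.2 hQ)
  · simp only [smooth3_eq_cut]
    rw [h1.deriv, ← integral_neg]
    refine integral_congr_ae ?_
    filter_upwards [ae_muO_mem] with Q hQ
    rw [((hk Q).const_mul (cutX Q.1.1)).deriv, cutX_eq_one hQ.1.1]
    ring
  · exact (contDiff_cutX.comp (contDiff_fst.comp (contDiff_fst.comp contDiff_snd))).mul
      ((contDiff_ker3 _ (dl_pos n)).comp (f := fun z : ℝ × ℝ³ => (c z.1, z.2))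
        ((hc.comp contDiff_fst).prodMk contDiff_snd))

lemma integral_mul_ker3 (n : ℕ) (g : F³) (P : ℝ³) :
    ∫ Q, g Q * ker3 (dl n) P Q ∂muO = smooth3 n g P := by
  simp only [smooth3, kop, mul_comm]

lemma dX_smooth3 (n : ℕ) (hf : LocallyIntegrable f muO) (h : WeakOX f g) (P : ℝ³) :
    dX (smooth3 n f) P = smooth3 n g P := by
  refine (deriv_smooth3 n hf (c := fun t => ((t, P.1.2), P.2)) (by fun_prop) (fun t _ => by simp)
    (deriv_ker3_x (dl_pos n) P)).trans ?_
  rw [h _ (isTest_ker3 (dl_pos n) P), neg_neg, integral_mul_ker3]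

lemma dY_smooth3 (n : ℕ) (hf : LocallyIntegrable f muO) (h : WeakOY f g) (P : ℝ³) :
    dY (smooth3 n f) P = smooth3 n g P := by
  refine (deriv_smooth3 n hf (c := fun t => ((P.1.1, t), P.2)) (by fun_prop)
    (fun t ht => ⟨ht, by simp⟩) (deriv_ker3_y (dl_pos n) P)).trans ?_
  rw [h _ (isTest_ker3 (dl_pos n) P), neg_neg, integral_mul_ker3]

lemma dZ_smooth3 (n : ℕ) (hf : LocallyIntegrable f muO) (hg : LocallyIntegrable g muO)
    (h : HasTopTrace f g 0) (P : ℝ³) (hP : 0 ≤ P.2) : dZ (smooth3 n f) P = smooth3 n g P := by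
  have hd := dl_pos n
  have h2 := h _ (isTest_ker3 hd P) (fun q => by
    have : mollR (dl n) (P.2 + 2 * dl n - 0) = 0 := mollR_eq_zero hd (by
      rw [abs_of_nonneg] <;> linarith)
    simp only [ker3, this, mul_zero])
  rw [integral_add ((isTest_ker3 hd P).dZ.integrable_mul hf)
    ((isTest_ker3 hd P).integrable_mul hg), integral_mul_ker3] at h2
  simp only [Pi.zero_apply, zero_mul, integral_zero] at h2
  refine (deriv_smooth3 n hf (c := fun t => (P.1, t)) (by fun_prop) (fun t ht => ⟨by simp, ht⟩)
    (deriv_ker3_z P)).trans ?_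
  exact neg_eq_of_add_eq_zero_right h2

/-! ### Convergence of the smoothing -/

lemma integral_ker3 (hd : 0 < d) (hd1 : d ≤ 1) {P : ℝ³} (hP : 0 ≤ P.2)
    (hP1 : P.2 + 3 * d ≤ 1) : ∫ Q, ker3 d P Q ∂muO = 1 := by
  rw [muO_eq]
  have h := integral_prod_mul (μ := muH) (ν := nu) (fun q => moll d (P.1 - q))
    (fun t => mollR d (P.2 + 2 * d - t))
  rw [integral_moll hd hd1, one_mul] at h
  refine h.trans ?_
  rw [nu, setIntegral_eq_integral_of_forall_compl_eq_zero, integral_mollR hd]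
  intro t ht
  by_contra hne
  have : |P.2 + 2 * d - t| < d := by
    by_contra h'; exact hne (mollR_eq_zero hd (not_lt.1 h'))
  rw [abs_lt] at this
  exact ht ⟨by linarith [this.2], by linarith [this.1]⟩

lemma tendsto_smooth3_apply (hg : Continuous g) {P : ℝ³} (hP : P ∈ cell) :
    Tendsto (fun n => smooth3 n g P) atTop (𝓝 (g P)) := by
  rw [Metric.tendsto_nhds]
  intro e he
  obtain ⟨r, hr, hr2⟩ := Metric.continuousAt_iff.1 hg.continuousAt (e / 2) (half_pos he)
  have hx := hP.1.1
  have hz := hP.2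
  have hpos : 0 < min (min (2 * r) (min (2 * P.1.1) (2 * (1 - P.1.1)))) (min (r / 3) ((1 - P.2) / 3)) := by
    have := hx.1; have := hx.2; have := hz.2
    refine lt_min (lt_min (by linarith) (lt_min (by linarith) (by linarith)))
      (lt_min (by linarith) (by linarith))
  filter_upwards [tendsto_dl.eventually (gt_mem_nhds hpos)] with n hn
  simp only [lt_min_iff] at hn
  obtain ⟨⟨n1, n2, n3⟩, n4, n5⟩ := hn
  have h1 : smooth3 n g P - g P = ∫ Q, ker3 (dl n) P Q * (g Q - g P) ∂muO := by
    simp only [mul_sub]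
    rw [integral_sub (integrable_ker3 n hg.locallyIntegrable P)
      ((isTest_ker3 (dl_pos n) P).integrable.mul_const _), integral_mul_const,
      integral_ker3 (dl_pos n) (dl_le_one n) hz.1.le (by linarith), one_mul]
    rfl
  have h2 : ∀ᵐ Q ∂muO, ‖ker3 (dl n) P Q * (g Q - g P)‖ ≤ ker3 (dl n) P Q * (e / 2) := by
    filter_upwards [ae_muO_mem] with Q hQ
    have h0 := ker3_nonneg (dl_pos n) (dl_le_one n) P Q
    rw [norm_mul, norm_of_nonneg h0]
    by_cases hz : ker3 (dl n) P Q = 0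
    · simp [hz]
    · refine mul_le_left ?_ h0
      obtain ⟨k1, k2, k3⟩ := ker3_ne_zero (dl_pos n) hz
      have k4 := abs_sub_lt_of_abs_sin_lt hx hQ.1.1 k1 n1.le n2.le n3.le
      have k5 : |Q.2 - P.2| < r := by
        rw [abs_lt] at k3 ⊢
        have := dl_pos n
        constructor <;> linarith [k3.1, k3.2]
      have : dist Q P < r := by
        rw [Prod.dist_eq, max_lt_iff, Prod.dist_eq, max_lt_iff, dist_eq, dist_eq,
          dist_eq, abs_sub_comm, abs_sub_comm Q.1.2]
        exact ⟨⟨k4, by linarith⟩, k5⟩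
      have := hr2 this
      rw [dist_eq] at this
      exact this.le
  have h3 := norm_integral_le_of_norm_le ((isTest_ker3 (dl_pos n) P).integrable.mul_const (e/2)) h2
  rw [integral_mul_const, integral_ker3 (dl_pos n) (dl_le_one n) hz.1.le (by linarith), one_mul,
    ← h1] at h3
  rw [dist_eq]
  exact lt_of_le_of_lt h3 (half_lt_self he)

lemma tendsto_eLpNorm_smooth3_sub (hf : MemLp f 2 muO) :
    Tendsto (fun n => eLpNorm (smooth3 n f - f) 2 muO) atTop (𝓝 0) := by
  refine tendsto_eLpNorm_of_dense (T := fun n f => smooth3 n f - f)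
    (D := fun g => Continuous g ∧ HasCompactSupport g) (A := 2) (by norm_num) (by simp)
    ?_ ?_ ?_ ?_ ?_ hf
  · intro f hf e he
    obtain ⟨g, h1, h2, h3, h4⟩ := hf.exists_hasCompactSupport_eLpNorm_sub_le (by simp) he
    exact ⟨g, ⟨h3, h1⟩, h4, h2⟩
  · exact fun n f hf => (aestronglyMeasurable_smooth3 n hf.1).sub hf.1
  · intro n f hf
    refine (eLpNorm_sub_le (aestronglyMeasurable_smooth3 n hf.1) hf.1 (by norm_num)).trans ?_
    rw [two_mul]
    gcongr
    exact eLpNorm_smooth3_le n hf.1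
  · intro n f g hf hg
    refine .of_forall fun P => ?_
    have : smooth3 n (f - g) P = smooth3 n f P - smooth3 n g P := by
      simp only [smooth3, kop, Pi.sub_apply, mul_sub]
      exact integral_sub (integrable_ker3 n (locInt_muO hf) P) (integrable_ker3 n (locInt_muO hg) P)
    simp only [Pi.sub_apply, this]
    ring
  · intro g hg _
    obtain ⟨hg, hs⟩ := hg
    obtain ⟨M, hM⟩ := hg.bounded_above_of_compact_support hs
    obtain ⟨R, hR⟩ := hs.isCompact.isBounded.subset_closedBall (0 : ℝ³)
    have hzero : ∀ Q : ℝ³, R < |Q.1.2| → g Q = 0 := by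
      intro Q hQ
      by_contra hne
      have := hR (subset_tsupport _ hne)
      rw [mem_closedBall_zero_iff, Prod.norm_def, sup_le_iff, Prod.norm_def, sup_le_iff] at this
      exact absurd this.1.2 (not_le.2 hQ)
    have hM0 : 0 ≤ M := (norm_nonneg _).trans (hM 0)
    set S : Set (ℝ³) := {q | |q.2 - 0| ≤ R + 1} ×ˢ univ with hS
    have hSm : MeasurableSet S := MeasurableSet.prod (by measurability) MeasurableSet.univ
    have hb : ∀ n P, |smooth3 n g P| ≤ M := by
      intro n P
      refine (ENNReal.ofReal_le_ofReal_iff hM0).1 ?_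
      rw [← enorm_eq_ofReal_abs]
      refine (enorm_integral_le_lintegral_enorm _).trans ?_
      calc ∫⁻ Q, ‖ker3 (dl n) P Q * g Q‖ₑ ∂muO ≤ ∫⁻ Q, ‖ker3 (dl n) P Q‖ₑ * ENNReal.ofReal M ∂muO := by
            refine lintegral_mono fun Q => ?_
            rw [enorm_mul]
            gcongr
            rw [enorm_eq_ofReal_abs]
            exact ENNReal.ofReal_le_ofReal (hM Q)
        _ ≤ 1 * ENNReal.ofReal M := by
            rw [lintegral_mul_const _ (isTest_ker3 (dl_pos n) P).smooth.continuous.measurable.enorm]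
            gcongr
            exact lintegral_ker3_right (dl_pos n) (dl_le_one n) P
        _ = _ := one_mul _
    have key := tendsto_nrm_zero_of_dominated (μ := muO) (l := atTop)
      (F := fun n P => smooth3 n g P - g P) (g := S.indicator fun _ => 2 * M) ?_ ?_ ?_ ?_
    · have hfin : ∀ n, eLpNorm (smooth3 n g - g) 2 muO ≠ ⊤ := fun n => by
        have h1 : MemLp g 2 muO := by assumption
        have h2 : MemLp (smooth3 n g) 2 muO :=
          ⟨aestronglyMeasurable_smooth3 n h1.1, (eLpNorm_smooth3_le n h1.1).trans_lt h1.2⟩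
        exact (h2.sub h1).2.ne
      exact (ENNReal.tendsto_toReal_iff hfin ENNReal.zero_ne_top).1 key
    · refine (memLp_indicator_const _ hSm _ (Or.inr ?_))
      rw [hS, muO_eq, Measure.prod_prod, muH_strip, nu_univ, mul_one]
      exact ENNReal.ofReal_ne_top
    · exact .of_forall fun n =>
        (aestronglyMeasurable_smooth3 n hg.aestronglyMeasurable).sub hg.aestronglyMeasurable
    · refine .of_forall fun n => .of_forall fun P => ?_
      by_cases hp : P ∈ S
      · rw [indicator_of_mem hp, abs_of_nonneg (by linarith : 0 ≤ 2 * M)]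
        have h1 := hb n P; have h2 := hM P
        rw [norm_eq_abs] at h2
        rw [abs_le] at h1 h2 ⊢
        constructor <;> linarith [h1.1, h1.2, h2.1, h2.2]
      · have hp' : R + 1 < |P.1.2| := by simpa [hS] using hp
        have hz : smooth3 n g P = 0 := by
          refine integral_eq_zero_of_ae (.of_forall fun Q => ?_)
          by_cases hne : ker3 (dl n) P Q = 0
          · simp [hne]
          · have h2 := (ker3_ne_zero (dl_pos n) hne).2.1
            have h3 := abs_sub_abs_le_abs_sub P.1.2 Q.1.2
            have h4 := dl_le_one n
            simp only [Pi.zero_apply]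
            rw [hzero Q (by linarith), mul_zero]
        rw [hz, hzero P (by linarith)]
        simp
    · filter_upwards [ae_muO_mem] with p hp
      have := (tendsto_smooth3_apply hg hp).sub_const (g p)
      simpa using this

end Smoothing

/-! ## Vertical estimates -/

section Vertical

lemma ae_ae_of_ae_prod_swap {X Y : Type*} [MeasurableSpace X] [MeasurableSpace Y] {μ : Measure X}
    {ν : Measure Y} [SFinite μ] [SFinite ν] {p : X × Y → Prop} (h : ∀ᵐ w ∂μ.prod ν, p w) :
    ∀ᵐ y ∂ν, ∀ᵐ x ∂μ, p (x, y) :=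
  Measure.ae_ae_of_ae_prod
    ((Measure.measurePreserving_swap (μ := ν) (ν := μ)).quasiMeasurePreserving.ae h)

variable {f g : F³}

/-- The vertical `L²` norm. -/
def vn (g : F³) (p : ℝ²) : ℝ := nrm nu (fun t => g (p, t))

lemma vn_nonneg (g : F³) (p : ℝ²) : 0 ≤ vn g p := nrm_nonneg _

lemma enorm_vn (hg : MemLp g 2 muO) : ∀ᵐ p ∂muH, ‖vn g p‖ₑ ^ 2 = ∫⁻ t, ‖g (p, t)‖ₑ ^ 2 ∂nu := by
  rw [muO_eq] at hg
  filter_upwards [ae_memLp_slice_left hg] with p hp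
  rw [enorm_of_nonneg (vn_nonneg g p), vn, nrm, ENNReal.ofReal_toReal hp.2.ne, eLpNorm_two_sq]

lemma aemeasurable_vn (hg : MemLp g 2 muO) : AESM (vn g) muH := by
  have h1 : AEMeasurable (fun P => ‖g P‖ₑ ^ 2) (muH.prod nu) := by
    rw [← muO_eq]; exact hg.1.enorm.pow_const 2
  have h2 := h1.lintegral_prod_right'
  have h3 : vn g = fun p => ((∫⁻ t, ‖g (p, t)‖ₑ ^ 2 ∂nu) ^ (1 / 2 : ℝ)).toReal := by
    funext p
    rw [vn, nrm, ← eLpNorm_two_sq, ← ENNReal.rpow_natCast, ← ENNReal.rpow_mul]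
    norm_num
  rw [h3]
  exact (h2.pow_const _).ennreal_toReal.aestronglyMeasurable

lemma eLpNorm_vn (hg : MemLp g 2 muO) : eLpNorm (vn g) 2 muH = eLpNorm g 2 muO := by
  have h : eLpNorm (vn g) 2 muH ^ 2 = eLpNorm g 2 muO ^ 2 := by
    rw [eLpNorm_two_sq, eLpNorm_two_sq, lintegral_congr_ae (enorm_vn hg), muO_eq]
    refine (lintegral_prod (μ := muH) (ν := nu) (fun P => ‖g P‖ₑ ^ 2) ?_).symm
    rw [← muO_eq]; exact hg.1.enorm.pow_const 2
  exact (ENNReal.pow_right_strictMono (by norm_num)).injective h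

lemma memLp_vn (hg : MemLp g 2 muO) : MemLp (vn g) 2 muH :=
  ⟨aemeasurable_vn hg, by rw [eLpNorm_vn hg]; exact hg.2⟩

lemma nrm_vn (hg : MemLp g 2 muO) : nrm muH (vn g) = nrm muO g := by
  rw [nrm, nrm, eLpNorm_vn hg]

lemma abs_le_vn {φ : F³} (hφ : ContDiff ℝ ∞ φ) (h1 : ∀ p, φ (p, 1) = 0) (p : ℝ²)
    {z : ℝ} (hz : z ∈ Icc (0:ℝ) 1) : |φ (p, z)| ≤ √(1 - z) * vn (dZ φ) p := by
  have hd : Differentiable ℝ φ := hφ.differentiable (by simp)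
  have hc : Continuous fun t => dZ φ (p, t) :=
    (contDiff_dZ hφ).continuous.comp (by fun_prop)
  have h2 : ∫ t in z..1, dZ φ (p, t) = -φ (p, z) := by
    rw [intervalIntegral.integral_eq_sub_of_hasDerivAt (f := fun t => φ (p, t))
      (fun t _ => hasDerivAt_dZ hd (p, t)) (hc.intervalIntegrable _ _), h1, zero_sub]
  have h3 : ∫ t in z..1, dZ φ (p, t) =
      ∫ t, (Ioo z 1).indicator (fun _ => (1:ℝ)) t * dZ φ (p, t) ∂nu := by
    rw [intervalIntegral.integral_of_le hz.2, integral_Ioc_eq_integral_Ioo,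
      ← integral_indicator measurableSet_Ioo, nu, ← integral_indicator measurableSet_Ioo]
    congr 1; funext t
    by_cases ht : t ∈ Ioo z 1
    · have : t ∈ Ioo (0:ℝ) 1 := ⟨hz.1.trans_lt ht.1, ht.2⟩
      simp [ht, this]
    · have : (Ioo z 1).indicator (fun _ => (1:ℝ)) t * dZ φ (p, t) = 0 := by
        rw [indicator_of_notMem ht, zero_mul]
      rw [indicator_of_notMem ht, indicator_apply, this, ite_self]
  have hm1 : MemLp ((Ioo z 1).indicator (fun _ => (1:ℝ))) 2 nu :=
    memLp_indicator_const _ measurableSet_Ioo _ (Or.inr (measure_ne_top _ _))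
  have hm2 : MemLp (fun t => dZ φ (p, t)) 2 nu := by
    obtain ⟨C, hC⟩ := (isCompact_Icc (a := (0:ℝ)) (b := 1)).exists_bound_of_continuousOn
      hc.continuousOn
    refine MemLp.of_bound hc.aestronglyMeasurable C ?_
    filter_upwards [ae_nu_mem] with t ht using hC t (Ioo_subset_Icc_self ht)
  have h4 := abs_integral_mul_le hm1 hm2
  rw [← h3, h2, abs_neg] at h4
  have h5 : nrm nu ((Ioo z 1).indicator (fun _ => (1:ℝ))) = √(1 - z) := by
    rw [← sqrt_sq (nrm_nonneg _), nrm_sq hm1]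
    congr 1
    have : (fun x => (Ioo z 1).indicator (fun _ => (1:ℝ)) x ^ 2) = (Ioo z 1).indicator fun _ => (1:ℝ) := by
      funext x; by_cases hx : x ∈ Ioo z 1 <;> simp [hx]
    rw [this, integral_indicator measurableSet_Ioo, nu, Measure.restrict_restrict measurableSet_Ioo]
    have : Ioo z 1 ∩ Ioo 0 1 = Ioo z 1 := inter_eq_left.2 (Ioo_subset_Ioo_left hz.1)
    rw [this]
    simp [hz.2]
  rwa [h5] at h4

lemma nrm_slice_le {φ : F³} (hφ : ContDiff ℝ ∞ φ) (h1 : ∀ p, φ (p, 1) = 0)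
    (hz : MemLp (dZ φ) 2 muO) {z : ℝ} (hz1 : z ∈ Icc (0:ℝ) 1) :
    eLpNorm (fun p => φ (p, z)) 2 muH ≤ eLpNorm (dZ φ) 2 muO := by
  rw [← eLpNorm_vn hz]
  refine eLpNorm_mono fun p => ?_
  rw [norm_eq_abs, norm_of_nonneg (vn_nonneg _ _)]
  refine (abs_le_vn hφ h1 p hz1).trans (mul_le_of_le_one_left (vn_nonneg _ _) ?_)
  rw [sqrt_le_one]
  linarith [hz1.1]

lemma eLpNorm_le_of_slices {φ : F³} (hm : AESM φ muO) {C : ENNReal}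
    (h : ∀ᵐ z ∂nu, eLpNorm (fun p => φ (p, z)) 2 muH ≤ C) : eLpNorm φ 2 muO ≤ C := by
  refine (ENNReal.pow_right_strictMono (n := 2) (by norm_num)).le_iff_le.1 ?_
  rw [muO_eq, eLpNorm_two_sq_prod (by rwa [← muO_eq])]
  calc _ ≤ ∫⁻ z, C ^ 2 ∂nu := lintegral_mono_ae (h.mono fun z hz => by gcongr)
    _ = _ := by simp

/-! ### Zero trace at the top -/

lemma memLp_smooth3 (n : ℕ) (hf : MemLp f 2 muO) : MemLp (smooth3 n f) 2 muO :=
  ⟨aestronglyMeasurable_smooth3 n hf.1, (eLpNorm_smooth3_le n hf.1).trans_lt hf.2⟩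

lemma dZ_smooth3_ae (n : ℕ) (hf : MemLp f 2 muO) (hg : MemLp g 2 muO) (h : HasTopTrace f g 0) :
    dZ (smooth3 n f) =ᵐ[muO] smooth3 n g := by
  filter_upwards [ae_muO_mem] with P hP
  exact dZ_smooth3 n (locInt_muO hf) (locInt_muO hg) h P hP.2.1.le

lemma ae_slice_le (hf : MemLp f 2 muO) (hg : MemLp g 2 muO) (h : HasTopTrace f g 0) :
    ∀ᵐ z ∂nu, eLpNorm (fun p => f (p, z)) 2 muH ≤ eLpNorm g 2 muO := by
  have h1 : TendstoInMeasure muO (fun n => smooth3 n f) atTop f :=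
    tendstoInMeasure_of_tendsto_eLpNorm (by norm_num) (fun n => (memLp_smooth3 n hf).1) hf.1
      (tendsto_eLpNorm_smooth3_sub hf)
  obtain ⟨ns, -, hns⟩ := h1.exists_seq_tendsto_ae
  rw [muO_eq] at hns
  have h2 := ae_ae_of_ae_prod_swap hns
  filter_upwards [h2, ae_nu_mem] with z hz hz1
  have hle : ∀ n, eLpNorm (fun p => smooth3 (ns n) f (p, z)) 2 muH ≤ eLpNorm g 2 muO := fun n => by
    refine (nrm_slice_le (contDiff_smooth3 _ (locInt_muO hf)) (smooth3_top _ f)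
      ((memLp_smooth3 (ns n) hg).ae_eq (dZ_smooth3_ae (ns n) hf hg h).symm)
      (Ioo_subset_Icc_self hz1)).trans ?_
    rw [eLpNorm_congr_ae (dZ_smooth3_ae (ns n) hf hg h)]
    exact eLpNorm_smooth3_le _ hg.1
  refine (Lp.eLpNorm_lim_le_liminf_eLpNorm (f := fun n p => smooth3 (ns n) f (p, z))
    (fun n => ?_) (fun p => f (p, z)) hz).trans ?_
  · exact ((contDiff_smooth3 _ (locInt_muO hf)).continuous.comp
      (by fun_prop)).aestronglyMeasurable
  · exact liminf_le_of_le (by isBoundedDefault) fun b hb => by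
      obtain ⟨n, hn⟩ := hb.exists
      exact hn.trans (hle n)

lemma nrm_le_of_topTrace (hf : MemLp f 2 muO) (hg : MemLp g 2 muO) (h : HasTopTrace f g 0) :
    eLpNorm f 2 muO ≤ eLpNorm g 2 muO :=
  eLpNorm_le_of_slices hf.1 (ae_slice_le hf hg h)

end Vertical

/-! ## Density of test functions -/

section Density

/-- A cut-off in `y`. -/
def cutY (n : ℕ) (y : ℝ) : ℝ := smoothTransition (2 - (y / (n + 1)) ^ 2)

lemma contDiff_cutY (n : ℕ) : ContDiff ℝ ∞ (cutY n) :=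
  smoothTransition.contDiff.comp (by fun_prop)

lemma cutY_eq_zero {n : ℕ} {y : ℝ} (h : 2 * ((n : ℝ) + 1) ≤ |y|) : cutY n y = 0 := by
  refine smoothTransition.zero_of_nonpos ?_
  have h0 : (0:ℝ) < n + 1 := by positivity
  rw [div_pow, sub_nonpos, le_div_iff₀ (by positivity), ← sq_abs y]
  nlinarith

lemma cutY_eq_one {n : ℕ} {y : ℝ} (h : |y| ≤ (n : ℝ) + 1) : cutY n y = 1 := by
  refine smoothTransition.one_of_one_le ?_
  have h0 : (0:ℝ) < n + 1 := by positivity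
  have : (y / (n + 1)) ^ 2 ≤ 1 := by
    rw [div_pow, div_le_one (by positivity), ← sq_abs y]
    exact pow_le_pow_left₀ (abs_nonneg _) h 2
  linarith

lemma cutY_nonneg (n : ℕ) (y : ℝ) : 0 ≤ cutY n y := smoothTransition.nonneg _

lemma cutY_le_one (n : ℕ) (y : ℝ) : cutY n y ≤ 1 := smoothTransition.le_one _

lemma abs_cutY_le_one (n : ℕ) (y : ℝ) : |cutY n y| ≤ 1 := by
  rw [abs_of_nonneg (cutY_nonneg n y)]; exact cutY_le_one n y

lemma cutY_eq (n : ℕ) (y : ℝ) : cutY n y = cutY 0 (y / (n + 1)) := by simp [cutY]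

lemma tendsto_cutY (y : ℝ) : Tendsto (fun n => cutY n y) atTop (𝓝 1) := by
  obtain ⟨N, hN⟩ := exists_nat_ge |y|
  refine tendsto_const_nhds.congr' ?_
  filter_upwards [eventually_ge_atTop N] with n hn
  rw [cutY_eq_one]
  have : (N:ℝ) ≤ n := by exact_mod_cast hn
  linarith

lemma exists_deriv_cutY_bound : ∃ C : ℝ, 0 ≤ C ∧ ∀ n y, |deriv (cutY n) y| ≤ C / (n + 1) := by
  have hc : Continuous (deriv (cutY 0)) :=
    ((contDiff_infty_iff_deriv.1 (contDiff_cutY 0)).2).continuous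
  obtain ⟨C, hC⟩ := hc.bounded_above_of_compact_support (HasCompactSupport.intro
    (isCompact_Icc (a := (-3:ℝ)) (b := 3)) fun y hy => eq_zero_of_le_abs_deriv (R := 2)
      (fun y hy => cutY_eq_zero (by simpa using hy)) (by
        by_contra h
        exact hy (abs_le.1 (by linarith))))
  refine ⟨C, (norm_nonneg _).trans (hC 0), fun n y => ?_⟩
  have h0 : (0:ℝ) < n + 1 := by positivity
  have h1 : HasDerivAt (cutY 0) (deriv (cutY 0) (y / (n + 1))) (y / (n + 1)) :=
    ((contDiff_cutY 0).differentiable (by simp) _).hasDerivAt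
  have h2 : HasDerivAt (fun y => cutY 0 (y / (n + 1))) (deriv (cutY 0) (y / (n + 1)) * (1 / (n + 1))) y :=
    HasDerivAt.comp (h₂ := cutY 0) y h1 ((hasDerivAt_id y).div_const _)
  rw [show cutY n = fun y => cutY 0 (y / (n + 1)) from funext (cutY_eq n), h2.deriv, abs_mul,
    abs_of_pos (by positivity : 0 < 1 / ((n:ℝ) + 1)), mul_one_div]
  gcongr
  exact hC _

lemma tendsto_nrm_cutY_mul_sub {X : Type*} [MeasurableSpace X] {μ : Measure X} {y : X → ℝ}
    (hy : Measurable y) {f : X → ℝ} {F : ℕ → X → ℝ} (hf : MemLp f 2 μ)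
    (hF : ∀ n, MemLp (F n) 2 μ) (h : Tendsto (fun n => eLpNorm (F n - f) 2 μ) atTop (𝓝 0)) :
    Tendsto (fun n => nrm μ (fun P => cutY n (y P) * F n P - f P)) atTop (𝓝 0) := by
  have hm : ∀ n, AESM (fun P => cutY n (y P)) μ := fun n =>
    ((contDiff_cutY n).continuous.measurable.comp hy).aestronglyMeasurable
  have hm1 : ∀ n, AESM (fun P => cutY n (y P) - 1) μ := fun n =>
    (hm n).sub aestronglyMeasurable_const
  have h1 : Tendsto (fun n => nrm μ (fun P => (cutY n (y P) - 1) * f P)) atTop (𝓝 0) := by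
    refine tendsto_nrm_zero_of_dominated hf (.of_forall fun n => (hm1 n).mul hf.1)
      (.of_forall fun n => .of_forall fun P => ?_)
      (.of_forall fun P => ?_)
    · rw [abs_mul]
      refine mul_le_of_le_one_left (abs_nonneg _) ?_
      rw [abs_le]; constructor <;> linarith [cutY_nonneg n (y P), cutY_le_one n (y P)]
    · have := ((tendsto_cutY (y P)).sub_const 1).mul_const (f P)
      simpa using this
  have h2 := tendsto_nrm_zero h
  refine squeeze_zero (fun n => nrm_nonneg _) (fun n => ?_) (by simpa using h2.add h1)
  have e1 : MemLp (fun P => cutY n (y P) * (F n - f) P) 2 μ :=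
    memLp_bdd_mul (hm n) (.of_forall fun P => abs_cutY_le_one n _) ((hF n).sub hf)
  have e2 : MemLp (fun P => (cutY n (y P) - 1) * f P) 2 μ :=
    memLp_bdd_mul (C := 1) (hm1 n) (.of_forall fun P => by
      rw [abs_le]; constructor <;> linarith [cutY_nonneg n (y P), cutY_le_one n (y P)]) hf
  have e3 := nrm_add_le e1 e2
  have e4 := nrm_bdd_mul_le zero_le_one (.of_forall fun P => abs_cutY_le_one n (y P))
    ((hF n).sub hf) (μ := μ) (a := fun P => cutY n (y P))
  rw [one_mul] at e4
  have e5 : (fun P => cutY n (y P) * F n P - f P) =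
      fun P => cutY n (y P) * (F n - f) P + (cutY n (y P) - 1) * f P := by
    funext P; simp only [Pi.sub_apply]; ring
  rw [e5]
  exact e3.trans (by gcongr)

lemma exists_test_approx {ψ ψx ψy ψz : F³} (h0 : MemLp ψ 2 muO) (hx : MemLp ψx 2 muO)
    (hy : MemLp ψy 2 muO) (hz : MemLp ψz 2 muO) (wx : WeakOX ψ ψx) (wy : WeakOY ψ ψy)
    (ht : HasTopTrace ψ ψz 0) :
    ∃ φ : ℕ → F³, (∀ n, IsTest (φ n)) ∧ (∀ n p, φ n (p, 1) = 0) ∧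
      Tendsto (fun n => nrm muO (fun P => φ n P - ψ P)) atTop (𝓝 0) ∧
      Tendsto (fun n => nrm muO (fun P => dX (φ n) P - ψx P)) atTop (𝓝 0) ∧
      Tendsto (fun n => nrm muO (fun P => dY (φ n) P - ψy P)) atTop (𝓝 0) ∧
      Tendsto (fun n => nrm muO (fun P => dZ (φ n) P - ψz P)) atTop (𝓝 0) := by
  have hl := locInt_muO h0
  have hYm : Measurable fun P : ℝ³ => P.1.2 := measurable_snd.comp measurable_fst
  have hs : ∀ n, ContDiff ℝ ∞ (smooth3 n ψ) := fun n => contDiff_smooth3 n hl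
  have hsd : ∀ n, Differentiable ℝ (smooth3 n ψ) := fun n => (hs n).differentiable (by simp)
  refine ⟨fun n P => cutY n P.1.2 * smooth3 n ψ P, fun n => ⟨?_, ?_, ?_⟩, fun n p => ?_, ?_, ?_, ?_, ?_⟩
  · exact ((contDiff_cutY n).comp (contDiff_snd.comp contDiff_fst)).mul (hs n)
  · intro x y z; simp only [smooth3_periodic]
  · exact ⟨2 * (n + 1), fun x y z h => by simp only [cutY_eq_zero h, zero_mul]⟩
  · simp only [smooth3_top, mul_zero]
  · exact tendsto_nrm_cutY_mul_sub hYm h0 (fun n => memLp_smooth3 n h0) (tendsto_eLpNorm_smooth3_sub h0)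
  · have : ∀ n, dX (fun P => cutY n P.1.2 * smooth3 n ψ P) = fun P => cutY n P.1.2 * smooth3 n ψx P := by
      intro n; funext P
      rw [← dX_smooth3 n hl wx P]
      exact ((hasDerivAt_dX (hsd n) P).const_mul (cutY n P.1.2)).deriv
    simp only [this]
    exact tendsto_nrm_cutY_mul_sub hYm hx (fun n => memLp_smooth3 n hx) (tendsto_eLpNorm_smooth3_sub hx)
  · have h1 : ∀ n, dY (fun P => cutY n P.1.2 * smooth3 n ψ P) =
        fun P => deriv (cutY n) P.1.2 * smooth3 n ψ P + cutY n P.1.2 * smooth3 n ψy P := by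
      intro n; funext P
      rw [← dY_smooth3 n hl wy P]
      exact ((((contDiff_cutY n).differentiable (by simp) P.1.2).hasDerivAt).mul
        (hasDerivAt_dY (hsd n) P)).deriv
    obtain ⟨C, hC, hb⟩ := exists_deriv_cutY_bound
    have h2 := tendsto_nrm_cutY_mul_sub hYm hy (fun n => memLp_smooth3 n hy)
      (tendsto_eLpNorm_smooth3_sub hy)
    have h3 : Tendsto (fun n : ℕ => C / ((n:ℝ) + 1) * nrm muO ψ) atTop (𝓝 0) := by
      have := (tendsto_one_div_add_atTop_nhds_zero_nat (𝕜 := ℝ)).const_mul (C * nrm muO ψ)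
      rw [mul_zero] at this
      refine this.congr fun n => ?_
      ring
    refine squeeze_zero (fun n => nrm_nonneg _) (fun n => ?_) (by simpa using h3.add h2)
    have hm : AESM (fun P : ℝ³ => deriv (cutY n) P.1.2) muO :=
      (((contDiff_infty_iff_deriv.1 (contDiff_cutY n)).2).continuous.comp
        (by fun_prop)).aestronglyMeasurable
    have hmc : AESM (fun P : ℝ³ => cutY n P.1.2) muO :=
      ((contDiff_cutY n).continuous.comp (by fun_prop)).aestronglyMeasurable
    have e1 := memLp_bdd_mul hm (.of_forall fun P => hb n P.1.2) (memLp_smooth3 n h0)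
    have e2 := (memLp_bdd_mul hmc (.of_forall fun P => abs_cutY_le_one n P.1.2)
      (memLp_smooth3 n hy)).sub hy
    have e3 := nrm_add_le e1 e2
    have e4 := nrm_bdd_mul_le (μ := muO) (a := fun P => deriv (cutY n) P.1.2)
      (by positivity : 0 ≤ C / ((n:ℝ) + 1)) (.of_forall fun P => hb n P.1.2)
      (memLp_smooth3 n h0)
    have e5 : nrm muO (smooth3 n ψ) ≤ nrm muO ψ :=
      ENNReal.toReal_mono h0.2.ne (eLpNorm_smooth3_le n h0.1)
    simp only [h1, add_sub_assoc]
    refine e3.trans (add_le_add (e4.trans ?_) le_rfl)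
    gcongr
  · have : ∀ n, (fun P => dZ (fun P => cutY n P.1.2 * smooth3 n ψ P) P - ψz P) =ᵐ[muO]
        fun P => cutY n P.1.2 * smooth3 n ψz P - ψz P := by
      intro n
      filter_upwards [dZ_smooth3_ae n h0 hz ht] with P hP
      rw [← hP]
      congr 1
      exact ((hasDerivAt_dZ (hsd n) P).const_mul (cutY n P.1.2)).deriv
    simp only [fun n => nrm_congr (this n)]
    exact tendsto_nrm_cutY_mul_sub hYm hz (fun n => memLp_smooth3 n hz) (tendsto_eLpNorm_smooth3_sub hz)

end Density

/-! ## The energy estimate -/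

section Energy

/-- Sum of a bounded and of a square integrable function. -/
def BddAddLp (v : F³) : Prop := ∃ (a c : F³) (C : ℝ), AESM a muO ∧ (∀ᵐ P ∂muO, |a P| ≤ C) ∧
    MemLp c 2 muO ∧ ∀ᵐ P ∂muO, v P = a P + c P

variable {v f h : F³} {M : ℝ}

lemma BddAddLp.aestronglyMeasurable (hv : BddAddLp v) : AESM v muO := by
  obtain ⟨a, c, C, ha, -, hc, hv⟩ := hv
  exact (ha.add hc.1).congr (hv.mono fun P h => h.symm)

lemma BddAddLp.integrable (hv : BddAddLp v) (hf : MemLp f 2 muO) (hh : MemLp h 2 muO)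
    (hM : ∀ᵐ P ∂muO, |h P| ≤ M) : Integrable (fun P => v P * f P * h P) muO := by
  obtain ⟨a, c, C, ha, hC, hc, hv⟩ := hv
  have h1 := int_mul (memLp_bdd_mul ha hC hf) hh
  have h2 := int_mul (memLp_bdd_mul hh.1 hM hc) hf
  refine (h1.add h2).congr ?_
  filter_upwards [hv] with P hP
  simp only [Pi.add_apply, hP]; ring

lemma BddAddLp.exists_bound (hv : BddAddLp v) : ∃ A B : ℝ, 0 ≤ A ∧ 0 ≤ B ∧
    ∀ (f h : F³) (M : ℝ), 0 ≤ M → MemLp f 2 muO → MemLp h 2 muO → (∀ᵐ P ∂muO, |h P| ≤ M) →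
      |∫ P, v P * f P * h P ∂muO| ≤ (A * nrm muO h + B * M) * nrm muO f := by
  obtain ⟨a, c, C, ha, hC, hc, hv⟩ := hv
  have hC' : ∀ᵐ P ∂muO, |a P| ≤ |C| := hC.mono fun P h => h.trans (le_abs_self _)
  refine ⟨|C|, nrm muO c, abs_nonneg _, nrm_nonneg _, fun f h M hM0 hf hh hM => ?_⟩
  have e1 := memLp_bdd_mul ha hC' hf
  have e2 := memLp_bdd_mul hh.1 hM hc
  have h3 : ∫ P, v P * f P * h P ∂muO = (∫ P, a P * f P * h P ∂muO) + ∫ P, h P * c P * f P ∂muO := by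
    rw [← integral_add (int_mul e1 hh) (int_mul e2 hf)]
    refine integral_congr_ae ?_
    filter_upwards [hv] with P hP
    simp only [hP]; ring
  rw [h3]
  refine (abs_add_le _ _).trans ?_
  have b1 := (abs_integral_mul_le e1 hh).trans (mul_le_right
    (nrm_bdd_mul_le (abs_nonneg C) hC' hf) (nrm_nonneg _))
  have b2 := (abs_integral_mul_le e2 hf).trans (mul_le_right
    (nrm_bdd_mul_le hM0 hM hc) (nrm_nonneg _))
  calc _ ≤ _ := add_le_add b1 b2
    _ = _ := by ring

lemma integral_add_three {X : Type*} [MeasurableSpace X] {μ : Measure X} {f g h : X → ℝ}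
    (hf : Integrable f μ) (hg : Integrable g μ) (hh : Integrable h μ) :
    ∫ x, (f x + g x + h x) ∂μ = ∫ x, f x ∂μ + ∫ x, g x ∂μ + ∫ x, h x ∂μ := by
  rw [← integral_add hf hg]
  exact integral_add (hf.add hg) hh

/-- The truncation `arctan (a s) / a`, its derivative and its primitive. -/
def trunc (a s : ℝ) : ℝ := arctan (a * s) / a

def truncDeriv (a s : ℝ) : ℝ := 1 / (1 + (a * s) ^ 2)

def truncPrim (a s : ℝ) : ℝ :=
  s * arctan (a * s) / a - log (1 + (a * s) ^ 2) / (2 * a ^ 2)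

lemma contDiff_trunc (a : ℝ) : ContDiff ℝ ∞ (trunc a) :=
  (contDiff_arctan.comp (contDiff_const.mul contDiff_id)).div_const _

lemma contDiff_truncPrim (a : ℝ) : ContDiff ℝ ∞ (truncPrim a) := by
  have h1 : ContDiff ℝ ∞ fun s : ℝ => arctan (a * s) :=
    contDiff_arctan.comp (contDiff_const.mul contDiff_id)
  have h2 : ContDiff ℝ ∞ fun s : ℝ => log (1 + (a * s) ^ 2) :=
    ContDiff.log (by fun_prop) fun s => by positivity
  exact ((contDiff_id.mul h1).div_const _).sub (h2.div_const _)

lemma hasDerivAt_trunc {a : ℝ} (ha : 0 < a) (s : ℝ) : HasDerivAt (trunc a) (truncDeriv a s) s := by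
  have h := (((hasDerivAt_id s).const_mul a).arctan).div_const a
  refine h.congr_deriv ?_
  simp only [truncDeriv, id]
  field_simp

lemma hasDerivAt_truncPrim {a : ℝ} (ha : 0 < a) (s : ℝ) :
    HasDerivAt (truncPrim a) (trunc a s) s := by
  have h1 := ((hasDerivAt_id s).const_mul a).arctan
  have h2 : HasDerivAt (fun s : ℝ => 1 + (a * s) ^ 2) (2 * (a * s) * a) s := by
    have := ((((hasDerivAt_id s).const_mul a).pow 2).const_add 1)
    refine this.congr_deriv ?_
    simp
  have hp : 1 + (a * s) ^ 2 ≠ 0 := by positivity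
  have h := (((hasDerivAt_id s).mul h1).div_const a).sub ((h2.log hp).div_const (2 * a ^ 2))
  refine h.congr_deriv ?_
  simp only [trunc, id]
  field_simp
  ring

lemma truncDeriv_nonneg (a s : ℝ) : 0 ≤ truncDeriv a s := by unfold truncDeriv; positivity

lemma truncDeriv_le_one (a s : ℝ) : truncDeriv a s ≤ 1 := by
  unfold truncDeriv
  rw [div_le_one (by positivity)]
  nlinarith [sq_nonneg (a * s)]

lemma abs_truncDeriv_le (a s : ℝ) : |truncDeriv a s| ≤ 1 := by
  rw [abs_of_nonneg (truncDeriv_nonneg a s)]; exact truncDeriv_le_one a s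

lemma continuous_truncDeriv (a : ℝ) : Continuous (truncDeriv a) := by
  unfold truncDeriv
  exact Continuous.div (by fun_prop) (by fun_prop) fun s => by positivity

lemma abs_trunc_le {a : ℝ} (ha : 0 < a) (s : ℝ) : |trunc a s| ≤ π / (2 * a) := by
  have h1 := arctan_lt_pi_div_two (a * s)
  have h2 := neg_pi_div_two_lt_arctan (a * s)
  rw [trunc, abs_div, abs_of_pos ha, ← div_div]
  gcongr
  rw [abs_le]; constructor <;> linarith

lemma abs_trunc_le_abs {a : ℝ} (ha : 0 < a) (s : ℝ) : |trunc a s| ≤ |s| := by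
  have h := Convex.norm_image_sub_le_of_norm_hasDerivWithin_le (f := trunc a) (C := 1) (s := univ)
    (x := 0) (y := s) (fun x _ => (hasDerivAt_trunc ha x).hasDerivWithinAt)
    (fun x _ => abs_truncDeriv_le a x) convex_univ (mem_univ _) (mem_univ _)
  have h0 : trunc a 0 = 0 := by simp [trunc]
  rwa [h0, sub_zero, sub_zero, one_mul] at h

lemma dX_comp {T : ℝ → ℝ} {φ : F³} (hφ : Differentiable ℝ φ) {T' : ℝ} (P : ℝ³)
    (hT : HasDerivAt T T' (φ P)) : dX (fun P => T (φ P)) P = T' * dX φ P :=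
  (HasDerivAt.comp (h₂ := T) P.1.1 hT (hasDerivAt_dX hφ P)).deriv

lemma dY_comp {T : ℝ → ℝ} {φ : F³} (hφ : Differentiable ℝ φ) {T' : ℝ} (P : ℝ³)
    (hT : HasDerivAt T T' (φ P)) : dY (fun P => T (φ P)) P = T' * dY φ P :=
  (HasDerivAt.comp (h₂ := T) P.1.2 hT (hasDerivAt_dY hφ P)).deriv

lemma dZ_comp {T : ℝ → ℝ} {φ : F³} (hφ : Differentiable ℝ φ) {T' : ℝ} (P : ℝ³)
    (hT : HasDerivAt T T' (φ P)) : dZ (fun P => T (φ P)) P = T' * dZ φ P :=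
  (HasDerivAt.comp (h₂ := T) P.2 hT (hasDerivAt_dZ hφ P)).deriv

lemma tendsto_integral_weight {τ : ℕ → F³} {τ0 f : F³}
    (hm : ∀ n, AESM (τ n) muO) (hb : ∀ n P, |τ n P| ≤ 1)
    (hl : ∀ᵐ P ∂muO, Tendsto (fun n => τ n P) atTop (𝓝 (τ0 P))) (hf : MemLp f 2 muO) :
    Tendsto (fun n => ∫ P, τ n P * (f P * f P) ∂muO) atTop (𝓝 (∫ P, τ0 P * (f P * f P) ∂muO)) := by
  have hi := int_mul hf hf
  refine tendsto_integral_of_dominated_convergence (fun P => ‖f P * f P‖)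
    (fun n => (hm n).mul hi.1) hi.norm (fun n => .of_forall fun P => ?_) ?_
  · rw [norm_mul]; exact mul_le_of_le_one_left (norm_nonneg _) (hb n P)
  · filter_upwards [hl] with P hP using hP.mul_const _

lemma tendsto_integral_weight_mul {τ F : ℕ → F³} {τ0 f : F³}
    (hm : ∀ n, AESM (τ n) muO) (hb : ∀ n P, |τ n P| ≤ 1)
    (hl : ∀ᵐ P ∂muO, Tendsto (fun n => τ n P) atTop (𝓝 (τ0 P))) (hf : MemLp f 2 muO)
    (hF : ∀ n, MemLp (F n) 2 muO) (h : Tendsto (fun n => nrm muO (fun P => F n P - f P)) atTop (𝓝 0)) :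
    Tendsto (fun n => ∫ P, f P * (τ n P * F n P) ∂muO) atTop
      (𝓝 (∫ P, τ0 P * (f P * f P) ∂muO)) := by
  have h1 := tendsto_integral_weight hm hb hl hf
  have e1 : ∀ n, MemLp (fun P => τ n P * f P) 2 muO := fun n =>
    memLp_bdd_mul (hm n) (.of_forall (hb n)) hf
  have h2 : Tendsto (fun n => ∫ P, (τ n P * f P) * (F n P - f P) ∂muO) atTop (𝓝 0) := by
    refine squeeze_zero_norm (fun n => (abs_integral_mul_le (e1 n) ((hF n).sub hf)).trans
      (mul_le_right (nrm_bdd_mul_le zero_le_one (.of_forall (hb n)) hf) (nrm_nonneg _))) ?_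
    have := h.const_mul (1 * nrm muO f)
    rwa [mul_zero] at this
  have h3 := h1.add h2
  rw [add_zero] at h3
  refine h3.congr fun n => ?_
  have i1 : Integrable (fun P => τ n P * (f P * f P)) muO := by
    simpa only [mul_assoc] using int_mul (e1 n) hf
  have i2 : Integrable (fun P => (τ n P * f P) * (F n P - f P)) muO :=
    int_mul (e1 n) ((hF n).sub hf)
  rw [← integral_add i1 i2]
  congr 1; funext P
  ring

lemma nrm_le_add_sub {F f : F³} (hF : MemLp F 2 muO) (hf : MemLp f 2 muO) :
    nrm muO F ≤ nrm muO (fun P => F P - f P) + nrm muO f := by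
  have := nrm_add_le (hF.sub hf) hf
  have e : (fun x => (F - f) x + f x) = F := by funext x; simp
  rw [e] at this
  exact this

lemma tendsto_advection {F Φ : ℕ → F³} (hv : BddAddLp v) (hf : MemLp f 2 muO)
    (hF : ∀ n, MemLp (F n) 2 muO) (hl : Tendsto (fun n => nrm muO (fun P => F n P - f P)) atTop (𝓝 0))
    (hM : 0 ≤ M) (hΦ : ∀ n, MemLp (Φ n) 2 muO) (hb : ∀ n, ∀ᵐ P ∂muO, |Φ n P| ≤ M) {K : ℝ}
    (hK : ∀ n, nrm muO (Φ n) ≤ K) :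
    Tendsto (fun n => (∫ P, v P * f P * Φ n P ∂muO) - ∫ P, v P * F n P * Φ n P ∂muO) atTop (𝓝 0) := by
  obtain ⟨A, B, hA, hB, hbd⟩ := hv.exists_bound
  refine squeeze_zero_norm (a := fun n => (A * K + B * M) * nrm muO (fun P => F n P - f P))
    (fun n => ?_) (by simpa using hl.const_mul (A * K + B * M))
  rw [← integral_sub (hv.integrable hf (hΦ n) (hb n)) (hv.integrable (hF n) (hΦ n) (hb n)),
    nrm_sub_comm]
  have h1 := hbd _ (Φ n) M hM (hf.sub (hF n)) (hΦ n) (hb n)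
  have h2 : ∀ P, v P * f P * Φ n P - v P * F n P * Φ n P = v P * (f - F n) P * Φ n P := fun P => by
    simp only [Pi.sub_apply]; ring
  simp only [h2, norm_eq_abs]
  refine h1.trans (mul_le_right ?_ (nrm_nonneg _))
  gcongr
  exact hK n

variable {v1 v2 v3 ψ ψx ψy ψz : F³} {lam e κ : ℝ}

lemma energy_truncated (h1 : BddAddLp v1) (h2 : BddAddLp v2) (h3 : BddAddLp v3)
    (hdiv : ∀ Φ, IsTest Φ → (∀ p, Φ (p, 1) = 0) →
      ∫ P, (v1 P * dX Φ P + v2 P * dY Φ P + v3 P * dZ Φ P) ∂muO = 0)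
    (m0 : MemLp ψ 2 muO) (mx : MemLp ψx 2 muO) (my : MemLp ψy 2 muO) (mz : MemLp ψz 2 muO)
    (wx : WeakOX ψ ψx) (wy : WeakOY ψ ψy) (wt : HasTopTrace ψ ψz 0) (he : 0 < e) (hκ : 0 ≤ κ)
    (H : ∀ φ, IsTest φ → (∀ p, φ (p, 1) = 0) →
      |∫ P, ((v1 P * ψx P + v2 P * ψy P + v3 P * ψz P) * φ P
        + e ^ 2 * lam * (ψx P * dX φ P + ψy P * dY φ P) + lam * (ψz P * dZ φ P)) ∂muO|
      ≤ κ * (nrm muO (dZ φ) + e * nrm muO (dX φ) + e * nrm muO (dY φ))) {a : ℝ} (ha : 0 < a) :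
    e ^ 2 * lam * (∫ P, truncDeriv a (ψ P) * (ψx P * ψx P) ∂muO
      + ∫ P, truncDeriv a (ψ P) * (ψy P * ψy P) ∂muO)
      + lam * ∫ P, truncDeriv a (ψ P) * (ψz P * ψz P) ∂muO
    ≤ κ * (nrm muO ψz + e * nrm muO ψx + e * nrm muO ψy) := by
  obtain ⟨φ', ht', htop', l0', lx', ly', lz'⟩ := exists_test_approx m0 mx my mz wx wy wt
  have hmeas : TendstoInMeasure muO φ' atTop ψ := by
    refine tendstoInMeasure_of_tendsto_eLpNorm (p := 2) (by norm_num) (fun n => (ht' n).memLp.1) m0.1 ?_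
    refine (ENNReal.tendsto_toReal_iff (fun n => ?_) ENNReal.zero_ne_top).1 l0'
    exact ((ht' n).memLp.sub m0).2.ne
  obtain ⟨ns, hns, hae⟩ := hmeas.exists_seq_tendsto_ae
  set φ := fun n => φ' (ns n) with hφ
  have ht : ∀ n, IsTest (φ n) := fun n => ht' _
  have htop : ∀ n p, φ n (p, 1) = 0 := fun n p => htop' _ p
  have l0 := l0'.comp hns.tendsto_atTop
  have lx := lx'.comp hns.tendsto_atTop
  have ly := ly'.comp hns.tendsto_atTop
  have lz := lz'.comp hns.tendsto_atTop
  set Φ : ℕ → F³ := fun n P => trunc a (φ n P) with hΦ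
  have hT0 : trunc a 0 = 0 := by simp [trunc]
  have hΦt : ∀ n, IsTest (Φ n) := fun n => (ht n).comp (contDiff_trunc a) hT0
  have hΦ1 : ∀ n p, Φ n (p, 1) = 0 := fun n p => by simp only [hΦ, htop, hT0]
  have hb : ∀ n, ∀ᵐ P ∂muO, |Φ n P| ≤ π / (2 * a) := fun n =>
    .of_forall fun P => abs_trunc_le ha _
  have hdx : ∀ n P, dX (Φ n) P = truncDeriv a (φ n P) * dX (φ n) P := fun n P =>
    dX_comp (ht n).diff P (hasDerivAt_trunc ha _)
  have hdy : ∀ n P, dY (Φ n) P = truncDeriv a (φ n P) * dY (φ n) P := fun n P =>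
    dY_comp (ht n).diff P (hasDerivAt_trunc ha _)
  have hdz : ∀ n P, dZ (Φ n) P = truncDeriv a (φ n P) * dZ (φ n) P := fun n P =>
    dZ_comp (ht n).diff P (hasDerivAt_trunc ha _)
  obtain ⟨K, hK⟩ := (l0.bddAbove_range)
  have hΦn : ∀ n, nrm muO (Φ n) ≤ K + nrm muO ψ := fun n => by
    refine (nrm_mono (ht n).memLp (.of_forall fun P => abs_trunc_le_abs ha _)).trans ?_
    exact (nrm_le_add_sub (ht n).memLp m0).trans (add_le_add (hK ⟨n, rfl⟩) le_rfl)
  have hM : 0 ≤ π / (2 * a) := by positivity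
  have a1 := tendsto_advection h1 mx (fun n => (ht n).dX.memLp) lx hM (fun n => (hΦt n).memLp) hb hΦn
  have a2 := tendsto_advection h2 my (fun n => (ht n).dY.memLp) ly hM (fun n => (hΦt n).memLp) hb hΦn
  have a3 := tendsto_advection h3 mz (fun n => (ht n).dZ.memLp) lz hM (fun n => (hΦt n).memLp) hb hΦn
  have hadv : ∀ n, (∫ P, v1 P * dX (φ n) P * Φ n P ∂muO) + (∫ P, v2 P * dY (φ n) P * Φ n P ∂muO)
      + ∫ P, v3 P * dZ (φ n) P * Φ n P ∂muO = 0 := fun n => by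
    have h := hdiv _ ((ht n).comp (contDiff_truncPrim a) (by simp [truncPrim]))
      (fun p => by simp only [htop]; simp [truncPrim])
    rw [← integral_add_three (h1.integrable (ht n).dX.memLp (hΦt n).memLp (hb n))
      (h2.integrable (ht n).dY.memLp (hΦt n).memLp (hb n))
      (h3.integrable (ht n).dZ.memLp (hΦt n).memLp (hb n)), ← h]
    congr 1; funext P
    rw [dX_comp (ht n).diff P (hasDerivAt_truncPrim ha _),
      dY_comp (ht n).diff P (hasDerivAt_truncPrim ha _),
      dZ_comp (ht n).diff P (hasDerivAt_truncPrim ha _)]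
    simp only [hΦ]; ring
  have hτm : ∀ n, AESM (fun P => truncDeriv a (φ n P)) muO := fun n =>
    ((continuous_truncDeriv a).comp (ht n).smooth.continuous).aestronglyMeasurable
  have hτb : ∀ n P, |truncDeriv a (φ n P)| ≤ 1 := fun n P => abs_truncDeriv_le a _
  have hτl : ∀ᵐ P ∂muO, Tendsto (fun n => truncDeriv a (φ n P)) atTop (𝓝 (truncDeriv a (ψ P))) := by
    filter_upwards [hae] with P hP using ((continuous_truncDeriv a).tendsto _).comp hP
  have wx' := tendsto_integral_weight_mul hτm hτb hτl mx (fun n => (ht n).dX.memLp) lx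
  have wy' := tendsto_integral_weight_mul hτm hτb hτl my (fun n => (ht n).dY.memLp) ly
  have wz' := tendsto_integral_weight_mul hτm hτb hτl mz (fun n => (ht n).dZ.memLp) lz
  have hL := (((a1.add a2).add a3).add ((wx'.add wy').const_mul (e ^ 2 * lam))).add (wz'.const_mul lam)
  have hR := (((lz.add_const (nrm muO ψz)).add ((lx.add_const (nrm muO ψx)).const_mul e)).add
    ((ly.add_const (nrm muO ψy)).const_mul e)).const_mul κ
  simp only [zero_add] at hL hR
  refine le_of_tendsto_of_tendsto' hL hR fun n => ?_
  have hn := H _ (hΦt n) (hΦ1 n)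
  have b1 : nrm muO (dX (Φ n)) ≤ nrm muO (fun P => dX (φ n) P - ψx P) + nrm muO ψx := by
    refine (nrm_mono (ht n).dX.memLp (.of_forall fun P => ?_)).trans
      (nrm_le_add_sub (ht n).dX.memLp mx)
    rw [hdx, abs_mul]; exact mul_le_of_le_one_left (abs_nonneg _) (hτb n P)
  have b2 : nrm muO (dY (Φ n)) ≤ nrm muO (fun P => dY (φ n) P - ψy P) + nrm muO ψy := by
    refine (nrm_mono (ht n).dY.memLp (.of_forall fun P => ?_)).trans
      (nrm_le_add_sub (ht n).dY.memLp my)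
    rw [hdy, abs_mul]; exact mul_le_of_le_one_left (abs_nonneg _) (hτb n P)
  have b3 : nrm muO (dZ (Φ n)) ≤ nrm muO (fun P => dZ (φ n) P - ψz P) + nrm muO ψz := by
    refine (nrm_mono (ht n).dZ.memLp (.of_forall fun P => ?_)).trans
      (nrm_le_add_sub (ht n).dZ.memLp mz)
    rw [hdz, abs_mul]; exact mul_le_of_le_one_left (abs_nonneg _) (hτb n P)
  have i1 := h1.integrable mx (hΦt n).memLp (hb n)
  have i2 := h2.integrable my (hΦt n).memLp (hb n)
  have i3 := h3.integrable mz (hΦt n).memLp (hb n)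
  have j1 := int_mul mx (hΦt n).dX.memLp
  have j2 := int_mul my (hΦt n).dY.memLp
  have j3 := int_mul mz (hΦt n).dZ.memLp
  have hsplit : ∫ P, ((v1 P * ψx P + v2 P * ψy P + v3 P * ψz P) * Φ n P
        + e ^ 2 * lam * (ψx P * dX (Φ n) P + ψy P * dY (Φ n) P) + lam * (ψz P * dZ (Φ n) P)) ∂muO
      = (∫ P, v1 P * ψx P * Φ n P ∂muO) + (∫ P, v2 P * ψy P * Φ n P ∂muO)
        + (∫ P, v3 P * ψz P * Φ n P ∂muO) + e ^ 2 * lam * ((∫ P, ψx P * dX (Φ n) P ∂muO)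
        + ∫ P, ψy P * dY (Φ n) P ∂muO) + lam * ∫ P, ψz P * dZ (Φ n) P ∂muO := by
    have i0 : Integrable (fun P => v1 P * ψx P * Φ n P + v2 P * ψy P * Φ n P
        + v3 P * ψz P * Φ n P) muO := (i1.add i2).add i3
    have j0 : Integrable (fun P => ψx P * dX (Φ n) P + ψy P * dY (Φ n) P) muO := j1.add j2
    rw [← integral_add_three i1 i2 i3, ← integral_add j1 j2, ← integral_const_mul,
      ← integral_const_mul, ← integral_add_three i0 (j0.const_mul _) (j3.const_mul _)]
    congr 1; funext P
    ring
  rw [hsplit] at hn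
  have hn' := (le_abs_self _).trans hn
  have e1 : ∫ P, ψx P * (truncDeriv a (φ n P) * dX (φ n) P) ∂muO = ∫ P, ψx P * dX (Φ n) P ∂muO := by
    simp only [hdx]
  have e2 : ∫ P, ψy P * (truncDeriv a (φ n P) * dY (φ n) P) ∂muO = ∫ P, ψy P * dY (Φ n) P ∂muO := by
    simp only [hdy]
  have e3 : ∫ P, ψz P * (truncDeriv a (φ n P) * dZ (φ n) P) ∂muO = ∫ P, ψz P * dZ (Φ n) P ∂muO := by
    simp only [hdz]
  simp only [Function.comp_apply]
  rw [e1, e2, e3]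
  have hbnd : κ * (nrm muO (dZ (Φ n)) + e * nrm muO (dX (Φ n)) + e * nrm muO (dY (Φ n))) ≤
      κ * (nrm muO (fun P => dZ (φ n) P - ψz P) + nrm muO ψz
        + e * (nrm muO (fun P => dX (φ n) P - ψx P) + nrm muO ψx)
        + e * (nrm muO (fun P => dY (φ n) P - ψy P) + nrm muO ψy)) := by gcongr
  have := hadv n
  refine le_trans (le_of_eq ?_) (hn'.trans hbnd)
  linear_combination -this

lemma energy_bound (h1 : BddAddLp v1) (h2 : BddAddLp v2) (h3 : BddAddLp v3)
    (hdiv : ∀ Φ, IsTest Φ → (∀ p, Φ (p, 1) = 0) →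
      ∫ P, (v1 P * dX Φ P + v2 P * dY Φ P + v3 P * dZ Φ P) ∂muO = 0)
    (m0 : MemLp ψ 2 muO) (mx : MemLp ψx 2 muO) (my : MemLp ψy 2 muO) (mz : MemLp ψz 2 muO)
    (wx : WeakOX ψ ψx) (wy : WeakOY ψ ψy) (wt : HasTopTrace ψ ψz 0) (hlam : 0 < lam) (he : 0 < e)
    (hκ : 0 ≤ κ)
    (H : ∀ φ, IsTest φ → (∀ p, φ (p, 1) = 0) →
      |∫ P, ((v1 P * ψx P + v2 P * ψy P + v3 P * ψz P) * φ P
        + e ^ 2 * lam * (ψx P * dX φ P + ψy P * dY φ P) + lam * (ψz P * dZ φ P)) ∂muO|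
      ≤ κ * (nrm muO (dZ φ) + e * nrm muO (dX φ) + e * nrm muO (dY φ))) :
    nrm muO ψz ≤ 3 * κ / lam := by
  have hpos : ∀ m : ℕ, (0:ℝ) < 1 / ((m:ℝ) + 1) := fun m => by positivity
  have hτm : ∀ m : ℕ, AESM (fun P => truncDeriv (1 / ((m:ℝ) + 1)) (ψ P)) muO :=
    fun m => (continuous_truncDeriv _).comp_aestronglyMeasurable m0.1
  have hτl : ∀ᵐ P ∂muO, Tendsto (fun m : ℕ => truncDeriv (1 / ((m:ℝ) + 1)) (ψ P)) atTop
      (𝓝 ((fun _ => (1:ℝ)) P)) := .of_forall fun P => by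
    have h := tendsto_one_div_add_atTop_nhds_zero_nat (𝕜 := ℝ)
    have hc : Continuous fun a : ℝ => truncDeriv a (ψ P) := by
      unfold truncDeriv
      exact Continuous.div (by fun_prop) (by fun_prop) fun s => by positivity
    have := (hc.tendsto 0).comp h
    simpa [truncDeriv, Function.comp_def] using this
  have hτb : ∀ (m : ℕ) P, |truncDeriv (1 / ((m:ℝ) + 1)) (ψ P)| ≤ 1 := fun m P => abs_truncDeriv_le _ _
  have lx := tendsto_integral_weight hτm hτb hτl mx
  have ly := tendsto_integral_weight hτm hτb hτl my
  have lz := tendsto_integral_weight hτm hτb hτl mz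
  have hL := ((lx.add ly).const_mul (e ^ 2 * lam)).add (lz.const_mul lam)
  have key := le_of_tendsto' hL fun m =>
    energy_truncated h1 h2 h3 hdiv m0 mx my mz wx wy wt he hκ H (hpos m)
  have s : ∀ {f : F³}, MemLp f 2 muO → ∫ P, 1 * (f P * f P) ∂muO = nrm muO f ^ 2 := by
    intro f hf
    rw [nrm_sq hf]; congr 1; funext P; ring
  rw [s mx, s my, s mz] at key
  set X := nrm muO ψx
  set Y := nrm muO ψy
  set Z := nrm muO ψz
  have hX : 0 ≤ X := nrm_nonneg _
  have hY : 0 ≤ Y := nrm_nonneg _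
  have hZ : 0 ≤ Z := nrm_nonneg _
  set S := Z + e * X + e * Y with hS
  have hS0 : 0 ≤ S := by positivity
  have hSS : lam * S ^ 2 ≤ 3 * κ * S := by
    have h3 : S ^ 2 ≤ 3 * (Z ^ 2 + (e * X) ^ 2 + (e * Y) ^ 2) := by
      rw [hS]; nlinarith [sq_nonneg (Z - e * X), sq_nonneg (Z - e * Y), sq_nonneg (e * X - e * Y)]
    calc lam * S ^ 2 ≤ lam * (3 * (Z ^ 2 + (e * X) ^ 2 + (e * Y) ^ 2)) := by gcongr
      _ = 3 * (e ^ 2 * lam * (X ^ 2 + Y ^ 2) + lam * Z ^ 2) := by ring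
      _ ≤ 3 * (κ * S) := by gcongr
      _ = _ := by ring
  have hZS : Z ≤ S := by rw [hS]; nlinarith [mul_nonneg he.le hX, mul_nonneg he.le hY]
  refine hZS.trans ?_
  rw [le_div_iff₀ hlam]
  rcases hS0.eq_or_lt with h | h
  · rw [← h]; simp [hκ]
  · nlinarith

end Energy

/-! ## Horizontal convolution on `ω` -/

section HorizontalConvolution

/-- Convolution in the horizontal variables. -/
def convS (k : F²) (f : F³) (P : ℝ³) : ℝ :=
  conv k (fun q => f (q, P.2)) P.1

variable {k : F²} {f g φ : F³}

lemma memLp_slice (hf : MemLp f 2 muO) : ∀ᵐ z ∂nu, MemLp (fun p => f (p, z)) 2 muH :=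
  ae_memLp_slice (by rwa [← muO_eq])

lemma aestronglyMeasurable_convS (hk : IsTestH k) (hf : AESM f muO) : AESM (convS k f) muO := by
  rw [muO_eq] at hf ⊢
  exact aestronglyMeasurable_kop_slices (k := fun p q => k (p - q)) (aesm_sub_kernel hk) hf

lemma memLp_convS (hk : IsTestH k) (hf : MemLp f 2 muO) : MemLp (convS k f) 2 muO := by
  obtain ⟨A, hA, hb⟩ := hk.exists_conv_bound
  have hm := aestronglyMeasurable_convS hk hf.1
  refine ⟨hm, ?_⟩
  rw [muO_eq] at hm hf ⊢
  exact (eLpNorm_two_slices_le (T := conv k) hb hf hm).trans_lt (ENNReal.mul_lt_top hA.lt_top hf.2)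

lemma IsTest.memLp_slice (hφ : IsTest φ) (z : ℝ) : MemLp (fun p => φ (p, z)) 2 muH :=
  (hφ.slice z).memLp

lemma integral_muO {F : F³} (hF : Integrable F muO) :
    ∫ P, F P ∂muO = ∫ z, ∫ p, F (p, z) ∂muH ∂nu := by
  rw [muO_eq] at hF ⊢
  exact integral_prod_symm F hF

lemma integral_muO' {F : F³} (hF : Integrable F muO) :
    ∫ P, F P ∂muO = ∫ p, ∫ z, F (p, z) ∂nu ∂muH := by
  rw [muO_eq] at hF ⊢
  exact integral_prod F hF

lemma integral_convS_mul (hk : IsTestH k) (hf : MemLp f 2 muO) (hg : MemLp g 2 muO) :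
    ∫ P, convS k f P * g P ∂muO = ∫ P, f P * convS (fun r => k (-r)) g P ∂muO := by
  have hk' : IsTestH fun r => k (-r) := by simpa using hk.reflect 0
  rw [integral_muO (int_mul (memLp_convS hk hf) hg), integral_muO (int_mul hf (memLp_convS hk' hg))]
  refine integral_congr_ae ?_
  filter_upwards [memLp_slice hf, memLp_slice hg] with z h1 h2
  exact integral_conv_mul hk h1 h2

lemma contDiff_convS (hk : IsTestH k) (hφ : IsTest φ) : ContDiff ℝ ∞ (convS k φ) := by
  obtain ⟨R, hR⟩ := hφ.support
  have h1 : convS k φ = fun P => ∫ q, (1:ℝ) * (cutX q.1 * k (P.1 - q) * φ (q, P.2)) ∂muH := by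
    funext P
    simp only [convS, conv_apply]
    refine integral_congr_ae ?_
    filter_upwards [ae_muH_mem] with q hq
    rw [cutX_eq_one hq.1]; ring
  rw [h1]
  refine contDiff_integral_param (f := fun _ => (1:ℝ))
    (h := fun (P : ℝ³) q => cutX q.1 * k (P.1 - q) * φ (q, P.2)) ?_
    (locallyIntegrable_const _) fun P => ?_
  · exact ((contDiff_cutX.comp (contDiff_fst.comp contDiff_snd)).mul
      (hk.smooth.comp ((contDiff_fst.comp contDiff_fst).sub contDiff_snd))).mul
      (hφ.smooth.comp (contDiff_snd.prodMk (contDiff_snd.comp contDiff_fst)))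
  · refine ⟨univ, isOpen_univ, mem_univ _, Icc (-2) 3 ×ˢ Icc (-R) R, isCompact_Icc.prod isCompact_Icc,
      fun P' _ q hq => ?_⟩
    by_cases h : q.1 ∈ Icc (-2:ℝ) 3
    · have : R ≤ |q.2| := by
        by_contra h'
        exact hq ⟨h, abs_le.1 (not_le.1 h').le⟩
      rw [hR q.1 q.2 P'.2 this, mul_zero]
    · rw [cutX_eq_zero h, zero_mul, zero_mul]

lemma isTest_convS (hk : IsTestH k) (hφ : IsTest φ) : IsTest (convS k φ) where
  smooth := contDiff_convS hk hφ
  periodic x y z := conv_periodic hk _ x y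
  support := by
    obtain ⟨R, hR⟩ := hφ.support
    obtain ⟨R', hR'⟩ := hk.support
    refine ⟨R + R', fun x y z hy => integral_eq_zero_of_ae (.of_forall fun q => ?_)⟩
    by_cases h : R ≤ |q.2|
    · simp only [Pi.zero_apply]
      rw [hR q.1 q.2 z h, mul_zero]
    · have h2 := abs_sub_abs_le_abs_sub y q.2
      simp only [Pi.zero_apply]
      have : k ((x, y) - q) = 0 := hR' (x - q.1) (y - q.2) (by linarith)
      rw [this, zero_mul]

lemma dX_convS (hk : IsTestH k) (hφ : IsTest φ) : dX (convS k φ) = convS (pdx k) φ := by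
  funext P
  exact pdx_conv hk (locInt_muH (hφ.memLp_slice P.2)) P.1

lemma dY_convS (hk : IsTestH k) (hφ : IsTest φ) : dY (convS k φ) = convS (pdy k) φ := by
  funext P
  exact pdy_conv hk (locInt_muH (hφ.memLp_slice P.2)) P.1

lemma dX_convS' (hk : IsTestH k) (hφ : IsTest φ) : convS (pdx k) φ = convS k (dX φ) := by
  funext P
  exact congrFun (conv_pdx hk (hφ.slice P.2).weakX) P.1

lemma dY_convS' (hk : IsTestH k) (hφ : IsTest φ) : convS (pdy k) φ = convS k (dY φ) := by
  funext P
  exact congrFun (conv_pdy hk (hφ.slice P.2).weakY) P.1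

lemma dZ_convS (hk : IsTestH k) (hφ : IsTest φ) : dZ (convS k φ) = convS k (dZ φ) := by
  funext P
  obtain ⟨R, hR⟩ := hφ.support
  have h1 := hasDerivAt_integral_param (μ := muH) (f := fun _ => (1:ℝ))
    (h := fun t q => cutX q.1 * k (P.1 - q) * φ (q, t)) ?_ (locallyIntegrable_const _) P.2
    (k := Icc (-2) 3 ×ˢ Icc (-R) R) (isCompact_Icc.prod isCompact_Icc) fun t _ q hq => ?_
  · have h2 : (fun t => convS k φ (P.1, t)) =
        fun t => ∫ q, (1:ℝ) * (cutX q.1 * k (P.1 - q) * φ (q, t)) ∂muH := by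
      funext t
      simp only [convS, conv_apply]
      refine integral_congr_ae ?_
      filter_upwards [ae_muH_mem] with q hq
      rw [cutX_eq_one hq.1]; ring
    rw [dZ, h2, h1.deriv]
    simp only [convS, conv_apply]
    refine integral_congr_ae ?_
    filter_upwards [ae_muH_mem] with q hq
    rw [((hasDerivAt_dZ hφ.diff (q, P.2)).const_mul (cutX q.1 * k (P.1 - q))).deriv,
      cutX_eq_one hq.1]
    ring
  · exact ((contDiff_cutX.comp (contDiff_fst.comp contDiff_snd)).mul
      (hk.smooth.comp (contDiff_const.sub contDiff_snd))).mul
      (hφ.smooth.comp (contDiff_snd.prodMk contDiff_fst))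
  · by_cases h : q.1 ∈ Icc (-2:ℝ) 3
    · have : R ≤ |q.2| := by
        by_contra h'
        exact hq ⟨h, abs_le.1 (not_le.1 h').le⟩
      rw [hR q.1 q.2 t this, mul_zero]
    · rw [cutX_eq_zero h, zero_mul, zero_mul]

lemma convS_eq_zero {z : ℝ} (h : ∀ p, φ (p, z) = 0) (p : ℝ²) : convS k φ (p, z) = 0 := by
  simp [convS, conv_apply, h]

/-! ### Even kernels -/

lemma pdx_neg_of_even (hk : IsTestH k) (he : ∀ r, k (-r) = k r) (r : ℝ²) :
    pdx k (-r) = -pdx k r := by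
  have h := pdx_reflect hk 0 r
  simp only [zero_sub, he] at h
  rw [← neg_neg (pdx k (-r)), ← h]

lemma pdy_neg_of_even (hk : IsTestH k) (he : ∀ r, k (-r) = k r) (r : ℝ²) :
    pdy k (-r) = -pdy k r := by
  have h := pdy_reflect hk 0 r
  simp only [zero_sub, he] at h
  rw [← neg_neg (pdy k (-r)), ← h]

lemma integral_convS_mul_even (hk : IsTestH k) (he : ∀ r, k (-r) = k r) (hf : MemLp f 2 muO)
    (hg : MemLp g 2 muO) : ∫ P, convS k f P * g P ∂muO = ∫ P, f P * convS k g P ∂muO := by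
  rw [integral_convS_mul hk hf hg]
  simp only [he]

lemma convS_neg_kernel (k : F²) (f : F³) (P : ℝ³) :
    convS (fun r => -k r) f P = -convS k f P := by
  simp only [convS, conv_apply, neg_mul, integral_neg]

lemma integral_convS_pdx_mul (hk : IsTestH k) (he : ∀ r, k (-r) = k r) (hf : MemLp f 2 muO)
    (hg : MemLp g 2 muO) :
    ∫ P, convS (pdx k) f P * g P ∂muO = -∫ P, f P * convS (pdx k) g P ∂muO := by
  rw [integral_convS_mul hk.pdx hf hg, ← integral_neg]
  simp only [pdx_neg_of_even hk he, convS_neg_kernel, mul_neg]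

lemma integral_convS_pdy_mul (hk : IsTestH k) (he : ∀ r, k (-r) = k r) (hf : MemLp f 2 muO)
    (hg : MemLp g 2 muO) :
    ∫ P, convS (pdy k) f P * g P ∂muO = -∫ P, f P * convS (pdy k) g P ∂muO := by
  rw [integral_convS_mul hk.pdy hf hg, ← integral_neg]
  simp only [pdy_neg_of_even hk he, convS_neg_kernel, mul_neg]

lemma weakOX_convS (hk : IsTestH k) (he : ∀ r, k (-r) = k r) (hf : MemLp f 2 muO) :
    WeakOX (convS k f) (convS (pdx k) f) := fun φ hφ => by
  rw [integral_convS_mul_even hk he hf hφ.dX.memLp, integral_convS_pdx_mul hk he hf hφ.memLp,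
    dX_convS' hk hφ, neg_neg]

lemma weakOY_convS (hk : IsTestH k) (he : ∀ r, k (-r) = k r) (hf : MemLp f 2 muO) :
    WeakOY (convS k f) (convS (pdy k) f) := fun φ hφ => by
  rw [integral_convS_mul_even hk he hf hφ.dY.memLp, integral_convS_pdy_mul hk he hf hφ.memLp,
    dY_convS' hk hφ, neg_neg]

lemma hasTopTrace_convS (hk : IsTestH k) (he : ∀ r, k (-r) = k r) (hf : MemLp f 2 muO)
    (hg : MemLp g 2 muO) (h : HasTopTrace f g 0) : HasTopTrace (convS k f) (convS k g) 0 := by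
  intro φ hφ h0
  have h1 := h _ (isTest_convS hk hφ) (convS_eq_zero h0)
  rw [dZ_convS hk hφ] at h1
  rw [integral_add (int_mul (memLp_convS hk hf) hφ.dZ.memLp) (int_mul (memLp_convS hk hg) hφ.memLp),
    integral_convS_mul_even hk he hf hφ.dZ.memLp, integral_convS_mul_even hk he hg hφ.memLp,
    ← integral_add (int_mul hf (memLp_convS hk hφ.dZ.memLp))
    (int_mul hg (memLp_convS hk hφ.memLp)), h1]
  simp

/-! ### Functions that do not depend on `z` -/

lemma memLp_comp_fst {h : F²} (hh : MemLp h 2 muH) : MemLp (fun P : ℝ³ => h P.1) 2 muO := by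
  rw [muO_eq]; exact hh.comp_fst nu

lemma nrm_comp_fst {h : F²} (hh : AESM h muH) : nrm muO (fun P : ℝ³ => h P.1) = nrm muH h := by
  have hmp : MeasurePreserving (Prod.fst : ℝ³ → ℝ²) muO muH := by
    rw [muO_eq]; exact measurePreserving_fst
  rw [nrm, nrm, ← eLpNorm_comp_measurePreserving hh hmp]
  rfl

lemma WeakX.comp_fst {h h' : F²} (w : WeakX h h') (m : MemLp h 2 muH) (m' : MemLp h' 2 muH) :
    WeakOX (fun P => h P.1) (fun P => h' P.1) := fun φ hφ => by
  rw [integral_muO (int_mul (memLp_comp_fst m) hφ.dX.memLp),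
    integral_muO (int_mul (memLp_comp_fst m') hφ.memLp), ← integral_neg]
  congr 1; funext z
  exact w _ (hφ.slice z)

lemma WeakY.comp_fst {h h' : F²} (w : WeakY h h') (m : MemLp h 2 muH) (m' : MemLp h' 2 muH) :
    WeakOY (fun P => h P.1) (fun P => h' P.1) := fun φ hφ => by
  rw [integral_muO (int_mul (memLp_comp_fst m) hφ.dY.memLp),
    integral_muO (int_mul (memLp_comp_fst m') hφ.memLp), ← integral_neg]
  congr 1; funext z
  exact w _ (hφ.slice z)

lemma integral_dZ_nu (hφ : IsTest φ) (p : ℝ²) : ∫ z, dZ φ (p, z) ∂nu = φ (p, 1) - φ (p, 0) := by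
  rw [nu, ← integral_Ioc_eq_integral_Ioo, ← intervalIntegral.integral_of_le zero_le_one]
  exact intervalIntegral.integral_eq_sub_of_hasDerivAt (f := fun t => φ (p, t))
    (fun t _ => hasDerivAt_dZ hφ.diff (p, t))
    ((hφ.dZ.smooth.continuous.comp (by fun_prop)).intervalIntegrable _ _)

lemma hasTopTrace_comp_fst {h : F²} (m : MemLp h 2 muH) :
    HasTopTrace (fun P => h P.1) 0 h := fun φ hφ h0 => by
  simp only [Pi.zero_apply, zero_mul, add_zero]
  rw [integral_muO' (int_mul (memLp_comp_fst m) hφ.dZ.memLp)]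
  congr 1; funext p
  refine (integral_const_mul (h p) fun z => dZ φ (p, z)).trans ?_
  rw [integral_dZ_nu hφ, h0, sub_zero]

lemma HasTopTrace.sub {f g f' g' : F³} {h h' : F²} (mf : MemLp f 2 muO)
    (mg : MemLp g 2 muO) (mf' : MemLp f' 2 muO) (mg' : MemLp g' 2 muO) (mh : MemLp h 2 muH)
    (mh' : MemLp h' 2 muH) (t : HasTopTrace f g h) (t' : HasTopTrace f' g' h') :
    HasTopTrace (fun P => f P - f' P) (fun P => g P - g' P) (fun p => h p - h' p) := fun φ hφ h0 => by
  have e1 := t φ hφ h0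
  have e2 := t' φ hφ h0
  have i1 : ∀ {f g : F³}, MemLp f 2 muO → MemLp g 2 muO →
      Integrable (fun P => f P * dZ φ P + g P * φ P) muO := fun hf hg =>
    (int_mul hf hφ.dZ.memLp).add (int_mul hg hφ.memLp)
  have i2 : ∀ {h : F²}, MemLp h 2 muH → Integrable (fun p => h p * φ (p, 1)) muH :=
    fun hh => int_mul hh (hφ.memLp_slice 1)
  simp only [sub_mul]
  rw [integral_sub (i2 mh) (i2 mh'), ← e1, ← e2, ← integral_sub (i1 mf mg) (i1 mf' mg')]
  congr 1; funext P
  ring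

/-- Multiplication by a bounded function of the horizontal variables commutes with `∂_z`. -/
lemma integral_mul_dZ_of_weakDz {w : F²} {M : ℝ} (hw : AESM w muH)
    (hM : ∀ᵐ p ∂muH, |w p| ≤ M) (h : IsWeakDz f g) (hφ : IsTest φ) (h0 : ∀ p, φ (p, 0) = 0)
    (h1 : ∀ p, φ (p, 1) = 0) :
    ∫ P, w P.1 * f P * dZ φ P ∂muO = -∫ P, w P.1 * g P * φ P ∂muO := by
  have hwl : LocallyIntegrable w muH := by
    intro p
    obtain ⟨s, hs, hfin⟩ := (inferInstance : IsLocallyFiniteMeasure muH).finiteAtNhds p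
    exact ⟨s, hs, Measure.integrableOn_of_bounded (M := M) hfin.ne hw (ae_restrict_of_ae hM)⟩
  obtain ⟨R, hR⟩ := hφ.support
  obtain ⟨ns, hns⟩ := exists_seq_mol_tendsto_ae hwl (R + 1)
  have hsm : ∀ n, ContDiff ℝ ∞ (mol n w) := fun n => contDiff_conv (testDl n) hwl
  have hbd : ∀ n p, |mol n w p| ≤ M := by
    intro n p
    have e1 : ∀ᵐ q ∂muH, ‖moll (dl n) (p - q) * w q‖ ≤ moll (dl n) (p - q) * M := by
      filter_upwards [hM] with q hq
      rw [norm_mul, norm_of_nonneg (moll_nonneg (dl_pos n) (dl_le_one n) _)]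
      exact mul_le_left hq (moll_nonneg (dl_pos n) (dl_le_one n) _)
    have e2 := norm_integral_le_of_norm_le (((testDl n).reflect p).integrable.mul_const M) e1
    rwa [integral_mul_const, integral_moll (dl_pos n) (dl_le_one n), one_mul] at e2
  have hns' : ∀ᵐ P ∂muO, |P.1.2| ≤ R + 1 →
      Tendsto (fun i => mol (ns i) w P.1) atTop (𝓝 (w P.1)) := by
    rw [muO_eq]; exact Measure.quasiMeasurePreserving_fst.ae hns
  have hlim : ∀ {F G : F³}, MemLp F 2 muO → IsTest G → (∀ x y z, R + 1 ≤ |y| → G ((x, y), z) = 0) →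
      Tendsto (fun i => ∫ P, F P * (mol (ns i) w P.1 * G P) ∂muO) atTop
        (𝓝 (∫ P, w P.1 * F P * G P ∂muO)) := by
    intro F G hF hG hG0
    have hi := int_mul hF hG.memLp
    refine tendsto_integral_of_dominated_convergence (fun P => M * ‖F P * G P‖) (fun i => ?_)
      (hi.norm.const_mul M) (fun i => .of_forall fun P => ?_) ?_
    · exact hF.1.mul ((((hsm _).continuous.comp continuous_fst).mul
        hG.smooth.continuous).aestronglyMeasurable)
    · rw [show F P * (mol (ns i) w P.1 * G P) = mol (ns i) w P.1 * (F P * G P) by ring, norm_mul]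
      exact mul_le_right (hbd _ _) (norm_nonneg _)
    · filter_upwards [hns'] with P hP
      by_cases hy : |P.1.2| ≤ R + 1
      · rw [show w P.1 * F P * G P = F P * (w P.1 * G P) by ring]
        exact ((hP hy).mul_const _).const_mul _
      · have : G P = 0 := hG0 _ _ _ (not_le.1 hy).le
        simp only [this, mul_zero]
        exact tendsto_const_nhds
  have l1 := hlim h.memLp hφ.dZ fun x y z hy => by
    have : (fun t => φ ((x, y), t)) = fun _ => 0 := funext fun t => hR x y t (by linarith)
    simp [dZ, this]
  have l2 := (hlim h.memLp' hφ fun x y z hy => hR x y z (by linarith)).neg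
  refine tendsto_nhds_unique l1 (l2.congr fun i => ?_)
  have hT : IsTest (fun P => mol (ns i) w P.1 * φ P) :=
    hφ.mul_smooth ((hsm _).comp contDiff_fst) fun x y z => conv_periodic (testDl _) w x y
  rw [← h.eq _ hT (fun p => by simp only [h0, mul_zero]) (fun p => by simp only [h1, mul_zero])]
  congr 1; funext P
  congr 1
  exact ((hasDerivAt_dZ hφ.diff P).const_mul (mol (ns i) w P.1)).deriv

end HorizontalConvolution

/-! ## Commutators of the smoothing with transport -/

section Commutator

/-- A bounded horizontal field `(u1, u2)` with divergence `-w`, Lipschitz up to null sets. -/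
structure IsLipField (u1 u2 w : F²) (M L : ℝ) : Prop where
  nonneg : 0 ≤ M
  nonneg' : 0 ≤ L
  meas1 : AESM u1 muH
  meas2 : AESM u2 muH
  meas3 : AESM w muH
  bdd1 : ∀ᵐ p ∂muH, |u1 p| ≤ M
  bdd2 : ∀ᵐ p ∂muH, |u2 p| ≤ M
  bdd3 : ∀ᵐ p ∂muH, |w p| ≤ M
  div : ∀ φ, IsTestH φ → ∫ p, (u1 p * pdx φ p + u2 p * pdy φ p) ∂muH = ∫ p, w p * φ p ∂muH
  lip1 : ∀ᵐ p ∂muH, ∀ᵐ q ∂muH,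
    |u1 p - u1 q| ≤ L * (|sπ(p.1 - q.1)| + |p.2 - q.2|)
  lip2 : ∀ᵐ p ∂muH, ∀ᵐ q ∂muH,
    |u2 p - u2 q| ≤ L * (|sπ(p.1 - q.1)| + |p.2 - q.2|)

/-- The kernel of the commutator. -/
def comKer (u1 u2 w : F²) (n : ℕ) (p q : ℝ²) : ℝ :=
  (u1 p - u1 q) * pdx (moll (dl n)) (p - q) + (u2 p - u2 q) * pdy (moll (dl n)) (p - q)
    - moll (dl n) (p - q) * w q

variable {u1 u2 w : F²} {M L : ℝ}

lemma aestronglyMeasurable_comKer (hu : IsLipField u1 u2 w M L) (n : ℕ) :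
    AESM (fun z : (ℝ²) × (ℝ²) => comKer u1 u2 w n z.1 z.2) (muH.prod muH) := by
  have hd := testDl n
  exact (((hu.meas1.comp_fst.sub hu.meas1.comp_snd).mul (aesm_sub_kernel hd.pdx)).add
    ((hu.meas2.comp_fst.sub hu.meas2.comp_snd).mul (aesm_sub_kernel hd.pdy))).sub
    ((aesm_sub_kernel hd).mul hu.meas3.comp_snd)

lemma exists_comKer_bound (hu : IsLipField u1 u2 w M L) : ∃ A : ℝ, 0 ≤ A ∧ ∀ n,
    (∀ᵐ p ∂muH, ∀ᵐ q ∂muH, |comKer u1 u2 w n p q| ≤ A * moll (2 * dl n) (p - q)) ∧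
    (∀ᵐ q ∂muH, ∀ᵐ p ∂muH, |comKer u1 u2 w n p q| ≤ A * moll (2 * dl n) (p - q)) := by
  obtain ⟨C, hC, hdom⟩ := exists_moll_dominates
  have hM := hu.nonneg
  have hL := hu.nonneg'
  have key : ∀ n, ∀ p q : ℝ²,
      |u1 p - u1 q| ≤ L * (|sπ(p.1 - q.1)| + |p.2 - q.2|) →
      |u2 p - u2 q| ≤ L * (|sπ(p.1 - q.1)| + |p.2 - q.2|) → |w q| ≤ M →
      |comKer u1 u2 w n p q| ≤ (8 * L * C + C * M) * moll (2 * dl n) (p - q) := by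
    intro n p q h1 h2 h3
    have hd := dl_pos n
    have hd1 : 2 * dl n ≤ 1 := by linarith [dl_le n]
    obtain ⟨k1, k2, k3⟩ := hdom (dl n) hd (by linarith [dl_le n]) (p - q)
    have hm0 := moll_nonneg (by linarith : 0 < 2 * dl n) hd1 (p - q)
    have hm1 := moll_nonneg hd (dl_le_one n) (p - q)
    by_cases hz : moll (2 * dl n) (p - q) = 0
    · rw [hz, mul_zero] at k1 k2 k3
      have z1 := le_antisymm k1 hm1
      have z2 := abs_nonpos_iff.1 k2
      have z3 := abs_nonpos_iff.1 k3
      simp [comKer, z1, z2, z3, hz]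
    · obtain ⟨s1, s2⟩ := moll_ne_zero (by linarith : 0 < 2 * dl n) hz
      have hlip : L * (|sπ(p.1 - q.1)| + |p.2 - q.2|) ≤ L * (4 * dl n) := by
        refine mul_le_left ?_ hL
        simp only [Prod.fst_sub, Prod.snd_sub] at s1 s2
        linarith
      have e1 : |(u1 p - u1 q) * pdx (moll (dl n)) (p - q)| ≤
          L * (4 * dl n) * (C / dl n * moll (2 * dl n) (p - q)) := by
        rw [abs_mul]; gcongr; exact h1.trans hlip
      have e2 : |(u2 p - u2 q) * pdy (moll (dl n)) (p - q)| ≤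
          L * (4 * dl n) * (C / dl n * moll (2 * dl n) (p - q)) := by
        rw [abs_mul]; gcongr; exact h2.trans hlip
      have e3 : |moll (dl n) (p - q) * w q| ≤ C * moll (2 * dl n) (p - q) * M := by
        rw [abs_mul, abs_of_nonneg hm1]; gcongr
      have e4 : L * (4 * dl n) * (C / dl n * moll (2 * dl n) (p - q)) =
          4 * L * C * moll (2 * dl n) (p - q) := by field_simp
      rw [e4] at e1 e2
      rw [comKer]
      refine (abs_sub _ _).trans ?_
      refine (add_le_add (abs_add_le _ _) le_rfl).trans ?_
      linarith
  refine ⟨8 * L * C + C * M, by positivity, fun n => ⟨?_, ?_⟩⟩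
  · filter_upwards [hu.lip1, hu.lip2] with p h1 h2
    filter_upwards [h1, h2, hu.bdd3] with q a1 a2 a3 using key n p q a1 a2 a3
  · filter_upwards [hu.lip1, hu.lip2, hu.bdd3] with q h1 h2 h3
    filter_upwards [h1, h2] with p a1 a2
    have hs : |sπ(q.1 - p.1)| = |sπ(p.1 - q.1)| := by
      rw [← neg_sub p.1 q.1, mul_neg, sin_neg, abs_neg]
    rw [abs_sub_comm, hs, abs_sub_comm q.2] at a1 a2
    exact key n p q a1 a2 h3

/-- The commutator. -/
def com (u1 u2 w : F²) (n : ℕ) (f : F²) : F² := kop muH (comKer u1 u2 w n) f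

lemma exists_com_bound (hu : IsLipField u1 u2 w M L) : ∃ A : ENNReal, A ≠ ⊤ ∧
    ∀ n f, MemLp f 2 muH → eLpNorm (com u1 u2 w n f) 2 muH ≤ A * eLpNorm f 2 muH := by
  obtain ⟨A, hA, hb⟩ := exists_comKer_bound hu
  refine ⟨ENNReal.ofReal A, ENNReal.ofReal_ne_top, fun n f hf => ?_⟩
  have h2d : (0:ℝ) < 2 * dl n := by linarith [dl_pos n]
  have h2d1 : 2 * dl n ≤ 1 := by linarith [dl_le n]
  refine eLpNorm_two_kop_le (aestronglyMeasurable_comKer hu n) ?_ ?_ hf.1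
  · filter_upwards [(hb n).1] with p hp
    calc ∫⁻ q, ‖comKer u1 u2 w n p q‖ₑ ∂muH
        ≤ ∫⁻ q, ENNReal.ofReal A * ‖moll (2 * dl n) (p - q)‖ₑ ∂muH := by
          refine lintegral_mono_ae ?_
          filter_upwards [hp] with q hq
          rw [enorm_eq_ofReal_abs, enorm_of_nonneg (moll_nonneg h2d h2d1 _),
            ← ENNReal.ofReal_mul hA]
          exact ENNReal.ofReal_le_ofReal hq
      _ = ENNReal.ofReal A := by
          rw [lintegral_const_mul' _ _ ENNReal.ofReal_ne_top, lintegral_moll h2d h2d1, mul_one]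
  · filter_upwards [(hb n).2] with q hq
    calc ∫⁻ p, ‖comKer u1 u2 w n p q‖ₑ ∂muH
        ≤ ∫⁻ p, ENNReal.ofReal A * ‖moll (2 * dl n) (p - q)‖ₑ ∂muH := by
          refine lintegral_mono_ae ?_
          filter_upwards [hq] with p hp
          rw [enorm_eq_ofReal_abs, enorm_of_nonneg (moll_nonneg h2d h2d1 _),
            ← ENNReal.ofReal_mul hA]
          exact ENNReal.ofReal_le_ofReal hp
      _ = ENNReal.ofReal A := by
          rw [lintegral_const_mul' _ _ ENNReal.ofReal_ne_top, lintegral_moll' h2d h2d1, mul_one]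

lemma integrable_moll_mul (n : ℕ) {f : F²} (hf : MemLp f 2 muH) (p : ℝ²) :
    Integrable (fun q => moll (dl n) (p - q) * f q) muH ∧
    Integrable (fun q => pdx (moll (dl n)) (p - q) * f q) muH ∧
    Integrable (fun q => pdy (moll (dl n)) (p - q) * f q) muH :=
  ⟨integrable_conv (testDl n) (locInt_muH hf) p, integrable_conv (testDl n).pdx (locInt_muH hf) p,
    integrable_conv (testDl n).pdy (locInt_muH hf) p⟩

lemma integrable_comKer_mul (hu : IsLipField u1 u2 w M L) (n : ℕ) {f : F²}
    (hf : MemLp f 2 muH) (p : ℝ²) : Integrable (fun q => comKer u1 u2 w n p q * f q) muH := by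
  have m1 := memLp_bdd_mul hu.meas1 hu.bdd1 hf
  have m2 := memLp_bdd_mul hu.meas2 hu.bdd2 hf
  have m3 := memLp_bdd_mul hu.meas3 hu.bdd3 hf
  refine ((((integrable_moll_mul n hf p).2.1.const_mul (u1 p)).sub (integrable_moll_mul n m1 p).2.1).add
    (((integrable_moll_mul n hf p).2.2.const_mul (u2 p)).sub (integrable_moll_mul n m2 p).2.2)).sub
    (integrable_moll_mul n m3 p).1 |>.congr (.of_forall fun q => ?_)
  simp only [Pi.sub_apply, Pi.add_apply, comKer]
  ring

lemma com_eq (hu : IsLipField u1 u2 w M L) (n : ℕ) {f : F²} (hf : MemLp f 2 muH)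
    (p : ℝ²) : com u1 u2 w n f p =
      u1 p * conv (pdx (moll (dl n))) f p + u2 p * conv (pdy (moll (dl n))) f p
      - (conv (pdx (moll (dl n))) (fun q => u1 q * f q) p
        + conv (pdy (moll (dl n))) (fun q => u2 q * f q) p + mol n (fun q => w q * f q) p) := by
  have m1 := memLp_bdd_mul hu.meas1 hu.bdd1 hf
  have m2 := memLp_bdd_mul hu.meas2 hu.bdd2 hf
  have m3 := memLp_bdd_mul hu.meas3 hu.bdd3 hf
  have i1 := (integrable_moll_mul n hf p).2.1.const_mul (u1 p)
  have i2 := (integrable_moll_mul n hf p).2.2.const_mul (u2 p)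
  have i3 := (integrable_moll_mul n m1 p).2.1
  have i4 := (integrable_moll_mul n m2 p).2.2
  have i5 := (integrable_moll_mul n m3 p).1
  rw [mol, conv_apply, conv_apply, conv_apply, conv_apply, conv_apply, ← integral_const_mul,
    ← integral_const_mul, ← integral_add_three i3 i4 i5, ← integral_add i1 i2,
    ← integral_sub (by exact i1.add i2) (by exact (i3.add i4).add i5)]
  refine integral_congr_ae (.of_forall fun q => ?_)
  simp only [comKer]
  ring

lemma com_eq_of_test (hu : IsLipField u1 u2 w M L) (n : ℕ) {f : F²} (hf : IsTestH f)
    (p : ℝ²) : com u1 u2 w n f p = u1 p * mol n (pdx f) p + u2 p * mol n (pdy f) p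
      - mol n (fun q => u1 q * pdx f q + u2 q * pdy f q) p := by
  have hd := testDl n
  rw [com_eq hu n hf.memLp, conv_pdx hd hf.weakX, conv_pdy hd hf.weakY]
  congr 1
  have m1 := memLp_bdd_mul hu.meas1 hu.bdd1 hf.memLp
  have m2 := memLp_bdd_mul hu.meas2 hu.bdd2 hf.memLp
  have m3 := memLp_bdd_mul hu.meas3 hu.bdd3 hf.memLp
  have m4 := (memLp_bdd_mul hu.meas1 hu.bdd1 hf.pdx.memLp).add
    (memLp_bdd_mul hu.meas2 hu.bdd2 hf.pdy.memLp)
  have i1 := (integrable_moll_mul n m1 p).2.1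
  have i2 := (integrable_moll_mul n m2 p).2.2
  have i3 := (integrable_moll_mul n m3 p).1
  have i4 : Integrable (fun q => moll (dl n) (p - q) * (u1 q * pdx f q + u2 q * pdy f q)) muH :=
    (integrable_moll_mul n m4 p).1
  have hT : IsTestH (fun q => moll (dl n) (p - q) * f q) :=
    hf.mul_smooth (hd.reflect p).smooth (hd.reflect p).periodic
  have h := hu.div _ hT
  have e1 : ∀ q, pdx (fun q => moll (dl n) (p - q) * f q) q =
      -pdx (moll (dl n)) (p - q) * f q + moll (dl n) (p - q) * pdx f q := fun q => by
    rw [pdx_mul (hd.reflect p).diff hf.diff, pdx_reflect hd]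
  have e2 : ∀ q, pdy (fun q => moll (dl n) (p - q) * f q) q =
      -pdy (moll (dl n)) (p - q) * f q + moll (dl n) (p - q) * pdy f q := fun q => by
    rw [pdy_mul (hd.reflect p).diff hf.diff, pdy_reflect hd]
  rw [mol, mol, conv_apply, conv_apply, conv_apply, conv_apply, ← integral_add i1 i2]
  have h5 : ∫ q, moll (dl n) (p - q) * (w q * f q) ∂muH =
      ∫ q, w q * (moll (dl n) (p - q) * f q) ∂muH := by
    congr 1; funext q; ring
  rw [h5, ← h, ← eq_sub_iff_add_eq', ← integral_sub i4 (by exact i1.add i2)]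
  congr 1; funext q
  rw [e1, e2]; ring

lemma exists_isTestH_approx {f : F²} (hf : MemLp f 2 muH) {e : ENNReal} (he : e ≠ 0) :
    ∃ g, IsTestH g ∧ eLpNorm (f - g) 2 muH ≤ e := by
  have hl := locInt_muH hf
  have hmol : ∀ n, MemLp (mol n f) 2 muH := fun n => memLp_conv (testDl n) hf
  have hT : ∀ n, IsTestH (fun p => cutY n p.2 * mol n f p) := fun n =>
    { smooth := ((contDiff_cutY n).comp contDiff_snd).mul (contDiff_conv (testDl n) hl)
      periodic := fun x y => by
        have := conv_periodic (testDl n) f x y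
        simp only [mol, this]
      support := ⟨2 * (n + 1), fun x y h => by simp only [cutY_eq_zero h, zero_mul]⟩ }
  have h := tendsto_nrm_cutY_mul_sub measurable_snd hf hmol (tendsto_mol_sub hf)
  have h' : Tendsto (fun n => eLpNorm (fun p => cutY n p.2 * mol n f p - f p) 2 muH) atTop (𝓝 0) :=
    (ENNReal.tendsto_toReal_iff (fun n => ((hT n).memLp.sub hf).2.ne) ENNReal.zero_ne_top).1 h
  obtain ⟨n, hn⟩ := (h'.eventually (gt_mem_nhds (pos_iff_ne_zero.2 he))).exists
  refine ⟨_, hT n, ?_⟩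
  rw [eLpNorm_sub_comm]
  exact hn.le

lemma tendsto_com (hu : IsLipField u1 u2 w M L) {f : F²} (hf : MemLp f 2 muH) :
    Tendsto (fun n => eLpNorm (com u1 u2 w n f) 2 muH) atTop (𝓝 0) := by
  obtain ⟨A, hA, hb⟩ := exists_com_bound hu
  have hmeas : ∀ n f, MemLp f 2 muH → AESM (com u1 u2 w n f) muH := fun n f hf =>
    aestronglyMeasurable_kop (aestronglyMeasurable_comKer hu n) hf.1
  refine tendsto_eLpNorm_of_dense (T := com u1 u2 w) (D := IsTestH) (by norm_num) hA ?_ hmeas hb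
    ?_ ?_ hf
  · intro f hf e he
    obtain ⟨g, hg, h⟩ := exists_isTestH_approx hf he
    exact ⟨g, hg, hg.memLp, h⟩
  · intro n f g hf hg
    refine .of_forall fun p => ?_
    simp only [com, kop, Pi.sub_apply, mul_sub]
    exact integral_sub (integrable_comKer_mul hu n hf p) (integrable_comKer_mul hu n hg p)
  · intro g hg _
    have m1 := memLp_bdd_mul hu.meas1 hu.bdd1 hg.pdx.memLp
    have m2 := memLp_bdd_mul hu.meas2 hu.bdd2 hg.pdy.memLp
    have m3 : MemLp (fun q => u1 q * pdx g q + u2 q * pdy g q) 2 muH := m1.add m2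
    have l1 := tendsto_nrm_zero (tendsto_mol_sub hg.pdx.memLp)
    have l2 := tendsto_nrm_zero (tendsto_mol_sub hg.pdy.memLp)
    have l3 := tendsto_nrm_zero (tendsto_mol_sub m3)
    have hfin : ∀ n, eLpNorm (com u1 u2 w n g) 2 muH ≠ ⊤ := fun n =>
      ((hb n g hg.memLp).trans_lt (ENNReal.mul_lt_top hA.lt_top hg.memLp.2)).ne
    refine (ENNReal.tendsto_toReal_iff hfin ENNReal.zero_ne_top).1 ?_
    have lim := ((l1.const_mul M).add (l2.const_mul M)).add l3
    simp only [mul_zero, add_zero] at lim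
    refine squeeze_zero (fun n => ENNReal.toReal_nonneg) (fun n => ?_) lim
    have hmolm : ∀ {f : F²}, MemLp f 2 muH → MemLp (mol n f) 2 muH := fun hf =>
      memLp_conv (testDl n) hf
    have k1 := memLp_bdd_mul hu.meas1 hu.bdd1 ((hmolm hg.pdx.memLp).sub hg.pdx.memLp)
    have k2 := memLp_bdd_mul hu.meas2 hu.bdd2 ((hmolm hg.pdy.memLp).sub hg.pdy.memLp)
    have k3 := (hmolm m3).sub m3
    have e : com u1 u2 w n g = fun p => (u1 p * (mol n (pdx g) - pdx g) p
        + u2 p * (mol n (pdy g) - pdy g) p)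
        - (mol n (fun q => u1 q * pdx g q + u2 q * pdy g q)
          - fun q => u1 q * pdx g q + u2 q * pdy g q) p := by
      funext p
      rw [com_eq_of_test hu n hg]
      simp only [Pi.sub_apply]; ring
    change nrm muH (com u1 u2 w n g) ≤ _
    rw [e]
    refine (nrm_sub_le (k1.add k2) k3).trans (add_le_add ((nrm_add_le k1 k2).trans
      (add_le_add ?_ ?_)) le_rfl)
    · exact nrm_bdd_mul_le hu.nonneg hu.bdd1 ((hmolm hg.pdx.memLp).sub hg.pdx.memLp)
    · exact nrm_bdd_mul_le hu.nonneg hu.bdd2 ((hmolm hg.pdy.memLp).sub hg.pdy.memLp)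

/-- Commutator of the smoothing and the multiplication by `w`. -/
lemma tendsto_mul_mol_sub (hm : AESM w muH) (hM : 0 ≤ M)
    (hw : ∀ᵐ p ∂muH, |w p| ≤ M) {f : F²} (hf : MemLp f 2 muH) :
    Tendsto (fun n => eLpNorm (fun p => w p * mol n f p - mol n (fun q => w q * f q) p) 2 muH)
      atTop (𝓝 0) := by
  have m1 := memLp_bdd_mul hm hw hf
  have hmolm : ∀ n {f : F²}, MemLp f 2 muH → MemLp (mol n f) 2 muH := fun n _ hf =>
    memLp_conv (testDl n) hf
  have l1 := tendsto_nrm_zero (tendsto_mol_sub hf)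
  have l2 := tendsto_nrm_zero (tendsto_mol_sub m1)
  have hmem : ∀ n, MemLp (fun p => w p * mol n f p - mol n (fun q => w q * f q) p) 2 muH := fun n =>
    (memLp_bdd_mul hm hw (hmolm n hf)).sub (hmolm n m1)
  refine (ENNReal.tendsto_toReal_iff (fun n => (hmem n).2.ne) ENNReal.zero_ne_top).1 ?_
  have lim := (l1.const_mul M).add l2
  simp only [mul_zero, add_zero] at lim
  refine squeeze_zero (fun n => ENNReal.toReal_nonneg) (fun n => ?_) lim
  have k1 := memLp_bdd_mul hm hw ((hmolm n hf).sub hf)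
  have e : (fun p => w p * mol n f p - mol n (fun q => w q * f q) p) = fun p =>
      w p * (mol n f - f) p - (mol n (fun q => w q * f q) - fun q => w q * f q) p := by
    funext p; simp only [Pi.sub_apply]; ring
  change nrm muH _ ≤ _
  rw [e]
  exact (nrm_sub_le k1 ((hmolm n m1).sub m1)).trans
    (add_le_add (nrm_bdd_mul_le hM hw ((hmolm n hf).sub hf)) le_rfl)

end Commutator

/-! ## The residual of the smoothed interior temperature -/

section Residual

/-- The interior temperature `θ` for the flow `(u1, u2, z w)`, with the bounded datum `θ1` at the top. -/
structure IsInterior (lam M L M1 : ℝ) (u1 u2 w θ1 gx gy m : F²) (θ θz : F³) : Prop where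
  lip : IsLipField u1 u2 w M L
  pos : 0 < lam
  mem : MemLp θ1 2 muH
  memx : MemLp gx 2 muH
  memy : MemLp gy 2 muH
  wx : WeakX θ1 gx
  wy : WeakY θ1 gy
  bdd : ∀ᵐ p ∂muH, |θ1 p| ≤ M1
  nonneg : 0 ≤ M1
  mulx : MemLp (fun p => m p * gx p) 2 muH
  muly : MemLp (fun p => m p * gy p) 2 muH
  memm : MemLp m 2 muH
  weak : IsWeakDz θ θz
  top : HasTopTrace θ θz θ1
  eqn : ∀ φ, IsTest φ → (∀ p, φ (p, 1) = 0) → ∫ P, (lam * (θz P * dZ φ P)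
      - θ P * (u1 P.1 * dX φ P + u2 P.1 * dY φ P + P.2 * w P.1 * dZ φ P)) ∂muO = 0

variable {u1 u2 w θ1 gx gy m : F²} {M L lam M1 : ℝ} {θ θz : F³} {n : ℕ}

local notation "Hx" => convS (pdx (moll (dl n))) (fun P => θ P - θ1 (Prod.fst P))
local notation "Hy" => convS (pdy (moll (dl n))) (fun P => θ P - θ1 (Prod.fst P))
local notation "Hz" => convS (moll (dl n)) θz
local notation "𝓘" => IsInterior lam M L M1 u1 u2 w θ1 gx gy m θ θz

lemma ae_comp_fst {p : ℝ² → Prop} (h : ∀ᵐ q ∂muH, p q) : ∀ᵐ P ∂muO, p P.1 := by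
  rw [muO_eq]; exact Measure.quasiMeasurePreserving_fst.ae h

lemma ae_of_slices {p : ℝ³ → Prop} (h : ∀ᵐ z ∂nu, ∀ q, p (q, z)) : ∀ᵐ P ∂muO, p P := by
  rw [muO_eq]
  filter_upwards [Measure.quasiMeasurePreserving_snd.ae h] with P hP using hP P.1

lemma aesm_comp_fst {h : F²} (hh : AESM h muH) : AESM (fun P : ℝ³ => h P.1) muO := by
  rw [muO_eq]; exact hh.comp_fst

/-- The residual. -/
def residual (u1 u2 w gx gy : F²) (θ θz : F³) (n : ℕ) (P : ℝ³) : ℝ :=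
  u1 P.1 * (gx P.1 - mol n gx P.1) + u2 P.1 * (gy P.1 - mol n gy P.1)
    + com u1 u2 w n (fun q => θ (q, P.2)) P.1
    + P.2 * (w P.1 * mol n (fun q => θz (q, P.2)) P.1 - mol n (fun q => w q * θz (q, P.2)) P.1)

lemma abs_snd_le_one : ∀ᵐ P : ℝ³ ∂muO, |P.2| ≤ 1 := by
  filter_upwards [ae_muO_mem] with P hP
  rw [abs_of_pos hP.2.1]; exact hP.2.2.le

lemma memLp_snd_mul {f : F³} (hf : MemLp f 2 muO) : MemLp (fun P => P.2 * f P) 2 muO :=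
  memLp_bdd_mul (a := fun P : ℝ³ => P.2) measurable_snd.aestronglyMeasurable abs_snd_le_one hf

lemma dZ_snd_mul {φ : F³} (hφ : IsTest φ) (P : ℝ³) :
    dZ (fun P => P.2 * φ P) P = φ P + P.2 * dZ φ P := by
  have := ((hasDerivAt_id P.2).mul (hasDerivAt_dZ hφ.diff P)).deriv
  rwa [one_mul] at this

lemma residual_terms (H : 𝓘) (n : ℕ) :
    MemLp (fun P : ℝ³ => u1 P.1 * (gx P.1 - mol n gx P.1)) 2 muO ∧
    MemLp (fun P : ℝ³ => u2 P.1 * (gy P.1 - mol n gy P.1)) 2 muO ∧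
    MemLp (fun P : ℝ³ => com u1 u2 w n (fun q => θ (q, P.2)) P.1) 2 muO ∧
    MemLp (fun P : ℝ³ => w P.1 * mol n (fun q => θz (q, P.2)) P.1
      - mol n (fun q => w q * θz (q, P.2)) P.1) 2 muO := by
  have hu := H.lip
  have mθ := H.weak.memLp
  have mz := H.weak.memLp'
  have hwm := aesm_comp_fst hu.meas3
  have hwb := ae_comp_fst hu.bdd3
  refine ⟨memLp_comp_fst (memLp_bdd_mul hu.meas1 hu.bdd1 (H.memx.sub (memLp_mol H.memx))),
    memLp_comp_fst (memLp_bdd_mul hu.meas2 hu.bdd2 (H.memy.sub (memLp_mol H.memy))), ?_,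
    (memLp_bdd_mul hwm hwb (memLp_convS (testDl n) mz)).sub
      (memLp_convS (testDl n) (memLp_bdd_mul hwm hwb mz))⟩
  obtain ⟨A, hA, hb⟩ := exists_com_bound hu
  have hm : AESM (fun P : ℝ³ => com u1 u2 w n (fun q => θ (q, P.2)) P.1) muO := by
    have h1 := mθ.1
    rw [muO_eq] at h1 ⊢
    exact aestronglyMeasurable_kop_slices (aestronglyMeasurable_comKer hu n) h1
  refine ⟨hm, ?_⟩
  rw [muO_eq] at hm mθ ⊢
  exact (eLpNorm_two_slices_le (T := com u1 u2 w n) (hb n) mθ hm).trans_lt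
    (ENNReal.mul_lt_top hA.lt_top mθ.2)

lemma memLp_residual (H : 𝓘) (n : ℕ) : MemLp (residual u1 u2 w gx gy θ θz n) 2 muO := by
  obtain ⟨r1, r2, r3, r4⟩ := residual_terms H n
  exact ((r1.add r2).add r3).add (memLp_snd_mul r4)

lemma tendsto_residual (H : 𝓘) :
    Tendsto (fun n => nrm muO (residual u1 u2 w gx gy θ θz n)) atTop (𝓝 0) := by
  have hu := H.lip
  have mθ := H.weak.memLp
  have mz := H.weak.memLp'
  obtain ⟨A, hA, hb⟩ := exists_com_bound hu
  have l3 : Tendsto (fun n => nrm muO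
      (fun P : ℝ³ => com u1 u2 w n (fun q => θ (q, P.2)) P.1)) atTop (𝓝 0) := by
    refine tendsto_nrm_zero ?_
    have hm := fun n => (residual_terms H n).2.2.1.1
    rw [muO_eq] at hm mθ ⊢
    exact tendsto_eLpNorm_two_slices (T := com u1 u2 w) hA hb (fun h hh => tendsto_com hu hh) mθ hm
  have l4 : Tendsto (fun n => nrm muO (fun P : ℝ³ => w P.1 * mol n (fun q => θz (q, P.2)) P.1
      - mol n (fun q => w q * θz (q, P.2)) P.1)) atTop (𝓝 0) := by
    refine tendsto_nrm_zero ?_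
    have hm := fun n => (residual_terms H n).2.2.2.1
    rw [muO_eq] at hm mz ⊢
    refine tendsto_eLpNorm_two_slices
      (T := fun n h p => w p * mol n h p - mol n (fun q => w q * h q) p)
      (A := ENNReal.ofReal (2 * M)) ENNReal.ofReal_ne_top (fun n h hh => ?_)
      (fun h hh => tendsto_mul_mol_sub hu.meas3 hu.nonneg hu.bdd3 hh) mz hm
    have m1 := memLp_bdd_mul hu.meas3 hu.bdd3 hh
    have m2 := memLp_bdd_mul hu.meas3 hu.bdd3 (memLp_mol (n := n) hh)
    have hle : nrm muH (mol n h) ≤ nrm muH h := ENNReal.toReal_mono hh.2.ne (eLpNorm_mol_le n hh.1)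
    have hle' : nrm muH (mol n fun q => w q * h q) ≤ nrm muH fun q => w q * h q :=
      ENNReal.toReal_mono m1.2.ne (eLpNorm_mol_le n m1.1)
    have key : nrm muH (fun p => w p * mol n h p - mol n (fun q => w q * h q) p) ≤
        2 * M * nrm muH h := by
      refine (nrm_sub_le m2 (memLp_mol m1)).trans ?_
      have e1 := nrm_bdd_mul_le hu.nonneg hu.bdd3 (memLp_mol (n := n) hh)
      have e2 := nrm_bdd_mul_le hu.nonneg hu.bdd3 hh
      have e3 := mul_le_left hle hu.nonneg
      linarith
    have hfin := (m2.sub (memLp_mol (n := n) m1)).2.ne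
    rw [← ENNReal.ofReal_toReal hh.2.ne, ← ENNReal.ofReal_mul (by linarith [hu.nonneg])]
    exact (ENNReal.le_ofReal_iff_toReal_le hfin
      (mul_nonneg (by linarith [hu.nonneg]) ENNReal.toReal_nonneg)).2 key
  have l1 := tendsto_nrm_zero (tendsto_mol_sub H.memx)
  have l2 := tendsto_nrm_zero (tendsto_mol_sub H.memy)
  have lim := (((l1.const_mul M).add (l2.const_mul M)).add l3).add l4
  simp only [mul_zero, add_zero] at lim
  refine squeeze_zero (fun n => nrm_nonneg _) (fun n => ?_) lim
  obtain ⟨r1, r2, r3, r4⟩ := residual_terms H n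
  have n0 : ∀ {a g : F²}, AESM a muH → (∀ᵐ p ∂muH, |a p| ≤ M) → MemLp g 2 muH →
      nrm muO (fun P : ℝ³ => a P.1 * (g P.1 - mol n g P.1)) ≤ M * nrm muH (mol n g - g) :=
    fun ma ha hg => by
      refine (nrm_comp_fst (memLp_bdd_mul ma ha (hg.sub (memLp_mol hg))).1).trans_le ?_
      refine (nrm_bdd_mul_le hu.nonneg ha (hg.sub (memLp_mol hg))).trans (le_of_eq ?_)
      congr 1
      exact nrm_sub_comm _ _
  have n4 := nrm_bdd_mul_le (a := fun P : ℝ³ => P.2) zero_le_one abs_snd_le_one r4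
  rw [one_mul] at n4
  refine (nrm_add_le ((r1.add r2).add r3) (memLp_snd_mul r4)).trans (add_le_add ?_ n4)
  refine (nrm_add_le (r1.add r2) r3).trans (add_le_add ?_ le_rfl)
  exact (nrm_add_le r1 r2).trans (add_le_add (n0 hu.meas1 hu.bdd1 H.memx)
    (n0 hu.meas2 hu.bdd2 H.memy))

/-- The smoothed interior temperature solves the interior equation up to the residual. -/
lemma residual_spec (H : 𝓘) {φ : F³} (hφ : IsTest φ) (h1 : ∀ p, φ (p, 1) = 0) :
    ∫ P, ((u1 P.1 * (gx P.1 + Hx P) + u2 P.1 * (gy P.1 + Hy P) + P.2 * w P.1 * Hz P) * φ P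
      + lam * (Hz P * dZ φ P)) ∂muO = ∫ P, residual u1 u2 w gx gy θ θz n P * φ P ∂muO := by
  obtain ⟨hu, -, m1, mgx, mgy, wx, wy, -, -, -, -, -, hθ, -, heq⟩ := id H
  set K := moll (dl n) with hKdef
  have hK : IsTestH K := testDl n
  have he : ∀ r, K (-r) = K r := moll_neg _
  have mθ := hθ.memLp
  have mz := hθ.memLp'
  have mu1 := aesm_comp_fst hu.meas1
  have mu2 := aesm_comp_fst hu.meas2
  have mw := aesm_comp_fst hu.meas3
  have bu1 := ae_comp_fst hu.bdd1
  have bu2 := ae_comp_fst hu.bdd2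
  have bw := ae_comp_fst hu.bdd3
  have f1 := memLp_bdd_mul mu1 bu1 mθ
  have f2 := memLp_bdd_mul mu2 bu2 mθ
  have f3 := memLp_bdd_mul mw bw mθ
  have f4 := memLp_bdd_mul mw bw mz
  -- the weak equation tested with the smoothed test function
  have hJ : IsTest (convS K φ) := isTest_convS hK hφ
  have hJ1 : ∀ p, convS K φ (p, 1) = 0 := convS_eq_zero h1
  have hz : IsTest (fun P => P.2 * convS K φ P) := hJ.mul_smooth contDiff_snd fun _ _ _ => rfl
  have E1 := heq _ hJ hJ1
  have E2 := integral_mul_dZ_of_weakDz hu.meas3 hu.bdd3 hθ hz (fun p => by simp)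
    (fun p => by simp only [hJ1, mul_zero])
  have A1 := integral_convS_mul_even hK he mz hφ.dZ.memLp
  have A2 := integral_convS_pdx_mul hK he f1 hφ.memLp
  have A3 := integral_convS_pdy_mul hK he f2 hφ.memLp
  have A4 := integral_convS_mul_even hK he f3 hφ.memLp
  have A5 := integral_convS_mul_even hK he f4 (memLp_snd_mul hφ.memLp)
  have hzc : ∀ P, convS K (fun P => P.2 * φ P) P = P.2 * convS K φ P := fun P => by
    simp only [convS, conv_apply]
    rw [← integral_const_mul]
    congr 1; funext q; ring
  rw [← dZ_convS hK hφ] at A1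
  rw [← dX_convS hK hφ] at A2
  rw [← dY_convS hK hφ] at A3
  simp only [hzc] at A5
  have I1 := int_mul mz hJ.dZ.memLp
  have I2 := int_mul f1 hJ.dX.memLp
  have I3 := int_mul f2 hJ.dY.memLp
  have I4 := int_mul f3 hJ.memLp
  have I5 := int_mul f3 (memLp_snd_mul hJ.dZ.memLp)
  have E1' : lam * ∫ P, θz P * dZ (convS K φ) P ∂muO = (∫ P, u1 P.1 * θ P * dX (convS K φ) P ∂muO)
      + (∫ P, u2 P.1 * θ P * dY (convS K φ) P ∂muO)
      + ∫ P, w P.1 * θ P * (P.2 * dZ (convS K φ) P) ∂muO := by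
    rw [← integral_const_mul, ← integral_add_three I2 I3 I5, ← sub_eq_zero,
      ← integral_sub (I1.const_mul lam) (by exact (I2.add I3).add I5), ← E1]
    congr 1; funext P; ring
  have E2' : (∫ P, w P.1 * θ P * convS K φ P ∂muO)
      + (∫ P, w P.1 * θ P * (P.2 * dZ (convS K φ) P) ∂muO)
      = -∫ P, w P.1 * θz P * (P.2 * convS K φ P) ∂muO := by
    rw [← integral_add I4 I5, ← E2]
    congr 1; funext P; rw [dZ_snd_mul hJ]; ring
  -- the integrand
  have g1 := memLp_convS hK.pdx f1
  have g2 := memLp_convS hK.pdy f2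
  have g3 := memLp_convS hK f3
  have g4 := memLp_convS hK f4
  have g5 := memLp_convS hK mz
  have J1 := int_mul g1 hφ.memLp
  have J2 := int_mul g2 hφ.memLp
  have J3 := int_mul g3 hφ.memLp
  have J4 := int_mul g4 (memLp_snd_mul hφ.memLp)
  have J5 := (int_mul g5 hφ.dZ.memLp).const_mul lam
  have JR := int_mul (memLp_residual H n) hφ.memLp
  have hsum : (∫ P, convS (pdx K) (fun P => u1 P.1 * θ P) P * φ P ∂muO)
      + (∫ P, convS (pdy K) (fun P => u2 P.1 * θ P) P * φ P ∂muO)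
      + ((∫ P, convS K (fun P => w P.1 * θ P) P * φ P ∂muO)
      + (∫ P, convS K (fun P => w P.1 * θz P) P * (P.2 * φ P) ∂muO)
      + ∫ P, lam * (convS K θz P * dZ φ P) ∂muO) = 0 := by
    rw [A2, A3, A4, A5, integral_const_mul, A1, E1']
    linear_combination E2'
  have hptw : ∀ᵐ P ∂muO, (u1 P.1 * (gx P.1 + convS (pdx K) (fun P => θ P - θ1 P.1) P)
      + u2 P.1 * (gy P.1 + convS (pdy K) (fun P => θ P - θ1 P.1) P)
      + P.2 * w P.1 * convS K θz P) * φ P + lam * (convS K θz P * dZ φ P)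
      = residual u1 u2 w gx gy θ θz n P * φ P +
      (convS (pdx K) (fun P => u1 P.1 * θ P) P * φ P + convS (pdy K) (fun P => u2 P.1 * θ P) P * φ P
      + (convS K (fun P => w P.1 * θ P) P * φ P + convS K (fun P => w P.1 * θz P) P * (P.2 * φ P)
      + lam * (convS K θz P * dZ φ P))) := by
    refine ae_of_slices ?_
    filter_upwards [memLp_slice mθ] with z hz p
    have l1 := locInt_muH hz
    have l2 := locInt_muH m1
    have c1 : convS (pdx K) (fun P => θ P - θ1 P.1) (p, z) =
        conv (pdx K) (fun q => θ (q, z)) p - mol n gx p := by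
      have := conv_sub hK.pdx l1 l2 p
      rw [conv_pdx hK wx] at this
      exact this
    have c2 : convS (pdy K) (fun P => θ P - θ1 P.1) (p, z) =
        conv (pdy K) (fun q => θ (q, z)) p - mol n gy p := by
      have := conv_sub hK.pdy l1 l2 p
      rw [conv_pdy hK wy] at this
      exact this
    have c3 := com_eq hu n hz p
    rw [c1, c2]
    simp only [residual]
    rw [c3]
    simp only [convS, mol]
    ring
  rw [integral_congr_ae hptw, integral_add JR (by exact (J1.add J2).add ((J3.add J4).add J5)),
    integral_add (by exact J1.add J2) (by exact (J3.add J4).add J5), integral_add J1 J2,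
    integral_add_three J3 J4 J5, hsum, add_zero]

end Residual

/-! ## Consistency of the smoothed interior temperature -/

section Consistency

/-- A divergence free boundary layer field `(A1 + g1, A2 + g2, A3)`, where `(g1, g2)` is a gradient. -/
structure IsBoundaryField (η : ℝ) (f g1 g2 m : F²) (A1 A2 A3 : F³) : Prop where
  nonneg : 0 ≤ η
  meas1 : AESM A1 muO
  meas2 : AESM A2 muO
  meas3 : AESM A3 muO
  bdd1 : ∃ C, ∀ᵐ P ∂muO, |A1 P| ≤ C
  bdd2 : ∃ C, ∀ᵐ P ∂muO, |A2 P| ≤ C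
  bdd3 : ∃ C, ∀ᵐ P ∂muO, |A3 P| ≤ C
  layer₁ : ∀ᵐ P ∂muO, |A1 P| * √(1 - P.2) ≤ η * (m P.1 * (1 - P.2) ^ (-(3 / 4) : ℝ))
  layer₂ : ∀ᵐ P ∂muO, |A2 P| * √(1 - P.2) ≤ η * (m P.1 * (1 - P.2) ^ (-(3 / 4) : ℝ))
  memf : MemLp f 2 muH
  memg1 : MemLp g1 2 muH
  memg2 : MemLp g2 2 muH
  pot : ∀ φ, IsTestH φ → ∫ p, (g1 p * pdx φ p + g2 p * pdy φ p) ∂muH = -∫ p, f p * φ p ∂muH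
  div : ∀ Φ, IsTest Φ → (∀ p, Φ (p, 1) = 0) →
    ∫ P, ((A1 P + g1 P.1) * dX Φ P + (A2 P + g2 P.1) * dY Φ P + A3 P * dZ Φ P) ∂muO = 0

lemma integrable_layer_weight : Integrable (fun z : ℝ => (1 - z) ^ (-(3 / 4) : ℝ)) nu := by
  have h : IntervalIntegrable (fun z : ℝ => z ^ (-(3 / 4) : ℝ)) volume 0 1 :=
    intervalIntegral.intervalIntegrable_rpow' (by norm_num)
  have h2 := (h.comp_sub_left 1).symm
  simp only [sub_zero, sub_self] at h2
  rw [intervalIntegrable_iff_integrableOn_Ioo_of_le zero_le_one] at h2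
  exact h2

/-- The integral of the layer weight. -/
def layerMass : ℝ := ∫ z, (1 - z) ^ (-(3 / 4) : ℝ) ∂nu

lemma layerMass_nonneg : 0 ≤ layerMass := by
  refine integral_nonneg_of_ae ?_
  filter_upwards [ae_nu_mem] with z hz
  exact rpow_nonneg (by linarith [hz.2]) _

lemma layer_bound {η : ℝ} (hη : 0 ≤ η) {m x : F²} {A X φ : F³}
    (hA : ∀ᵐ P ∂muO, |A P| * √(1 - P.2) ≤ η * (m P.1 * (1 - P.2) ^ (-(3 / 4) : ℝ)))
    (hX : ∀ᵐ P ∂muO, |X P| ≤ |x P.1|) (hmx : MemLp (fun p => m p * x p) 2 muH)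
    (hφ : IsTest φ) (h1 : ∀ p, φ (p, 1) = 0) :
    |∫ P, A P * X P * φ P ∂muO| ≤
      η * layerMass * nrm muH (fun p => m p * x p) * nrm muO (dZ φ) := by
  have hv := memLp_vn hφ.dZ.memLp
  have hi : Integrable (fun p => |m p * x p| * |vn (dZ φ) p|) muH := by
    have := (int_mul hmx hv).norm
    simpa only [norm_mul, norm_eq_abs, abs_mul] using this
  have hprod := hi.mul_prod integrable_layer_weight
  rw [← muO_eq] at hprod
  have hle : ∀ᵐ P ∂muO, ‖A P * X P * φ P‖ ≤
      η * (|m P.1 * x P.1| * |vn (dZ φ) P.1| * (1 - P.2) ^ (-(3 / 4) : ℝ)) := by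
    filter_upwards [hA, hX, ae_muO_mem] with P a1 a2 a3
    have e1 := abs_le_vn hφ.smooth h1 P.1 (Ioo_subset_Icc_self a3.2)
    have hw : 0 ≤ (1 - P.2) ^ (-(3 / 4) : ℝ) := rpow_nonneg (by linarith [a3.2.2]) _
    have hv0 := vn_nonneg (dZ φ) P.1
    rw [norm_mul, norm_mul, norm_eq_abs, norm_eq_abs, norm_eq_abs, abs_mul, abs_of_nonneg hv0]
    calc |A P| * |X P| * |φ P| ≤ |A P| * |x P.1| * (√(1 - P.2) * vn (dZ φ) P.1) := by gcongr
      _ = (|A P| * √(1 - P.2)) * (|x P.1| * vn (dZ φ) P.1) := by ring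
      _ ≤ (η * (m P.1 * (1 - P.2) ^ (-(3 / 4) : ℝ))) * (|x P.1| * vn (dZ φ) P.1) := by gcongr
      _ ≤ (η * (|m P.1| * (1 - P.2) ^ (-(3 / 4) : ℝ))) * (|x P.1| * vn (dZ φ) P.1) := by
          gcongr; exact le_abs_self _
      _ = _ := by ring
  refine (norm_integral_le_of_norm_le (hprod.const_mul η) hle).trans ?_
  rw [integral_const_mul, muO_eq, integral_prod_mul (fun p => |m p * x p| * |vn (dZ φ) p|)
    (fun z : ℝ => (1 - z) ^ (-(3 / 4) : ℝ)), ← muO_eq]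
  have := integral_abs_mul_le hmx hv
  rw [nrm_vn hφ.dZ.memLp] at this
  calc _ ≤ η * ((nrm muH (fun p => m p * x p) * nrm muO (dZ φ)) * layerMass) := by
        refine mul_le_left (mul_le_mul this le_rfl layerMass_nonneg ?_) hη
        exact mul_nonneg (nrm_nonneg _) (nrm_nonneg _)
    _ = _ := by ring

lemma nrm_le_nrm_dZ {φ : F³} (hφ : IsTest φ) (h1 : ∀ p, φ (p, 1) = 0) :
    nrm muO φ ≤ nrm muO (dZ φ) := by
  refine ENNReal.toReal_mono hφ.dZ.memLp.2.ne ?_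
  exact eLpNorm_le_of_slices hφ.memLp.1 (ae_nu_mem.mono fun z hz =>
    nrm_slice_le hφ.smooth h1 hφ.dZ.memLp (Ioo_subset_Icc_self hz))

lemma abs_mol_le {f : F²} {M : ℝ} (hM : ∀ᵐ p ∂muH, |f p| ≤ M) (n : ℕ) (p : ℝ²) :
    |mol n f p| ≤ M := by
  have e1 : ∀ᵐ q ∂muH, ‖moll (dl n) (p - q) * f q‖ ≤ moll (dl n) (p - q) * M := by
    filter_upwards [hM] with q hq
    rw [norm_mul, norm_of_nonneg (moll_nonneg (dl_pos n) (dl_le_one n) _)]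
    exact mul_le_left hq (moll_nonneg (dl_pos n) (dl_le_one n) _)
  have e2 := norm_integral_le_of_norm_le (((testDl n).reflect p).integrable.mul_const M) e1
  rwa [integral_mul_const, integral_moll (dl_pos n) (dl_le_one n), one_mul] at e2

variable {u1 u2 w θ1 gx gy f g1 g2 m : F²} {M L lam η e M1 : ℝ} {θ θz A1 A2 A3 φ : F³}

lemma IsTest.ae_bound (hφ : IsTest φ) : ∃ C, 0 ≤ C ∧ ∀ᵐ P ∂muO, |φ P| ≤ C := by
  obtain ⟨C, hC, h⟩ := hφ.exists_bound
  exact ⟨C, hC, ae_muO_mem.mono fun P hP => h P.1 P.2 (Ioo_subset_Icc_self hP.2)⟩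

/-- The gradient part of the field transports a bounded function by integration by parts. -/
lemma potential_bound (H : IsInterior lam M L M1 u1 u2 w θ1 gx gy m θ θz)
    (hB : IsBoundaryField η f g1 g2 m A1 A2 A3) (hφ : IsTest φ) :
    |∫ P, (g1 P.1 * gx P.1 + g2 P.1 * gy P.1) * φ P ∂muO| ≤
      M1 * (nrm muH f * nrm muO φ + nrm muH g1 * nrm muO (dX φ) + nrm muH g2 * nrm muO (dY φ)) := by
  have hK := testDl
  obtain ⟨-, -, m1, mgx, mgy, wx, wy, hM1, hM, -, -, -, -, -, -⟩ := id H
  obtain ⟨-, -, -, -, -, -, -, -, -, memf, memg1, memg2, pot, -⟩ := id hB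
  have hl := locInt_muH m1
  have hsm : ∀ n, ContDiff ℝ ∞ (mol n θ1) := fun n => contDiff_conv (hK n) hl
  have hsd : ∀ n, Differentiable ℝ (mol n θ1) := fun n => (hsm n).differentiable (by simp)
  have hpx : ∀ n p, pdx (mol n θ1) p = mol n gx p := fun n p => by
    rw [mol, pdx_conv (hK n) hl, conv_pdx (hK n) wx, mol]
  have hpy : ∀ n p, pdy (mol n θ1) p = mol n gy p := fun n p => by
    rw [mol, pdy_conv (hK n) hl, conv_pdy (hK n) wy, mol]
  obtain ⟨C, -, hφb'⟩ := hφ.ae_bound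
  have G1 := memLp_comp_fst memg1
  have G2 := memLp_comp_fst memg2
  have F0 := memLp_comp_fst memf
  have Gφ1 := memLp_bdd_mul hφ.memLp.1 hφb' G1
  have Gφ2 := memLp_bdd_mul hφ.memLp.1 hφb' G2
  have hms : ∀ n, AESM (fun P : ℝ³ => mol n θ1 P.1) muO := fun n =>
    ((hsm n).continuous.comp continuous_fst).aestronglyMeasurable
  have hmb : ∀ n, ∀ᵐ P : ℝ³ ∂muO, |mol n θ1 P.1| ≤ M1 := fun n =>
    .of_forall fun P => abs_mol_le hM1 n _
  -- the bound for smooth functions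
  have hstep : ∀ n, |(∫ P, φ P * g1 P.1 * mol n gx P.1 ∂muO) + ∫ P, φ P * g2 P.1 * mol n gy P.1 ∂muO|
      ≤ M1 * (nrm muH f * nrm muO φ + nrm muH g1 * nrm muO (dX φ) + nrm muH g2 * nrm muO (dY φ)) := by
    intro n
    have b0 := memLp_bdd_mul (hms n) (hmb n) hφ.memLp
    have b1 := memLp_bdd_mul (hms n) (hmb n) hφ.dX.memLp
    have b2 := memLp_bdd_mul (hms n) (hmb n) hφ.dY.memLp
    have i0 := int_mul F0 b0
    have i1 := int_mul G1 b1
    have i2 := int_mul G2 b2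
    have j1 := int_mul Gφ1 (memLp_comp_fst (memLp_mol (n := n) mgx))
    have j2 := int_mul Gφ2 (memLp_comp_fst (memLp_mol (n := n) mgy))
    have hid : (∫ P, φ P * g1 P.1 * mol n gx P.1 ∂muO) + (∫ P, φ P * g2 P.1 * mol n gy P.1 ∂muO)
        = -((∫ P, f P.1 * (mol n θ1 P.1 * φ P) ∂muO) + (∫ P, g1 P.1 * (mol n θ1 P.1 * dX φ P) ∂muO)
          + ∫ P, g2 P.1 * (mol n θ1 P.1 * dY φ P) ∂muO) := by
      rw [← integral_add_three i0 i1 i2, ← integral_add j1 j2, eq_neg_iff_add_eq_zero,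
        ← integral_add (by exact j1.add j2) (by exact (i0.add i1).add i2),
        integral_muO (by exact (j1.add j2).add ((i0.add i1).add i2))]
      refine integral_eq_zero_of_ae (.of_forall fun z => ?_)
      have hT : IsTestH (fun p => mol n θ1 p * φ (p, z)) :=
        (hφ.slice z).mul_smooth (hsm n) (conv_periodic (hK n) θ1)
      have h := pot _ hT
      rw [← sub_eq_zero, sub_neg_eq_add, ← integral_add] at h
      · refine Eq.trans ?_ h
        refine integral_congr_ae (.of_forall fun p => ?_)
        simp only []
        rw [pdx_mul (hsd n) (hφ.slice z).diff, pdy_mul (hsd n) (hφ.slice z).diff, hpx, hpy]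
        change φ (p, z) * g1 p * mol n gx p + φ (p, z) * g2 p * mol n gy p + (f p * (mol n θ1 p * φ (p, z))
          + g1 p * (mol n θ1 p * dX φ (p, z)) + g2 p * (mol n θ1 p * dY φ (p, z))) = g1 p * (mol n gx p * φ (p, z) + mol n θ1 p * dX φ (p, z)) + g2 p *
          (mol n gy p * φ (p, z) + mol n θ1 p * dY φ (p, z)) + f p * (mol n θ1 p * φ (p, z))
        ring
      · exact (int_mul memg1 hT.pdx.memLp).add
          (int_mul memg2 hT.pdy.memLp)
      · exact int_mul memf hT.memLp
    rw [hid, abs_neg]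
    refine (abs_add_three _ _ _).trans ?_
    have k0 := abs_integral_mul_le F0 b0
    have k1 := abs_integral_mul_le G1 b1
    have k2 := abs_integral_mul_le G2 b2
    rw [nrm_comp_fst memf.1] at k0
    rw [nrm_comp_fst memg1.1] at k1
    rw [nrm_comp_fst memg2.1] at k2
    have l0 := mul_le_left (nrm_bdd_mul_le hM (hmb n) hφ.memLp) (nrm_nonneg (μ := muH) f)
    have l1 := mul_le_left (nrm_bdd_mul_le hM (hmb n) hφ.dX.memLp) (nrm_nonneg (μ := muH) g1)
    have l2 := mul_le_left (nrm_bdd_mul_le hM (hmb n) hφ.dY.memLp) (nrm_nonneg (μ := muH) g2)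
    calc _ ≤ _ := add_le_add (add_le_add (k0.trans l0) (k1.trans l1)) (k2.trans l2)
      _ = _ := by ring
  have hlim : ∀ {G : F³} {h : F²}, MemLp G 2 muO → MemLp h 2 muH →
      Tendsto (fun n => ∫ P, G P * mol n h P.1 ∂muO) atTop (𝓝 (∫ P, G P * h P.1 ∂muO)) := by
    intro G h hG hh
    rw [tendsto_iff_norm_sub_tendsto_zero]
    have l := (tendsto_nrm_zero (tendsto_mol_sub hh)).const_mul (nrm muO G)
    rw [mul_zero] at l
    refine squeeze_zero (fun n => norm_nonneg _) (fun n => ?_) l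
    rw [← integral_sub (int_mul hG (memLp_comp_fst (memLp_mol hh)))
      (int_mul hG (memLp_comp_fst hh))]
    have := abs_integral_mul_le hG (memLp_comp_fst ((memLp_mol (n := n) hh).sub hh))
    rw [nrm_comp_fst ((memLp_mol hh).sub hh).1] at this
    simp only [Pi.sub_apply, mul_sub] at this
    exact this
  have hl2 := ((hlim Gφ1 mgx).add (hlim Gφ2 mgy)).abs
  have hfin := le_of_tendsto' hl2 hstep
  have j1 := int_mul Gφ1 (memLp_comp_fst mgx)
  have j2 := int_mul Gφ2 (memLp_comp_fst mgy)
  rw [← integral_add j1 j2] at hfin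
  refine le_trans (le_of_eq ?_) hfin
  congr 2; funext P; ring

lemma bddAddLp_of_bdd {A : F³} (hm : AESM A muO) {C : ℝ} (hb : ∀ᵐ P ∂muO, |A P| ≤ C) : BddAddLp A :=
  ⟨A, 0, C, hm, hb, MemLp.zero', .of_forall fun P => by simp⟩

lemma bddAddLp_add {A : F³} {g : F²} (hm : AESM A muO) {C : ℝ}
    (hb : ∀ᵐ P ∂muO, |A P| ≤ C) (hg : MemLp g 2 muH) : BddAddLp (fun P => A P + g P.1) :=
  ⟨A, fun P => g P.1, C, hm, hb, memLp_comp_fst hg, .of_forall fun _ => rfl⟩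

/-- The interior flow is divergence free. -/
lemma IsLipField.integral_div (hu : IsLipField u1 u2 w M L) (hφ : IsTest φ) (h1 : ∀ p, φ (p, 1) = 0) :
    ∫ P, (u1 P.1 * dX φ P + u2 P.1 * dY φ P + P.2 * w P.1 * dZ φ P) ∂muO = 0 := by
  obtain ⟨C0, -, hC0⟩ := hφ.ae_bound
  have hb : ∀ {G : F³} {a : F²}, IsTest G → AESM a muH →
      (∀ᵐ p ∂muH, |a p| ≤ M) → Integrable (fun P => a P.1 * G P) muO := fun hG ha hM =>
    hG.integrable.bdd_mul (c := M) (aesm_comp_fst ha) (ae_comp_fst hM)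
  have hz : IsTest (fun P => P.2 * φ P) := hφ.mul_smooth contDiff_snd fun _ _ _ => rfl
  have hz' : IsTest (fun P => P.2 * dZ φ P) := hφ.dZ.mul_smooth contDiff_snd fun _ _ _ => rfl
  have i1 := hb hφ.dX hu.meas1 hu.bdd1
  have i2 := hb hφ.dY hu.meas2 hu.bdd2
  have i3 := hb hz' hu.meas3 hu.bdd3
  have i4 := hb hφ hu.meas3 hu.bdd3
  have i5 := hb hz.dZ hu.meas3 hu.bdd3
  have e1 : ∫ P, (u1 P.1 * dX φ P + u2 P.1 * dY φ P) ∂muO = ∫ P, w P.1 * φ P ∂muO := by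
    rw [integral_muO (by exact i1.add i2), integral_muO i4]
    congr 1; funext z
    exact hu.div _ (hφ.slice z)
  have e2 : ∫ P, w P.1 * dZ (fun P => P.2 * φ P) P ∂muO = 0 := by
    rw [integral_muO' i5]
    refine integral_eq_zero_of_ae (.of_forall fun p => ?_)
    refine (integral_const_mul (w p) fun z => dZ (fun P => P.2 * φ P) (p, z)).trans ?_
    rw [integral_dZ_nu hz, h1]
    simp
  have e3 : ∫ P, w P.1 * dZ (fun P => P.2 * φ P) P ∂muO =
      (∫ P, w P.1 * φ P ∂muO) + ∫ P, w P.1 * (P.2 * dZ φ P) ∂muO := by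
    rw [← integral_add i4 i3]
    congr 1; funext P; rw [dZ_snd_mul hφ]; ring
  have e4 : ∫ P, (u1 P.1 * dX φ P + u2 P.1 * dY φ P + P.2 * w P.1 * dZ φ P) ∂muO =
      (∫ P, (u1 P.1 * dX φ P + u2 P.1 * dY φ P) ∂muO) + ∫ P, w P.1 * (P.2 * dZ φ P) ∂muO := by
    rw [← integral_add (by exact i1.add i2) i3]
    congr 1; funext P; ring
  rw [e4, e1, ← e3, e2]

end Consistency

/-! ## Comparison of the temperature with the smoothed interior temperature -/

section Comparison

/-- An integrable function with a bound for its integral. -/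
def IntBound (F : F³) (c : ℝ) : Prop := Integrable F muO ∧ |∫ P, F P ∂muO| ≤ c

lemma IntBound.add {F G : F³} {c d : ℝ} (hF : IntBound F c)
    (hG : IntBound G d) : IntBound (fun P => F P + G P) (c + d) := by
  refine ⟨hF.1.add hG.1, ?_⟩
  rw [integral_add hF.1 hG.1]
  exact (abs_add_le _ _).trans (add_le_add hF.2 hG.2)

lemma IntBound.const_mul {F : F³} {c : ℝ} (hF : IntBound F c) (a : ℝ) :
    IntBound (fun P => a * F P) (|a| * c) := by
  refine ⟨hF.1.const_mul a, ?_⟩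
  rw [integral_const_mul, abs_mul]
  exact mul_le_left hF.2 (abs_nonneg _)

lemma IntBound.mono {F : F³} {c d : ℝ} (hF : IntBound F c) (h : c ≤ d) :
    IntBound F d := ⟨hF.1, hF.2.trans h⟩

lemma IntBound.congr {F G : F³} {c d : ℝ} (hF : IntBound F c)
    (h : ∀ P, F P = G P) (hc : c = d) : IntBound G d := by
  rw [← hc, ← funext h]; exact hF

lemma intBound_mul {F G : F³} (hF : MemLp F 2 muO) (hG : MemLp G 2 muO) :
    IntBound (fun P => F P * G P) (nrm muO F * nrm muO G) :=
  ⟨int_mul hF hG, abs_integral_mul_le hF hG⟩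

variable {u1 u2 w θ1 gx gy f g1 g2 m : F²} {M L lam η e M1 C : ℝ} {n : ℕ}
  {θ θz A1 A2 A3 φ T Tx Ty Tz : F³}

local notation "Hx" => convS (pdx (moll (dl n))) (fun P => θ P - θ1 (Prod.fst P))
local notation "Hy" => convS (pdy (moll (dl n))) (fun P => θ P - θ1 (Prod.fst P))
local notation "Hz" => convS (moll (dl n)) θz
local notation "𝓘" => IsInterior lam M L M1 u1 u2 w θ1 gx gy m θ θz
local notation "𝓑" => IsBoundaryField η f g1 g2 m A1 A2 A3

/-- A temperature for the flow `(V1, V2, V3)` with the datum `θ1` at the top. -/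
structure IsSolution (lam e : ℝ) (θ1 : F²) (V1 V2 V3 T Tx Ty Tz : F³) : Prop where
  weak : IsWeakDz T Tz
  memx : MemLp Tx 2 muO
  memy : MemLp Ty 2 muO
  wx : WeakOX T Tx
  wy : WeakOY T Ty
  top : HasTopTrace T Tz θ1
  eqn : ∀ φ, IsTest φ → (∀ p, φ (p, 1) = 0) → ∫ P, ((V1 P * Tx P + V2 P * Ty P + V3 P * Tz P) * φ P
      + e ^ 2 * lam * (Tx P * dX φ P + Ty P * dY φ P) + lam * (Tz P * dZ φ P)) ∂muO = 0

lemma integral_sub_add_mul {X : Type*} [MeasurableSpace X] {μ : Measure X}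
    {a b c a' b' c' p q : X → ℝ} (ha : MemLp a 2 μ) (hb : MemLp b 2 μ) (hc : MemLp c 2 μ)
    (ha' : MemLp a' 2 μ) (hb' : MemLp b' 2 μ) (hc' : MemLp c' 2 μ) (hp : MemLp p 2 μ)
    (hq : MemLp q 2 μ) (e1 : ∫ x, a x * p x ∂μ = -∫ x, a' x * q x ∂μ)
    (e2 : ∫ x, b x * p x ∂μ = -∫ x, b' x * q x ∂μ) (e3 : ∫ x, c x * p x ∂μ = -∫ x, c' x * q x ∂μ) :
    ∫ x, (a x - (b x + c x)) * p x ∂μ = -∫ x, (a' x - (b' x + c' x)) * q x ∂μ := by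
  have h : ∀ {a b c p : X → ℝ}, MemLp a 2 μ → MemLp b 2 μ → MemLp c 2 μ → MemLp p 2 μ →
      ∫ x, (a x - (b x + c x)) * p x ∂μ =
        (∫ x, a x * p x ∂μ) - ((∫ x, b x * p x ∂μ) + ∫ x, c x * p x ∂μ) := fun ha hb hc hp => by
    rw [← integral_add (int_mul hb hp) (int_mul hc hp),
      ← integral_sub (int_mul ha hp) (by exact (int_mul hb hp).add (int_mul hc hp))]
    congr 1; funext x; ring
  rw [h ha hb hc hp, h ha' hb' hc' hq, e1, e2, e3]; ring

/-- The consistency error. -/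
def consistencyBound (u1 u2 w θ1 gx gy f g1 g2 m : F²) (lam η e M1 C : ℝ)
    (θ θz A3 : F³) (n : ℕ) : ℝ :=
  nrm muO (residual u1 u2 w gx gy θ θz n) + nrm muO (fun P => A3 P * convS (moll (dl n)) θz P)
    + e * lam * (nrm muO (fun P => gx P.1 + convS (pdx (moll (dl n))) (fun P => θ P - θ1 P.1) P)
      + nrm muO (fun P => gy P.1 + convS (pdy (moll (dl n))) (fun P => θ P - θ1 P.1) P))
    + η * layerMass * (nrm muH (fun p => m p * gx p) + nrm muH (fun p => m p * gy p)
      + 2 * nrm muH (fun p => m p * C))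
    + C * (nrm muH g1 + nrm muH g2) + M1 * (nrm muH f + (nrm muH g1 + nrm muH g2) / e)

local notation "κn" => consistencyBound u1 u2 w θ1 gx gy f g1 g2 m lam η e M1 C θ θz A3 n

lemma consistency (H : 𝓘) (hB : 𝓑) (he : 0 < e) (hC : 0 ≤ C) (hC1 : ∀ᵐ P ∂muO, |Hx P| ≤ C)
    (hC2 : ∀ᵐ P ∂muO, |Hy P| ≤ C) (hφ : IsTest φ) (h1 : ∀ p, φ (p, 1) = 0) :
    IntBound (fun P =>
      ((u1 P.1 + A1 P + g1 P.1) * (gx P.1 + Hx P) + (u2 P.1 + A2 P + g2 P.1) * (gy P.1 + Hy P)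
      + (P.2 * w P.1 + A3 P) * Hz P) * φ P
      + e ^ 2 * lam * ((gx P.1 + Hx P) * dX φ P + (gy P.1 + Hy P) * dY φ P)
      + lam * (Hz P * dZ φ P))
    (κn * (nrm muO (dZ φ) + e * nrm muO (dX φ) + e * nrm muO (dY φ))) := by
  obtain ⟨hu, hlam, m1, mgx, mgy, wx, wy, hM1, hM, hmx, hmy, hm, hθ, -, heq⟩ := id H
  have hK := testDl n
  obtain ⟨C1, hA1⟩ := hB.bdd1
  obtain ⟨C2, hA2⟩ := hB.bdd2
  obtain ⟨C3, hA3⟩ := hB.bdd3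
  obtain ⟨Cφ, hCφ0, hCφ⟩ := hφ.ae_bound
  have hη := hB.nonneg
  have mdiff : MemLp (fun P => θ P - θ1 P.1) 2 muO := hθ.memLp.sub (memLp_comp_fst m1)
  have mHx : MemLp Hx 2 muO := memLp_convS hK.pdx mdiff
  have mHy : MemLp Hy 2 muO := memLp_convS hK.pdy mdiff
  have mHz : MemLp Hz 2 muO := memLp_convS hK hθ.memLp'
  have mX := memLp_comp_fst mgx
  have mY := memLp_comp_fst mgy
  have mWx : MemLp (fun P => gx P.1 + Hx P) 2 muO := mX.add mHx
  have mWy : MemLp (fun P => gy P.1 + Hy P) 2 muO := mY.add mHy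
  have mφ := hφ.memLp
  have mφz := hφ.dZ.memLp
  have mφx := hφ.dX.memLp
  have mφy := hφ.dY.memLp
  have mr := memLp_residual H n
  set S := nrm muO (dZ φ) + e * nrm muO (dX φ) + e * nrm muO (dY φ) with hS
  have nX := nrm_nonneg (μ := muO) (dX φ)
  have nY := nrm_nonneg (μ := muO) (dY φ)
  have nZ := nrm_nonneg (μ := muO) (dZ φ)
  have hSz : nrm muO (dZ φ) ≤ S := by
    rw [hS]; linarith [mul_nonneg he.le nX, mul_nonneg he.le nY]
  have hSx : e * nrm muO (dX φ) ≤ S := by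
    rw [hS]; linarith [mul_nonneg he.le nX, mul_nonneg he.le nY]
  have hSy : e * nrm muO (dY φ) ≤ S := by
    rw [hS]; linarith [mul_nonneg he.le nX, mul_nonneg he.le nY]
  have hS0 : nrm muO φ ≤ S := (nrm_le_nrm_dZ hφ h1).trans hSz
  have hSxe : nrm muO (dX φ) ≤ S / e := by rw [le_div_iff₀ he]; linarith
  have hSye : nrm muO (dY φ) ≤ S / e := by rw [le_div_iff₀ he]; linarith
  have hSnn : 0 ≤ S := (nrm_nonneg _).trans hS0
  -- the interior part
  have t1 : IntBound (fun P => (u1 P.1 * (gx P.1 + Hx P) + u2 P.1 * (gy P.1 + Hy P)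
      + P.2 * w P.1 * Hz P) * φ P + lam * (Hz P * dZ φ P))
      (nrm muO (residual u1 u2 w gx gy θ θz n) * S) := by
    constructor
    · have k1 := memLp_bdd_mul (aesm_comp_fst hu.meas1) (ae_comp_fst hu.bdd1) mWx
      have k2 := memLp_bdd_mul (aesm_comp_fst hu.meas2) (ae_comp_fst hu.bdd2) mWy
      have k3 := memLp_snd_mul (memLp_bdd_mul (aesm_comp_fst hu.meas3) (ae_comp_fst hu.bdd3) mHz)
      have k4 := int_mul ((k1.add k2).add k3) mφ
      refine (k4.add ((int_mul mHz mφz).const_mul lam)).congr (.of_forall fun P => ?_)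
      simp only [Pi.add_apply]; ring
    · rw [residual_spec H hφ h1]
      exact (abs_integral_mul_le mr mφ).trans (by gcongr; exact nrm_nonneg _)
  -- the layer terms
  have tl : ∀ {A X : F³} {x : F²} {D : ℝ}, AESM A muO → (∀ᵐ P ∂muO, |A P| ≤ D) →
      (∀ᵐ P ∂muO, |A P| * √(1 - P.2) ≤ η * (m P.1 * (1 - P.2) ^ (-(3 / 4) : ℝ))) →
      MemLp X 2 muO → (∀ᵐ P ∂muO, |X P| ≤ |x P.1|) → MemLp (fun p => m p * x p) 2 muH →
      IntBound (fun P => A P * X P * φ P) (η * layerMass * nrm muH (fun p => m p * x p) * S) :=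
    fun mA hA l mX hX hm => ⟨int_mul (memLp_bdd_mul mA hA mX) mφ, (layer_bound hη l hX hm hφ h1).trans
      (mul_le_left hSz (mul_nonneg (mul_nonneg hη layerMass_nonneg) (nrm_nonneg _)))⟩
  have t2 := tl (x := gx) hB.meas1 hA1 hB.layer₁ mX (.of_forall fun _ => le_rfl) hmx
  have t3 := tl (x := gy) hB.meas2 hA2 hB.layer₂ mY (.of_forall fun _ => le_rfl) hmy
  have hmC : MemLp (fun p => m p * C) 2 muH := hm.mul_const C
  have t4 := tl (x := fun _ => C) hB.meas1 hA1 hB.layer₁ mHx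
    (hC1.mono fun P h => h.trans (le_abs_self _)) hmC
  have t5 := tl (x := fun _ => C) hB.meas2 hA2 hB.layer₂ mHy
    (hC2.mono fun P h => h.trans (le_abs_self _)) hmC
  have t6 : IntBound (fun P => A3 P * Hz P * φ P) (nrm muO (fun P => A3 P * Hz P) * S) :=
    (intBound_mul (memLp_bdd_mul hB.meas3 hA3 mHz) mφ).mono (mul_le_left hS0 (nrm_nonneg _))
  -- the gradient terms
  have t7 : IntBound (fun P => (g1 P.1 * gx P.1 + g2 P.1 * gy P.1) * φ P)
      (M1 * (nrm muH f + (nrm muH g1 + nrm muH g2) / e) * S) := by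
    constructor
    · have k1 := (int_mul (memLp_comp_fst hB.memg1) mX).bdd_mul (c := Cφ) mφ.1 hCφ
      have k2 := (int_mul (memLp_comp_fst hB.memg2) mY).bdd_mul (c := Cφ) mφ.1 hCφ
      refine (k1.add k2).congr (.of_forall fun P => ?_)
      simp only [Pi.add_apply]; ring
    · refine (potential_bound H hB hφ).trans ?_
      rw [mul_assoc]
      refine mul_le_left ?_ hM
      have n1 := mul_le_left hS0 (nrm_nonneg (μ := muH) f)
      have n2 := mul_le_left hSxe (nrm_nonneg (μ := muH) g1)
      have n3 := mul_le_left hSye (nrm_nonneg (μ := muH) g2)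
      calc _ ≤ _ := add_le_add (add_le_add n1 n2) n3
        _ = _ := by ring
  have tg : ∀ {g : F²} {X : F³}, MemLp g 2 muH → MemLp X 2 muO → (∀ᵐ P ∂muO, |X P| ≤ C) →
      IntBound (fun P => g P.1 * (X P * φ P)) (C * nrm muH g * S) := fun {g _} mg mX hX => by
    refine (intBound_mul (memLp_comp_fst mg) (memLp_bdd_mul mX.1 hX mφ)).mono ?_
    rw [nrm_comp_fst mg.1]
    have := mul_le_left ((nrm_bdd_mul_le hC hX mφ).trans
      (mul_le_left hS0 hC)) (nrm_nonneg (μ := muH) g)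
    exact this.trans (le_of_eq (by ring))
  -- the horizontal diffusion
  have td : ∀ {X Y : F³}, MemLp X 2 muO → MemLp Y 2 muO → e * nrm muO Y ≤ S →
      IntBound (fun P => e ^ 2 * lam * (X P * Y P)) (e * lam * nrm muO X * S) :=
    fun {X _} mX mY h => by
      refine ((intBound_mul mX mY).const_mul _).mono ?_
      rw [abs_of_nonneg (by positivity)]
      have n0 := nrm_nonneg (μ := muO) X
      have := mul_le_left h (by positivity : 0 ≤ e * lam * nrm muO X)
      exact (le_of_eq (by ring)).trans this
  have key := (((((((((t1.add t2).add t3).add t4).add t5).add t6).add t7).add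
    (tg hB.memg1 mHx hC1)).add (tg hB.memg2 mHy hC2)).add (td mWx mφx hSx)).add (td mWy mφy hSy)
  refine key.congr (fun P => by ring) ?_
  rw [consistencyBound]
  ring

lemma difference_bound (H : 𝓘) (hB : 𝓑) (he : 0 < e) (hC : 0 ≤ C)
    (hC1 : ∀ᵐ P ∂muO, |Hx P| ≤ C) (hC2 : ∀ᵐ P ∂muO, |Hy P| ≤ C)
    (hS : IsSolution lam e θ1 (fun P => u1 P.1 + A1 P + g1 P.1) (fun P => u2 P.1 + A2 P + g2 P.1)
      (fun P => P.2 * w P.1 + A3 P) T Tx Ty Tz) :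
    nrm muO (fun P => Tz P - Hz P) ≤ 3 * κn / lam := by
  obtain ⟨hu, hlam, m1, mgx, mgy, wx, wy, -, hM, -, -, -, hθ, hθ1, -⟩ := id H
  obtain ⟨hT, mTx, mTy, wTx, wTy, hT1, hTeq⟩ := hS
  have hK := testDl n
  have hev : ∀ r, moll (dl n) (-r) = moll (dl n) r := moll_neg _
  obtain ⟨C1, hA1⟩ := hB.bdd1
  obtain ⟨C2, hA2⟩ := hB.bdd2
  obtain ⟨C3, hA3⟩ := hB.bdd3
  have hη := hB.nonneg
  have m1' := memLp_comp_fst m1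
  have mdiff : MemLp (fun P => θ P - θ1 P.1) 2 muO := hθ.memLp.sub m1'
  have mH := memLp_convS hK mdiff
  have mHx : MemLp Hx 2 muO := memLp_convS hK.pdx mdiff
  have mHy : MemLp Hy 2 muO := memLp_convS hK.pdy mdiff
  have mHz : MemLp Hz 2 muO := memLp_convS hK hθ.memLp'
  have mX := memLp_comp_fst mgx
  have mY := memLp_comp_fst mgy
  have b1 : BddAddLp fun P => u1 P.1 + A1 P + g1 P.1 :=
    bddAddLp_add (A := fun P => u1 P.1 + A1 P) (C := M + C1)
      ((aesm_comp_fst hu.meas1).add hB.meas1) (by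
        filter_upwards [ae_comp_fst hu.bdd1, hA1] with P h1 h2
        exact (abs_add_le _ _).trans (add_le_add h1 h2)) hB.memg1
  have b2 : BddAddLp fun P => u2 P.1 + A2 P + g2 P.1 :=
    bddAddLp_add (A := fun P => u2 P.1 + A2 P) (C := M + C2)
      ((aesm_comp_fst hu.meas2).add hB.meas2) (by
        filter_upwards [ae_comp_fst hu.bdd2, hA2] with P h1 h2
        exact (abs_add_le _ _).trans (add_le_add h1 h2)) hB.memg2
  have b3 : BddAddLp fun P => P.2 * w P.1 + A3 P := bddAddLp_of_bdd (C := M + C3)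
      ((measurable_snd.aestronglyMeasurable.mul (aesm_comp_fst hu.meas3)).add hB.meas3) (by
        filter_upwards [ae_comp_fst hu.bdd3, hA3, abs_snd_le_one] with P h1 h2 h3
        refine (abs_add_le _ _).trans (add_le_add ?_ h2)
        rw [abs_mul]
        exact (mul_le_of_le_one_left (abs_nonneg _) h3).trans h1)
  have hdiv : ∀ Φ, IsTest Φ → (∀ p, Φ (p, 1) = 0) →
      ∫ P, ((u1 P.1 + A1 P + g1 P.1) * dX Φ P + (u2 P.1 + A2 P + g2 P.1) * dY Φ P
        + (P.2 * w P.1 + A3 P) * dZ Φ P) ∂muO = 0 := by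
    intro Φ hΦ h1
    obtain ⟨Dx, -, hDx⟩ := hΦ.dX.ae_bound
    obtain ⟨Dy, -, hDy⟩ := hΦ.dY.ae_bound
    have hb : ∀ {G : F³} {a : F³} {c : ℝ}, IsTest G →
        AESM a muO → (∀ᵐ P ∂muO, |a P| ≤ c) → Integrable (fun P => a P * G P) muO :=
      fun hG ha hM => hG.integrable.bdd_mul ha hM
    have i1 := hb hΦ.dX (aesm_comp_fst hu.meas1) (ae_comp_fst hu.bdd1)
    have i2 := hb hΦ.dY (aesm_comp_fst hu.meas2) (ae_comp_fst hu.bdd2)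
    have i3 := hb (hΦ.dZ.mul_smooth contDiff_snd fun _ _ _ => rfl)
      (aesm_comp_fst hu.meas3) (ae_comp_fst hu.bdd3)
    have j1 := (hb hΦ.dX hB.meas1 hA1).add (int_mul (memLp_comp_fst hB.memg1) hΦ.dX.memLp)
    have j2 := (hb hΦ.dY hB.meas2 hA2).add (int_mul (memLp_comp_fst hB.memg2) hΦ.dY.memLp)
    have j3 := hb hΦ.dZ hB.meas3 hA3
    have k1 : Integrable (fun P => u1 P.1 * dX Φ P + u2 P.1 * dY Φ P + P.2 * w P.1 * dZ Φ P) muO :=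
      ((i1.add i2).add i3).congr (.of_forall fun P => by simp only [Pi.add_apply]; ring)
    have k2 : Integrable (fun P => (A1 P + g1 P.1) * dX Φ P + (A2 P + g2 P.1) * dY Φ P
        + A3 P * dZ Φ P) muO :=
      ((j1.add j2).add j3).congr (.of_forall fun P => by simp only [Pi.add_apply]; ring)
    have h := integral_add k1 k2
    rw [hu.integral_div hΦ h1, hB.div Φ hΦ h1, add_zero] at h
    rw [← h]
    congr 1; funext P; ring
  -- the difference
  set H0 := convS (moll (dl n)) (fun P => θ P - θ1 P.1)
  have s0 : MemLp (fun P => T P - (θ1 P.1 + H0 P)) 2 muO := hT.memLp.sub (m1'.add mH)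
  have sx : MemLp (fun P => Tx P - (gx P.1 + Hx P)) 2 muO := mTx.sub (mX.add mHx)
  have sy : MemLp (fun P => Ty P - (gy P.1 + Hy P)) 2 muO := mTy.sub (mY.add mHy)
  have sz : MemLp (fun P => Tz P - Hz P) 2 muO := hT.memLp'.sub mHz
  have hwx : WeakOX (fun P => T P - (θ1 P.1 + H0 P)) (fun P => Tx P - (gx P.1 + Hx P)) := fun Φ hΦ =>
    integral_sub_add_mul hT.memLp m1' mH mTx mX mHx hΦ.dX.memLp hΦ.memLp (wTx Φ hΦ)
      (wx.comp_fst m1 mgx Φ hΦ) (weakOX_convS hK hev mdiff Φ hΦ)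
  have hwy : WeakOY (fun P => T P - (θ1 P.1 + H0 P)) (fun P => Ty P - (gy P.1 + Hy P)) := fun Φ hΦ =>
    integral_sub_add_mul hT.memLp m1' mH mTy mY mHy hΦ.dY.memLp hΦ.memLp (wTy Φ hΦ)
      (wy.comp_fst m1 mgy Φ hΦ) (weakOY_convS hK hev mdiff Φ hΦ)
  have mzero : MemLp (0 : F³) 2 muO := MemLp.zero'
  have htop : HasTopTrace (fun P => T P - (θ1 P.1 + H0 P)) (fun P => Tz P - Hz P) 0 := by
    have d0 := HasTopTrace.sub hθ.memLp hθ.memLp' m1' mzero m1 m1 hθ1 (hasTopTrace_comp_fst m1)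
    simp only [Pi.zero_apply, sub_zero, sub_self] at d0
    have d1 := hasTopTrace_convS hK hev mdiff hθ.memLp' d0
    have d2 := HasTopTrace.sub hT.memLp hT.memLp' m1' mzero m1 m1 hT1 (hasTopTrace_comp_fst m1)
    simp only [Pi.zero_apply, sub_zero, sub_self] at d2
    have d3 := HasTopTrace.sub (hT.memLp.sub m1') hT.memLp' mH mHz MemLp.zero' MemLp.zero' d2 d1
    simp only [sub_zero, Pi.sub_apply, sub_sub] at d3
    exact d3
  have hκ : 0 ≤ κn := by
    have := layerMass_nonneg
    unfold consistencyBound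
    have hn : ∀ {X : Type} [MeasurableSpace X] (μ : Measure X) (f : X → ℝ), 0 ≤ nrm μ f :=
      fun μ f => nrm_nonneg f
    have n1 := hn muH f; have n2 := hn muH g1; have n3 := hn muH g2
    have n4 := hn muO (residual u1 u2 w gx gy θ θz n)
    have n5 := hn muO fun P => A3 P * Hz P
    have n6 := hn muO fun P => gx P.1 + Hx P
    have n7 := hn muO fun P => gy P.1 + Hy P
    have n8 := hn muH fun p => m p * gx p
    have n9 := hn muH fun p => m p * gy p
    have n10 := hn muH fun p => m p * C
    positivity
  refine energy_bound b1 b2 b3 hdiv s0 sx sy sz hwx hwy htop hlam he hκ fun Φ hΦ h1 => ?_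
  have hc := consistency H hB he hC hC1 hC2 hΦ h1
  obtain ⟨D, -, hD⟩ := hΦ.ae_bound
  have hTi : Integrable (fun P => ((u1 P.1 + A1 P + g1 P.1) * Tx P + (u2 P.1 + A2 P + g2 P.1) * Ty P
        + (P.2 * w P.1 + A3 P) * Tz P) * Φ P
        + e ^ 2 * lam * (Tx P * dX Φ P + Ty P * dY Φ P) + lam * (Tz P * dZ Φ P)) muO := by
    have k := (((b1.integrable mTx hΦ.memLp hD).add (b2.integrable mTy hΦ.memLp hD)).add
      (b3.integrable hT.memLp' hΦ.memLp hD)).add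
      ((((int_mul mTx hΦ.dX.memLp).add (int_mul mTy hΦ.dY.memLp)).const_mul (e ^ 2 * lam)).add
        ((int_mul hT.memLp' hΦ.dZ.memLp).const_mul lam))
    refine k.congr (.of_forall fun P => ?_)
    simp only [Pi.add_apply]; ring
  have hsub := integral_sub hTi hc.1
  rw [hTeq Φ hΦ h1, zero_sub] at hsub
  have hneg : ∫ P, (((u1 P.1 + A1 P + g1 P.1) * (Tx P - (gx P.1 + Hx P))
      + (u2 P.1 + A2 P + g2 P.1) * (Ty P - (gy P.1 + Hy P))
      + (P.2 * w P.1 + A3 P) * (Tz P - Hz P)) * Φ P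
      + e ^ 2 * lam * ((Tx P - (gx P.1 + Hx P)) * dX Φ P + (Ty P - (gy P.1 + Hy P)) * dY Φ P)
      + lam * ((Tz P - Hz P) * dZ Φ P)) ∂muO = _ := Eq.trans (by congr 1; funext P; ring) hsub
  rw [hneg, abs_neg]
  exact hc.2

end Comparison

/-! ## The limit of the vertical derivatives -/

section Limit

lemma tendsto_nrm_convS_sub {f : F³} (hf : MemLp f 2 muO) :
    Tendsto (fun n => nrm muO (fun P => convS (moll (dl n)) f P - f P)) atTop (𝓝 0) := by
  refine tendsto_nrm_zero ?_
  have hm : ∀ n, AESM (fun P => convS (moll (dl n)) f P - f P) muO := fun n =>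
    (memLp_convS (testDl n) hf).1.sub hf.1
  rw [muO_eq] at hf hm ⊢
  refine tendsto_eLpNorm_two_slices (T := fun n h p => mol n h p - h p) (A := 2) (by norm_num)
    (fun n h hh => ?_) (fun h hh => tendsto_mol_sub hh) hf hm
  refine (eLpNorm_sub_le (memLp_conv (testDl n) hh).1 hh.1 (by norm_num)).trans ?_
  rw [two_mul]
  gcongr
  exact eLpNorm_mol_le n hh.1

lemma exists_convS_bound {k : F²} (hk : IsTestH k) {f g : F³}
    (hf : MemLp f 2 muO) (hg : MemLp g 2 muO) (h : HasTopTrace f g 0) :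
    ∃ C : ℝ, 0 ≤ C ∧ ∀ᵐ P ∂muO, |convS k f P| ≤ C := by
  obtain ⟨A, hA, hb⟩ := hk.exists_conv_sup_bound
  refine ⟨A * nrm muO g, mul_nonneg hA (nrm_nonneg _), ae_of_slices ?_⟩
  filter_upwards [memLp_slice hf, ae_slice_le hf hg h] with z h1 h2 q
  exact (hb _ h1 q).trans (mul_le_left (ENNReal.toReal_mono hg.2.ne h2) hA)

variable {u1 u2 w θ1 gx gy m : F²} {M L lam M1 D : ℝ} {η : ℝ → ℝ}
  {f g1 g2 : ℝ → F²} {θ θz : F³} {A1 A2 A3 T Tx Ty Tz : ℝ → F³}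

lemma tendsto_difference (H : IsInterior lam M L M1 u1 u2 w θ1 gx gy m θ θz)
    (hB : ∀ e : ℝ, 0 < e → IsBoundaryField (η e) (f e) (g1 e) (g2 e) m (A1 e) (A2 e) (A3 e))
    (hη : Tendsto η (𝓝[>] 0) (𝓝 0))
    (hf : Tendsto (fun e => nrm muH (f e)) (𝓝[>] 0) (𝓝 0))
    (hg : Tendsto (fun e => (nrm muH (g1 e) + nrm muH (g2 e)) / e) (𝓝[>] 0) (𝓝 0))
    (hD : ∀ e : ℝ, 0 < e → ∀ᵐ P ∂muO, |A3 e P| ≤ D)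
    (hA : ∀ᵐ P ∂muO, Tendsto (fun e => A3 e P) (𝓝[>] 0) (𝓝 0))
    (hS : ∀ e : ℝ, 0 < e → IsSolution lam e θ1 (fun P => u1 P.1 + A1 e P + g1 e P.1)
      (fun P => u2 P.1 + A2 e P + g2 e P.1) (fun P => P.2 * w P.1 + A3 e P) (T e) (Tx e) (Ty e) (Tz e)) :
    Tendsto (fun e => nrm muO (fun P => Tz e P - θz P)) (𝓝[>] 0) (𝓝 0) := by
  have hpos : ∀ᶠ e : ℝ in 𝓝[>] 0, 0 < e := eventually_mem_nhdsWithin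
  have he0 : Tendsto (fun e : ℝ => e) (𝓝[>] 0) (𝓝 0) := tendsto_id.mono_left nhdsWithin_le_nhds
  have hθ := H.weak
  have m1 := H.mem
  have m1' := memLp_comp_fst m1
  have mdiff : MemLp (fun P => θ P - θ1 P.1) 2 muO := hθ.memLp.sub m1'
  have d0 := HasTopTrace.sub hθ.memLp hθ.memLp' m1' MemLp.zero' m1 m1 H.top (hasTopTrace_comp_fst m1)
  simp only [sub_zero, sub_self] at d0
  have hr := tendsto_residual H
  have hc := tendsto_nrm_convS_sub hθ.memLp'
  have hsum := (hr.const_mul (3 / lam)).add hc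
  rw [mul_zero, add_zero] at hsum
  rw [Metric.tendsto_nhds]
  intro δ hδ
  obtain ⟨n, hn⟩ := (hsum.eventually (gt_mem_nhds (half_pos hδ))).exists
  set K := moll (dl n)
  have hK : IsTestH K := testDl n
  obtain ⟨C1, hC₁0, hC1⟩ := exists_convS_bound hK.pdx mdiff hθ.memLp' d0
  obtain ⟨C2, hC₂0, hC2⟩ := exists_convS_bound hK.pdy mdiff hθ.memLp' d0
  set C := max C1 C2 with hCdef
  have hC0 : 0 ≤ C := hC₁0.trans (le_max_left _ _)
  have hC₁' := hC1.mono fun P h => h.trans (le_max_left C1 C2)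
  have hC₂' := hC2.mono fun P h => h.trans (le_max_right C1 C2)
  have mHz : MemLp (convS K θz) 2 muO := memLp_convS hK hθ.memLp'
  have hA3 : Tendsto (fun e => nrm muO (fun P => A3 e P * convS K θz P)) (𝓝[>] 0) (𝓝 0) := by
    refine tendsto_nrm_zero_of_dominated (mHz.const_mul D) ?_ ?_ ?_
    · filter_upwards [hpos] with e he using (hB e he).meas3.mul mHz.1
    · filter_upwards [hpos] with e he
      filter_upwards [hD e he] with P hP
      rw [abs_mul, abs_mul]
      exact mul_le_right (hP.trans (le_abs_self _)) (abs_nonneg _)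
    · filter_upwards [hA] with P hP
      have := hP.mul_const (convS K θz P)
      rwa [zero_mul] at this
  have hg' : Tendsto (fun e => nrm muH (g1 e) + nrm muH (g2 e)) (𝓝[>] 0) (𝓝 0) := by
    have := hg.mul he0
    rw [mul_zero] at this
    refine this.congr' ?_
    filter_upwards [hpos] with e he using div_mul_cancel₀ _ he.ne'
  have hκ : Tendsto (fun e => consistencyBound u1 u2 w θ1 gx gy (f e) (g1 e) (g2 e) m lam (η e) e M1 C
      θ θz (A3 e) n) (𝓝[>] 0) (𝓝 (nrm muO (residual u1 u2 w gx gy θ θz n))) := by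
    unfold consistencyBound
    have h1 := (he0.mul_const lam).mul_const
      (nrm muO (fun P => gx P.1 + convS (pdx K) (fun P => θ P - θ1 P.1) P)
      + nrm muO (fun P => gy P.1 + convS (pdy K) (fun P => θ P - θ1 P.1) P))
    have h2 := (hη.mul_const layerMass).mul_const (nrm muH (fun p => m p * gx p)
      + nrm muH (fun p => m p * gy p) + 2 * nrm muH (fun p => m p * C))
    have h3 := hg'.const_mul C
    have h4 := (hf.add hg).const_mul M1
    have := (((((tendsto_const_nhds (x := nrm muO (residual u1 u2 w gx gy θ θz n))).add hA3).add
      h1).add h2).add h3).add h4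
    simpa only [zero_mul, mul_zero, add_zero] using this
  have hlim := (hκ.const_mul (3 / lam)).add_const (nrm muO (fun P => convS K θz P - θz P))
  have hlt := hlim.eventually (gt_mem_nhds (hn.trans (half_lt_self hδ)))
  filter_upwards [hlt, hpos] with e h1 he
  have h2 := difference_bound H (hB e he) he hC0 hC₁' hC₂' (hS e he)
  have h3 := nrm_add_le ((hS e he).weak.memLp'.sub mHz) (mHz.sub hθ.memLp')
  have e1 : (fun P => (Tz e - convS K θz) P + (convS K θz - θz) P) =
      fun P => Tz e P - θz P := by funext P; simp
  rw [e1] at h3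
  rw [dist_eq, sub_zero, abs_of_nonneg (nrm_nonneg _)]
  calc _ ≤ _ := h3
    _ ≤ 3 * consistencyBound u1 u2 w θ1 gx gy (f e) (g1 e) (g2 e) m lam (η e) e M1 C θ θz (A3 e) n / lam
        + nrm muO (fun P => convS K θz P - θz P) := add_le_add h2 le_rfl
    _ < δ := by
        refine lt_of_le_of_lt (le_of_eq ?_) h1
        ring

end Limit

/-! ## Bounds for functions in `H²` -/

section Sobolev

lemma abs_le_integral_unit {h h' : ℝ → ℝ} (hd : ∀ t, HasDerivAt h (h' t) t) (hc : Continuous h')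
    {a t : ℝ} (ht : t ∈ Icc a (a + 1)) : |h t| ≤ ∫ s in a..(a + 1), (|h s| + |h' s|) := by
  have ch : Continuous h := continuous_iff_continuousAt.2 fun t => (hd t).continuousAt
  have ia : ∀ u v, IntervalIntegrable (fun s => |h' s|) volume u v := fun u v =>
    hc.abs.intervalIntegrable u v
  have key : ∀ s ∈ Icc a (a + 1), |h t| ≤ |h s| + ∫ r in a..(a + 1), |h' r| := by
    intro s hs
    have e : h t - h s = ∫ r in s..t, h' r :=
      (intervalIntegral.integral_eq_sub_of_hasDerivAt (fun r _ => hd r)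
        (hc.intervalIntegrable s t)).symm
    have b : |h t - h s| ≤ ∫ r in a..(a + 1), |h' r| := by
      rw [e]
      have h1 := intervalIntegral.norm_integral_le_integral_norm_uIoc (f := h') (a := s) (b := t)
        (μ := volume)
      refine h1.trans ?_
      rw [intervalIntegral.integral_of_le (by linarith)]
      refine setIntegral_mono_set ((ia a (a + 1)).1) (ae_of_all _ fun _ => abs_nonneg _) ?_
      exact (show uIoc s t ⊆ Ioc a (a + 1) from
        Ioc_subset_Ioc (le_min hs.1 ht.1) (max_le hs.2 ht.2)).eventuallyLE
    have := abs_sub_abs_le_abs_sub (h t) (h s)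
    linarith
  have := intervalIntegral.integral_mono_on (μ := volume) (a := a) (b := a + 1) (by linarith)
    (f := fun _ => |h t|) (g := fun s => |h s| + ∫ r in a..(a + 1), |h' r|) (by simp)
    ((ch.abs.add continuous_const).intervalIntegrable _ _) key
  rw [intervalIntegral.integral_add (ch.abs.intervalIntegrable _ _) (by simp)] at this
  rw [intervalIntegral.integral_add (ch.abs.intervalIntegrable _ _) (ia _ _)]
  simpa using this

lemma integral_strip_le {G : F²} (hG : Continuous G) (m : MemLp G 2 muH) (y : ℝ) :
    ∫ s in (0:ℝ)..1, ∫ t in y..(y + 1), |G (s, t)| ≤ nrm muH G := by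
  set S : Set (ℝ²) := Ioc (0:ℝ) 1 ×ˢ Ioc y (y + 1)
  have hS : MeasurableSet S := measurableSet_Ioc.prod measurableSet_Ioc
  have e : ∫ s in (0:ℝ)..1, ∫ t in y..(y + 1), |G (s, t)| = ∫ p in S, |G p| := by
    have hi : IntegrableOn (fun p => |G p|) S (volume.prod volume) :=
      (hG.abs.continuousOn.integrableOn_compact (isCompact_Icc.prod isCompact_Icc)).mono_set
        (Set.prod_mono Ioc_subset_Icc_self Ioc_subset_Icc_self)
    rw [intervalIntegral.integral_of_le zero_le_one]
    rw [show (volume : Measure (ℝ²)) = volume.prod volume from rfl, setIntegral_prod _ hi]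
    simp only [intervalIntegral.integral_of_le (show y ≤ y + 1 by linarith)]
  set T : Set (ℝ²) := univ ×ˢ Ioc y (y + 1)
  have hT : MeasurableSet T := MeasurableSet.univ.prod measurableSet_Ioc
  have mT : muH T = 1 := by
    rw [muH_eq, Measure.prod_prod]; simp
  have e2 : ∫ p in S, |G p| = ∫ p, T.indicator 1 p * |G p| ∂muH := by
    have : ∀ p, T.indicator (1 : F²) p * |G p| = T.indicator (fun p => |G p|) p := by
      intro p; by_cases hp : p ∈ T <;> simp [hp]
    simp only [this]
    rw [integral_indicator hT, muH, Measure.restrict_restrict hT]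
    refine setIntegral_congr_set ?_
    have : T ∩ cellH = Ioo (0:ℝ) 1 ×ˢ Ioc y (y + 1) := by
      ext p; simp [T, cellH]; tauto
    rw [this]
    exact (Measure.set_prod_ae_eq Ioo_ae_eq_Ioc (ae_eq_refl _)).symm
  have mi : MemLp (T.indicator (1 : F²)) 2 muH :=
    memLp_indicator_const 2 hT 1 (Or.inr (by simp [mT]))
  have n1 : nrm muH (T.indicator (1 : F²)) = 1 := by
    have : T.indicator (1 : F²) = T.indicator (fun _ => (1:ℝ)) := rfl
    rw [nrm, this, eLpNorm_indicator_const hT (by simp) (by simp), mT]; simp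
  have := abs_integral_mul_le mi m.norm
  rw [e, e2]
  refine (le_abs_self _).trans (this.trans ?_)
  rw [n1, one_mul]
  exact (nrm_mono m (ae_of_all _ fun p => by simp))

/-- A continuous Sobolev inequality on unit squares. -/
lemma abs_le_nrm_sum {F : F²} (hF : ContDiff ℝ ∞ F) (m : MemLp F 2 muH)
    (mx : MemLp (pdx F) 2 muH) (my : MemLp (pdy F) 2 muH) (mxy : MemLp (pdy (pdx F)) 2 muH)
    {p : ℝ²} (hp : p ∈ cellH) :
    |F p| ≤ nrm muH F + nrm muH (pdy F) + (nrm muH (pdx F) + nrm muH (pdy (pdx F))) := by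
  have cx : ContDiff ℝ ∞ (pdx F) := contDiff_pdx hF (by simp)
  have cy : ContDiff ℝ ∞ (pdy F) := contDiff_pdy hF (by simp)
  have cxy : ContDiff ℝ ∞ (pdy (pdx F)) := contDiff_pdy cx (by simp)
  have dF := hF.differentiable (by simp)
  have dx := cx.differentiable (by simp)
  have h1 := abs_le_integral_unit (h := fun t => F (t, p.2)) (a := 0) (t := p.1)
    (fun t => hasDerivAt_pdx dF (t, p.2)) (cx.continuous.comp (by fun_prop))
    ⟨hp.1.1.le, by simpa using hp.1.2.le⟩
  have hy : p.2 ∈ Icc p.2 (p.2 + 1) := ⟨le_rfl, by linarith⟩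
  have h2 := fun s : ℝ => abs_le_integral_unit (h := fun t => F (s, t))
    (fun t => hasDerivAt_pdy dF (s, t)) (cy.continuous.comp (by fun_prop)) hy
  have h3 := fun s : ℝ => abs_le_integral_unit (h := fun t => pdx F (s, t))
    (fun t => hasDerivAt_pdy dx (s, t)) (cxy.continuous.comp (by fun_prop)) hy
  have ci : ∀ {G : F²}, Continuous G →
      Continuous fun s : ℝ => ∫ t in p.2..(p.2 + 1), |G (s, t)| := fun {G} hG =>
    intervalIntegral.continuous_parametric_intervalIntegral_of_continuous'
      (f := fun s t => |G (s, t)|) (by fun_prop) _ _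
  have ii : ∀ {G : F²}, Continuous G → ∀ s : ℝ,
      IntervalIntegrable (fun t => |G (s, t)|) volume p.2 (p.2 + 1) := fun {G} hG s =>
    Continuous.intervalIntegrable (by fun_prop) _ _
  simp only [intervalIntegral.integral_add (ii hF.continuous _) (ii cy.continuous _)] at h2
  simp only [intervalIntegral.integral_add (ii cx.continuous _) (ii cxy.continuous _)] at h3
  rw [zero_add] at h1
  have h4 : |F p| ≤ ∫ s in (0:ℝ)..1,
      (((∫ t in p.2..(p.2 + 1), |F (s, t)|) + ∫ t in p.2..(p.2 + 1), |pdy F (s, t)|) +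
      ((∫ t in p.2..(p.2 + 1), |pdx F (s, t)|) + ∫ t in p.2..(p.2 + 1), |pdy (pdx F) (s, t)|)) := by
    refine h1.trans (intervalIntegral.integral_mono_on zero_le_one ?_ ?_ fun s _ =>
      add_le_add (h2 s) (h3 s))
    · have c1 := hF.continuous
      have c2 := cx.continuous
      exact Continuous.intervalIntegrable (by fun_prop) _ _
    · exact Continuous.intervalIntegrable (((ci hF.continuous).add (ci cy.continuous)).add
        ((ci cx.continuous).add (ci cxy.continuous))) _ _
  have iv : ∀ {G : F²}, Continuous G →
      IntervalIntegrable (fun s : ℝ => ∫ t in p.2..(p.2 + 1), |G (s, t)|) volume 0 1 :=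
    fun hG => (ci hG).intervalIntegrable _ _
  rw [intervalIntegral.integral_add ((iv hF.continuous).add (iv cy.continuous))
      ((iv cx.continuous).add (iv cxy.continuous)),
    intervalIntegral.integral_add (iv hF.continuous) (iv cy.continuous),
    intervalIntegral.integral_add (iv cx.continuous) (iv cxy.continuous)] at h4
  have a1 := integral_strip_le hF.continuous m p.2
  have a2 := integral_strip_le cy.continuous my p.2
  have a3 := integral_strip_le cx.continuous mx p.2
  have a4 := integral_strip_le cxy.continuous mxy p.2
  linarith

lemma MemH.memLp {n : ℕ} {f : F²} (h : MemH n f) : MemLp f 2 muH := by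
  cases n with
  | zero => exact h
  | succ n => exact h.1

lemma MemH.of_succ {n : ℕ} {f : F²} (h : MemH (n + 1) f) : MemH n f := by
  induction n generalizing f with
  | zero => exact h.1
  | succ n ih =>
    obtain ⟨m, gx, gy, wx, wy, hx, hy⟩ := h
    exact ⟨m, gx, gy, wx, wy, ih hx, ih hy⟩

lemma MemH.mono {n m : ℕ} {f : F²} (h : MemH n f) (hm : m ≤ n) : MemH m f := by
  induction n, hm using Nat.le_induction with
  | base => exact h
  | succ n _ ih => exact ih h.of_succ

lemma MemH.exists_ae_bound {f : F²} (h : MemH 2 f) : ∃ C, 0 ≤ C ∧ ∀ᵐ p ∂muH, |f p| ≤ C := by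
  obtain ⟨m, gx, gy, wx, wy, ⟨mx, -, gxy, -, wxy, -, mxy⟩, ⟨my, -⟩⟩ := h
  have ex : ∀ n, pdx (mol n f) = mol n gx := fun n => by
    rw [mol, mol, ← conv_pdx (testDl n) wx.eq]
    exact funext fun p => pdx_conv (testDl n) (locInt_muH m) p
  have ey : ∀ n, pdy (mol n f) = mol n gy := fun n => by
    rw [mol, mol, ← conv_pdy (testDl n) wy.eq]
    exact funext fun p => pdy_conv (testDl n) (locInt_muH m) p
  have exy : ∀ n, pdy (mol n gx) = mol n gxy := fun n => by
    rw [mol, mol, ← conv_pdy (testDl n) wxy.eq]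
    exact funext fun p => pdy_conv (testDl n) (locInt_muH mx) p
  have mm : ∀ {g}, MemLp g 2 muH → ∀ n, MemLp (mol n g) 2 muH := fun hg n =>
    memLp_conv (testDl n) hg
  have nn : ∀ {g}, MemLp g 2 muH → ∀ n, nrm muH (mol n g) ≤ nrm muH g := fun hg n =>
    ENNReal.toReal_mono hg.2.ne (eLpNorm_mol_le n hg.1)
  set C := nrm muH f + nrm muH gy + (nrm muH gx + nrm muH gxy)
  have hb : ∀ n, ∀ p ∈ cellH, |mol n f p| ≤ C := by
    intro n p hp
    have := abs_le_nrm_sum (contDiff_conv (testDl n) (locInt_muH m)) (mm m n)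
      (by rw [← mol, ex]; exact mm mx n) (by rw [← mol, ey]; exact mm my n)
      (by rw [← mol, ex, exy]; exact mm mxy n) hp
    rw [← mol, ex, ey, exy] at this
    linarith [nn m n, nn mx n, nn my n, nn mxy n]
  refine ⟨C, add_nonneg (add_nonneg (nrm_nonneg _) (nrm_nonneg _))
    (add_nonneg (nrm_nonneg _) (nrm_nonneg _)), ?_⟩
  refine ae_of_forall_abs_le fun R => ?_
  obtain ⟨ns, hns⟩ := exists_seq_mol_tendsto_ae (locInt_muH m) R
  filter_upwards [hns, ae_muH_mem] with p hp hc hR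
  exact le_of_tendsto (hp hR).abs (.of_forall fun i => hb _ p hc)

lemma forall_abs_le_of_ae {f : F²} (hf : Continuous f)
    (hp : ∀ x y, f (x + 1, y) = f (x, y)) {C : ℝ} (h : ∀ᵐ p ∂muH, |f p| ≤ C) (p : ℝ²) :
    |f p| ≤ C := by
  have hcl : IsClosed {p | |f p| ≤ C} := isClosed_le hf.abs continuous_const
  have h1 : cellH ⊆ {p | |f p| ≤ C} := by
    have ho : IsOpen (cellH ∩ {p | |f p| ≤ C}ᶜ) :=
      (isOpen_Ioo.prod isOpen_univ).inter hcl.isOpen_compl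
    have h0 : volume (cellH ∩ {p | |f p| ≤ C}ᶜ) = 0 := by
      rw [muH, ae_restrict_iff' measurableSet_cellH, ae_iff] at h
      refine measure_mono_null (fun p hp => ?_) h
      simpa using hp
    rw [ho.measure_eq_zero_iff volume] at h0
    exact fun p hp => by_contra fun hn => (h0 ▸ (⟨hp, hn⟩ : p ∈ cellH ∩ {p | |f p| ≤ C}ᶜ) : p ∈ (∅ : Set _))
  have h2 : closure cellH ⊆ {p | |f p| ≤ C} := closure_minimal h1 hcl
  have h3 : closure cellH = Icc (0:ℝ) 1 ×ˢ univ := by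
    rw [cellH, closure_prod_eq, closure_Ioo (by norm_num), closure_univ]
  have h4 := periodic_add_int hp (Int.fract p.1) p.2 ⌊p.1⌋
  rw [Int.fract_add_floor] at h4
  have h5 : ((Int.fract p.1, p.2) : ℝ²) ∈ closure cellH := by
    rw [h3]; exact ⟨⟨Int.fract_nonneg _, (Int.fract_lt_one _).le⟩, trivial⟩
  rw [show p = (p.1, p.2) from rfl, h4]
  exact h2 h5

lemma exists_bound_pow {a : F²} {C C' : ℝ} {k : ℕ} (h : ∀ p, |a p| ≤ C)
    (h' : ∀ p : ℝ², |a p| ≤ C' * |p.2| ^ k) {j : ℕ} (hj : j ≤ k) (p : ℝ²) :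
    |a p| ≤ (|C| + |C'|) * |p.2| ^ j := by
  rcases le_total |p.2| 1 with h1 | h1
  · calc |a p| ≤ C' * |p.2| ^ k := h' p
      _ ≤ |C'| * |p.2| ^ j := mul_le_mul (le_abs_self _)
        (pow_le_pow_of_le_one (abs_nonneg _) h1 hj) (by positivity) (abs_nonneg _)
      _ ≤ _ := by gcongr; linarith [abs_nonneg C]
  · calc |a p| ≤ |C| * 1 := by linarith [h p, le_abs_self C]
      _ ≤ (|C| + |C'|) * |p.2| ^ j :=
        mul_le_mul (by linarith [abs_nonneg C']) (one_le_pow₀ h1) zero_le_one (by positivity)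

lemma memLp_div_pow {a : F²} (m : MemLp a 2 muH) {C : ℝ} {j : ℕ}
    (h : ∀ p : ℝ², |a p| ≤ C * |p.2| ^ j) : MemLp (fun p : ℝ² => a p / p.2 ^ j) 2 muH := by
  set T : Set (ℝ²) := {p | |p.2 - 0| ≤ 1}
  have hT : MeasurableSet T := measurableSet_le (by fun_prop) (by fun_prop)
  have mi : MemLp (T.indicator fun _ => |C|) 2 muH :=
    memLp_indicator_const 2 hT _ (Or.inr (by rw [muH_strip]; simp))
  have hme : AESM (fun p : ℝ² => a p / p.2 ^ j) muH := by
    simp only [div_eq_mul_inv]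
    exact m.1.mul (Measurable.aestronglyMeasurable (by fun_prop))
  refine (mi.add m.norm).mono hme (ae_of_all _ fun p => ?_)
  have i0 : 0 ≤ T.indicator (fun _ => |C|) p := indicator_nonneg (fun _ _ => abs_nonneg _) p
  rw [Pi.add_apply, norm_of_nonneg (add_nonneg i0 (norm_nonneg _))]
  simp only [norm_div, norm_pow, norm_eq_abs]
  by_cases hp : |p.2| ≤ 1
  · have : p ∈ T := by simpa [T] using hp
    rw [indicator_of_mem this]
    have : |a p| / |p.2| ^ j ≤ |C| := by
      rcases eq_or_lt_of_le (show 0 ≤ |p.2| ^ j by positivity) with h0 | h0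
      · rw [← h0]; simp
      · rw [div_le_iff₀ h0]; exact (h p).trans (by gcongr; exact le_abs_self _)
    linarith [abs_nonneg (a p)]
  · have : |a p| / |p.2| ^ j ≤ |a p| := div_le_self (abs_nonneg _) (one_le_pow₀ (not_le.1 hp).le)
    linarith

end Sobolev

section Wind

variable {k s : ℕ} {σ1 σ2 : F²}

lemma weakX_pdx {f : F²} (hf : ContDiff ℝ 1 f) (hp : ∀ x y, f (x + 1, y) = f (x, y)) :
    WeakX f (pdx f) := fun _ hφ => integral_mul_pdx hf hp hφ

lemma weakY_pdy {f : F²} (hf : ContDiff ℝ 1 f) : WeakY f (pdy f) :=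
  fun _ hφ => integral_mul_pdy hf hφ

/-- Pointwise and integral bounds for a component of the wind stress. -/
structure IsFlat (N : ℕ) (C : ℝ) (a : F²) : Prop where
  memLp : MemLp a 2 muH
  bound : ∀ (p : ℝ²) (j : ℕ), j ≤ N → |a p| ≤ C * |p.2| ^ j

lemma exists_isFlat {a : F²} (ha : ContDiff ℝ 2 a) (hp : ∀ x y, a (x + 1, y) = a (x, y))
    (hm : MemH 3 a) {C : ℝ} (h0 : ∀ p : ℝ², |a p| ≤ C * |p.2| ^ k)
    (hx : ∀ p : ℝ², |pdx a p| ≤ C * |p.2| ^ (k - 1))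
    (hy : ∀ p : ℝ², |pdy a p| ≤ C * |p.2| ^ (k - 1)) :
    ∃ K, 0 ≤ K ∧ IsFlat (k - 1) K a ∧ IsFlat (k - 1) K (pdx a) ∧ IsFlat (k - 1) K (pdy a) := by
  obtain ⟨m, gx, gy, wx, wy, mx, my⟩ := id hm
  have c1 : ContDiff ℝ 1 a := ha.of_le (by norm_num)
  have cx : Continuous (pdx a) := (contDiff_pdx (m := 1) ha (by norm_num)).continuous
  have cy : Continuous (pdy a) := (contDiff_pdy (m := 1) ha (by norm_num)).continuous
  have ex : gx =ᵐ[muH] pdx a := WeakX.ae_unique (locInt_muH mx.memLp)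
    cx.locallyIntegrable wx.eq (weakX_pdx c1 hp)
  have ey : gy =ᵐ[muH] pdy a := WeakY.ae_unique (locInt_muH my.memLp)
    cy.locallyIntegrable wy.eq (weakY_pdy c1)
  obtain ⟨C0, -, b0⟩ := (hm.mono (show 2 ≤ 3 by norm_num)).exists_ae_bound
  obtain ⟨C1, -, b1⟩ := mx.exists_ae_bound
  obtain ⟨C2, -, b2⟩ := my.exists_ae_bound
  have B0 := forall_abs_le_of_ae ha.continuous hp b0
  have B1 := forall_abs_le_of_ae cx (pdx_periodic hp) (C := C1)
    (by filter_upwards [b1, ex] with p h e; rwa [← e])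
  have B2 := forall_abs_le_of_ae cy (pdy_periodic hp) (C := C2)
    (by filter_upwards [b2, ey] with p h e; rwa [← e])
  refine ⟨|C0| + |C1| + |C2| + |C|, by positivity, ⟨m, fun p j hj => ?_⟩,
    ⟨(memLp_congr_ae ex).1 mx.memLp, fun p j hj => ?_⟩,
    ⟨(memLp_congr_ae ey).1 my.memLp, fun p j hj => ?_⟩⟩
  · refine (exists_bound_pow B0 h0 (hj.trans (Nat.sub_le _ _)) p).trans ?_
    gcongr; linarith [abs_nonneg C1, abs_nonneg C2]
  · refine (exists_bound_pow B1 hx hj p).trans ?_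
    gcongr; linarith [abs_nonneg C0, abs_nonneg C2]
  · refine (exists_bound_pow B2 hy hj p).trans ?_
    gcongr; linarith [abs_nonneg C1, abs_nonneg C0]

end Wind

/-! ## Weak derivatives of functions that are smooth on slices -/

section SliceWise

lemma weakX_of_hasDerivAt {f f' : F²} (hf : Continuous f) (hf' : Continuous f')
    (h : ∀ x y, HasDerivAt (fun t => f (t, y)) (f' (x, y)) x)
    (hp : ∀ x y, f (x + 1, y) = f (x, y)) : WeakX f f' := fun φ hφ => by
  have hi1 := hφ.pdx.integrable_mul (f := f) hf.locallyIntegrable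
  have hi2 := hφ.integrable_mul (f := f') hf'.locallyIntegrable
  rw [eq_neg_iff_add_eq_zero, ← integral_add hi1 hi2]
  have hi : Integrable (fun p => f p * pdx φ p + f' p * φ p) muH := hi1.add hi2
  have c1 := hφ.smooth.continuous
  have c2 := hφ.pdx.smooth.continuous
  rw [muH_eq] at hi ⊢
  rw [integral_prod_symm _ hi]
  refine integral_eq_zero_of_ae (.of_forall fun y => ?_)
  have e := intervalIntegral.integral_eq_sub_of_hasDerivAt (a := 0) (b := 1)
    (f := fun x => f (x, y) * φ (x, y)) (f' := fun x => f' (x, y) * φ (x, y) + f (x, y) * pdx φ (x, y))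
    (fun x _ => (h x y).mul (hasDerivAt_pdx hφ.diff (x, y)))
    (Continuous.intervalIntegrable (by fun_prop) _ _)
  rw [intervalIntegral.integral_of_le zero_le_one, ← integral_Ioc_eq_integral_Ioo.symm] at e
  have h1 := hp 0 y
  have h2 := hφ.periodic 0 y
  simp only [zero_add] at h1 h2
  rw [h1, h2, sub_self] at e
  simpa [nu, add_comm] using e

/-- Local Lipschitz continuity in `y`, uniformly in `x`. -/
def LipY (f : F²) : Prop :=
  ∀ R : ℝ, ∃ K : NNReal, ∀ x ∈ Icc (0:ℝ) 1, LipschitzOnWith K (fun y => f (x, y)) (Icc (-R) R)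

lemma LipY.exists_pdy_bound {f : F²} (hL : LipY f) (R : ℝ) :
    ∃ K : ℝ, 0 ≤ K ∧ ∀ x ∈ Icc (0:ℝ) 1, ∀ y, |y| ≤ R → |pdy f (x, y)| ≤ K := by
  obtain ⟨K, hK⟩ := hL (R + 1)
  refine ⟨K, K.2, fun x hx y hy => ?_⟩
  have := abs_le.1 hy
  exact norm_deriv_le_of_lipschitzOn (Icc_mem_nhds (by linarith) (by linarith)) (hK x hx)

lemma locallyIntegrable_of_bdd_on_strips {f : F²} (hm : AESM f muH)
    (h : ∀ R : ℝ, ∃ K : ℝ, ∀ᵐ p ∂muH, |p.2| ≤ R → |f p| ≤ K) : LocallyIntegrable f muH := fun p => by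
  obtain ⟨K, hK⟩ := h (|p.2| + 1)
  have hT : MeasurableSet {q : ℝ² | |q.2 - 0| ≤ |p.2| + 1} :=
    measurableSet_le (by fun_prop) (by fun_prop)
  refine ⟨{q | |q.2 - 0| ≤ |p.2| + 1}, ?_, ?_⟩
  · refine mem_of_superset ((isOpen_lt (by fun_prop) (by fun_prop) :
      IsOpen {q : ℝ² | |q.2| < |p.2| + 1}).mem_nhds (by simp)) fun q hq => ?_
    simpa using (le_of_lt hq)
  · refine Measure.integrableOn_of_bounded (M := K) (by
      rw [muH_strip]; exact ENNReal.ofReal_ne_top) hm ?_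
    rw [ae_restrict_iff' hT]
    filter_upwards [hK] with q hq h'
    exact hq (by simpa using h')

lemma LipY.locallyIntegrable_pdy {f : F²} (hf : Continuous f) (hL : LipY f) :
    LocallyIntegrable (pdy f) muH := by
  have hm : Measurable (pdy f) := measurable_deriv_with_param (f := fun x y => f (x, y)) hf
  refine locallyIntegrable_of_bdd_on_strips hm.aestronglyMeasurable fun R => ?_
  obtain ⟨K, -, hK⟩ := hL.exists_pdy_bound R
  refine ⟨K, ?_⟩
  filter_upwards [ae_muH_mem] with p hp
  exact hK p.1 (Ioo_subset_Icc_self hp.1) p.2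

lemma weakY_of_lipY {f : F²} (hf : Continuous f) (hL : LipY f) : WeakY f (pdy f) :=
  fun φ hφ => by
  obtain ⟨R, hR⟩ := hφ.support
  have hi1 := hφ.pdy.integrable_mul (f := f) hf.locallyIntegrable
  have hi2 := hφ.integrable_mul (hL.locallyIntegrable_pdy hf)
  rw [eq_neg_iff_add_eq_zero, ← integral_add hi1 hi2]
  have hi : Integrable (fun p => f p * pdy φ p + pdy f p * φ p) muH := hi1.add hi2
  rw [muH_eq] at hi ⊢
  rw [integral_prod _ hi]
  refine integral_eq_zero_of_ae ?_
  filter_upwards [ae_nu_mem] with x hx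
  set a := |R| + 1
  have ha : R + 1 ≤ a := by simp only [a]; linarith [le_abs_self R]
  have ha0 : 0 ≤ a := by positivity
  have hsupp : ∀ y, a ≤ |y| → φ (x, y) = 0 := fun y hy => hR x y (by linarith)
  have hsupp' : ∀ y, a ≤ |y| → pdy φ (x, y) = 0 := fun y hy =>
    eq_zero_of_le_abs_deriv (fun t => hR x t) (by linarith)
  obtain ⟨L, hL⟩ := hL a
  have ac1 : AbsolutelyContinuousOnInterval (fun y => f (x, y)) (-a) a :=
    LipschitzOnWith.absolutelyContinuousOnInterval (K := L) (by
      rw [uIcc_of_le (by linarith)]; exact hL x (Ioo_subset_Icc_self hx))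
  have ac2 : AbsolutelyContinuousOnInterval (fun y => φ (x, y)) (-a) a :=
    ContDiffOn.absolutelyContinuousOnInterval
      (ContDiff.contDiffOn ((hφ.smooth.comp (by fun_prop : ContDiff ℝ ∞ fun y : ℝ => (x, y))).of_le
        (by simp)))
  have e := ac1.integral_mul_deriv_eq_deriv_mul ac2
  rw [hsupp a (le_abs_self a), hsupp (-a) (by rw [abs_neg]; exact le_abs_self a)] at e
  simp only [mul_zero, sub_self, zero_sub] at e
  have conv1 : ∀ {g h : ℝ → ℝ}, (∀ y, a ≤ |y| → h y = 0) →
      ∫ y, g y * h y = ∫ y in (-a)..a, g y * h y := fun {g h} hh => by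
    refine (intervalIntegral.integral_eq_integral_of_support_subset fun y hy => ?_).symm
    have : ¬ a ≤ |y| := fun hy' => hy (by simp [hh y hy'])
    have := abs_lt.1 (not_le.1 this)
    exact ⟨this.1, this.2.le⟩
  have s1 : Integrable fun y => f (x, y) * pdy φ (x, y) := by
    have c := hφ.pdy.smooth.continuous
    refine Continuous.integrable_of_hasCompactSupport (by fun_prop)
      (HasCompactSupport.intro (isCompact_Icc (a := -a) (b := a)) fun y hy => ?_)
    rw [hsupp', mul_zero]
    by_contra h
    exact hy (abs_le.1 (not_le.1 h).le)
  by_cases s2 : Integrable fun y => pdy f (x, y) * φ (x, y)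
  · have : ∫ y, (f (x, y) * pdy φ (x, y) + pdy f (x, y) * φ (x, y)) = 0 := by
      rw [integral_add s1 s2, conv1 hsupp', conv1 hsupp]
      exact (congrArg (· + _) e).trans (neg_add_cancel _)
    exact this
  · refine integral_undef fun h => s2 ?_
    exact (h.sub s1).congr (ae_of_all _ fun y => by simp)

lemma pdx_pdy_comm {φ : F²} (hφ : ContDiff ℝ 2 φ) (p : ℝ²) : pdx (pdy φ) p = pdy (pdx φ) p := by
  have d := hφ.differentiable (by norm_num)
  have d1 : Differentiable ℝ (pdx φ) := (contDiff_pdx (m := 1) hφ (by norm_num)).differentiable (by simp)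
  have d2 : Differentiable ℝ (pdy φ) := (contDiff_pdy (m := 1) hφ (by norm_num)).differentiable (by simp)
  have df : DifferentiableAt ℝ (fderiv ℝ φ) p :=
    ((hφ.fderiv_right (m := 1) (by norm_num)).differentiable (by simp)) p
  rw [pdx_eq_fderiv d2, pdy_eq_fderiv d1, funext (pdx_eq_fderiv d), funext (pdy_eq_fderiv d)]
  rw [fderiv_clm_apply df (differentiableAt_const _), fderiv_clm_apply df (differentiableAt_const _)]
  simpa using (hφ.contDiffAt.isSymmSndFDerivAt (by simp)).eq (1, 0) (0, 1)

lemma abs_sub_le_of_gradient {F : F²} (hF : ContDiff ℝ ∞ F)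
    (hp : ∀ x y, F (x + 1, y) = F (x, y)) {M : ℝ} (hx : ∀ p, |pdx F p| ≤ M)
    (hy : ∀ p, |pdy F p| ≤ M) (p q : ℝ²) :
    |F p - F q| ≤ M * (|sπ(p.1 - q.1)| + |p.2 - q.2|) := by
  have dF := hF.differentiable (by simp)
  have hM : 0 ≤ M := (abs_nonneg _).trans (hx p)
  have l1 : ∀ y s t : ℝ, |F (s, y) - F (t, y)| ≤ M * |s - t| := fun y s t => by
    simpa using Convex.norm_image_sub_le_of_norm_hasDerivWithin_le (s := univ)
      (f := fun t => F (t, y)) (fun t _ => (hasDerivAt_pdx dF (t, y)).hasDerivWithinAt)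
      (fun t _ => hx (t, y)) convex_univ (mem_univ t) (mem_univ s)
  have l2 : ∀ x s t : ℝ, |F (x, s) - F (x, t)| ≤ M * |s - t| := fun x s t => by
    simpa using Convex.norm_image_sub_le_of_norm_hasDerivWithin_le (s := univ)
      (f := fun t => F (x, t)) (fun t _ => (hasDerivAt_pdy dF (x, t)).hasDerivWithinAt)
      (fun t _ => hy (x, t)) convex_univ (mem_univ t) (mem_univ s)
  set k := round (p.1 - q.1)
  have e := periodic_add_int hp q.1 p.2 k
  have h1 := l1 p.2 p.1 (q.1 + k)
  have h2 := l2 q.1 p.2 q.2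
  rw [e] at h1
  have h3 : |p.1 - (q.1 + k)| ≤ |sπ(p.1 - q.1)| := by
    have hr := abs_sub_round (p.1 - q.1)
    have := two_mul_le_abs_sin (t := p.1 - q.1 - k) hr
    have e2 := abs_sin_periodic (p.1 - q.1 - k) k
    rw [sub_add_cancel] at e2
    rw [e2, show p.1 - (q.1 + k) = p.1 - q.1 - k by ring]
    linarith [abs_nonneg (p.1 - q.1 - k)]
  have h4 := abs_sub_le (F p) (F (q.1, p.2)) (F q)
  have h5 := mul_le_left h3 hM
  change |F (p.1, p.2) - F (q.1, p.2)| ≤ _ at h1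
  change |F (q.1, p.2) - F (q.1, q.2)| ≤ _ at h2
  rw [mul_add]
  exact h4.trans (add_le_add (h1.trans h5) h2)

lemma ae_abs_sub_le_of_weak {f gx gy : F²} (hf : LocallyIntegrable f muH)
    (wx : WeakX f gx) (wy : WeakY f gy) {M : ℝ} (hx : ∀ᵐ p ∂muH, |gx p| ≤ M)
    (hy : ∀ᵐ p ∂muH, |gy p| ≤ M) : ∀ᵐ p ∂muH, ∀ᵐ q ∂muH,
      |f p - f q| ≤ M * (|sπ(p.1 - q.1)| + |p.2 - q.2|) := by
  have hb : ∀ n p q, |mol n f p - mol n f q| ≤ M * (|sπ(p.1 - q.1)| + |p.2 - q.2|) := fun n =>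
    abs_sub_le_of_gradient (contDiff_conv (testDl n) hf) (conv_periodic (testDl n) f)
      (fun p => by
        rw [pdx_conv (testDl n) hf, conv_pdx (testDl n) wx]; exact abs_mol_le hx n p)
      (fun p => by
        rw [pdy_conv (testDl n) hf, conv_pdy (testDl n) wy]; exact abs_mol_le hy n p)
  have key : ∀ R : ℕ, ∀ᵐ p ∂muH, ∀ᵐ q ∂muH, |p.2| ≤ (R:ℝ) → |q.2| ≤ (R:ℝ) →
      |f p - f q| ≤ M * (|sπ(p.1 - q.1)| + |p.2 - q.2|) := fun R => by
    obtain ⟨ns, hns⟩ := exists_seq_mol_tendsto_ae hf R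
    filter_upwards [hns] with p hp
    filter_upwards [hns] with q hq h1 h2
    exact le_of_tendsto ((hp h1).sub (hq h2)).abs (.of_forall fun i => hb _ p q)
  filter_upwards [ae_all_iff.2 key] with p hp
  filter_upwards [ae_all_iff.2 hp] with q hq
  obtain ⟨R, hR⟩ := exists_nat_ge (max |p.2| |q.2|)
  exact hq R ((le_max_left _ _).trans hR) ((le_max_right _ _).trans hR)

lemma exists_conv_le_of_bdd {k : F²} (hk : IsTestH k) :
    ∃ A : ℝ, 0 ≤ A ∧ ∀ (f : F²) (C : ℝ), (∀ᵐ p ∂muH, |f p| ≤ C) → ∀ p, |conv k f p| ≤ A * C := by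
  obtain ⟨A, hA, h1, -⟩ := hk.exists_lintegral_bound
  refine ⟨A.toReal, ENNReal.toReal_nonneg, fun f C hf p => ?_⟩
  have hi : Integrable (fun q => k (p - q)) muH := (hk.reflect p).integrable
  have hA' : ∫ q, |k (p - q)| ∂muH ≤ A.toReal := by
    have := integral_norm_eq_lintegral_enorm hi.1
    simp only [norm_eq_abs] at this
    rw [this]
    exact ENNReal.toReal_mono hA (h1 p)
  have hC : 0 ≤ C := by
    have : (ae muH).NeBot := by
      rw [ae_neBot, muH]
      intro h
      have : volume cellH = 0 := by simpa using congrArg (fun m => m univ) h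
      rw [cellH, Measure.volume_eq_prod, Measure.prod_prod] at this
      simp at this
    obtain ⟨q, hq⟩ := hf.exists
    exact (abs_nonneg _).trans hq
  rw [conv_apply]
  calc |∫ q, k (p - q) * f q ∂muH| ≤ ∫ q, |k (p - q)| * C ∂muH := by
        rw [← norm_eq_abs]
        refine norm_integral_le_of_norm_le (hi.abs.mul_const C) ?_
        filter_upwards [hf] with q hq
        rw [norm_eq_abs, abs_mul]
        gcongr
    _ ≤ A.toReal * C := by rw [integral_mul_const]; gcongr

/-- Lipschitz functions with bounded mollification are bounded. -/
lemma exists_bound_of_lipschitz {f : F²} (hf : LocallyIntegrable f muH) {L C : ℝ}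
    (hL : 0 ≤ L) (h : ∀ᵐ p ∂muH, ∀ᵐ q ∂muH,
      |f p - f q| ≤ L * (|sπ(p.1 - q.1)| + |p.2 - q.2|))
    (hC : ∀ p, |mol 0 f p| ≤ C) : ∀ᵐ p ∂muH, |f p| ≤ C + 2 * L := by
  filter_upwards [h] with p hp
  have e := mol_sub_apply 0 hf p
  have hk := testDl 0
  have hi : Integrable (fun q => moll (dl 0) (p - q)) muH := (hk.reflect p).integrable
  have b : |mol 0 f p - f p| ≤ ∫ q, moll (dl 0) (p - q) * (2 * L) ∂muH := by
    rw [e, ← norm_eq_abs]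
    refine norm_integral_le_of_norm_le (hi.mul_const _) ?_
    filter_upwards [hp] with q hq
    rw [norm_eq_abs, abs_mul, abs_of_nonneg (moll_nonneg (dl_pos 0) (dl_le_one 0) _)]
    rcases eq_or_ne (moll (dl 0) (p - q)) 0 with h0 | h0
    · simp [h0]
    · have h1 := moll_ne_zero (dl_pos 0) h0
      have h2 := dl_le_one 0
      refine mul_le_left ?_ (moll_nonneg (dl_pos 0) (dl_le_one 0) _)
      rw [abs_sub_comm]
      refine hq.trans ?_
      rw [mul_comm 2 L]
      refine mul_le_left ?_ hL
      simp only [Prod.fst_sub, Prod.snd_sub] at h1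
      linarith [h1.1, h1.2]
  rw [integral_mul_const, integral_moll (dl_pos 0) (dl_le_one 0), one_mul] at b
  have := abs_sub_abs_le_abs_sub (f p) (mol 0 f p)
  rw [abs_sub_comm] at this
  linarith [hC p]

end SliceWise

/-! ## The interior flow -/

section InteriorFlow

lemma lipY_of_hasDerivAt {f f' : F²} (h : ∀ x y, HasDerivAt (fun t => f (x, t)) (f' (x, y)) y)
    (hb : ∀ R : ℝ, ∃ K : ℝ, ∀ x ∈ Icc (0:ℝ) 1, ∀ y ∈ Icc (-R) R, |f' (x, y)| ≤ K) : LipY f := by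
  intro R
  obtain ⟨K, hK⟩ := hb R
  refine ⟨K.toNNReal, fun x hx => Convex.lipschitzOnWith_of_nnnorm_hasDerivWithin_le
    (convex_Icc _ _) (fun y _ => (h x y).hasDerivWithinAt) fun y hy => ?_⟩
  rw [← NNReal.coe_le_coe, coe_nnnorm, norm_eq_abs]
  exact (hK x hx y hy).trans (le_coe_toNNReal K)

lemma exists_bound_on_box {f : F²} (hf : Continuous f) (R : ℝ) :
    ∃ K : ℝ, 0 ≤ K ∧ ∀ x ∈ Icc (0:ℝ) 1, ∀ y ∈ Icc (-R) R, |f (x, y)| ≤ K := by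
  obtain ⟨K, hK⟩ := (isCompact_Icc.prod isCompact_Icc :
    IsCompact (Icc (0:ℝ) 1 ×ˢ Icc (-R) R)).exists_bound_of_continuousOn hf.continuousOn
  exact ⟨|K|, abs_nonneg _, fun x hx y hy => (hK (x, y) ⟨hx, hy⟩).trans (le_abs_self K)⟩

lemma lipY_of_contDiff {f : F²} (hf : ContDiff ℝ 1 f) : LipY f :=
  lipY_of_hasDerivAt (fun x y => hasDerivAt_pdy (hf.differentiable (by simp)) (x, y)) fun R =>
    (exists_bound_on_box (contDiff_pdy (m := 0) hf (by simp)).continuous R).imp fun _ h => h.2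

lemma LipY.mul {f g : F²} (hf : LipY f) (hg : LipY g) (cf : Continuous f)
    (cg : Continuous g) : LipY (fun p => f p * g p) := by
  intro R
  obtain ⟨K, hK⟩ := hf R
  obtain ⟨L, hL⟩ := hg R
  obtain ⟨A, hA0, hA⟩ := exists_bound_on_box cf R
  obtain ⟨B, hB0, hB⟩ := exists_bound_on_box cg R
  refine ⟨A.toNNReal * L + B.toNNReal * K, fun x hx => LipschitzOnWith.of_dist_le_mul
    fun s hs t ht => ?_⟩
  have h1 := (hK x hx).dist_le_mul s hs t ht
  have h2 := (hL x hx).dist_le_mul s hs t ht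
  rw [dist_eq] at h1 h2 ⊢
  have e : f (x, s) * g (x, s) - f (x, t) * g (x, t)
    = f (x, s) * (g (x, s) - g (x, t)) + g (x, t) * (f (x, s) - f (x, t)) := by ring
  push_cast
  rw [e, coe_toNNReal _ hA0, coe_toNNReal _ hB0]
  refine (abs_add_le _ _).trans ?_
  rw [abs_mul, abs_mul, add_mul, mul_assoc, mul_assoc]
  gcongr
  · exact hA x hx s hs
  · exact hB x hx t ht

lemma hasDerivAt_zero_of_sq {E : Type*} [NormedAddCommGroup E] [NormedSpace ℝ E] {f : ℝ → E} {C : ℝ}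
    (h : ∀ t, ‖f t‖ ≤ C * |t| ^ 2) : HasDerivAt f 0 0 := by
  have h0 : f 0 = 0 := by simpa using h 0
  rw [hasDerivAt_iff_isLittleO]
  simp only [h0, sub_zero, smul_zero]
  refine (Asymptotics.IsBigO.of_bound C (g := fun t : ℝ => t ^ 2) (.of_forall fun t => by
    simpa using h t)).trans_isLittleO ?_
  simpa using Asymptotics.isLittleO_pow_pow (𝕜 := ℝ) (show 1 < 2 by norm_num)

variable {b : ℝ → ℝ}

lemma IsCoriolis.zero (hb : IsCoriolis b) : b 0 = 0 := by
  obtain ⟨β, -, h⟩ := hb.equiv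
  have h1 : Tendsto (fun y : ℝ => β * y) (𝓝 0) (𝓝 0) := by
    have : Continuous fun y : ℝ => β * y := by fun_prop
    simpa using this.tendsto 0
  exact tendsto_nhds_unique hb.diff.continuous.continuousAt (h.symm.tendsto_nhds h1)

lemma IsCoriolis.continuous_deriv (hb : IsCoriolis b) : Continuous (deriv b) := hb.lip.continuous

/-- Quantitative form of the assumptions on the Coriolis factor. -/
structure CoriolisBound (b : ℝ → ℝ) (c : ℝ) : Prop where
  one_le : 1 ≤ c
  deriv_lower : ∀ y, c⁻¹ ≤ deriv b y
  deriv_upper : ∀ y, deriv b y ≤ c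
  le_abs : ∀ y, |y| ≤ c * |b y|
  abs_le : ∀ y, |b y| ≤ c * |y|

lemma IsCoriolis.exists_bound (hb : IsCoriolis b) : ∃ c, CoriolisBound b c := by
  obtain ⟨c, hc, h⟩ := hb.deriv_bounds
  have h1 : 1 ≤ c := by
    by_contra hlt
    have := (one_lt_inv₀ hc).2 (not_le.1 hlt)
    linarith [h 0]
  have mono : ∀ y, 0 ≤ y → c⁻¹ * y ≤ b y ∧ b y ≤ c * y := fun y hy => by
    have e1 := Convex.mul_sub_le_image_sub_of_le_deriv (D := univ) convex_univ
      hb.diff.continuous.continuousOn hb.diff.differentiableOn (fun x _ => (h x).1) 0 trivial y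
      trivial hy
    have e2 := Convex.image_sub_le_mul_sub_of_deriv_le (D := univ) convex_univ
      hb.diff.continuous.continuousOn hb.diff.differentiableOn (fun x _ => (h x).2) 0 trivial y
      trivial hy
    rw [hb.zero] at e1 e2
    constructor <;> linarith
  have mono' : ∀ y, y ≤ 0 → c * y ≤ b y ∧ b y ≤ c⁻¹ * y := fun y hy => by
    have e1 := Convex.mul_sub_le_image_sub_of_le_deriv (D := univ) convex_univ
      hb.diff.continuous.continuousOn hb.diff.differentiableOn (fun x _ => (h x).1) y trivial 0
      trivial hy
    have e2 := Convex.image_sub_le_mul_sub_of_deriv_le (D := univ) convex_univ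
      hb.diff.continuous.continuousOn hb.diff.differentiableOn (fun x _ => (h x).2) y trivial 0
      trivial hy
    rw [hb.zero] at e1 e2
    constructor <;> linarith
  have key : ∀ y, c⁻¹ * |y| ≤ |b y| ∧ |b y| ≤ c * |y| := fun y => by
    rcases le_total 0 y with hy | hy
    · have h0 : 0 ≤ b y := le_trans (by positivity) (mono y hy).1
      rw [abs_of_nonneg hy, abs_of_nonneg h0]; exact mono y hy
    · have h0 : b y ≤ 0 := (mono' y hy).2.trans (mul_nonpos_of_nonneg_of_nonpos (by positivity) hy)
      rw [abs_of_nonpos hy, abs_of_nonpos h0]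
      constructor <;> linarith [(mono' y hy).1, (mono' y hy).2]
  refine ⟨c, h1, fun y => (h y).1, fun y => (h y).2, fun y => ?_, fun y => (key y).2⟩
  have := (key y).1
  rwa [inv_mul_le_iff₀ hc] at this

variable {c : ℝ}

lemma CoriolisBound.abs_deriv_le (hc : CoriolisBound b c) (y : ℝ) :
    0 < deriv b y ∧ |deriv b y| ≤ c ∧ |(deriv b y)⁻¹| ≤ c := by
  have h0 : 0 < c := by linarith [hc.one_le]
  have h1 : 0 < deriv b y := lt_of_lt_of_le (by positivity) (hc.deriv_lower y)
  refine ⟨h1, by rw [abs_of_pos h1]; exact hc.deriv_upper y, ?_⟩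
  rw [abs_of_pos (by positivity)]
  exact inv_le_of_inv_le₀ h0 (hc.deriv_lower y)

lemma CoriolisBound.abs_div_le (hc : CoriolisBound b c) {a K y : ℝ} {j m : ℕ} (hK : 0 ≤ K)
    (h : |a| ≤ K * |y| ^ (m + j)) : |a / b y ^ j| ≤ K * c ^ j * |y| ^ m := by
  have h0 : 0 ≤ c := by linarith [hc.one_le]
  rw [abs_div, abs_pow]
  rcases eq_or_lt_of_le (show 0 ≤ |b y| ^ j by positivity) with hb | hb
  · rw [← hb, div_zero]; positivity
  · rw [div_le_iff₀ hb]
    have := pow_le_pow_left₀ (abs_nonneg y) (hc.le_abs y) j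
    calc |a| ≤ K * |y| ^ (m + j) := h
      _ = K * |y| ^ m * |y| ^ j := by ring
      _ ≤ K * |y| ^ m * (c * |b y|) ^ j := by gcongr
      _ = _ := by ring

lemma continuous_div_coriolis (hb : IsCoriolis b) (hc : CoriolisBound b c) {a : F²}
    (ha : Continuous a) {K : ℝ} (hK : 0 ≤ K) (h : ∀ p : ℝ², |a p| ≤ K * |p.2| ^ 2) :
    Continuous fun p : ℝ² => a p / b p.2 := by
  refine continuous_iff_continuousAt.2 fun p => ?_
  by_cases hp : p.2 = 0
  · have e : a p / b p.2 = 0 := by rw [hp, hb.zero, div_zero]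
    rw [ContinuousAt, e]
    refine squeeze_zero_norm (a := fun q : ℝ² => K * c ^ 1 * |q.2| ^ 1) (fun q => ?_) ?_
    · simpa [abs_div] using hc.abs_div_le (j := 1) (m := 1) hK (h q)
    · have : Continuous fun q : ℝ² => K * c ^ 1 * |q.2| ^ 1 := by fun_prop
      simpa [hp] using this.tendsto p
  · exact ha.continuousAt.div (hb.diff.continuous.comp continuous_snd).continuousAt
      (hb.ne_zero _ hp)

lemma hasDerivAt_div_coriolis (hb : IsCoriolis b) (hc : CoriolisBound b c) {a : F²}
    (ha : ContDiff ℝ 1 a) {K : ℝ} (hK : 0 ≤ K) (h : ∀ p : ℝ², |a p| ≤ K * |p.2| ^ 3) (x y : ℝ) :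
    HasDerivAt (fun t => a (x, t) / b t)
      ((pdy a (x, y) * b y - a (x, y) * deriv b y) / b y ^ 2) y := by
  by_cases hy : y = 0
  · subst hy
    rw [hb.zero]
    simpa using hasDerivAt_zero_of_sq (f := fun t => a (x, t) / b t) (C := K * c ^ 1) fun t => by
      simpa [abs_div] using hc.abs_div_le (j := 1) (m := 2) hK (h (x, t))
  · exact (hasDerivAt_pdy (ha.differentiable (by simp)) (x, y)).div (hb.diff y).hasDerivAt
      (hb.ne_zero y hy)

lemma continuous_inv_deriv (hb : IsCoriolis b) (hc : CoriolisBound b c) :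
    Continuous fun p : ℝ² => (deriv b p.2)⁻¹ :=
  (hb.continuous_deriv.comp continuous_snd).inv₀ fun p => (hc.abs_deriv_le p.2).1.ne'

lemma lipY_inv_deriv (hb : IsCoriolis b) (hc : CoriolisBound b c) :
    LipY fun p : ℝ² => (deriv b p.2)⁻¹ := by
  intro R
  obtain ⟨K, hK⟩ := hb.lip.locallyLipschitzOn.exists_lipschitzOnWith_of_compact
    (isCompact_Icc (a := -R) (b := R))
  have h0 : 0 ≤ c := by linarith [hc.one_le]
  refine ⟨c.toNNReal * c.toNNReal * K, fun x _ => LipschitzOnWith.of_dist_le_mul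
    fun s hs t ht => ?_⟩
  have h1 := hK.dist_le_mul s hs t ht
  have hs' := hc.abs_deriv_le s
  have ht' := hc.abs_deriv_le t
  push_cast
  rw [coe_toNNReal _ h0]
  rw [dist_eq] at h1 ⊢
  have e : (deriv b s)⁻¹ - (deriv b t)⁻¹
      = (deriv b s)⁻¹ * (deriv b t)⁻¹ * (deriv b t - deriv b s) := by
    field_simp [hs'.1.ne', ht'.1.ne']
  rw [e, abs_mul, abs_mul, abs_sub_comm, mul_assoc (c * c)]
  gcongr
  · exact hs'.2.2
  · exact ht'.2.2

/-! ### The zonal primitive -/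

variable {a : F²}

lemma pdy_zonalPrimitive (ha : ContDiff ℝ 1 a) (p : ℝ²) :
    pdy (zonalPrimitive a) p = ∫ t in (0:ℝ)..p.1, pdy a (t, p.2) := by
  have ca := ha.continuous
  have cy : Continuous (pdy a) := (contDiff_pdy (m := 0) ha (by simp)).continuous
  obtain ⟨K, hK⟩ := (isCompact_uIcc.prod isCompact_Icc :
    IsCompact (uIcc 0 p.1 ×ˢ Icc (p.2 - 1) (p.2 + 1))).exists_bound_of_continuousOn cy.continuousOn
  refine (intervalIntegral.hasDerivAt_integral_of_dominated_loc_of_deriv_le (μ := volume)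
    (F := fun y t => a (t, y)) (F' := fun y t => pdy a (t, y)) (bound := fun _ => K)
    (Icc_mem_nhds (show p.2 - 1 < p.2 by linarith) (show p.2 < p.2 + 1 by linarith))
    (.of_forall fun y => Continuous.aestronglyMeasurable (by fun_prop))
    (Continuous.intervalIntegrable (by fun_prop) _ _)
    (Continuous.aestronglyMeasurable (by fun_prop))
    (ae_of_all _ fun t ht y hy => hK (t, y) ⟨uIoc_subset_uIcc ht, hy⟩) (by simp)
    (ae_of_all _ fun t _ y _ => hasDerivAt_pdy (ha.differentiable (by simp)) (t, y))).2.deriv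

lemma zonalPrimitive_periodic (ha : Continuous a) (hp : ∀ x y, a (x + 1, y) = a (x, y))
    (h0 : ∀ y, ∫ x in (0:ℝ)..1, a (x, y) = 0) (x y : ℝ) :
    zonalPrimitive a (x + 1, y) = zonalPrimitive a (x, y) := by
  have hi : ∀ u v, IntervalIntegrable (fun t => a (t, y)) volume u v := fun u v =>
    Continuous.intervalIntegrable (by fun_prop) _ _
  have hper : Function.Periodic (fun t => a (t, y)) 1 := fun t => hp t y
  have h1 := hper.intervalIntegral_add_eq x 0
  rw [zero_add, h0] at h1
  have := intervalIntegral.integral_add_adjacent_intervals (hi 0 x) (hi x (x + 1))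
  simp only [zonalPrimitive]
  rw [← this, h1, add_zero]

lemma continuous_pdy_zonalPrimitive (ha : ContDiff ℝ 1 a) : Continuous (pdy (zonalPrimitive a)) := by
  have cy : Continuous (pdy a) := (contDiff_pdy (m := 0) ha (by simp)).continuous
  rw [funext (pdy_zonalPrimitive ha)]
  exact intervalIntegral.continuous_parametric_intervalIntegral_of_continuous
    (f := fun (p : ℝ²) t => pdy a (t, p.2)) (by fun_prop) continuous_fst

lemma hasDerivAt_pdy_zonalPrimitive (ha : ContDiff ℝ 1 a) (x y : ℝ) :
    HasDerivAt (fun t => pdy (zonalPrimitive a) (t, y)) (pdy a (x, y)) x := by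
  have cy : Continuous (pdy a) := (contDiff_pdy (m := 0) ha (by simp)).continuous
  simp only [pdy_zonalPrimitive ha]
  exact (Continuous.integral_hasStrictDerivAt (f := fun t => pdy a (t, y)) (by fun_prop)
    0 x).hasDerivAt

lemma lipY_pdy_zonalPrimitive (ha : ContDiff ℝ 2 a) : LipY (pdy (zonalPrimitive a)) := by
  intro R
  have c1 : ContDiff ℝ 1 (pdy a) := contDiff_pdy ha (by norm_num)
  have cy := c1.continuous
  obtain ⟨K, hK⟩ := lipY_of_contDiff c1 R
  refine ⟨K, fun x hx => LipschitzOnWith.of_dist_le_mul fun s hs t ht => ?_⟩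
  rw [pdy_zonalPrimitive (ha.of_le (by norm_num)), pdy_zonalPrimitive (ha.of_le (by norm_num)),
    dist_eq_norm, ← intervalIntegral.integral_sub (Continuous.intervalIntegrable (by fun_prop) _ _)
      (Continuous.intervalIntegrable (by fun_prop) _ _)]
  refine (intervalIntegral.norm_integral_le_of_norm_le_const (C := K * dist s t) fun r hr => ?_).trans ?_
  · rw [uIoc_of_le hx.1] at hr
    rw [← dist_eq_norm]
    exact (hK r ⟨hr.1.le, hr.2.trans hx.2⟩).dist_le_mul s hs t ht
  · simp only [sub_zero]
    exact mul_le_of_le_one_right (by positivity) (by rw [abs_of_nonneg hx.1]; exact hx.2)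

lemma abs_pdy_zonalPrimitive_le (ha : ContDiff ℝ 1 a) {K : ℝ} (h : ∀ p, |pdy a p| ≤ K) {p : ℝ²}
    (hp : p ∈ cellH) : |pdy (zonalPrimitive a) p| ≤ K := by
  have hK := (abs_nonneg _).trans (h 0)
  rw [pdy_zonalPrimitive ha]
  refine (intervalIntegral.norm_integral_le_of_norm_le_const (C := K)
    (f := fun t => pdy a (t, p.2)) fun r _ => h _).trans ?_
  rw [sub_zero, abs_of_pos hp.1.1]
  exact mul_le_of_le_one_right hK hp.1.2.le

end InteriorFlow

section InteriorField

variable {b : ℝ → ℝ} {c K : ℝ} {σ1 σ2 : F²} {k s : ℕ}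

/-- Quantitative form of the assumptions on the wind stress. -/
structure WindBound (K : ℝ) (σ1 σ2 : F²) : Prop where
  nonneg : 0 ≤ K
  smooth₁ : ContDiff ℝ 2 σ1
  smooth₂ : ContDiff ℝ 2 σ2
  periodic₁ : ∀ x y : ℝ, σ1 (x + 1, y) = σ1 (x, y)
  periodic₂ : ∀ x y : ℝ, σ2 (x + 1, y) = σ2 (x, y)
  flat1 : IsFlat 9 K σ1
  flat2 : IsFlat 9 K σ2
  flat₁x : IsFlat 9 K (pdx σ1)
  flat₁y : IsFlat 9 K (pdy σ1)
  flat₂x : IsFlat 9 K (pdx σ2)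
  flat₂y : IsFlat 9 K (pdy σ2)

lemma IsFlat.mono {N M : ℕ} {C D : ℝ} {a : F²} (h : IsFlat N C a) (hM : M ≤ N)
    (hD : C ≤ D) : IsFlat M D a :=
  ⟨h.memLp, fun p j hj => (h.bound p j (hj.trans hM)).trans (by gcongr)⟩

lemma IsWind.exists_bound (hw : IsWind k s σ1 σ2) (hk : 10 ≤ k) (hs : 3 ≤ s) :
    ∃ K, WindBound K σ1 σ2 := by
  obtain ⟨C, hC⟩ := hw.vanish
  obtain ⟨C', hC'⟩ := hw.vanish_grad
  have l : ∀ (p : ℝ²) (j : ℕ), C * |p.2| ^ j ≤ max C C' * |p.2| ^ j :=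
    fun p j => by gcongr; exact le_max_left _ _
  have l' : ∀ (p : ℝ²) (j : ℕ), C' * |p.2| ^ j ≤ max C C' * |p.2| ^ j :=
    fun p j => by gcongr; exact le_max_right _ _
  obtain ⟨K1, h1, a1, a2, a3⟩ := exists_isFlat hw.smooth₁ hw.periodic₁ (hw.memH₁.mono hs)
    (fun p => (hC p).1.trans (l p _)) (fun p => (hC' p).1.trans (l' p _))
    (fun p => (hC' p).2.1.trans (l' p _))
  obtain ⟨K2, h2, b1, b2, b3⟩ := exists_isFlat hw.smooth₂ hw.periodic₂ (hw.memH₂.mono hs)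
    (fun p => (hC p).2.trans (l p _)) (fun p => (hC' p).2.2.1.trans (l' p _))
    (fun p => (hC' p).2.2.2.trans (l' p _))
  have hN : 9 ≤ k - 1 := by omega
  have q1 : K1 ≤ K1 + K2 := by linarith
  have q2 : K2 ≤ K1 + K2 := by linarith
  exact ⟨K1 + K2, by positivity, hw.smooth₁, hw.smooth₂, hw.periodic₁, hw.periodic₂, a1.mono hN q1,
    b1.mono hN q2, a2.mono hN q1, a3.mono hN q1, b2.mono hN q2, b3.mono hN q2⟩

lemma IsFlat.le {N : ℕ} {C : ℝ} {a : F²} (h : IsFlat N C a) (p : ℝ²) : |a p| ≤ C := by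
  simpa using h.bound p 0 (Nat.zero_le _)

lemma ae_snd_ne_zero : ∀ᵐ p : ℝ² ∂muH, p.2 ≠ 0 := by
  rw [ae_iff]
  have : {p : ℝ² | ¬p.2 ≠ 0} = univ ×ˢ {0} := by ext p; simp
  rw [this, muH_eq, Measure.prod_prod]
  simp

lemma pump_eq (hb : IsCoriolis b) (hc : CoriolisBound b c) (hw : WindBound K σ1 σ2) (p : ℝ²) :
    pump b σ1 σ2 p = pdx σ2 p / b p.2 - (pdy σ1 p * b p.2 - σ1 p * deriv b p.2) / b p.2 ^ 2 := by
  have := (hasDerivAt_div_coriolis hb hc (hw.smooth₁.of_le (by norm_num)) hw.nonneg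
    (fun p => hw.flat1.bound p 3 (by norm_num)) p.1 p.2).deriv
  rw [pump, ← this]
  rfl

lemma abs_pdy_div_le (hc : CoriolisBound b c) (hw : WindBound K σ1 σ2) (p : ℝ²) :
    |(pdy σ1 p * b p.2 - σ1 p * deriv b p.2) / b p.2 ^ 2| ≤ K * c + K * c ^ 3 := by
  have h0 := hw.nonneg
  have hc0 : 0 ≤ c := by linarith [hc.one_le]
  have e : (pdy σ1 p * b p.2 - σ1 p * deriv b p.2) / b p.2 ^ 2
      = pdy σ1 p / b p.2 ^ 1 - σ1 p / b p.2 ^ 2 * deriv b p.2 := by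
    rcases eq_or_ne (b p.2) 0 with h | h
    · simp [h]
    · field_simp
  rw [e]
  have h1 := hc.abs_div_le (m := 0) (j := 1) h0 (hw.flat₁y.bound p 1 (by norm_num))
  have h2 := hc.abs_div_le (m := 0) (j := 2) h0 (hw.flat1.bound p 2 (by norm_num))
  have h3 := (hc.abs_deriv_le p.2).2.1
  refine (abs_sub _ _).trans ?_
  rw [abs_mul]
  have h4 := mul_le_mul h2 h3 (abs_nonneg _) (by positivity)
  rw [pow_zero, mul_one] at h1 h4
  calc _ ≤ K * c ^ 1 + K * c ^ 2 * c := add_le_add h1 h4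
    _ = _ := by ring

lemma abs_pump_le (hb : IsCoriolis b) (hc : CoriolisBound b c) (hw : WindBound K σ1 σ2) (p : ℝ²) :
    |pump b σ1 σ2 p| ≤ 2 * K * c + K * c ^ 3 := by
  rw [pump_eq hb hc hw]
  have h1 := hc.abs_div_le (m := 0) (j := 1) hw.nonneg (hw.flat₂x.bound p 1 (by norm_num))
  have h2 := abs_pdy_div_le hc hw p
  rw [pow_one, pow_zero, mul_one, pow_one] at h1
  linarith [abs_sub (pdx σ2 p / b p.2) ((pdy σ1 p * b p.2 - σ1 p * deriv b p.2) / b p.2 ^ 2)]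

lemma measurable_pump (hb : IsCoriolis b) (hc : CoriolisBound b c) (hw : WindBound K σ1 σ2) :
    Measurable (pump b σ1 σ2) := by
  rw [funext (pump_eq hb hc hw)]
  have m1 := (contDiff_pdx (m := 1) hw.smooth₂ (by norm_num)).continuous.measurable
  have m2 := (contDiff_pdy (m := 1) hw.smooth₁ (by norm_num)).continuous.measurable
  have m3 := hw.smooth₁.continuous.measurable
  have m4 : Measurable fun p : ℝ² => b p.2 := hb.diff.continuous.measurable.comp measurable_snd
  have m5 : Measurable fun p : ℝ² => deriv b p.2 :=
    hb.continuous_deriv.measurable.comp measurable_snd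
  exact (m1.div m4).sub (((m2.mul m4).sub (m3.mul m5)).div (m4.pow_const 2))

lemma int₂_eq (hb : IsCoriolis b) (hc : CoriolisBound b c) (hw : WindBound K σ1 σ2) {p : ℝ²}
    (hp : p.2 ≠ 0) : int₂ b σ1 σ2 p
      = pdx σ2 p * (deriv b p.2)⁻¹ - pdy σ1 p * (deriv b p.2)⁻¹ + σ1 p / b p.2 := by
  have h0 := hb.ne_zero _ hp
  have h1 := (hc.abs_deriv_le p.2).1.ne'
  rw [int₂, pump_eq hb hc hw]
  field_simp
  ring

lemma abs_int₂_le (hb : IsCoriolis b) (hc : CoriolisBound b c) (hw : WindBound K σ1 σ2) :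
    ∀ᵐ p ∂muH, |int₂ b σ1 σ2 p| ≤ 3 * (K * c) := by
  filter_upwards [ae_snd_ne_zero] with p hp
  rw [int₂_eq hb hc hw hp]
  have h0 := hw.nonneg
  have h1 := hc.abs_div_le (m := 0) (j := 1) h0 (hw.flat1.bound p 1 (by norm_num))
  have h2 := (hc.abs_deriv_le p.2).2.2
  have h3 := mul_le_mul (hw.flat₂x.le p) h2 (abs_nonneg _) h0
  have h4 := mul_le_mul (hw.flat₁y.le p) h2 (abs_nonneg _) h0
  rw [← abs_mul] at h3 h4
  rw [pow_one, pow_zero, mul_one, pow_one] at h1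
  have a1 := abs_add_le (pdx σ2 p * (deriv b p.2)⁻¹ - pdy σ1 p * (deriv b p.2)⁻¹) (σ1 p / b p.2)
  have a2 := abs_sub (pdx σ2 p * (deriv b p.2)⁻¹) (pdy σ1 p * (deriv b p.2)⁻¹)
  linarith

lemma int₁_eq (p : ℝ²) : int₁ b σ1 σ2 p =
    pdy (fun q => pdy (zonalPrimitive σ1) q * (deriv b q.2)⁻¹) p
      - pdy (fun q => σ2 q * (deriv b q.2)⁻¹) p - σ2 p / b p.2 := by
  simp only [int₁, div_eq_mul_inv]
  ring

lemma isLipField_int (hb : IsCoriolis b) (hc : CoriolisBound b c) (hw : WindBound K σ1 σ2)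
    (h0 : ∀ y, ∫ x in (0:ℝ)..1, σ1 (x, y) = 0) {L : ℝ} (hL : 0 ≤ L)
    (hG : GradIntBound b σ1 σ2 L) :
    ∃ M, IsLipField (int₁ b σ1 σ2) (int₂ b σ1 σ2) (pump b σ1 σ2) M L := by
  obtain ⟨g1x, g1y, g2x, g2y, w1x, w1y, w2x, w2y, hB⟩ := hG
  have hK := hw.nonneg
  have hc0 : 0 ≤ c := by linarith [hc.one_le]
  have l1 := locallyIntegrable_muH w1x.locInt
  have l2 := locallyIntegrable_muH w2x.locInt
  have lip1 := ae_abs_sub_le_of_weak l1 w1x.eq w1y.eq (hB.mono fun p h => h.1)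
    (hB.mono fun p h => h.2.1)
  have lip2 := ae_abs_sub_le_of_weak l2 w2x.eq w2y.eq (hB.mono fun p h => h.2.2.1)
    (hB.mono fun p h => h.2.2.2)
  have s1 : ContDiff ℝ 1 σ1 := hw.smooth₁.of_le (by norm_num)
  have s2 : ContDiff ℝ 1 σ2 := hw.smooth₂.of_le (by norm_num)
  have cI := continuous_inv_deriv hb hc
  have cS := continuous_pdy_zonalPrimitive s1
  have c1y : Continuous (pdy σ1) := (contDiff_pdy (m := 1) hw.smooth₁ (by norm_num)).continuous
  have c2x : Continuous (pdx σ2) := (contDiff_pdx (m := 1) hw.smooth₂ (by norm_num)).continuous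
  set f1 : F² := fun q => pdy (zonalPrimitive σ1) q * (deriv b q.2)⁻¹ with hf1
  set f2 : F² := fun q => σ2 q * (deriv b q.2)⁻¹ with hf2
  have cf1 : Continuous f1 := cS.mul cI
  have cf2 : Continuous f2 := s2.continuous.mul cI
  have L1 : LipY f1 := (lipY_pdy_zonalPrimitive hw.smooth₁).mul (lipY_inv_deriv hb hc) cS cI
  have L2 : LipY f2 := (lipY_of_contDiff s2).mul (lipY_inv_deriv hb hc) s2.continuous cI
  have y1 := weakY_of_lipY cf1 L1
  have y2 := weakY_of_lipY cf2 L2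
  have hper : ∀ x y, f1 (x + 1, y) = f1 (x, y) := fun x y => by
    simp only [hf1]
    rw [pdy_periodic (zonalPrimitive_periodic s1.continuous hw.periodic₁ h0)]
  have x1 : WeakX f1 fun q => pdy σ1 q * (deriv b q.2)⁻¹ := weakX_of_hasDerivAt cf1 (c1y.mul cI)
      (fun x y => (hasDerivAt_pdy_zonalPrimitive s1 x y).mul_const (deriv b y)⁻¹) hper
  have x2 : WeakX f2 fun q => pdx σ2 q * (deriv b q.2)⁻¹ := weakX_of_hasDerivAt cf2 (c2x.mul cI)
      (fun x y => (hasDerivAt_pdx (s2.differentiable (by simp)) (x, y)).mul_const (deriv b y)⁻¹)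
      (fun x y => by simp only [hf2, hw.periodic₂])
  have cq1 := continuous_div_coriolis hb hc s1.continuous hK fun p => hw.flat1.bound p 2 (by norm_num)
  have cq2 := continuous_div_coriolis hb hc s2.continuous hK fun p => hw.flat2.bound p 2 (by norm_num)
  have cq₂x := continuous_div_coriolis hb hc c2x hK fun p => hw.flat₂x.bound p 2 (by norm_num)
  have x3 : WeakX (fun q => σ2 q / b q.2) fun q => pdx σ2 q / b q.2 := weakX_of_hasDerivAt cq2 cq₂x
      (fun x y => (hasDerivAt_pdx (s2.differentiable (by simp)) (x, y)).div_const (b y))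
      (fun x y => by simp only [hw.periodic₂])
  have Lq : LipY fun q : ℝ² => σ1 q / b q.2 :=
    lipY_of_hasDerivAt (f' := fun p => (pdy σ1 p * b p.2 - σ1 p * deriv b p.2) / b p.2 ^ 2)
      (fun x y => hasDerivAt_div_coriolis hb hc s1 hK
      (fun p => hw.flat1.bound p 3 (by norm_num)) x y)
      fun R => ⟨_, fun x _ y _ => abs_pdy_div_le hc hw (x, y)⟩
  have y3 := weakY_of_lipY cq1 Lq
  have dq := Lq.locallyIntegrable_pdy cq1
  have d1 := L1.locallyIntegrable_pdy cf1
  have d2 := L2.locallyIntegrable_pdy cf2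
  have hdiv : ∀ φ, IsTestH φ → ∫ p, (int₁ b σ1 σ2 p * pdx φ p + int₂ b σ1 σ2 p * pdy φ p) ∂muH
      = ∫ p, pump b σ1 σ2 p * φ p ∂muH := fun φ hφ => by
    have i1 := hφ.pdx.integrable_mul d1
    have i2 := hφ.pdx.integrable_mul d2
    have i3 := hφ.pdx.integrable_mul cq2.locallyIntegrable
    have i4 : Integrable (fun p => pdx σ2 p * (deriv b p.2)⁻¹ * pdy φ p) muH := hφ.pdy.integrable_mul (c2x.mul cI).locallyIntegrable
    have i5 : Integrable (fun p => pdy σ1 p * (deriv b p.2)⁻¹ * pdy φ p) muH := hφ.pdy.integrable_mul (c1y.mul cI).locallyIntegrable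
    have i6 := hφ.pdy.integrable_mul cq1.locallyIntegrable
    have i7 := hφ.integrable_mul cq₂x.locallyIntegrable
    have i8 := hφ.integrable_mul dq
    have e1 : ∫ p, (int₁ b σ1 σ2 p * pdx φ p + int₂ b σ1 σ2 p * pdy φ p) ∂muH
        = ∫ p, (pdy f1 p * pdx φ p - pdy f2 p * pdx φ p - σ2 p / b p.2 * pdx φ p
          + (pdx σ2 p * (deriv b p.2)⁻¹ * pdy φ p - pdy σ1 p * (deriv b p.2)⁻¹ * pdy φ p
            + σ1 p / b p.2 * pdy φ p)) ∂muH := by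
      refine integral_congr_ae ?_
      filter_upwards [ae_snd_ne_zero] with p hp
      rw [int₂_eq hb hc hw hp, int₁_eq]
      ring
    have e2 : ∫ p, pump b σ1 σ2 p * φ p ∂muH = ∫ p, (pdx σ2 p / b p.2 * φ p
        - pdy (fun q => σ1 q / b q.2) p * φ p) ∂muH :=
      integral_congr_ae (ae_of_all _ fun p => by simp only [pump]; ring)
    have z1 := y1 _ hφ.pdx
    have z2 := y2 _ hφ.pdx
    have z3 := x1 _ hφ.pdy
    have z4 := x2 _ hφ.pdy
    have z5 := x3 _ hφ
    have z6 := y3 _ hφ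
    simp only [pdx_pdy_comm (contDiff_infty.1 hφ.smooth 2)] at z3 z4
    rw [e1, e2, integral_sub i7 i8]
    have a1 : Integrable (fun p => pdy f1 p * pdx φ p - pdy f2 p * pdx φ p) muH := i1.sub i2
    have a2 : Integrable (fun p => pdx σ2 p * (deriv b p.2)⁻¹ * pdy φ p
      - pdy σ1 p * (deriv b p.2)⁻¹ * pdy φ p) muH := i4.sub i5
    have a3 : Integrable (fun p => pdy f1 p * pdx φ p - pdy f2 p * pdx φ p
      - σ2 p / b p.2 * pdx φ p) muH := a1.sub i3
    have a4 : Integrable (fun p => pdx σ2 p * (deriv b p.2)⁻¹ * pdy φ p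
      - pdy σ1 p * (deriv b p.2)⁻¹ * pdy φ p + σ1 p / b p.2 * pdy φ p) muH := a2.add i6
    rw [integral_add a3 a4, integral_add a2 i6, integral_sub a1 i3, integral_sub i1 i2,
      integral_sub i4 i5]
    linarith
  obtain ⟨A, hA0, hA⟩ := exists_conv_le_of_bdd (testDl 0)
  obtain ⟨B, hB0, hB'⟩ := exists_conv_le_of_bdd (testDl 0).pdy
  have bI : ∀ p : ℝ², |(deriv b p.2)⁻¹| ≤ c := fun p => (hc.abs_deriv_le p.2).2.2
  have m0 : ∀ p, |mol 0 (int₁ b σ1 σ2) p| ≤ B * (K * c) + B * (K * c) + A * (K * c) := fun p => by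
    have e : int₁ b σ1 σ2 = pdy f1 - pdy f2 - fun q => σ2 q / b q.2 := by
      funext q; rw [int₁_eq]; rfl
    rw [mol, e, conv_sub (testDl 0) (d1.sub d2) cq2.locallyIntegrable,
      conv_sub (testDl 0) d1 d2, ← conv_pdy (testDl 0) y1, ← conv_pdy (testDl 0) y2]
    have t1 := hB' f1 (K * c) (by
      filter_upwards [ae_muH_mem] with p hp
      rw [hf1, abs_mul]
      exact mul_le_mul (abs_pdy_zonalPrimitive_le s1 hw.flat₁y.le hp) (bI p) (abs_nonneg _) hK) p
    have t2 := hB' f2 (K * c) (ae_of_all _ fun p => by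
      rw [hf2, abs_mul]
      exact mul_le_mul (hw.flat2.le p) (bI p) (abs_nonneg _) hK) p
    have t3 := hA (fun q => σ2 q / b q.2) (K * c) (ae_of_all _ fun p => by
      simpa using hc.abs_div_le (m := 0) (j := 1) hK (hw.flat2.bound p 1 (by norm_num))) p
    refine (abs_sub _ _).trans (add_le_add ((abs_sub _ _).trans (add_le_add t1 t2)) t3)
  have b1 := exists_bound_of_lipschitz l1 hL lip1 m0
  have nn : 0 ≤ K * c := by positivity
  set M := (B * (K * c) + B * (K * c) + A * (K * c) + 2 * L) + 3 * (K * c)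
    + (2 * K * c + K * c ^ 3) with hM
  have q1 : 0 ≤ B * (K * c) + B * (K * c) + A * (K * c) + 2 * L := by positivity
  have q3 : 0 ≤ 2 * K * c + K * c ^ 3 := by positivity
  refine ⟨M, by positivity, hL, l1.aestronglyMeasurable, l2.aestronglyMeasurable,
    (measurable_pump hb hc hw).aestronglyMeasurable, b1.mono fun p h => by linarith,
    (abs_int₂_le hb hc hw).mono fun p h => by linarith,
    ae_of_all _ fun p => (abs_pump_le hb hc hw p).trans (by linarith), hdiv, lip1, lip2⟩

end InteriorField

/-! ## Potential gradients in `L²` -/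

section Potential

variable {ψ H1 H2 : F²}

lemma integral_sq_slice_le (hψ : ContDiff ℝ ∞ ψ) (my : MemLp (pdy ψ) 2 muH) :
    ∃ (a : ℝ → ℝ) (C : ℝ), Integrable a nu ∧ ∀ᵐ x ∂nu, ∀ y, ψ (x, y) ^ 2 ≤ C + 2 * |y| * a x := by
  have cψ := hψ.continuous
  have hi : Integrable (fun p => pdy ψ p ^ 2) (nu.prod volume) := by
    rw [← muH_eq]; exact my.integrable_sq
  obtain ⟨C0, hC0⟩ := (isCompact_Icc (a := (0:ℝ)) (b := 1)).exists_bound_of_continuousOn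
    (f := fun x => ψ (x, 0)) (by fun_prop)
  refine ⟨_, 2 * C0 ^ 2, hi.integral_prod_left, ?_⟩
  filter_upwards [ae_nu_mem, hi.prod_right_ae] with x hx hx2 y
  have cy : Continuous fun t => pdy ψ (x, t) :=
    (contDiff_pdy hψ (m := 0) (by simp)).continuous.comp (by fun_prop)
  have e : ψ (x, y) - ψ (x, 0) = ∫ t in (0:ℝ)..y, pdy ψ (x, t) :=
    (intervalIntegral.integral_eq_sub_of_hasDerivAt (f := fun t => ψ (x, t))
      (fun t _ => hasDerivAt_pdy (hψ.differentiable (by simp)) (x, t))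
      (cy.intervalIntegrable _ _)).symm
  have m : MemLp (fun t => pdy ψ (x, t)) 2 (volume.restrict (uIoc 0 y)) :=
    ((memLp_two_iff_integrable_sq cy.aestronglyMeasurable).2 hx2).restrict _
  have : IsFiniteMeasure (volume.restrict (uIoc 0 y)) := ⟨by simp [uIoc]⟩
  have m1 : MemLp (fun _ : ℝ => (1:ℝ)) 2 (volume.restrict (uIoc 0 y)) := memLp_const 1
  have h1 := integral_abs_mul_le m1 m
  have h2 : |ψ (x, y) - ψ (x, 0)| ≤ nrm (volume.restrict (uIoc 0 y)) (fun _ => (1:ℝ)) *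
      nrm (volume.restrict (uIoc 0 y)) (fun t => pdy ψ (x, t)) := by
    rw [e, ← norm_eq_abs]
    refine (intervalIntegral.norm_integral_le_integral_norm_uIoc).trans ?_
    simpa using h1
  have h3 : nrm (volume.restrict (uIoc 0 y)) (fun _ => (1:ℝ)) ^ 2 = |y| := by
    rw [nrm_sq m1]; simp [Measure.real, uIoc]
    rcases le_total 0 y with h | h <;> simp [h, abs_of_nonneg, abs_of_nonpos]
  have h4 : nrm (volume.restrict (uIoc 0 y)) (fun t => pdy ψ (x, t)) ^ 2 ≤
      ∫ t, pdy ψ (x, t) ^ 2 := by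
    rw [nrm_sq m]
    exact setIntegral_le_integral hx2 (ae_of_all _ fun t => sq_nonneg _)
  have h5 := pow_le_pow_left₀ (abs_nonneg _) h2 2
  rw [sq_abs, mul_pow, h3] at h5
  have h6 := mul_le_left h4 (abs_nonneg y)
  have h7 := pow_le_pow_left₀ (abs_nonneg _) (hC0 x (Ioo_subset_Icc_self hx)) 2
  rw [norm_eq_abs, sq_abs] at h7
  nlinarith [sq_nonneg (ψ (x, y) - 2 * ψ (x, 0))]

lemma exists_nrm_cutoff_bound (hψ : ContDiff ℝ ∞ ψ) (my : MemLp (pdy ψ) 2 muH) :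
    ∃ C : ℝ, ∀ n : ℕ, MemLp (fun p => deriv (cutY n) p.2 * ψ p) 2 muH ∧
      nrm muH (fun p => deriv (cutY n) p.2 * ψ p) ≤ C := by
  obtain ⟨a, C, ia, hψa⟩ := integral_sq_slice_le hψ my
  obtain ⟨B, hB, hcut⟩ := exists_deriv_cutY_bound
  set G : ℝ := ∫ x, (|C| + 2 * |a x|) ∂nu
  have iG : Integrable (fun x => |C| + 2 * |a x|) nu := (integrable_const _).add (ia.abs.const_mul 2)
  have hG : 0 ≤ G := integral_nonneg fun x => by positivity
  refine ⟨√(B ^ 2 * (18 * G)), fun n => ?_⟩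
  set N : ℝ := n + 1
  have hN : 1 ≤ N := by simp [N]
  set S : Set ℝ := Icc (-(3 * N)) (3 * N)
  have dcut : Continuous (deriv (cutY n)) := (contDiff_cutY n).continuous_deriv (by simp)
  have hm : AESM (fun p : ℝ² => deriv (cutY n) p.2 * ψ p) muH :=
    ((dcut.comp continuous_snd).mul hψ.continuous).aestronglyMeasurable
  have hz : ∀ y ∉ S, deriv (cutY n) y = 0 := fun y hy => by
    refine eq_zero_of_le_abs_deriv (R := 2 * N) (fun t ht => cutY_eq_zero ht) ?_
    have : 3 * N < |y| := by
      by_contra h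
      exact hy (abs_le.1 (not_lt.1 h))
    linarith
  have iS : Integrable (S.indicator fun _ => (1:ℝ)) volume :=
    (integrable_indicator_iff measurableSet_Icc).2 (integrableOn_const (by simp))
  have iP := (iG.mul_prod iS).const_mul (B ^ 2 / N ^ 2 * (3 * N))
  rw [← muH_eq] at iP
  have hle : ∀ᵐ p ∂muH, (deriv (cutY n) p.2 * ψ p) ^ 2 ≤
      B ^ 2 / N ^ 2 * (3 * N) * ((|C| + 2 * |a p.1|) * S.indicator (fun _ => (1:ℝ)) p.2) := by
    rw [muH_eq]
    filter_upwards [Measure.quasiMeasurePreserving_fst.ae hψa] with p hp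
    by_cases hy : p.2 ∈ S
    · have h1 := hcut n p.2
      have h2 := pow_le_pow_left₀ (abs_nonneg _) h1 2
      rw [sq_abs, div_pow] at h2
      have h3 : |p.2| ≤ 3 * N := abs_le.2 hy
      have h4 : ψ p ^ 2 ≤ 3 * N * (|C| + 2 * |a p.1|) := by
        refine (hp p.2).trans ?_
        have q1 : |p.2| * a p.1 ≤ 3 * N * |a p.1| :=
          (mul_le_left (le_abs_self _) (abs_nonneg _)).trans (by gcongr)
        nlinarith [le_abs_self C, abs_nonneg C]
      rw [indicator_of_mem hy, mul_one, mul_pow, mul_assoc]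
      exact mul_le_mul h2 h4 (sq_nonneg _) (by positivity)
    · rw [hz _ hy, indicator_of_notMem hy]; simp
  have isq : Integrable (fun p : ℝ² => (deriv (cutY n) p.2 * ψ p) ^ 2) muH :=
    iP.mono' (hm.pow 2) (hle.mono fun p hp => by rwa [norm_of_nonneg (sq_nonneg _)])
  have mm := (memLp_two_iff_integrable_sq hm).2 isq
  refine ⟨mm, le_sqrt_of_sq_le ?_⟩
  rw [nrm_sq mm]
  refine (integral_mono_ae isq iP hle).trans ?_
  have e : ∫ p, (|C| + 2 * |a p.1|) * S.indicator (fun _ => (1:ℝ)) p.2 ∂muH = G * (6 * N) := by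
    rw [muH_eq, integral_prod_mul (fun x => |C| + 2 * |a x|), integral_indicator measurableSet_Icc]
    simp only [integral_const, smul_eq_mul, mul_one, Measure.real, Measure.restrict_apply_univ,
      volume_Icc]
    rw [ENNReal.toReal_ofReal (by linarith)]
    ring
  rw [integral_const_mul, e]
  have : B ^ 2 / N ^ 2 * (3 * N) * (G * (6 * N)) = B ^ 2 * (18 * G) := by
    field_simp; ring
  exact this.le

lemma integral_mul_gradient_eq_zero (hψ : ContDiff ℝ ∞ ψ) (hp : ∀ x y, ψ (x + 1, y) = ψ (x, y))
    (mx : MemLp (pdx ψ) 2 muH) (my : MemLp (pdy ψ) 2 muH) (m1 : MemLp H1 2 muH)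
    (m2 : MemLp H2 2 muH)
    (h : ∀ φ, IsTestH φ → ∫ p, (H1 p * pdx φ p + H2 p * pdy φ p) ∂muH = 0) :
    ∫ p, (H1 p * pdx ψ p + H2 p * pdy ψ p) ∂muH = 0 := by
  obtain ⟨C, hC⟩ := exists_nrm_cutoff_bound hψ my
  have dψ := hψ.differentiable (by simp)
  have cc : ∀ n, ContDiff ℝ ∞ fun p : ℝ² => cutY n p.2 := fun n => (contDiff_cutY n).comp contDiff_snd
  have ht : ∀ n : ℕ, IsTestH fun p => cutY n p.2 * ψ p := fun n =>
    ⟨(cc n).mul hψ, fun x y => by simp only [hp], 2 * ((n:ℝ) + 1), fun x y hy => by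
      simp only [cutY_eq_zero hy, zero_mul]⟩
  have ex : ∀ n p, pdx (fun p => cutY n p.2 * ψ p) p = cutY n p.2 * pdx ψ p := fun n p =>
    ((hasDerivAt_pdx dψ p).const_mul (cutY n p.2)).deriv
  have ey : ∀ n p, pdy (fun p => cutY n p.2 * ψ p) p
      = deriv (cutY n) p.2 * ψ p + cutY n p.2 * pdy ψ p := fun n p =>
    ((((contDiff_cutY n).differentiable (by simp)) p.2).hasDerivAt.mul (hasDerivAt_pdy dψ p)).deriv
  have iI : Integrable (fun p => H1 p * pdx ψ p + H2 p * pdy ψ p) muH :=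
    (int_mul m1 mx).add (int_mul m2 my)
  have ec : ∀ n : ℕ, ∫ p, cutY n p.2 * (H1 p * pdx ψ p + H2 p * pdy ψ p) ∂muH
      = -∫ p, H2 p * (deriv (cutY n) p.2 * ψ p) ∂muH := fun n => by
    have i1 := int_mul m2 (hC n).1
    have i2 : Integrable (fun p => cutY n p.2 * (H1 p * pdx ψ p + H2 p * pdy ψ p)) muH :=
      iI.bdd_mul (c := 1) (cc n).continuous.aestronglyMeasurable
        (ae_of_all _ fun p => abs_cutY_le_one n p.2)
    have := h _ (ht n)
    simp only [ex, ey] at this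
    rw [eq_neg_iff_add_eq_zero, ← integral_add i2 i1, ← this]
    congr 1; funext p; ring
  have l1 : Tendsto (fun n : ℕ => ∫ p, cutY n p.2 * (H1 p * pdx ψ p + H2 p * pdy ψ p) ∂muH) atTop
      (𝓝 (∫ p, (H1 p * pdx ψ p + H2 p * pdy ψ p) ∂muH)) := by
    refine tendsto_integral_of_dominated_convergence (fun p => |H1 p * pdx ψ p + H2 p * pdy ψ p|)
      (fun n => (cc n).continuous.aestronglyMeasurable.mul iI.1) iI.abs
      (fun n => ae_of_all _ fun p => ?_) (ae_of_all _ fun p => ?_)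
    · rw [norm_eq_abs, abs_mul]
      exact mul_le_of_le_one_left (abs_nonneg _) (abs_cutY_le_one n p.2)
    · simpa using (tendsto_cutY p.2).mul_const (H1 p * pdx ψ p + H2 p * pdy ψ p)
  set T : ℕ → F² := fun n p => {p : ℝ² | (n:ℝ) ≤ |p.2|}.indicator H2 p
  have hT : ∀ n : ℕ, MeasurableSet {p : ℝ² | (n:ℝ) ≤ |p.2|} := fun n =>
    measurableSet_le (by fun_prop) (by fun_prop)
  have mT : ∀ n, MemLp (T n) 2 muH := fun n => m2.indicator (hT n)
  have l2 : Tendsto (fun n => nrm muH (T n)) atTop (𝓝 0) := by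
    refine tendsto_nrm_zero_of_dominated m2 (.of_forall fun n => (mT n).1)
      (.of_forall fun n => ae_of_all _ fun p => ?_) (ae_of_all _ fun p => ?_)
    · exact norm_indicator_le_norm_self H2 p
    · obtain ⟨n0, hn0⟩ := exists_nat_gt |p.2|
      refine tendsto_const_nhds.congr' ?_
      filter_upwards [eventually_ge_atTop n0] with n hn
      have : (n0:ℝ) ≤ n := by exact_mod_cast hn
      exact (indicator_of_notMem (by simp; linarith) _).symm
  have l3 : Tendsto (fun n : ℕ => ∫ p, H2 p * (deriv (cutY n) p.2 * ψ p) ∂muH) atTop (𝓝 0) := by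
    refine squeeze_zero_norm (a := fun n => nrm muH (T n) * C) (fun n => ?_)
      (by simpa using l2.mul_const C)
    have e : ∀ p : ℝ², H2 p * (deriv (cutY n) p.2 * ψ p) = T n p * (deriv (cutY n) p.2 * ψ p) := by
      intro p
      by_cases hpn : (n:ℝ) ≤ |p.2|
      · simp only [T]; rw [indicator_of_mem (by exact hpn)]
      · have : deriv (cutY n) p.2 = 0 := by
          have : cutY n =ᶠ[𝓝 p.2] fun _ => 1 := by
            filter_upwards [(isOpen_lt continuous_abs continuous_const).mem_nhds
              (show |p.2| < (n:ℝ) by linarith)] with t ht'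
            have : |t| < n := ht'
            exact cutY_eq_one (by linarith)
          rw [this.deriv_eq]; simp
        rw [this]; simp
    simp only [e]
    exact (abs_integral_mul_le (mT n) (hC n).1).trans (by gcongr; exacts [nrm_nonneg _, (hC n).2])
  simp only [ec] at l1
  simpa using tendsto_nhds_unique l1 l3.neg

lemma nrm_add_nrm_le_of_potential {χ g1 g2 F1 F2 : F²} (hχ : LocallyIntegrable χ muH)
    (wx : WeakX χ g1) (wy : WeakY χ g2) (mg1 : MemLp g1 2 muH) (mg2 : MemLp g2 2 muH)
    (mF1 : MemLp F1 2 muH) (mF2 : MemLp F2 2 muH)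
    (h : ∀ φ, IsTestH φ → ∫ p, (g1 p * pdx φ p + g2 p * pdy φ p) ∂muH =
      ∫ p, (F1 p * pdx φ p + F2 p * pdy φ p) ∂muH) :
    nrm muH g1 + nrm muH g2 ≤ 2 * (nrm muH F1 + nrm muH F2) := by
  have hk := testDl
  have mm : ∀ {g}, MemLp g 2 muH → ∀ n, MemLp (mol n g) 2 muH := fun hg n => memLp_conv (hk n) hg
  have m1 := mg1.sub mF1
  have m2 := mg2.sub mF2
  have h0 : ∀ φ, IsTestH φ → ∫ p, ((g1 - F1) p * pdx φ p + (g2 - F2) p * pdy φ p) ∂muH = 0 :=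
    fun φ hφ => by
    have i1 := (int_mul mg1 hφ.pdx.memLp).add (int_mul mg2 hφ.pdy.memLp)
    have i2 := (int_mul mF1 hφ.pdx.memLp).add (int_mul mF2 hφ.pdy.memLp)
    rw [← sub_eq_zero.2 (h φ hφ), ← integral_sub (by exact i1) (by exact i2)]
    congr 1; funext p; simp only [Pi.sub_apply]; ring
  have key : ∀ n, ∫ p, ((g1 - F1) p * mol n g1 p + (g2 - F2) p * mol n g2 p) ∂muH = 0 := fun n => by
    have ex : pdx (mol n χ) = mol n g1 := by
      rw [mol, mol, ← conv_pdx (hk n) wx]; exact funext fun p => pdx_conv (hk n) hχ p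
    have ey : pdy (mol n χ) = mol n g2 := by
      rw [mol, mol, ← conv_pdy (hk n) wy]; exact funext fun p => pdy_conv (hk n) hχ p
    have := integral_mul_gradient_eq_zero (contDiff_conv (hk n) hχ) (conv_periodic (hk n) χ)
      (by rw [← mol, ex]; exact mm mg1 n) (by rw [← mol, ey]; exact mm mg2 n) m1 m2 h0
    rwa [← mol, ex, ey] at this
  have lim : ∀ {H g : F²}, MemLp H 2 muH → MemLp g 2 muH →
      Tendsto (fun n => ∫ p, H p * mol n g p ∂muH) atTop (𝓝 (∫ p, H p * g p ∂muH)) := by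
    intro H g mH mg
    rw [tendsto_iff_norm_sub_tendsto_zero]
    have l := (tendsto_nrm_zero (tendsto_mol_sub mg)).const_mul (nrm muH H)
    rw [mul_zero] at l
    refine squeeze_zero (fun _ => norm_nonneg _) (fun n => ?_) l
    rw [← integral_sub (int_mul mH (mm mg n)) (int_mul mH mg)]
    simp only [← mul_sub]
    exact abs_integral_mul_le mH ((mm mg n).sub mg)
  have e : ∫ p, (g1 - F1) p * g1 p ∂muH + ∫ p, (g2 - F2) p * g2 p ∂muH = 0 := by
    refine tendsto_nhds_unique ((lim m1 mg1).add (lim m2 mg2)) (tendsto_const_nhds.congr fun n => ?_)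
    rw [← integral_add (int_mul m1 (mm mg1 n)) (int_mul m2 (mm mg2 n)), key]
  have sq : ∀ {g F : F²}, MemLp g 2 muH → MemLp F 2 muH →
      nrm muH g ^ 2 - nrm muH F * nrm muH g ≤ ∫ p, (g - F) p * g p ∂muH := by
    intro g F mg mF
    have e : ∫ p, (g - F) p * g p ∂muH = nrm muH g ^ 2 - ∫ p, F p * g p ∂muH := by
      rw [nrm_sq mg, ← integral_sub mg.integrable_sq (int_mul mF mg)]
      congr 1; funext p; simp only [Pi.sub_apply]; ring
    rw [e]
    linarith [le_abs_self (∫ p, F p * g p ∂muH), abs_integral_mul_le mF mg]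
  have s1 := sq mg1 mF1
  have s2 := sq mg2 mF2
  have n1 := nrm_nonneg (μ := muH) g1
  have n2 := nrm_nonneg (μ := muH) g2
  have n3 := nrm_nonneg (μ := muH) F1
  have n4 := nrm_nonneg (μ := muH) F2
  by_contra hlt
  nlinarith [sq_nonneg (nrm muH g1 - nrm muH g2), not_le.1 hlt, mul_nonneg n1 n4, mul_nonneg n2 n3]

end Potential

/-! ## Divergence of a field with a vertical primitive -/

section Divergence

variable {Φ : F³}

lemma fderiv_fderiv_comm (hΦ : ContDiff ℝ ∞ Φ) (P u v : ℝ³) :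
    fderiv ℝ (fun Q => fderiv ℝ Φ Q u) P v = fderiv ℝ (fun Q => fderiv ℝ Φ Q v) P u := by
  have df : DifferentiableAt ℝ (fderiv ℝ Φ) P :=
    ((hΦ.fderiv_right (m := ∞) (by simp)).differentiable (by simp)) P
  rw [fderiv_clm_apply df (differentiableAt_const _), fderiv_clm_apply df (differentiableAt_const _)]
  simpa using ((contDiff_infty.1 hΦ 2).contDiffAt.isSymmSndFDerivAt (by simp)).eq v u

lemma dX_dZ_comm (hΦ : ContDiff ℝ ∞ Φ) (P : ℝ³) : dZ (dX Φ) P = dX (dZ Φ) P := by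
  have d := hΦ.differentiable (by simp)
  rw [dZ_eq_fderiv ((contDiff_dX hΦ).differentiable (by simp)),
    dX_eq_fderiv ((contDiff_dZ hΦ).differentiable (by simp)), funext (dX_eq_fderiv d),
    funext (dZ_eq_fderiv d), fderiv_fderiv_comm hΦ]

lemma dY_dZ_comm (hΦ : ContDiff ℝ ∞ Φ) (P : ℝ³) : dZ (dY Φ) P = dY (dZ Φ) P := by
  have d := hΦ.differentiable (by simp)
  rw [dZ_eq_fderiv ((contDiff_dY hΦ).differentiable (by simp)),
    dY_eq_fderiv ((contDiff_dZ hΦ).differentiable (by simp)), funext (dY_eq_fderiv d),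
    funext (dZ_eq_fderiv d), fderiv_fderiv_comm hΦ]

lemma integral_vertical_primitive {V A G : F³} (hG : IsTest G)
    (h1 : ∀ p, G (p, 1) = 0) (i1 : Integrable (fun P => A P * G P) muO)
    (i2 : Integrable (fun P => V P * dZ G P) muO)
    (hd : ∀ p z, HasDerivAt (fun z => V (p, z)) (A (p, z)) z) (hc : ∀ p, Continuous fun z => A (p, z)) :
    ∫ P, A P * G P ∂muO + ∫ P, V P * dZ G P ∂muO = -∫ p, V (p, 0) * G (p, 0) ∂muH := by
  rw [← integral_add i1 i2, integral_muO' (by exact i1.add i2), ← integral_neg]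
  congr 1; funext p
  have e := intervalIntegral.integral_eq_sub_of_hasDerivAt (a := 0) (b := 1)
    (f := fun z => V (p, z) * G (p, z))
    (f' := fun z => A (p, z) * G (p, z) + V (p, z) * dZ G (p, z))
    (fun z _ => (hd p z).mul (hasDerivAt_dZ hG.diff (p, z))) (by
      have c1 := hc p
      have c2 : Continuous fun z => V (p, z) :=
        continuous_iff_continuousAt.2 fun z => (hd p z).continuousAt
      have c3 := hG.smooth.continuous
      have c4 := hG.dZ.smooth.continuous
      exact (((c1.mul (c3.comp (Continuous.prodMk_right p))).add
        (c2.mul (c4.comp (Continuous.prodMk_right p))))).intervalIntegrable _ _)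
  rw [intervalIntegral.integral_of_le zero_le_one, ← integral_Ioc_eq_integral_Ioo.symm, h1] at e
  simpa [nu] using e

lemma integral_div_of_primitive {V1 V2 A1 A2 D : F³} {f g1 g2 : F²} {C : ℝ}
    (mV1 : AESM V1 muO) (mV2 : AESM V2 muO)
    (mA1 : AESM A1 muO) (mA2 : AESM A2 muO)
    (mD : AESM D muO) (bV1 : ∀ᵐ P ∂muO, |V1 P| ≤ C) (bV2 : ∀ᵐ P ∂muO, |V2 P| ≤ C)
    (bA1 : ∀ᵐ P ∂muO, |A1 P| ≤ C) (bA2 : ∀ᵐ P ∂muO, |A2 P| ≤ C) (bD : ∀ᵐ P ∂muO, |D P| ≤ C)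
    (d1 : ∀ p z, HasDerivAt (fun z => V1 (p, z)) (A1 (p, z)) z)
    (d2 : ∀ p z, HasDerivAt (fun z => V2 (p, z)) (A2 (p, z)) z)
    (c1 : ∀ p, Continuous fun z => A1 (p, z)) (c2 : ∀ p, Continuous fun z => A2 (p, z))
    (hdiv : ∀ z ∈ Ico (0:ℝ) 1, ∀ φ, IsTestH φ →
      ∫ p, (V1 (p, z) * pdx φ p + V2 (p, z) * pdy φ p) ∂muH = -∫ p, D (p, z) * φ p ∂muH)
    (mF1 : MemLp (fun p => V1 (p, 0)) 2 muH) (mF2 : MemLp (fun p => V2 (p, 0)) 2 muH)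
    (mf : MemLp f 2 muH) (mg1 : MemLp g1 2 muH) (mg2 : MemLp g2 2 muH) (hf : ∀ p, f p = D (p, 0))
    (pot : ∀ φ, IsTestH φ → ∫ p, (g1 p * pdx φ p + g2 p * pdy φ p) ∂muH = -∫ p, f p * φ p ∂muH)
    (hΦ : IsTest Φ) (h1 : ∀ p, Φ (p, 1) = 0) :
    ∫ P, ((A1 P + g1 P.1) * dX Φ P + (A2 P + g2 P.1) * dY Φ P
      + (-D P + (1 - P.2) * f P.1) * dZ Φ P) ∂muO = 0 := by
  have hX := hΦ.dX
  have hY := hΦ.dY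
  have hZ := hΦ.dZ
  have iA1 := hX.integrable.bdd_mul (c := C) mA1 bA1
  have iA2 := hY.integrable.bdd_mul (c := C) mA2 bA2
  have iD := hZ.integrable.bdd_mul (c := C) mD bD
  have iV1 := hX.dZ.integrable.bdd_mul (c := C) mV1 bV1
  have iV2 := hY.dZ.integrable.bdd_mul (c := C) mV2 bV2
  have ig1 := int_mul (memLp_comp_fst mg1) hX.memLp
  have ig2 := int_mul (memLp_comp_fst mg2) hY.memLp
  have if0 := int_mul (memLp_comp_fst mf) hΦ.memLp
  have hW : IsTest fun P => (1 - P.2) * Φ P :=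
    hΦ.mul_smooth (contDiff_const.sub contDiff_snd) fun _ _ _ => rfl
  have eW : ∀ P, dZ (fun P => (1 - P.2) * Φ P) P = -Φ P + (1 - P.2) * dZ Φ P := fun P => by
    have := (((hasDerivAt_id P.2).const_sub 1).mul (hasDerivAt_dZ hΦ.diff P)).deriv
    rw [neg_one_mul] at this
    exact this
  have ifW := int_mul (memLp_comp_fst mf) hW.dZ.memLp
  have x1 : ∀ p, dX Φ (p, 1) = 0 := fun p => by simp [dX, h1]
  have y1 : ∀ p, dY Φ (p, 1) = 0 := fun p => by simp [dY, h1]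
  have p1 := integral_vertical_primitive hX x1 iA1 iV1 d1 c1
  have p2 := integral_vertical_primitive hY y1 iA2 iV2 d2 c2
  have eD : ∫ P, D P * dZ Φ P ∂muO
      = -(∫ P, V1 P * dZ (dX Φ) P ∂muO + ∫ P, V2 P * dZ (dY Φ) P ∂muO) := by
    rw [← integral_add iV1 iV2, integral_muO iD, integral_muO (by exact iV1.add iV2), ← integral_neg]
    refine integral_congr_ae ?_
    filter_upwards [ae_nu_mem] with z hz
    have := hdiv z ⟨hz.1.le, hz.2⟩ _ (hZ.slice z)
    simp only [dX_dZ_comm hΦ.smooth, dY_dZ_comm hΦ.smooth]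
    rw [← neg_eq_iff_eq_neg.2 this]
    rfl
  have e0 : ∫ p, V1 (p, 0) * dX Φ (p, 0) ∂muH + ∫ p, V2 (p, 0) * dY Φ (p, 0) ∂muH
      = -∫ p, f p * Φ (p, 0) ∂muH := by
    have := hdiv 0 ⟨le_rfl, zero_lt_one⟩ _ (hΦ.slice 0)
    simp only [← hf] at this
    rw [← this]
    exact (integral_add (int_mul mF1 (hX.slice 0).memLp) (int_mul mF2 (hY.slice 0).memLp)).symm
  have eg : ∫ P, g1 P.1 * dX Φ P ∂muO + ∫ P, g2 P.1 * dY Φ P ∂muO = -∫ P, f P.1 * Φ P ∂muO := by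
    rw [← integral_add ig1 ig2, integral_muO (by exact ig1.add ig2), integral_muO if0, ← integral_neg]
    congr 1; funext z
    exact pot _ (hΦ.slice z)
  have ef : ∫ P, f P.1 * dZ (fun P => (1 - P.2) * Φ P) P ∂muO = -∫ p, f p * Φ (p, 0) ∂muH := by
    rw [integral_muO' ifW, ← integral_neg]
    congr 1; funext p
    refine (integral_const_mul (f p) fun z => dZ (fun P => (1 - P.2) * Φ P) (p, z)).trans ?_
    rw [integral_dZ_nu hW]
    simp
  have tot : ∫ P, ((A1 P + g1 P.1) * dX Φ P + (A2 P + g2 P.1) * dY Φ P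
      + (-D P + (1 - P.2) * f P.1) * dZ Φ P) ∂muO
      = (∫ P, A1 P * dX Φ P ∂muO + ∫ P, g1 P.1 * dX Φ P ∂muO)
        + (∫ P, A2 P * dY Φ P ∂muO + ∫ P, g2 P.1 * dY Φ P ∂muO)
        + ((∫ P, f P.1 * dZ (fun P => (1 - P.2) * Φ P) P ∂muO + ∫ P, f P.1 * Φ P ∂muO)
          - ∫ P, D P * dZ Φ P ∂muO) := by
    rw [← integral_add iA1 ig1, ← integral_add iA2 ig2, ← integral_add ifW if0,
      ← integral_sub (by exact ifW.add if0) iD,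
      ← integral_add_three (by exact iA1.add ig1) (by exact iA2.add ig2)
        (by exact (ifW.add if0).sub iD)]
    congr 1; funext P; rw [eW]; ring
  rw [tot]
  linarith

end Divergence

/-! ## The boundary layer profiles -/

section Profiles

open Complex (I)

lemma sumPM_eq (F : ℝ → ℂ) : sumPM F = (F 1).re + (F (-1)).re := Complex.add_re _ _

lemma abs_sumPM_le {F : ℝ → ℂ} {C : ℝ} (h : ∀ s : ℝ, s ^ 2 = 1 → ‖F s‖ ≤ C) :
    |sumPM F| ≤ 2 * C :=
  ((Complex.abs_re_le_norm _).trans (norm_add_le _ _)).trans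
    (by linarith [h 1 (by norm_num), h (-1) (by norm_num)])

lemma sumPM_congr {F G : ℝ → ℂ} (h : ∀ s : ℝ, s ^ 2 = 1 → F s = G s) : sumPM F = sumPM G := by
  rw [sumPM, sumPM, h 1 (by norm_num), h (-1) (by norm_num)]

lemma hasDerivAt_sumPM {F : ℝ → ℝ → ℂ} {F' : ℝ → ℂ} {t : ℝ}
    (h : ∀ s : ℝ, s ^ 2 = 1 → HasDerivAt (fun t => F t s) (F' s) t) :
    HasDerivAt (fun t => sumPM (F t)) (sumPM F') t := by
  have := (h 1 (by norm_num)).add (h (-1) (by norm_num))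
  exact Complex.reCLM.hasFDerivAt.comp_hasDerivAt t this

variable {b : ℝ → ℝ} {c K ε s : ℝ} {r : ℂ} {σ1 σ2 a1 a2 : F²}

lemma rate_eq (y : ℝ) : rate b s y = ⟨√|b y| / √2, -(s * sign (b y)) * (√|b y| / √2)⟩ := by
  have h2 : (√2 : ℝ) ≠ 0 := by positivity
  have : rate b s y = (1 - ((s * sign (b y) : ℝ) : ℂ) * I) * ((√|b y| / √2 : ℝ) : ℂ) := by
    rw [rate]; push_cast; ring
  rw [this]
  apply Complex.ext <;> simp

lemma sign_sq {x : ℝ} (hx : x ≠ 0) : sign x ^ 2 = 1 := by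
  rcases sign_apply_eq_of_ne_zero x hx with h | h <;> simp [h]

/-- Admissible values of the decay rates. -/
def IsRate (r : ℂ) : Prop := 0 < ‖r‖ ∧ ‖r‖ ≤ 2 * r.re

lemma norm_rate_sq (hs : s ^ 2 = 1) {y : ℝ} (hy : b y ≠ 0) : ‖rate b s y‖ ^ 2 = |b y| := by
  rw [Complex.sq_norm, rate_eq, Complex.normSq_apply]
  have h2 := sq_sqrt (show (0:ℝ) ≤ 2 by norm_num)
  have h1 := sq_sqrt (abs_nonneg (b y))
  have h3 := sign_sq hy
  simp only
  rw [show √|b y| / √2 * (√|b y| / √2) + -(s * sign (b y)) * (√|b y| / √2) *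
    (-(s * sign (b y)) * (√|b y| / √2))
    = √|b y| ^ 2 / √2 ^ 2 * (1 + s ^ 2 * sign (b y) ^ 2) by ring, h1, h2, h3, hs]
  ring

lemma isRate_rate (hs : s ^ 2 = 1) {y : ℝ} (hy : b y ≠ 0) : IsRate (rate b s y) := by
  have h := norm_rate_sq hs hy
  have hb : 0 < |b y| := abs_pos.2 hy
  have hre : (rate b s y).re = √|b y| / √2 := by rw [rate_eq]
  have h0 : 0 < (rate b s y).re := by rw [hre]; positivity
  refine ⟨(norm_nonneg _).lt_of_ne' fun h' => by rw [h'] at h; exact hb.ne (by simpa using h), ?_⟩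
  refine abs_le_of_sq_le_sq' ?_ (by positivity) |>.2
  rw [h, mul_pow, hre, div_pow, sq_sqrt hb.le, sq_sqrt (by norm_num)]
  linarith

lemma IsRate.ne_zero (h : IsRate r) : r ≠ 0 := norm_pos_iff.1 h.1

lemma hasDerivAt_rate (hb : IsCoriolis b) (hs : s ^ 2 = 1) {y : ℝ} (hy : b y ≠ 0) :
    HasDerivAt (rate b s) (-(s * I) * deriv b y / (2 * rate b s y)) y := by
  have hr := (isRate_rate hs hy).ne_zero
  have h2 : ((√2 : ℝ) : ℂ) ≠ 0 := by exact_mod_cast (show (√2 : ℝ) ≠ 0 by positivity)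
  have hq : ((√|b y| : ℝ) : ℂ) ≠ 0 := by
    exact_mod_cast (sqrt_pos.2 (abs_pos.2 hy)).ne'
  set S : ℝ := sign (b y)
  have hS : (S:ℂ) ^ 2 = 1 := by exact_mod_cast sign_sq hy
  have hs' : (s:ℂ) ^ 2 = 1 := by exact_mod_cast hs
  have habs : |b y| = S * b y := by
    rcases hy.lt_or_gt with h | h
    · simp [S, sign_of_neg h, abs_of_neg h]
    · simp [S, sign_of_pos h, abs_of_pos h]
  have ev : ∀ᶠ t in 𝓝 y, rate b s t = (1 - (s:ℂ) * I * (S:ℂ)) / (√2 : ℝ) * (√(S * b t) : ℝ) := by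
    rcases hy.lt_or_gt with h | h
    · filter_upwards [hb.diff.continuous.continuousAt.eventually_lt_const h] with t ht
      simp only [rate, S, sign_of_neg h, sign_of_neg ht, abs_of_neg ht, neg_one_mul]
    · filter_upwards [hb.diff.continuous.continuousAt.eventually_const_lt h] with t ht
      simp only [rate, S, sign_of_pos h, sign_of_pos ht, abs_of_pos ht, one_mul]
  have hd := (((hb.diff y).hasDerivAt.const_mul S).sqrt (by rw [← habs]; positivity)).ofReal_comp
  refine ((hd.const_mul ((1 - (s:ℂ) * I * (S:ℂ)) / (√2 : ℝ))).congr_of_eventuallyEq ev).congr_deriv ?_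
  rw [eq_div_iff (by simpa using hr), ev.self_of_nhds, ← habs]
  push_cast
  field_simp
  have h22 : ((√2 : ℝ) : ℂ) ^ 2 = 2 := by
    exact_mod_cast sq_sqrt (show (0:ℝ) ≤ 2 by norm_num)
  have hI : I ^ 2 = -1 := Complex.I_sq
  set d : ℂ := ((deriv b y : ℝ) : ℂ)
  linear_combination (-2 * s * I * d + S * d * s ^ 2 * I ^ 2) * hS + S * d * I ^ 2 * hs'
    + S * d * hI + s * I * d * h22

/-! ### Bounds for the kernels -/

lemma IsRate.norm_exp_le (h : IsRate r) {τ : ℝ} (hτ : 0 < τ) (n : ℕ) :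
    ‖Complex.exp (-r * τ)‖ ≤ n.factorial * 2 ^ n * (‖r‖⁻¹ * τ⁻¹) ^ n := by
  obtain ⟨h0, h1⟩ := h
  have e : (-r * (τ:ℂ)).re = -(r.re * τ) := by simp
  rw [Complex.norm_exp, e]
  have h2 := pow_div_factorial_le_exp (‖r‖ * τ / 2) (by positivity) n
  have h3 : exp (‖r‖ * τ / 2) ≤ exp (r.re * τ) := exp_le_exp.2 (by nlinarith)
  rw [exp_neg, show (n.factorial : ℝ) * 2 ^ n * (‖r‖⁻¹ * τ⁻¹) ^ n
    = ((‖r‖ * τ / 2) ^ n / n.factorial)⁻¹ by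
      rw [inv_div, div_pow, mul_pow, mul_pow, inv_pow, inv_pow]; field_simp]
  exact inv_anti₀ (by positivity) (h2.trans h3)

/-- The kernel of the vertical primitive of the layer, as a function of the decay rate. -/
def kap (ε t : ℝ) (r : ℂ) : ℂ := 1 / 2 * (r⁻¹) ^ 2 * Complex.exp (-r * (t / ε : ℝ))
    - (t ^ 3 / (12 * ε ^ 2) : ℝ) * Complex.exp (-r * (1 / ε : ℝ))

/-- The derivative of the kernel in the decay rate. -/
def kap' (ε t : ℝ) (r : ℂ) : ℂ := -(r⁻¹) ^ 3 * Complex.exp (-r * (t / ε : ℝ))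
    - 1 / 2 * (r⁻¹) ^ 2 * ((t / ε : ℝ) * Complex.exp (-r * (t / ε : ℝ)))
    + (t ^ 3 / (12 * ε ^ 3) : ℝ) * Complex.exp (-r * (1 / ε : ℝ))

/-- The kernel of the horizontal layer velocity. -/
def kz (ε t : ℝ) (r : ℂ) : ℂ :=
  (1 / (2 * ε) : ℝ) * r⁻¹ * Complex.exp (-r * (t / ε : ℝ))
    + (t ^ 2 / (4 * ε ^ 2) : ℝ) * Complex.exp (-r * (1 / ε : ℝ))

lemma hasDerivAt_kap (hr : r ≠ 0) (t : ℝ) : HasDerivAt (kap ε t) (kap' ε t r) r := by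
  have e : ∀ τ : ℝ, HasDerivAt (fun r : ℂ => Complex.exp (-r * τ))
      (Complex.exp (-r * τ) * (-1 * τ)) r := fun τ => ((hasDerivAt_id r).neg.mul_const _).cexp
  have hi := (((hasDerivAt_inv hr).fun_pow 2).const_mul (1 / 2 : ℂ)).mul (e (t / ε))
  refine (hi.sub ((e (1 / ε)).const_mul ((t ^ 3 / (12 * ε ^ 2) : ℝ) : ℂ))).congr_deriv ?_
  simp only [kap']
  push_cast
  field_simp
  ring

lemma hasDerivAt_kap_z (r : ℂ) (z : ℝ) :
    HasDerivAt (fun z : ℝ => kap ε (1 - z) r) (kz ε (1 - z) r) z := by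
  have h1 : HasDerivAt (fun z : ℝ => 1 - z) (-1) z := (hasDerivAt_id z).const_sub 1
  have e := ((h1.div_const ε).ofReal_comp.const_mul (-r)).cexp.const_mul (1 / 2 * (r⁻¹) ^ 2)
  have e2 := ((h1.pow 3).div_const (12 * ε ^ 2)).ofReal_comp.mul_const
    (Complex.exp (-r * (1 / ε : ℝ)))
  refine (e.sub e2).congr_deriv ?_
  simp only [kz]
  push_cast
  rcases eq_or_ne r 0 with rfl | hr
  · simp; ring
  · field_simp
    ring

lemma pow_inv_le {ρ : ℝ} (h : 0 < ρ) {j : ℕ} (hj : j ≤ 8) : (ρ⁻¹) ^ j ≤ 1 + (ρ⁻¹) ^ 8 := by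
  rcases le_total ρ⁻¹ 1 with h1 | h1
  · linarith [pow_le_one₀ (n := j) (inv_nonneg.2 h.le) h1, pow_pos (inv_pos.2 h) 8]
  · linarith [pow_le_pow_right₀ h1 hj]

lemma factorial_bound {n : ℕ} (hn : n ≤ 5) : (n.factorial : ℝ) * 2 ^ n ≤ 3840 := by
  interval_cases n <;> norm_num [Nat.factorial]

lemma IsRate.norm_kap_le (h : IsRate r) (hε : 0 < ε) {t : ℝ} (ht : 0 < t) (ht1 : t ≤ 1) {n : ℕ}
    (hn : n ≤ 2) : ‖kap ε t r‖ ≤ 3840 * (ε / t) ^ n * (1 + (‖r‖⁻¹) ^ 8) ∧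
      ‖kap' ε t r / r‖ ≤ 7680 * (ε / t) ^ n * (1 + (‖r‖⁻¹) ^ 8) := by
  have h0 := h.1
  set u := ‖r‖⁻¹
  have hu : 0 < u := inv_pos.2 h0
  set v := ε / t
  have hv : 0 < v := by positivity
  have et : (t / ε)⁻¹ = v := inv_div _ _
  have e1 : (1 / ε)⁻¹ = ε := by simp
  have E : ∀ m ≤ 5, ‖Complex.exp (-r * (t / ε : ℝ))‖ ≤ 3840 * (u ^ m * v ^ m) := fun m hm => by
    have := h.norm_exp_le (show 0 < t / ε by positivity) m
    rw [et, mul_pow] at this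
    exact this.trans (by gcongr; exact factorial_bound hm)
  have E1 : ∀ m ≤ 5, ‖Complex.exp (-r * (1 / ε : ℝ))‖ ≤ 3840 * (u ^ m * ε ^ m) := fun m hm => by
    have := h.norm_exp_le (show 0 < 1 / ε by positivity) m
    rw [e1, mul_pow] at this
    exact this.trans (by gcongr; exact factorial_bound hm)
  have hεv : ε ^ n ≤ v ^ n := by gcongr; rw [le_div_iff₀ ht]; nlinarith
  have t3 : t ^ 3 ≤ 1 := pow_le_one₀ ht.le ht1
  have w2 := pow_inv_le h0 (show n + 2 ≤ 8 by omega)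
  have w4 := pow_inv_le h0 (show n + 4 ≤ 8 by omega)
  constructor
  · have a1 := mul_le_left (E n (by omega)) (show 0 ≤ 1 / 2 * u ^ 2 by positivity)
    have a2 := mul_le_mul (div_le_div_of_nonneg_right t3 (show 0 ≤ 12 * ε ^ 2 by positivity))
      (E1 (n + 2) (by omega)) (norm_nonneg _) (by positivity)
    have a3 : 1 / (12 * ε ^ 2) * (3840 * (u ^ (n + 2) * ε ^ (n + 2)))
        ≤ 320 * (v ^ n * u ^ (n + 2)) := by
      rw [show 1 / (12 * ε ^ 2) * (3840 * (u ^ (n + 2) * ε ^ (n + 2)))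
        = 320 * (ε ^ n * u ^ (n + 2)) by field_simp; ring]
      gcongr
    have a4 : 3840 * v ^ n * u ^ (n + 2) ≤ 3840 * v ^ n * (1 + u ^ 8) := by gcongr
    have a5 : 0 ≤ v ^ n * u ^ (n + 2) := by positivity
    refine (norm_sub_le _ _).trans ?_
    simp only [norm_mul, norm_pow, norm_inv, Complex.norm_real, norm_eq_abs]
    rw [abs_of_nonneg (show 0 ≤ t ^ 3 / (12 * ε ^ 2) by positivity), show ‖(1 / 2 : ℂ)‖ = 1 / 2 by simp]
    calc _ ≤ 1 / 2 * u ^ 2 * (3840 * (u ^ n * v ^ n)) + 320 * (v ^ n * u ^ (n + 2)) :=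
          add_le_add a1 (a2.trans a3)
      _ = 2240 * (v ^ n * u ^ (n + 2)) := by ring
      _ ≤ _ := by linarith
  · have a1 := mul_le_left (E n (by omega)) (show 0 ≤ u ^ 3 by positivity)
    have a2 := mul_le_left (E (n + 1) (by omega))
      (show 0 ≤ 1 / 2 * u ^ 2 * (t / ε) by positivity)
    have a3 := mul_le_mul (div_le_div_of_nonneg_right t3 (show 0 ≤ 12 * ε ^ 3 by positivity))
      (E1 (n + 3) (by omega)) (norm_nonneg _) (by positivity)
    have a4 : 1 / (12 * ε ^ 3) * (3840 * (u ^ (n + 3) * ε ^ (n + 3)))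
        ≤ 320 * (v ^ n * u ^ (n + 3)) := by
      rw [show 1 / (12 * ε ^ 3) * (3840 * (u ^ (n + 3) * ε ^ (n + 3)))
        = 320 * (ε ^ n * u ^ (n + 3)) by field_simp; ring]
      gcongr
    have a5 : 7680 * v ^ n * u ^ (n + 4) ≤ 7680 * v ^ n * (1 + u ^ 8) := by gcongr
    have a6 : 0 ≤ v ^ n * u ^ (n + 4) := by positivity
    have a7 : 1 / 2 * u ^ 2 * (t / ε) * (3840 * (u ^ (n + 1) * v ^ (n + 1)))
        = 1920 * (v ^ n * u ^ (n + 3)) := by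
      rw [← inv_inv (t / ε), et, pow_succ v n]; field_simp; ring
    have key : ‖kap' ε t r‖ ≤ 6080 * (v ^ n * u ^ (n + 3)) := by
      refine (norm_add_le _ _).trans ((add_le_add_left (norm_sub_le _ _) _).trans ?_)
      simp only [norm_mul, norm_pow, norm_inv, norm_neg, Complex.norm_real, norm_eq_abs]
      rw [abs_of_nonneg (show 0 ≤ t ^ 3 / (12 * ε ^ 3) by positivity),
        abs_of_nonneg (show 0 ≤ t / ε by positivity), show ‖(1 / 2 : ℂ)‖ = 1 / 2 by simp, ← mul_assoc]
      calc _ ≤ u ^ 3 * (3840 * (u ^ n * v ^ n)) + 1920 * (v ^ n * u ^ (n + 3))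
            + 320 * (v ^ n * u ^ (n + 3)) := add_le_add (add_le_add a1 (a2.trans a7.le)) (a3.trans a4)
        _ = _ := by ring
    rw [norm_div, div_eq_mul_inv]
    calc _ ≤ 6080 * (v ^ n * u ^ (n + 3)) * u := by gcongr
      _ = 6080 * (v ^ n * u ^ (n + 4)) := by ring
      _ ≤ _ := by linarith

lemma IsRate.norm_kz_le (h : IsRate r) (hε : 0 < ε) {t : ℝ} (ht : 0 < t) (ht1 : t ≤ 1) :
    ‖kz ε t r‖ ≤ (1 / ε + 1 / ε ^ 2) * (1 + (‖r‖⁻¹) ^ 8) ∧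
      ‖kz ε t r‖ * √t ≤ 3840 * (ε ^ (1 / 4 : ℝ) + ε) * t ^ (-(3 / 4) : ℝ) * (1 + (‖r‖⁻¹) ^ 8) := by
  have h0 := h.1
  set u := ‖r‖⁻¹
  have hu : 0 < u := inv_pos.2 h0
  set W := 1 + u ^ 8
  have w0 : 1 ≤ W := by simp only [W]; linarith [pow_pos hu 8]
  have w1 : u ≤ W := (pow_one u).symm.le.trans (pow_inv_le h0 (by norm_num))
  have w2 : u ^ 2 ≤ W := pow_inv_le h0 (by norm_num)
  have w3 : u ^ 3 ≤ W := pow_inv_le h0 (by norm_num)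
  set E := ‖Complex.exp (-r * (t / ε : ℝ))‖
  set E1 := ‖Complex.exp (-r * (1 / ε : ℝ))‖
  have t2 : t ^ 2 ≤ 1 := pow_le_one₀ ht.le ht1
  have hk : ‖kz ε t r‖ ≤ 1 / (2 * ε) * u * E + 1 / (4 * ε ^ 2) * E1 := by
    refine (norm_add_le _ _).trans ?_
    simp only [norm_mul, norm_inv, Complex.norm_real, norm_eq_abs]
    rw [abs_of_nonneg (show 0 ≤ 1 / (2 * ε) by positivity),
      abs_of_nonneg (show 0 ≤ t ^ 2 / (4 * ε ^ 2) by positivity)]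
    gcongr
  have hE0 : 0 ≤ E := norm_nonneg _
  have hE : ∀ n, E ≤ n.factorial * 2 ^ n * (u * (t / ε)⁻¹) ^ n :=
    h.norm_exp_le (show 0 < t / ε by positivity)
  have hE1 : ∀ n, E1 ≤ n.factorial * 2 ^ n * (u * (1 / ε)⁻¹) ^ n :=
    h.norm_exp_le (show 0 < 1 / ε by positivity)
  constructor
  · have q0 : E ≤ 1 := by simpa using hE 0
    have q1 : E1 ≤ 1 := by simpa using hE1 0
    calc _ ≤ 1 / (2 * ε) * W * 1 + 1 / (4 * ε ^ 2) * W :=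
          hk.trans (by gcongr; exact q1.trans w0)
      _ = (1 / ε * (1 / 2) + 1 / ε ^ 2 * (1 / 4)) * W := by field_simp
      _ ≤ _ := by gcongr <;> nlinarith [show 0 < 1 / ε by positivity, show 0 < 1 / ε ^ 2 by positivity]
  · have q3 : E1 ≤ 48 * ε ^ 3 * W := by
      have := hE1 3
      rw [show (1 / ε)⁻¹ = ε by simp, mul_pow] at this
      norm_num [Nat.factorial] at this
      nlinarith [pow_pos hε 3]
    set x := t / ε
    have hx : 0 < x := by positivity
    have q2 : u * (E * x ^ (5 / 4 : ℝ)) ≤ 10 * W := by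
      have p1 : E * x ≤ 2 * u := by
        have := mul_le_right (hE 1) hx.le
        norm_num at this
        rwa [mul_assoc, mul_assoc, inv_mul_cancel₀ hx.ne', mul_one] at this
      have p2 : E * x ^ 2 ≤ 8 * u ^ 2 := by
        have := mul_le_right (hE 2) (sq_nonneg x)
        norm_num [Nat.factorial, mul_pow] at this
        rwa [mul_assoc, mul_assoc, inv_mul_cancel₀ (by positivity), mul_one] at this
      have p3 : x ^ (5 / 4 : ℝ) ≤ x + x ^ 2 := by
        rcases le_total x 1 with h1 | h1
        · have := rpow_le_rpow_of_exponent_ge hx h1 (show (1:ℝ) ≤ 5 / 4 by norm_num)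
          rw [rpow_one] at this
          nlinarith [sq_nonneg x]
        · have := rpow_le_rpow_of_exponent_le h1 (show (5 / 4 : ℝ) ≤ (2:ℕ) by norm_num)
          rw [rpow_natCast] at this
          linarith
      calc _ ≤ u * (E * (x + x ^ 2)) := by gcongr
        _ = u * (E * x + E * x ^ 2) := by ring
        _ ≤ u * (2 * u + 8 * u ^ 2) := by gcongr
        _ ≤ _ := by linarith
    have q4 : √t = x ^ (5 / 4 : ℝ) * (ε * ε ^ (1 / 4 : ℝ)) * t ^ (-(3 / 4) : ℝ) := by
      rw [show ε * ε ^ (1 / 4 : ℝ) = ε ^ (5 / 4 : ℝ) by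
        rw [← rpow_one_add' hε.le (by norm_num)]; norm_num,
        ← mul_rpow hx.le hε.le, div_mul_cancel₀ _ hε.ne', ← rpow_add ht, sqrt_eq_rpow]
      norm_num
    have q5 : √t ≤ t ^ (-(3 / 4) : ℝ) := by
      rw [sqrt_eq_rpow]
      exact rpow_le_rpow_of_exponent_ge ht ht1 (by norm_num)
    set T := t ^ (-(3 / 4) : ℝ)
    set e4 := ε ^ (1 / 4 : ℝ)
    have hT : 0 ≤ T := by positivity
    have he4 : 0 ≤ e4 := by positivity
    have s1 : 1 / (2 * ε) * u * E * √t ≤ 1 / 2 * (10 * W) * e4 * T := by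
      rw [q4, show 1 / (2 * ε) * u * E * (x ^ (5 / 4 : ℝ) * (ε * e4) * T)
        = 1 / 2 * (u * (E * x ^ (5 / 4 : ℝ))) * e4 * T by field_simp]
      gcongr
    have s2 : 1 / (4 * ε ^ 2) * E1 * √t ≤ 12 * ε * W * T := by
      calc _ ≤ 1 / (4 * ε ^ 2) * (48 * ε ^ 3 * W) * T := by gcongr
        _ = _ := by field_simp; ring
    have s3 : 0 ≤ e4 * T * W := by positivity
    have s4 : 0 ≤ ε * T * W := by positivity
    calc _ ≤ (1 / (2 * ε) * u * E + 1 / (4 * ε ^ 2) * E1) * √t := by gcongr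
      _ ≤ 1 / 2 * (10 * W) * e4 * T + 12 * ε * W * T := by rw [add_mul]; exact add_le_add s1 s2
      _ ≤ _ := by linarith

end Profiles

/-! ## The boundary layer as a divergence-free field -/

section LayerField

open Complex (I)

variable {b : ℝ → ℝ} {c K ε s : ℝ} {σ1 σ2 : F²}

lemma norm_amp_le (hs : s ^ 2 = 1) (a1 a2 : F²) (p : ℝ²) :
    ‖amp₁ a1 a2 s p‖ ≤ |a1 p| + |a2 p| ∧ ‖amp₂ a1 a2 s p‖ ≤ |a1 p| + |a2 p| := by
  have h1 : |s| = 1 := (sq_eq_sq₀ (abs_nonneg s) zero_le_one).1 (by rw [sq_abs, hs, one_pow])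
  constructor
  · exact (norm_sub_le _ _).trans (by simp [h1])
  · exact (norm_add_le _ _).trans (by simp [h1, add_comm])

/-- The weight measuring the singularity of the layer profiles at the equator. -/
def weight (b : ℝ → ℝ) (p : ℝ²) : ℝ := 1 + (b p.2 ^ 4)⁻¹

lemma weight_nonneg (p : ℝ²) : 0 ≤ weight b p := by unfold weight; positivity

lemma weight_eq (hs : s ^ 2 = 1) {p : ℝ²} (hp : b p.2 ≠ 0) :
    1 + (‖rate b s p.2‖⁻¹) ^ 8 = weight b p := by
  have h := norm_rate_sq hs hp
  rw [weight, inv_pow, show ‖rate b s p.2‖ ^ 8 = (‖rate b s p.2‖ ^ 2) ^ 4 by ring, h,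
    show |b p.2| ^ 4 = b p.2 ^ 4 from (even_two_mul 2).pow_abs _]

lemma IsFlat.mul_weight_le {a : F²} (ha : IsFlat 9 K a) (hc : CoriolisBound b c) (hK : 0 ≤ K)
    {j : ℕ} (hj : j ≤ 5) (p : ℝ²) : |a p| * weight b p ≤ K * (1 + c ^ 4) * |p.2| ^ j := by
  have h1 := hc.abs_div_le (m := j) (j := 4) hK (ha.bound p (j + 4) (by omega))
  have h2 := ha.bound p j (by omega)
  have e : |a p| * weight b p = |a p| + |a p / b p.2 ^ 4| := by
    rw [weight, abs_div, abs_of_nonneg (show 0 ≤ b p.2 ^ 4 by positivity)]; ring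
  rw [e]
  linarith

lemma IsFlat.memLp_weight {a : F²} (ha : IsFlat 9 K a) (hb : IsCoriolis b)
    (hc : CoriolisBound b c) : MemLp (fun p => |a p| * weight b p) 2 muH := by
  have mb : Measurable b := hb.diff.continuous.measurable
  have h4 := ((memLp_div_pow ha.memLp fun p => ha.bound p 4 (by norm_num)).norm.const_mul (c ^ 4)).add
    ha.memLp.norm
  have mw : Measurable (weight b) := by unfold weight; fun_prop
  refine h4.mono (ha.memLp.1.norm.mul mw.aestronglyMeasurable) ?_
  filter_upwards [ae_snd_ne_zero] with p hp
  have h1 := pow_le_pow_left₀ (abs_nonneg _) (hc.le_abs p.2) 4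
  rw [mul_pow, (show Even 4 by decide).pow_abs, (show Even 4 by decide).pow_abs] at h1
  have h2 : 0 < p.2 ^ 4 := by positivity
  have h3 : 0 < b p.2 ^ 4 := by have := hb.ne_zero _ hp; positivity
  simp only [Pi.add_apply, norm_eq_abs, abs_mul, abs_div, abs_abs, abs_of_nonneg (weight_nonneg p)]
  refine le_trans ?_ (le_abs_self _)
  rw [abs_of_pos h2, weight, mul_add, mul_one, add_comm]
  refine add_le_add_left ?_ _
  have h4 : (b p.2 ^ 4)⁻¹ ≤ c ^ 4 / p.2 ^ 4 := by
    rw [le_div_iff₀ h2, inv_mul_le_iff₀ h3]; linarith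
  exact (mul_le_left h4 (abs_nonneg _)).trans_eq (by ring)

/-- A majorant for all layer terms. -/
def majorant (b : ℝ → ℝ) (c : ℝ) (σ1 σ2 : F²) (p : ℝ²) : ℝ :=
  7680 * c * (|σ1 p| * weight b p + |σ2 p| * weight b p + |pdx σ1 p| * weight b p
    + |pdy σ1 p| * weight b p + |pdx σ2 p| * weight b p + |pdy σ2 p| * weight b p)

local notation "𝔪" => majorant b c σ1 σ2

lemma memLp_majorant (hb : IsCoriolis b) (hc : CoriolisBound b c) (hw : WindBound K σ1 σ2) :
    MemLp 𝔪 2 muH :=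
  ((((((hw.flat1.memLp_weight hb hc).add (hw.flat2.memLp_weight hb hc)).add
    (hw.flat₁x.memLp_weight hb hc)).add (hw.flat₁y.memLp_weight hb hc)).add
    (hw.flat₂x.memLp_weight hb hc)).add (hw.flat₂y.memLp_weight hb hc)).const_mul _

lemma majorant_le (hc : CoriolisBound b c) (hw : WindBound K σ1 σ2) {j : ℕ} (hj : j ≤ 5) (p : ℝ²) :
    𝔪 p ≤ 7680 * c * (6 * (K * (1 + c ^ 4))) * |p.2| ^ j := by
  have hK := hw.nonneg
  have := hc.one_le
  rw [majorant, mul_assoc (7680 * c)]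
  refine mul_le_left ?_ (by positivity)
  linarith [hw.flat1.mul_weight_le hc hK hj p, hw.flat2.mul_weight_le hc hK hj p,
    hw.flat₁x.mul_weight_le hc hK hj p, hw.flat₁y.mul_weight_le hc hK hj p,
    hw.flat₂x.mul_weight_le hc hK hj p, hw.flat₂y.mul_weight_le hc hK hj p]

lemma mul_weight_le_majorant (hc : CoriolisBound b c) (p : ℝ²) :
    7680 * ((|σ1 p| + |σ2 p|) * weight b p) ≤ 𝔪 p := by
  have hw0 := weight_nonneg (b := b) p
  have h1 : 0 ≤ |pdx σ1 p| * weight b p + |pdy σ1 p| * weight b p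
    + |pdx σ2 p| * weight b p + |pdy σ2 p| * weight b p := by positivity
  rw [majorant, mul_assoc 7680]
  have h2 : 0 ≤ (|σ1 p| + |σ2 p|) * weight b p := by positivity
  nlinarith [hc.one_le]

lemma majorant_nonneg (hc : CoriolisBound b c) (p : ℝ²) : 0 ≤ 𝔪 p := by
  have := hc.one_le
  have := weight_nonneg (b := b) p
  unfold majorant; positivity

/-- A sum over both signs of amplitudes times a kernel in the decay rate. -/
def lay (b : ℝ → ℝ) (κ : ℝ → ℂ → ℂ) (α : ℝ → ℝ² → ℂ) (P : ℝ³) : ℝ :=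
  sumPM fun s => α s P.1 * κ (1 - P.2) (rate b s P.1.2)

local notation "𝔲₂" => lay b (kap ε) (amp₂ σ1 σ2)

local notation "𝔲₁" => lay b (kap ε) (amp₁ σ1 σ2)

/-- The `y`-derivative of `lay b κ (amp₂ σ1 σ2)`, where `κ'` is the derivative of `κ`. -/
def layY (b : ℝ → ℝ) (κ κ' : ℝ → ℂ → ℂ) (σ1 σ2 : F²) (P : ℝ³) : ℝ :=
  sumPM fun s => amp₂ (pdy σ1) (pdy σ2) s P.1 * κ (1 - P.2) (rate b s P.1.2)
    + amp₂ σ1 σ2 s P.1 * (κ' (1 - P.2) (rate b s P.1.2)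
      * (-(s * I) * deriv b P.1.2 / (2 * rate b s P.1.2)))

/-- The horizontal divergence of the vertical primitive of the layer. -/
def layDiv (b : ℝ → ℝ) (κ κ' : ℝ → ℂ → ℂ) (σ1 σ2 : F²) (P : ℝ³) : ℝ :=
  lay b κ (amp₁ (pdx σ1) (pdx σ2)) P + layY b κ κ' σ1 σ2 P

local notation "𝔡" => layDiv b (kap ε) (kap' ε) σ1 σ2

lemma WindBound.eq_zero (hw : WindBound K σ1 σ2) {p : ℝ²} (hp : p.2 = 0) : σ1 p = 0 ∧ σ2 p = 0 ∧
    pdx σ1 p = 0 ∧ pdx σ2 p = 0 ∧ pdy σ1 p = 0 ∧ pdy σ2 p = 0 := by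
  have : ∀ {a}, IsFlat 9 K a → a p = 0 := fun h => by simpa [hp] using h.bound p 1 (by norm_num)
  exact ⟨this hw.flat1, this hw.flat2, this hw.flat₁x, this hw.flat₂x, this hw.flat₁y, this hw.flat₂y⟩

lemma abs_lay_le (hb : IsCoriolis b) {κ : ℝ → ℂ → ℂ} {α : ℝ → ℝ² → ℂ} {P : ℝ³} {M S : ℝ}
    (hS : ∀ s : ℝ, s ^ 2 = 1 → ‖α s P.1‖ ≤ S) (h0 : P.1.2 = 0 → S = 0)
    (h : ∀ r, IsRate r → ‖κ (1 - P.2) r‖ ≤ M * (1 + (‖r‖⁻¹) ^ 8)) :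
    |lay b κ α P| ≤ 2 * M * (S * weight b P.1) := by
  rw [mul_assoc]
  refine abs_sumPM_le fun s hs => ?_
  rw [norm_mul]
  by_cases hy : P.1.2 = 0
  · have := hS s hs
    rw [h0 hy] at this ⊢
    rw [le_antisymm this (norm_nonneg _)]; simp
  · have hS0 := (norm_nonneg _).trans (hS s hs)
    have hbn := hb.ne_zero _ hy
    calc _ ≤ S * (M * weight b P.1) := by
          rw [← weight_eq hs hbn]
          exact mul_le_mul (hS s hs) (h _ (isRate_rate hs hbn)) (norm_nonneg _) hS0
      _ = _ := by ring

lemma abs_layers_le (hb : IsCoriolis b) (hc : CoriolisBound b c) (hw : WindBound K σ1 σ2) (hε : 0 < ε)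
    {P : ℝ³} (hz : P.2 ∈ Ico (0:ℝ) 1) {n : ℕ} (hn : n ≤ 2) :
    |𝔲₁ P| ≤ (ε / (1 - P.2)) ^ n * 𝔪 P.1 ∧
    |𝔲₂ P| ≤ (ε / (1 - P.2)) ^ n * 𝔪 P.1 ∧
    |lay b (kap ε) (amp₁ (pdx σ1) (pdx σ2)) P| ≤ (ε / (1 - P.2)) ^ n * 𝔪 P.1 ∧
    |layY b (kap ε) (kap' ε) σ1 σ2 P| ≤ (ε / (1 - P.2)) ^ n * 𝔪 P.1 ∧
    |𝔡 P| ≤ (ε / (1 - P.2)) ^ n * 𝔪 P.1 := by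
  have ht : 0 < 1 - P.2 := by linarith [hz.2]
  have ht1 : 1 - P.2 ≤ 1 := by linarith [hz.1]
  set v := (ε / (1 - P.2)) ^ n
  have hv : 0 ≤ v := by positivity
  have hk := fun r (hr : IsRate r) => hr.norm_kap_le hε ht ht1 hn
  have w0 := weight_nonneg (b := b) P.1
  set w := weight b P.1
  have hc1 := hc.one_le
  have g : ∀ {α : ℝ → ℝ² → ℂ} {S : ℝ}, (∀ s : ℝ, s ^ 2 = 1 → ‖α s P.1‖ ≤ S) →
      (P.1.2 = 0 → S = 0) → |lay b (kap ε) α P| ≤ v * (7680 * (S * w)) := fun hS h0 =>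
    (abs_lay_le hb hS h0 fun r hr => (hk r hr).1).trans (by linarith)
  have q1 : 0 ≤ |σ1 P.1| * w := by positivity
  have q2 : 0 ≤ |σ2 P.1| * w := by positivity
  have q3 : 0 ≤ |pdx σ1 P.1| * w := by positivity
  have q4 : 0 ≤ |pdy σ1 P.1| * w := by positivity
  have q5 : 0 ≤ |pdx σ2 P.1| * w := by positivity
  have q6 : 0 ≤ |pdy σ2 P.1| * w := by positivity
  have le : ∀ {x y : ℝ}, 0 ≤ y → x ≤ v * (7680 * y) → y ≤ |σ1 P.1| * w + |σ2 P.1| * w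
      + |pdx σ1 P.1| * w + |pdy σ1 P.1| * w + |pdx σ2 P.1| * w + |pdy σ2 P.1| * w →
      x ≤ v * 𝔪 P.1 := fun {x y} h0 h1 h2 => by
    refine h1.trans (mul_le_left ?_ hv)
    rw [majorant, mul_assoc]
    have h3 : y ≤ c * y := le_mul_of_one_le_left h0 hc1
    have h4 := mul_le_left h2 (show 0 ≤ c by linarith)
    linarith
  have hX := g (α := amp₁ (pdx σ1) (pdx σ2)) (fun s hs => (norm_amp_le hs _ _ P.1).1)
    fun hy => by simp [hw.eq_zero hy]
  have hY : |layY b (kap ε) (kap' ε) σ1 σ2 P| ≤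
      v * (7680 * ((|pdy σ1 P.1| + |pdy σ2 P.1|) * w)) + v * (7680 * (c * ((|σ1 P.1| + |σ2 P.1|) * w))) := by
    refine (abs_sumPM_le (C := (|pdy σ1 P.1| + |pdy σ2 P.1|) * (3840 * v * w)
      + (|σ1 P.1| + |σ2 P.1|) * (c / 2 * (7680 * v * w))) fun s hs => ?_).trans (by linarith)
    by_cases hy : P.1.2 = 0
    · simp [amp₂, hw.eq_zero hy]
    · have hbn := hb.ne_zero _ hy
      obtain ⟨k1, k2⟩ := hk _ (isRate_rate hs hbn)
      rw [weight_eq hs hbn] at k1 k2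
      refine (norm_add_le _ _).trans (add_le_add ?_ ?_)
      · rw [norm_mul]
        exact mul_le_mul (norm_amp_le hs _ _ _).2 k1 (norm_nonneg _) (by positivity)
      · rw [norm_mul]
        refine mul_le_mul (norm_amp_le hs _ _ _).2 ?_ (norm_nonneg _) (by positivity)
        have h1 : |s| = 1 := (sq_eq_sq₀ (abs_nonneg s) zero_le_one).1 (by rw [sq_abs, hs, one_pow])
        rw [show kap' ε (1 - P.2) (rate b s P.1.2) * (-(s * I) * deriv b P.1.2 / (2 * rate b s P.1.2))
          = (-(s * I) * deriv b P.1.2 / 2) * (kap' ε (1 - P.2) (rate b s P.1.2) / rate b s P.1.2) by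
            have := (isRate_rate hs hbn).ne_zero
            field_simp, norm_mul]
        refine mul_le_mul ?_ k2 (norm_nonneg _) (by positivity)
        simpa [h1] using div_le_div_of_nonneg_right (hc.abs_deriv_le P.1.2).2.1 zero_le_two
  have hYm : v * (7680 * ((|pdy σ1 P.1| + |pdy σ2 P.1|) * w))
      + v * (7680 * (c * ((|σ1 P.1| + |σ2 P.1|) * w)))
      ≤ v * (7680 * (c * ((|pdy σ1 P.1| + |pdy σ2 P.1| + |σ1 P.1| + |σ2 P.1|) * w))) := by
    have h3 := le_mul_of_one_le_left (show 0 ≤ (|pdy σ1 P.1| + |pdy σ2 P.1|) * w by positivity) hc1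
    have := mul_le_left h3 hv
    linarith
  have em : v * 𝔪 P.1 = v * (7680 * (c * ((|pdy σ1 P.1| + |pdy σ2 P.1| + |σ1 P.1|
      + |σ2 P.1|) * w))) + v * (7680 * (c * ((|pdx σ1 P.1| + |pdx σ2 P.1|) * w))) := by
    rw [majorant]; ring
  have hXc : v * (7680 * ((|pdx σ1 P.1| + |pdx σ2 P.1|) * w))
      ≤ v * (7680 * (c * ((|pdx σ1 P.1| + |pdx σ2 P.1|) * w))) := by
    have h3 := le_mul_of_one_le_left (show 0 ≤ (|pdx σ1 P.1| + |pdx σ2 P.1|) * w by positivity) hc1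
    exact mul_le_left (by linarith) hv
  refine ⟨le (by positivity) (g (fun s hs => (norm_amp_le hs _ _ P.1).1)
      fun hy => by simp [hw.eq_zero hy]) (by linarith),
    le (by positivity) (g (fun s hs => (norm_amp_le hs _ _ P.1).2)
      fun hy => by simp [hw.eq_zero hy]) (by linarith), le (by positivity) hX (by linarith), ?_, ?_⟩
  · rw [em]
    have : 0 ≤ v * (7680 * (c * ((|pdx σ1 P.1| + |pdx σ2 P.1|) * w))) := by positivity
    linarith
  · refine (abs_add_le _ _).trans ?_
    rw [em]
    linarith

lemma measurable_rate (hb : Measurable b) (s : ℝ) : Measurable (rate b s) := by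
  have h : Measurable sign := by
    unfold sign
    exact Measurable.ite measurableSet_Iio measurable_const
      (Measurable.ite measurableSet_Ioi measurable_const measurable_const)
  unfold rate
  fun_prop

lemma measurable_sumPM {X : Type*} [MeasurableSpace X] {F : X → ℝ → ℂ}
    (h : ∀ s, Measurable fun x => F x s) : Measurable fun x => sumPM (F x) :=
  Complex.measurable_re.comp ((h 1).add (h (-1)))

lemma measurable_layers (hb : IsCoriolis b) (hw : WindBound K σ1 σ2) (ε : ℝ) :
    Measurable 𝔲₁ ∧ Measurable 𝔲₂ ∧
    Measurable (lay b (kz ε) (amp₁ σ1 σ2)) ∧ Measurable (lay b (kz ε) (amp₂ σ1 σ2)) ∧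
    Measurable 𝔡 := by
  have mr := measurable_rate hb.diff.continuous.measurable
  have md := hb.continuous_deriv.measurable
  have m1 := hw.smooth₁.continuous.measurable
  have m2 := hw.smooth₂.continuous.measurable
  have m3 := (contDiff_pdx (m := 1) hw.smooth₁ (by norm_num)).continuous.measurable
  have m4 := (contDiff_pdx (m := 1) hw.smooth₂ (by norm_num)).continuous.measurable
  have m5 := (contDiff_pdy (m := 1) hw.smooth₁ (by norm_num)).continuous.measurable
  have m6 := (contDiff_pdy (m := 1) hw.smooth₂ (by norm_num)).continuous.measurable
  refine ⟨measurable_sumPM fun s => ?_, measurable_sumPM fun s => ?_, measurable_sumPM fun s => ?_,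
    measurable_sumPM fun s => ?_, (measurable_sumPM fun s => ?_).add (measurable_sumPM fun s => ?_)⟩ <;>
  · have := mr s
    simp only [amp₁, amp₂, kap, kap', kz]
    fun_prop

lemma hasDerivAt_layX (hw : WindBound K σ1 σ2) (k : ℝ → ℂ) (x y : ℝ) :
    HasDerivAt (fun t => sumPM fun s => amp₁ σ1 σ2 s (t, y) * k s)
      (sumPM fun s => amp₁ (pdx σ1) (pdx σ2) s (x, y) * k s) x :=
  hasDerivAt_sumPM fun s _ =>
    ((hasDerivAt_pdx (hw.smooth₁.differentiable (by norm_num)) (x, y)).ofReal_comp.sub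
      ((hasDerivAt_pdx (hw.smooth₂.differentiable (by norm_num)) (x, y)).ofReal_comp.const_mul
        ((s:ℂ) * I))).mul_const (k s)

lemma hasDerivAt_layY (hb : IsCoriolis b) (hw : WindBound K σ1 σ2) {κ κ' : ℝ → ℂ → ℂ} {x y z : ℝ}
    (hκ : ∀ r, r ≠ 0 → HasDerivAt (κ (1 - z)) (κ' (1 - z) r) r) (hy : y ≠ 0) :
    HasDerivAt (fun t => lay b κ (amp₂ σ1 σ2) ((x, t), z)) (layY b κ κ' σ1 σ2 ((x, y), z)) y :=
  hasDerivAt_sumPM fun s hs => by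
  have hbn := hb.ne_zero _ hy
  have h1 := (hasDerivAt_pdy (hw.smooth₁.differentiable (by norm_num)) (x, y)).ofReal_comp
  have h2 := (hasDerivAt_pdy (hw.smooth₂.differentiable (by norm_num)) (x, y)).ofReal_comp
  exact (h2.add (h1.const_mul ((s:ℂ) * I))).mul
    (((hκ _ (isRate_rate hs hbn).ne_zero)).comp_of_eq y (hasDerivAt_rate hb hs hbn) rfl)

lemma continuous_lay (hb : IsCoriolis b) {α : ℝ → ℝ² → ℂ} (hα : ∀ s, Continuous (α s)) {z C : ℝ}
    (h : ∀ p : ℝ², |lay b (kap ε) α (p, z)| ≤ C * |p.2|) :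
    Continuous fun p : ℝ² => lay b (kap ε) α (p, z) := by
  refine continuous_iff_continuousAt.2 fun p => ?_
  by_cases hp : p.2 = 0
  · have h0 : lay b (kap ε) α (p, z) = 0 := by simpa [hp] using h p
    rw [ContinuousAt, h0]
    refine squeeze_zero_norm h ?_
    have : Continuous fun q : ℝ² => C * |q.2| := by fun_prop
    simpa [hp] using this.tendsto p
  · have hbn := hb.ne_zero _ hp
    have e : ∀ s : ℝ, s ^ 2 = 1 →
        ContinuousAt (fun q : ℝ² => α s q * kap ε (1 - z) (rate b s q.2)) p := fun s hs =>
      (hα s).continuousAt.mul ((hasDerivAt_kap (isRate_rate hs hbn).ne_zero _).continuousAt.comp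
        (f := fun q : ℝ² => rate b s q.2)
        ((hasDerivAt_rate hb hs hbn).continuousAt.comp (f := Prod.snd) continuousAt_snd))
    exact Complex.continuous_re.continuousAt.comp ((e 1 (by norm_num)).add (e (-1) (by norm_num)))

lemma hasDerivAt_lay_z (α : ℝ → ℝ² → ℂ) (p : ℝ²) (z : ℝ) :
    HasDerivAt (fun z => lay b (kap ε) α (p, z)) (lay b (kz ε) α (p, z)) z :=
  hasDerivAt_sumPM fun s _ => (hasDerivAt_kap_z (rate b s p.2) z).const_mul (α s p)

lemma continuous_lay_kz (α : ℝ → ℝ² → ℂ) (p : ℝ²) : Continuous fun z => lay b (kz ε) α (p, z) := by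
  simp only [lay, sumPM, kz]; fun_prop

lemma amp_periodic {a1 a2 : F²} {x y : ℝ} (h1 : a1 (x + 1, y) = a1 (x, y))
    (h2 : a2 (x + 1, y) = a2 (x, y)) (s : ℝ) : amp₁ a1 a2 s (x + 1, y) = amp₁ a1 a2 s (x, y) := by
  simp only [amp₁, h1, h2]

/-- `layDiv` is the horizontal divergence of the vertical primitive of the layer. -/
lemma integral_lay_div (hb : IsCoriolis b) (hc : CoriolisBound b c) (hw : WindBound K σ1 σ2)
    (hε : 0 < ε) {z : ℝ} (hz : z ∈ Ico (0:ℝ) 1) {φ : F²} (hφ : IsTestH φ) :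
    ∫ p, (𝔲₁ (p, z) * pdx φ p + 𝔲₂ (p, z) * pdy φ p) ∂muH
      = -∫ p, 𝔡 (p, z) * φ p ∂muH := by
  have B := fun p : ℝ² => abs_layers_le hb hc hw hε (P := (p, z)) hz (Nat.zero_le 2)
  simp only [pow_zero, one_mul] at B
  have M := fun (j : ℕ) (hj : j ≤ 5) (p : ℝ²) => majorant_le hc hw hj p
  set C := 7680 * c * (6 * (K * (1 + c ^ 4)))
  have M0 : ∀ p, 𝔪 p ≤ C := fun p => by simpa using M 0 (by norm_num) p
  have M1 : ∀ p : ℝ², 𝔪 p ≤ C * |p.2| := fun p => by simpa using M 1 (by norm_num) p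
  obtain ⟨m1, m2, -, -, m3⟩ := measurable_layers hb hw ε
  have s1 := contDiff_pdx (m := 1) hw.smooth₁ (by norm_num)
  have s2 := contDiff_pdx (m := 1) hw.smooth₂ (by norm_num)
  have ca : ∀ s, Continuous (amp₁ σ1 σ2 s) := fun s => by
    have := hw.smooth₁.continuous; have := hw.smooth₂.continuous; unfold amp₁; fun_prop
  have ca2 : ∀ s, Continuous (amp₂ σ1 σ2 s) := fun s => by
    have := hw.smooth₁.continuous; have := hw.smooth₂.continuous; unfold amp₂; fun_prop
  have ca' : ∀ s, Continuous (amp₁ (pdx σ1) (pdx σ2) s) := fun s => by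
    have := s1.continuous; have := s2.continuous; unfold amp₁; fun_prop
  have c1 := continuous_lay hb ca fun p => (B p).1.trans (M1 p)
  have c2 := continuous_lay hb ca2 fun p => (B p).2.1.trans (M1 p)
  have c3 := continuous_lay hb ca' fun p => (B p).2.2.1.trans (M1 p)
  have wX := weakX_of_hasDerivAt c1 c3 (fun x y => hasDerivAt_layX hw
    (fun s => kap ε (1 - z) (rate b s y)) x y) (fun x y => by
    simp only [lay, amp_periodic (hw.periodic₁ x y) (hw.periodic₂ x y)]) φ hφ
  have dY : ∀ x y, HasDerivAt (fun t => 𝔲₂ ((x, t), z))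
      (layY b (kap ε) (kap' ε) σ1 σ2 ((x, y), z)) y := fun x y => by
    by_cases hy : y = 0
    · subst hy
      rw [show layY b (kap ε) (kap' ε) σ1 σ2 ((x, 0), z) = 0 by
        simpa using (B (x, 0)).2.2.2.1.trans (M1 _)]
      exact hasDerivAt_zero_of_sq fun t => (B (x, t)).2.1.trans (M 2 (by norm_num) _)
    · exact hasDerivAt_layY hb hw (fun r hr => hasDerivAt_kap hr _) hy
  have wY := weakY_of_lipY c2 (lipY_of_hasDerivAt
    (f' := fun p => layY b (kap ε) (kap' ε) σ1 σ2 (p, z)) dY fun R =>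
    ⟨C, fun x _ y _ => (B (x, y)).2.2.2.1.trans (M0 _)⟩) φ hφ
  rw [show pdy (fun p => 𝔲₂ (p, z))
    = fun p => layY b (kap ε) (kap' ε) σ1 σ2 (p, z) from funext fun p => (dY p.1 p.2).deriv] at wY
  have int : ∀ {F : F³} {ψ : F²}, Measurable F → (∀ p, |F (p, z)| ≤ C) → IsTestH ψ →
      Integrable (fun p => F (p, z) * ψ p) muH := fun hF hC hψ =>
    hψ.integrable.bdd_mul (c := C) (hF.comp (measurable_prodMk_right (y := z))).aestronglyMeasurable
      (.of_forall hC)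
  have i3 := int (ψ := φ) m3 (fun p => (B p).2.2.2.2.trans (M0 p)) hφ
  have i4 : Integrable (fun p => lay b (kap ε) (amp₁ (pdx σ1) (pdx σ2)) (p, z) * φ p) muH :=
    hφ.integrable.bdd_mul (c := C) c3.aestronglyMeasurable
      (.of_forall fun p => (B p).2.2.1.trans (M0 p))
  rw [integral_add (int m1 (fun p => (B p).1.trans (M0 p)) hφ.pdx)
    (int m2 (fun p => (B p).2.1.trans (M0 p)) hφ.pdy), wX, wY, ← neg_add, ← integral_add i4]
  · simp only [layDiv, add_mul]
  · refine (i3.sub i4).congr (.of_forall fun p => ?_)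
    simp only [Pi.sub_apply, layDiv]
    ring

lemma abs_lay_kz_le (hb : IsCoriolis b) (hc : CoriolisBound b c) (hε : 0 < ε) {P : ℝ³}
    (hz : P.2 ∈ Ioo (0:ℝ) 1) {α : ℝ → ℝ² → ℂ}
    (hα : ∀ s : ℝ, s ^ 2 = 1 → ‖α s P.1‖ ≤ |σ1 P.1| + |σ2 P.1|) (hw : WindBound K σ1 σ2) :
    |lay b (kz ε) α P| ≤ (1 / ε + 1 / ε ^ 2) * 𝔪 P.1 ∧
    |lay b (kz ε) α P| * √(1 - P.2)
      ≤ (ε ^ (1 / 4 : ℝ) + ε) * (𝔪 P.1 * (1 - P.2) ^ (-(3 / 4) : ℝ)) := by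
  have ht : 0 < 1 - P.2 := by linarith [hz.2]
  have hk := fun r (hr : IsRate r) => hr.norm_kz_le hε ht (by linarith [hz.1])
  have h0 : P.1.2 = 0 → |σ1 P.1| + |σ2 P.1| = 0 := fun hy => by simp [hw.eq_zero hy]
  have hw0 := weight_nonneg (b := b) P.1
  have hS := mul_weight_le_majorant (b := b) (σ1 := σ1) (σ2 := σ2) hc P.1
  have hS0 : 0 ≤ (|σ1 P.1| + |σ2 P.1|) * weight b P.1 := by positivity
  constructor
  · refine (abs_lay_le hb hα h0 fun r hr => (hk r hr).1).trans ?_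
    rw [mul_comm 2, mul_assoc]
    exact mul_le_left (by linarith) (by positivity)
  · have hs := sqrt_pos.2 ht
    rw [← le_div_iff₀ hs]
    refine (abs_lay_le hb hα h0 (M := 3840 * (ε ^ (1 / 4 : ℝ) + ε) * (1 - P.2) ^ (-(3 / 4) : ℝ)
      / √(1 - P.2)) fun r hr => ?_).trans ?_
    · rw [div_mul_eq_mul_div, le_div_iff₀ hs]
      exact (hk r hr).2
    · rw [le_div_iff₀ hs]
      calc _ = (ε ^ (1 / 4 : ℝ) + ε) * (7680 * ((|σ1 P.1| + |σ2 P.1|) * weight b P.1)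
            * (1 - P.2) ^ (-(3 / 4) : ℝ)) := by field_simp; ring
        _ ≤ _ := by gcongr

end LayerField

/-! ## The stationary flow near the surface -/

section StationaryFlow

open Complex (I)

variable {b : ℝ → ℝ} {c K ε : ℝ} {σ1 σ2 gx gy : F²}

local notation "𝔴₂" => lay b (kz ε) (amp₂ σ1 σ2)

local notation "𝔴₁" => lay b (kz ε) (amp₁ σ1 σ2)

local notation "𝔡" => layDiv b (kap ε) (kap' ε) σ1 σ2

local notation "𝔪" => majorant b c σ1 σ2

lemma sumPM_add (F G : ℝ → ℂ) : sumPM F + sumPM G = sumPM fun s => F s + G s := by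
  simp only [sumPM_eq, Complex.add_re]; ring

lemma mul_sumPM (x : ℝ) (F : ℝ → ℂ) : x * sumPM F = sumPM fun s => (x:ℂ) * F s := by
  simp only [sumPM_eq, Complex.re_ofReal_mul]; ring

/-- The kernel of the bottom shear of the layer. -/
def ke (ε : ℝ) (_ : ℝ) (r : ℂ) : ℂ :=
  (1 / (2 * ε ^ 2) : ℝ) * Complex.exp (-r * (1 / ε : ℝ))

lemma hasDerivAt_ke (t : ℝ) (r : ℂ) : HasDerivAt (ke ε t) (((-(1 / ε) : ℝ) : ℂ) * ke ε t r) r := by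
  refine (((hasDerivAt_id r).neg.mul_const ((1 / ε : ℝ) : ℂ)).cexp.const_mul _).congr_deriv ?_
  simp only [ke, id, Pi.neg_apply]
  push_cast
  ring

lemma dZ_profile {α : ℝ → ℝ² → ℂ} {p : ℝ²} (h : ∀ s : ℝ, s ^ 2 = 1 → rate b s p.2 = 0 → α s p = 0) :
    deriv (fun t : ℝ => 1 / (2 * ε) * sumPM fun s => α s p / rate b s p.2
      * Complex.exp (-rate b s p.2 * (((1 - t) / ε : ℝ) : ℂ))) 0 = lay b (ke ε) α (p, 0) := by
  have hd : ∀ s : ℝ, HasDerivAt (fun t : ℝ => α s p / rate b s p.2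
      * Complex.exp (-rate b s p.2 * (((1 - t) / ε : ℝ) : ℂ))) _ 0 := fun s =>
    ((((hasDerivAt_id (0:ℝ)).const_sub 1).div_const ε).ofReal_comp.const_mul _).cexp.const_mul _
  rw [((hasDerivAt_sumPM fun s _ => hd s).const_mul _).deriv, lay, mul_sumPM]
  refine sumPM_congr fun s hs => ?_
  simp only [ke, id, sub_zero]
  push_cast
  by_cases hr : rate b s p.2 = 0
  · simp [h s hs hr]
  · field_simp

lemma bot_eq (hb : IsCoriolis b) (hw : WindBound K σ1 σ2) :
    bot₁ b σ1 σ2 ε = (fun p => lay b (ke ε) (amp₁ σ1 σ2) (p, 0)) ∧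
    bot₂ b σ1 σ2 ε = fun p => lay b (ke ε) (amp₂ σ1 σ2) (p, 0) := by
  have h : ∀ (p : ℝ²) (s : ℝ), s ^ 2 = 1 → rate b s p.2 = 0 → p.2 = 0 := fun p s hs hr => by
    by_contra hp
    exact (isRate_rate hs (hb.ne_zero _ hp)).ne_zero hr
  exact ⟨funext fun p => dZ_profile fun s hs hr => by simp [amp₁, hw.eq_zero (h p s hs hr)],
    funext fun p => dZ_profile fun s hs hr => by simp [amp₂, hw.eq_zero (h p s hs hr)]⟩

lemma layer_horizontal_eq (hb : IsCoriolis b) (hw : WindBound K σ1 σ2) (P : ℝ³) :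
    (uBL b σ1 σ2 ε).u₁ P + (1 - P.2) ^ 2 / 2 * bot₁ b σ1 σ2 ε P.1 = 𝔴₁ P ∧
    (uBL b σ1 σ2 ε).u₂ P + (1 - P.2) ^ 2 / 2 * bot₂ b σ1 σ2 ε P.1 = 𝔴₂ P := by
  have key : ∀ α : ℝ → ℝ² → ℂ, (1 / (2 * ε) * sumPM fun s => α s P.1 / rate b s P.1.2
      * Complex.exp (-rate b s P.1.2 * (((1 - P.2) / ε : ℝ) : ℂ)))
      + (1 - P.2) ^ 2 / 2 * lay b (ke ε) α (P.1, 0) = lay b (kz ε) α P := fun α => by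
    rw [lay, lay, mul_sumPM, mul_sumPM, sumPM_add]
    refine sumPM_congr fun s _ => ?_
    simp only [ke, kz]
    push_cast
    ring
  rw [(bot_eq hb hw).1, (bot_eq hb hw).2]
  exact ⟨key _, key _⟩

lemma layDiv_eq (hb : IsCoriolis b) (hw : WindBound K σ1 σ2) (hε : 0 < ε) {p : ℝ²}
    (hp : p.2 ≠ 0) (z : ℝ) :
    𝔡 (p, z) = -profile₃ b σ1 σ2 p ((1 - z) / ε)
      - (1 - z) ^ 3 / 6 * divH (bot₁ b σ1 σ2 ε) (bot₂ b σ1 σ2 ε) p := by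
  have hd : divH (bot₁ b σ1 σ2 ε) (bot₂ b σ1 σ2 ε) p
      = layDiv b (ke ε) (fun t r => ((-(1 / ε) : ℝ) : ℂ) * ke ε t r) σ1 σ2 (p, 0) := by
    rw [(bot_eq hb hw).1, (bot_eq hb hw).2]
    exact congrArg₂ (· + ·)
      (hasDerivAt_layX hw (fun s => ke ε (1 - 0) (rate b s p.2)) p.1 p.2).deriv
      (hasDerivAt_layY hb hw (x := p.1) (z := 0) (fun r _ => hasDerivAt_ke (1 - 0) r) hp).deriv
  rw [hd, layDiv, layDiv, lay, layY, lay, layY, profile₃, sumPM_add, sumPM_add, mul_sumPM,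
    neg_sub_left, eq_neg_iff_add_eq_zero, sumPM_add, sumPM_add, ← show
      sumPM (fun _ => 0) = 0 by simp [sumPM]]
  refine sumPM_congr fun s hs => ?_
  have hbn := hb.ne_zero _ hp
  have hr := (isRate_rate hs hbn).ne_zero
  have hε' : (ε:ℂ) ≠ 0 := by exact_mod_cast hε.ne'
  simp only [(hasDerivAt_rate hb hs hbn).deriv, divH, rotH, amp₁, amp₂, ke, kap, kap']
  push_cast
  field_simp
  ring

lemma poissonRhs_eq (hb : IsCoriolis b) (hw : WindBound K σ1 σ2) (hε : 0 < ε) {p : ℝ²}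
    (hp : p.2 ≠ 0) :
    poissonRhs b σ1 σ2 ε p = 𝔡 (p, 0) := by
  rw [layDiv_eq hb hw hε hp, poissonRhs, bot₃]
  simp only [uBL]
  ring

/-- The vertical velocity of the layer, corrected at the bottom. -/
def layVert (b : ℝ → ℝ) (ε : ℝ) (σ1 σ2 : F²) (P : ℝ³) : ℝ :=
  -layDiv b (kap ε) (kap' ε) σ1 σ2 P + (1 - P.2) * layDiv b (kap ε) (kap' ε) σ1 σ2 (P.1, 0)

lemma layer_vertical_eq (hb : IsCoriolis b) (hw : WindBound K σ1 σ2) (hε : 0 < ε)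
    {P : ℝ³} (hp : P.1.2 ≠ 0) : (uBL b σ1 σ2 ε).u₃ P + (vInt b σ1 σ2 ε gx gy).u₃ P
      = layVert b ε σ1 σ2 P := by
  have := layDiv_eq hb hw hε hp P.2
  simp only [layVert, vInt, poissonRhs_eq hb hw hε hp, uBL]
  rw [show 𝔡 P = _ from this]
  ring

lemma abs_layVert_le (hb : IsCoriolis b) (hc : CoriolisBound b c) (hw : WindBound K σ1 σ2)
    (hε : 0 < ε) {n : ℕ} (hn : n ≤ 2) {P : ℝ³} (hP : P.2 ∈ Ioo (0:ℝ) 1) :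
    |layVert b ε σ1 σ2 P| ≤ (ε / (1 - P.2)) ^ n * (2 * 𝔪 P.1) := by
  have ht : 0 < 1 - P.2 := by linarith [hP.2]
  have h1 := (abs_layers_le hb hc hw hε (P := P) ⟨hP.1.le, hP.2⟩ hn).2.2.2.2
  have h2 := (abs_layers_le hb hc hw hε (P := (P.1, 0)) ⟨le_rfl, zero_lt_one⟩ hn).2.2.2.2
  have h3 : (ε / (1 - 0)) ^ n ≤ (ε / (1 - P.2)) ^ n := by gcongr; exact hP.1.le
  have h4 := mul_le_right h3 (majorant_nonneg (σ1 := σ1) (σ2 := σ2) hc P.1)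
  refine (abs_add_le _ _).trans ?_
  rw [abs_neg, abs_mul, abs_of_pos ht]
  have h5 := mul_le_of_le_one_left
    (abs_nonneg (𝔡 (P.1, 0))) (show 1 - P.2 ≤ 1 by linarith [hP.1])
  linarith

lemma isBoundaryField_layer (hb : IsCoriolis b) (hc : CoriolisBound b c) (hw : WindBound K σ1 σ2)
    (hε : 0 < ε) (hg : IsPotentialGradient (poissonRhs b σ1 σ2 ε) gx gy) :
    IsBoundaryField (ε ^ (1 / 4 : ℝ) + ε) (fun p => 𝔡 (p, 0)) gx gy
      𝔪 𝔴₁ 𝔴₂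
      (layVert b ε σ1 σ2) ∧
    nrm muH (fun p => 𝔡 (p, 0)) ≤ ε * nrm muH 𝔪 ∧
    nrm muH gx + nrm muH gy ≤ 4 * ε ^ 2 * nrm muH 𝔪 := by
  obtain ⟨⟨χ, wx, wy⟩, mx, my, pot⟩ := hg
  have B := fun (n : ℕ) (hn : n ≤ 2) (P : ℝ³) (hz : P.2 ∈ Ico (0:ℝ) 1) =>
    abs_layers_le hb hc hw hε hz hn
  have B0 := fun (P : ℝ³) (hz : P.2 ∈ Ico (0:ℝ) 1) => B 0 (by norm_num) P hz
  simp only [pow_zero, one_mul] at B0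
  have z0 : (0:ℝ) ∈ Ico (0:ℝ) 1 := by norm_num
  have M0 : ∀ p, 𝔪 p ≤ 7680 * c * (6 * (K * (1 + c ^ 4))) := fun p => by
    simpa using majorant_le hc hw (Nat.zero_le 5) p
  set N := 7680 * c * (6 * (K * (1 + c ^ 4)))
  have hN : 0 ≤ N := (majorant_nonneg hc (0, 0)).trans (M0 _)
  obtain ⟨m1, m2, m3, m4, m5⟩ := measurable_layers hb hw ε
  have mm := memLp_majorant hb hc hw
  have ez : ∀ᵐ P : ℝ³ ∂muO, P.2 ∈ Ioo (0:ℝ) 1 := ae_muO_mem.mono fun P hP => hP.2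
  have trace : ∀ {F : F³}, Measurable F → ∀ n : ℕ,
      (∀ p, |F (p, 0)| ≤ (ε / (1 - 0)) ^ n * 𝔪 p) →
      MemLp (fun p => F (p, 0)) 2 muH ∧
        nrm muH (fun p => F (p, 0)) ≤ ε ^ n * nrm muH 𝔪 := fun hF n h => by
    have hb' : ∀ᵐ p ∂muH, |_| ≤ |ε ^ n * 𝔪 p| := .of_forall fun p =>
      (by simpa using h p : _ ≤ ε ^ n * 𝔪 p).trans (le_abs_self _)
    refine ⟨(mm.const_mul (ε ^ n)).mono
      (hF.comp (measurable_prodMk_right (y := (0:ℝ)))).aestronglyMeasurable hb', ?_⟩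
    have := nrm_mono (mm.const_mul (ε ^ n)) hb'
    rwa [nrm_const_mul, abs_of_nonneg (by positivity)] at this
  have tf := trace m5 1 fun p => (B 1 (by norm_num) (p, 0) z0).2.2.2.2
  have t1 := trace m1 2 fun p => (B 2 le_rfl (p, 0) z0).1
  have t2 := trace m2 2 fun p => (B 2 le_rfl (p, 0) z0).2.1
  have pot' : ∀ φ, IsTestH φ → ∫ p, (gx p * pdx φ p + gy p * pdy φ p) ∂muH
      = -∫ p, 𝔡 (p, 0) * φ p ∂muH := fun φ hφ => by
    rw [pot φ hφ]
    congr 1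
    refine integral_congr_ae (ae_snd_ne_zero.mono fun p hp => ?_)
    simp only [poissonRhs_eq hb hw hε hp]
  have A : ∀ P : ℝ³, P.2 ∈ Ioo (0:ℝ) 1 → _ ∧ _ := fun P hP =>
    And.intro (abs_lay_kz_le hb hc hε hP (fun s hs => (norm_amp_le hs σ1 σ2 P.1).1) hw)
      (abs_lay_kz_le hb hc hε hP (fun s hs => (norm_amp_le hs σ1 σ2 P.1).2) hw)
  set C := (1 + 1 / ε + 1 / ε ^ 2) * N
  have hC : N ≤ C := le_mul_of_one_le_left hN
    (by linarith [show 0 < 1 / ε by positivity, show 0 < 1 / ε ^ 2 by positivity])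
  have hAC : ∀ {x : ℝ} {p : ℝ²}, x ≤ (1 / ε + 1 / ε ^ 2) * 𝔪 p → x ≤ C :=
    fun {x p} h => h.trans ((mul_le_left (M0 p) (by positivity)).trans
      (mul_le_right (by linarith) hN))
  have bA1 : ∀ᵐ P ∂muO, |𝔴₁ P| ≤ C := ez.mono fun P hP => hAC (A P hP).1.1
  have bA2 : ∀ᵐ P ∂muO, |𝔴₂ P| ≤ C := ez.mono fun P hP => hAC (A P hP).2.1
  refine ⟨{
    nonneg := by positivity
    meas1 := m3.aestronglyMeasurable
    meas2 := m4.aestronglyMeasurable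
    meas3 := (m5.neg.add ((measurable_const.sub measurable_snd).mul
      (m5.comp (measurable_fst.prodMk measurable_const)))).aestronglyMeasurable
    bdd1 := ⟨C, bA1⟩
    bdd2 := ⟨C, bA2⟩
    bdd3 := ⟨2 * N, ez.mono fun P hP => (abs_layVert_le hb hc hw hε (Nat.zero_le 2) hP).trans
      (by linarith [M0 P.1])⟩
    layer₁ := ez.mono fun P hP => (A P hP).1.2
    layer₂ := ez.mono fun P hP => (A P hP).2.2
    memf := tf.1
    memg1 := mx.memLp
    memg2 := my.memLp
    pot := pot'
    div := fun Φ hΦ h1 => integral_div_of_primitive m1.aestronglyMeasurable m2.aestronglyMeasurable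
      m3.aestronglyMeasurable m4.aestronglyMeasurable m5.aestronglyMeasurable
      (ez.mono fun P hP => ((B0 P ⟨hP.1.le, hP.2⟩).1.trans (M0 _)).trans hC)
      (ez.mono fun P hP => ((B0 P ⟨hP.1.le, hP.2⟩).2.1.trans (M0 _)).trans hC) bA1 bA2
      (ez.mono fun P hP => ((B0 P ⟨hP.1.le, hP.2⟩).2.2.2.2.trans (M0 _)).trans hC)
      (hasDerivAt_lay_z _) (hasDerivAt_lay_z _) (continuous_lay_kz _) (continuous_lay_kz _)
      (fun z hz φ hφ => integral_lay_div hb hc hw hε hz hφ) t1.1 t2.1 tf.1 mx.memLp my.memLp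
      (fun _ => rfl) pot' hΦ h1 }, by simpa using tf.2, ?_⟩
  refine (nrm_add_nrm_le_of_potential (locallyIntegrable_muH wx.locInt) wx.eq wy.eq mx.memLp
    my.memLp t1.1 t2.1 fun φ hφ => ?_).trans (by linarith [t1.2, t2.2])
  rw [pot' φ hφ, integral_lay_div hb hc hw hε z0 hφ]

end StationaryFlow

/-! ## The temperature boundary layer -/

section LayerTemperature

variable {b : ℝ → ℝ} {c K ε lam : ℝ} {σ1 σ2 gx gy : F²} {j n : ℕ}

local notation "𝔪" => majorant b c σ1 σ2

def expKer (j : ℕ) (ζ : ℝ) (r : ℂ) : ℂ := (r⁻¹) ^ j * Complex.exp (-r * ζ)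

def layE (b : ℝ → ℝ) (j : ℕ) (α : ℝ → ℝ² → ℂ) (p : ℝ²) (ζ : ℝ) : ℝ :=
  sumPM fun s => α s p * expKer j ζ (rate b s p.2)

lemma hasDerivAt_layE (α : ℝ → ℝ² → ℂ) (p : ℝ²) (ζ : ℝ) :
    HasDerivAt (layE b (j + 2) α p) (-layE b (j + 1) α p ζ) ζ := by
  have := hasDerivAt_sumPM (t := ζ) (F := fun t s => α s p * expKer (j + 2) t (rate b s p.2))
    (F' := fun s => ((-1 : ℝ) : ℂ) * (α s p * expKer (j + 1) ζ (rate b s p.2))) fun s _ => by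
      refine ((((hasDerivAt_id ζ).ofReal_comp.const_mul (-rate b s p.2)).cexp.const_mul
        ((rate b s p.2)⁻¹ ^ (j + 2))).const_mul (α s p)).congr_deriv ?_
      simp only [expKer, id]
      push_cast
      rcases eq_or_ne (rate b s p.2) 0 with hr | hr
      · simp [hr]
      · rw [pow_succ _ (j + 1)]
        linear_combination -(α s p * (rate b s p.2)⁻¹ ^ (j + 1)
          * Complex.exp (-rate b s p.2 * ζ)) * inv_mul_cancel₀ hr
  rwa [← mul_sumPM, neg_one_mul] at this

lemma abs_layE_le (hb : IsCoriolis b) (hc : CoriolisBound b c) (hw : WindBound K σ1 σ2) (hn : n ≤ 1)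
    (hj : j ≤ 3) {ζ : ℝ} (hζ : 0 < ζ) {p : ℝ²} {α : ℝ → ℝ² → ℂ}
    (hα : ∀ s : ℝ, s ^ 2 = 1 → ‖α s p‖ ≤ |σ1 p| + |σ2 p|) :
    |layE b j α p ζ| ≤ ζ⁻¹ ^ n * 𝔪 p := by
  refine (abs_lay_le hb (κ := fun _ => expKer j ζ) (P := (p, 0)) (M := 3840 * ζ⁻¹ ^ n) hα
    (fun hy => by simp [hw.eq_zero hy]) fun r hr => ?_).trans ?_
  · rw [expKer, norm_mul, norm_pow, norm_inv]
    have h1 := hr.norm_exp_le hζ n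
    have h2 := pow_inv_le hr.1 (show j + n ≤ 8 by omega)
    have := hr.1
    calc _ ≤ ‖r‖⁻¹ ^ j * (3840 * (‖r‖⁻¹ * ζ⁻¹) ^ n) := by
          gcongr; exact h1.trans (by gcongr; exact factorial_bound (by omega))
      _ = 3840 * ζ⁻¹ ^ n * ‖r‖⁻¹ ^ (j + n) := by rw [mul_pow, pow_add]; ring
      _ ≤ _ := by gcongr
  · have := mul_le_left (mul_weight_le_majorant (b := b) (σ1 := σ1) (σ2 := σ2) hc p)
      (show 0 ≤ ζ⁻¹ ^ n by positivity)
    simp only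
    linarith

/-- The temperature boundary layer (`j = 3`), minus its derivative (`j = 2`), its second
derivative (`j = 1`). -/
def layTemp (b : ℝ → ℝ) (lam : ℝ) (σ1 σ2 gx gy : F²) (j : ℕ) (p : ℝ²) (ζ : ℝ) : ℝ :=
  1 / (2 * lam) * (gx p * layE b j (amp₁ σ1 σ2) p ζ + gy p * layE b j (amp₂ σ1 σ2) p ζ)

local notation "𝔱" => layTemp b lam σ1 σ2 gx gy

lemma hasDerivAt_layTemp (p : ℝ²) (ζ : ℝ) :
    HasDerivAt (𝔱 (j + 2) p) (-𝔱 (j + 1) p ζ) ζ := by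
  refine ((((hasDerivAt_layE (amp₁ σ1 σ2) p ζ).const_mul (gx p)).add
    ((hasDerivAt_layE (amp₂ σ1 σ2) p ζ).const_mul (gy p))).const_mul (1 / (2 * lam))).congr_deriv ?_
  rw [layTemp]; ring

/-- A majorant for the temperature boundary layer. -/
def tempMajorant (b : ℝ → ℝ) (c lam : ℝ) (σ1 σ2 gx gy : F²) (p : ℝ²) : ℝ :=
  1 / (2 * lam) * (|majorant b c σ1 σ2 p * gx p| + |majorant b c σ1 σ2 p * gy p|)

local notation "𝔟" => tempMajorant b c lam σ1 σ2 gx gy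

lemma abs_layTemp_le (hb : IsCoriolis b) (hc : CoriolisBound b c) (hw : WindBound K σ1 σ2)
    (hlam : 0 < lam) (hn : n ≤ 1) (hj : j ≤ 3) {ζ : ℝ} (hζ : 0 < ζ) (p : ℝ²) :
    |𝔱 j p ζ| ≤ ζ⁻¹ ^ n * 𝔟 p := by
  have h1 := abs_layE_le hb hc hw hn hj hζ fun s hs => (norm_amp_le hs σ1 σ2 p).1
  have h2 := abs_layE_le hb hc hw hn hj hζ fun s hs => (norm_amp_le hs σ1 σ2 p).2
  have hm := majorant_nonneg (σ1 := σ1) (σ2 := σ2) hc p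
  rw [layTemp, tempMajorant, abs_mul, abs_of_pos (show 0 < 1 / (2 * lam) by positivity), abs_mul,
    abs_mul, abs_of_nonneg hm, mul_left_comm]
  refine mul_le_left ((abs_add_le _ _).trans ?_) (by positivity)
  rw [abs_mul, abs_mul, mul_add]
  refine (add_le_add (mul_le_left h1 (abs_nonneg _))
    (mul_le_left h2 (abs_nonneg _))).trans_eq (by ring)

lemma memLp_majorant_mul (hb : IsCoriolis b) (hc : CoriolisBound b c) (hw : WindBound K σ1 σ2)
    {g : F²} (hg : MemLp g 2 muH) : MemLp (fun p => 𝔪 p * g p) 2 muH :=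
  memLp_bdd_mul (memLp_majorant hb hc hw).1 (.of_forall fun p => by
    rw [abs_of_nonneg (majorant_nonneg hc p)]
    simpa using majorant_le hc hw (Nat.zero_le 5) p) hg

lemma memLp_tempMajorant (hb : IsCoriolis b) (hc : CoriolisBound b c) (hw : WindBound K σ1 σ2)
    (hx : MemLp gx 2 muH) (hy : MemLp gy 2 muH) :
    MemLp (fun P : ℝ³ => 𝔟 P.1) 2 muO :=
  memLp_comp_fst (((memLp_majorant_mul hb hc hw hx).norm.add
    (memLp_majorant_mul hb hc hw hy).norm).const_mul _)

lemma aestronglyMeasurable_layTemp (hb : IsCoriolis b) (hw : WindBound K σ1 σ2)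
    (hx : MemLp gx 2 muH) (hy : MemLp gy 2 muH) (ε : ℝ) (j : ℕ) :
    AESM (fun P : ℝ³ =>
      𝔱 j P.1 ((1 - P.2) / ε)) muO := by
  have mr := measurable_rate hb.diff.continuous.measurable
  have m1 := hw.smooth₁.continuous.measurable
  have m2 := hw.smooth₂.continuous.measurable
  have e1 : Measurable fun P : ℝ³ => layE b j (amp₁ σ1 σ2) P.1 ((1 - P.2) / ε) :=
    measurable_sumPM fun s => by
      have := mr s
      simp only [amp₁, expKer]
      fun_prop
  have e2 : Measurable fun P : ℝ³ => layE b j (amp₂ σ1 σ2) P.1 ((1 - P.2) / ε) :=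
    measurable_sumPM fun s => by
      have := mr s
      simp only [amp₂, expKer]
      fun_prop
  exact (((aesm_comp_fst hx.1).mul e1.aestronglyMeasurable).add
    ((aesm_comp_fst hy.1).mul e2.aestronglyMeasurable)).const_mul _

lemma ae_abs_layTemp_le (hb : IsCoriolis b) (hc : CoriolisBound b c) (hw : WindBound K σ1 σ2)
    (hlam : 0 < lam) (hε : 0 < ε) (hn : n ≤ 1) (hj : j ≤ 3) :
    ∀ᵐ P : ℝ³ ∂muO, |𝔱 j P.1 ((1 - P.2) / ε)|
      ≤ (ε / (1 - P.2)) ^ n * 𝔟 P.1 := by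
  filter_upwards [ae_muO_mem] with P hP
  have ht : 0 < 1 - P.2 := by linarith [hP.2.2]
  simpa only [inv_div] using
    abs_layTemp_le (gx := gx) (gy := gy) hb hc hw hlam hn hj (div_pos ht hε) P.1

lemma memLp_layTemp (hb : IsCoriolis b) (hc : CoriolisBound b c) (hw : WindBound K σ1 σ2)
    (hlam : 0 < lam) (hε : 0 < ε) (hj : j ≤ 3) (hx : MemLp gx 2 muH) (hy : MemLp gy 2 muH) :
    MemLp (fun P : ℝ³ => 𝔱 j P.1 ((1 - P.2) / ε)) 2 muO :=
  (memLp_tempMajorant (lam := lam) hb hc hw hx hy).mono (aestronglyMeasurable_layTemp hb hw hx hy ε j)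
    ((ae_abs_layTemp_le hb hc hw hlam hε (Nat.zero_le 1) hj).mono fun P hP =>
      (by simpa using hP : _ ≤ 𝔟 P.1).trans (le_abs_self _))

lemma tendsto_layTemp (hb : IsCoriolis b) (hc : CoriolisBound b c) (hw : WindBound K σ1 σ2)
    (hlam : 0 < lam) (hj : j ≤ 3) (hx : MemLp gx 2 muH) (hy : MemLp gy 2 muH) :
    Tendsto (fun ε => eLpNorm (fun P : ℝ³ =>
      𝔱 j P.1 ((1 - P.2) / ε)) 2 muO) (𝓝[>] 0) (𝓝 0) := by
  refine tendsto_eLpNorm_zero_of_dominated (r := 2) two_ne_zero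
    (memLp_tempMajorant (lam := lam) hb hc hw hx hy)
    (.of_forall fun ε => aestronglyMeasurable_layTemp hb hw hx hy ε j) ?_ ?_
  · filter_upwards [self_mem_nhdsWithin] with ε hε
    filter_upwards [ae_abs_layTemp_le (gx := gx) (gy := gy) hb hc hw hlam hε (Nat.zero_le 1) hj]
      with P hP
    exact (by simpa using hP : _ ≤ 𝔟 P.1).trans (le_abs_self _)
  · filter_upwards [ae_muO_mem] with P hP
    have ht : 0 < 1 - P.2 := by linarith [hP.2.2]
    refine squeeze_zero_norm' (a := fun ε => ε / (1 - P.2) * 𝔟 P.1) ?_ ?_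
    · filter_upwards [self_mem_nhdsWithin] with ε hε
      simpa only [inv_div, pow_one, norm_eq_abs] using
        abs_layTemp_le (gx := gx) (gy := gy) hb hc hw hlam le_rfl hj (div_pos ht hε) P.1
    · have : Continuous fun ε => ε / (1 - P.2) * 𝔟 P.1 := by fun_prop
      simpa using (this.tendsto 0).mono_left nhdsWithin_le_nhds

lemma isWeakDz_layTemp (hb : IsCoriolis b) (hc : CoriolisBound b c) (hw : WindBound K σ1 σ2)
    (hlam : 0 < lam) (hε : 0 < ε) (hx : MemLp gx 2 muH) (hy : MemLp gy 2 muH) :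
    IsWeakDz (fun P => ε * 𝔱 3 P.1 ((1 - P.2) / ε))
      (fun P => 𝔱 2 P.1 ((1 - P.2) / ε)) := by
  have m3 := (memLp_layTemp hb hc hw hlam hε (j := 3) le_rfl hx hy).const_mul ε
  have m2 := memLp_layTemp hb hc hw hlam hε (j := 2) (by norm_num) hx hy
  refine ⟨m3, m2, fun φ hφ h0 h1 => ?_⟩
  have h := integral_vertical_primitive hφ h1 (int_mul m2 hφ.memLp)
    (int_mul m3 hφ.dZ.memLp) (fun p z => ?_) fun p => ?_
  · simp only [h0, mul_zero, integral_zero, neg_zero] at h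
    linarith
  · have hz : HasDerivAt (fun z : ℝ => (1 - z) / ε) (-1 / ε) z :=
      ((hasDerivAt_id z).const_sub 1).div_const ε
    refine (((hasDerivAt_layTemp (j := 1) p _).comp z hz).const_mul ε).congr_deriv ?_
    field_simp
  · exact (continuous_iff_continuousAt.2 fun ζ => (hasDerivAt_layTemp (j := 0) p ζ).continuousAt).comp
      (by fun_prop : Continuous fun z : ℝ => (1 - z) / ε)

lemma eq_zero_of_affine {f f' : ℝ → ℝ} (h : ∀ t, 0 < t → HasDerivAt f (f' t) t)
    (h' : ∀ t, 0 < t → HasDerivAt f' 0 t) (hl : Tendsto f atTop (𝓝 0)) {t : ℝ} (ht : 0 < t) :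
    f t = 0 := by
  have hc : ∀ s, 0 < s → f' s = f' 1 := fun s hs =>
    isOpen_Ioi.is_const_of_deriv_eq_zero isPreconnected_Ioi
      (fun x hx => (h' x hx).differentiableAt.differentiableWithinAt) (fun x hx => (h' x hx).deriv)
      (show s ∈ Ioi (0:ℝ) from hs) (show (1:ℝ) ∈ Ioi (0:ℝ) from zero_lt_one' ℝ)
  have hd : ∀ s, 0 < s → HasDerivAt (fun s => f s - f' 1 * s) 0 s := fun s hs =>
    ((h s hs).sub ((hasDerivAt_id s).const_mul (f' 1))).congr_deriv (by simp [hc s hs])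
  have hf : ∀ s, 0 < s → f s - f' 1 * s = f t - f' 1 * t := fun s hs =>
    isOpen_Ioi.is_const_of_deriv_eq_zero isPreconnected_Ioi
      (fun x hx => (hd x hx).differentiableAt.differentiableWithinAt) (fun x hx => (hd x hx).deriv)
      (show s ∈ Ioi (0:ℝ) from hs) (show t ∈ Ioi (0:ℝ) from ht)
  have hm : f' 1 = 0 := by
    have h1 := (hl.comp (tendsto_atTop_add_const_right atTop 1 tendsto_id)).sub hl
    rw [sub_zero] at h1
    refine tendsto_nhds_unique (tendsto_const_nhds.congr' ?_) h1
    filter_upwards [eventually_gt_atTop 0] with s hs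
    have e1 := hf s hs
    have e2 := hf (s + 1) (by linarith)
    simp only [Function.comp, id]
    linarith
  refine tendsto_nhds_unique (tendsto_const_nhds.congr' ?_) hl
  filter_upwards [eventually_gt_atTop 0] with s hs
  have := hf s hs
  rw [hm] at this
  linarith

lemma ae_eq_layTemp (hb : IsCoriolis b) (hc : CoriolisBound b c) (hw : WindBound K σ1 σ2)
    (hlam : 0 < lam) (hε : 0 < ε) {θ1 : F²} {Θ : ℝ² → ℝ → ℝ}
    (hΘ : IsLayerTemperature lam ε (uBL b σ1 σ2 ε) θ1 Θ) (hx : MemLp gx 2 muH) (hy : MemLp gy 2 muH)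
    (wx : WeakX θ1 gx) (wy : WeakY θ1 gy) :
    ∀ᵐ P : ℝ³ ∂muO, Θ P.1 ((1 - P.2) / ε) = 𝔱 3 P.1 ((1 - P.2) / ε) := by
  obtain ⟨kx, ky, wkx, wky, h⟩ := hΘ
  have ex := WeakX.ae_unique (locallyIntegrable_muH wkx.locInt') (locInt_muH hx) wkx.eq wx
  have ey := WeakY.ae_unique (locallyIntegrable_muH wky.locInt') (locInt_muH hy) wky.eq wy
  have key : ∀ᵐ p ∂muH, ∀ ζ, 0 < ζ → Θ p ζ = 𝔱 3 p ζ := by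
    filter_upwards [ex, ey, h] with p hpx hpy hp ζ hζ
    obtain ⟨hl, hd⟩ := hp
    refine sub_eq_zero.1 (eq_zero_of_affine (f := fun t => Θ p t - 𝔱 3 p t)
      (f' := fun t => deriv (Θ p) t - -𝔱 2 p t) (fun t ht =>
        (hd t ht).1.hasDerivAt.sub (hasDerivAt_layTemp (j := 1) p t)) (fun t ht => ?_) ?_ hζ)
    · refine ((hd t ht).2.1.hasDerivAt.sub (hasDerivAt_layTemp (j := 0) p t).neg).congr_deriv ?_
      have e := (hd t ht).2.2
      have e1 : (uBL b σ1 σ2 ε).u₁ (p, 1 - ε * t) = 1 / (2 * ε) * layE b 1 (amp₁ σ1 σ2) p t ∧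
          (uBL b σ1 σ2 ε).u₂ (p, 1 - ε * t) = 1 / (2 * ε) * layE b 1 (amp₂ σ1 σ2) p t := by
        simp only [uBL, profile₁, profile₂, layE, expKer, sub_sub_cancel,
          mul_div_cancel_left₀ t hε.ne', pow_one]
        simp only [div_eq_mul_inv, mul_assoc, and_self]
      rw [e1.1, e1.2, hpx, hpy] at e
      simp only [layTemp, zero_add]
      field_simp at e ⊢
      linarith
    · have h0 : Tendsto (𝔱 3 p) atTop (𝓝 0) := by
        refine squeeze_zero_norm' (a := fun t => t⁻¹ * 𝔟 p) ?_ ?_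
        · filter_upwards [eventually_gt_atTop 0] with t ht
          simpa only [pow_one, norm_eq_abs] using abs_layTemp_le hb hc hw hlam le_rfl le_rfl ht p
        · simpa using tendsto_inv_atTop_zero.mul_const (𝔟 p)
      simpa using hl.sub h0
  filter_upwards [ae_comp_fst key, ae_muO_mem] with P h1 hP
  exact h1 _ (div_pos (by linarith [hP.2.2]) hε)

lemma IsWeakDz.sub {f g f' g' : F³} (h : IsWeakDz f g) (h' : IsWeakDz f' g') :
    IsWeakDz (fun P => f P - f' P) (fun P => g P - g' P) := by
  refine ⟨h.memLp.sub h'.memLp, h.memLp'.sub h'.memLp', fun φ hφ h0 h1 => ?_⟩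
  simp only [sub_mul]
  rw [integral_sub (int_mul h.memLp hφ.dZ.memLp) (int_mul h'.memLp hφ.dZ.memLp),
    integral_sub (int_mul h.memLp' hφ.memLp)
    (int_mul h'.memLp' hφ.memLp), h.eq φ hφ h0 h1, h'.eq φ hφ h0 h1]
  ring

lemma IsWeakDz.congr {f g f' : F³} (h : IsWeakDz f g) (e : f =ᵐ[muO] f') : IsWeakDz f' g :=
  ⟨h.memLp.ae_eq e, h.memLp', fun φ hφ h0 h1 => by
    rw [← h.eq φ hφ h0 h1]
    exact integral_congr_ae (e.mono fun P hP => by simp only [hP])⟩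

end LayerTemperature

end

end BetaPlane

theorem mainTheorem4 :
    ∃ k₀ s₀ : ℕ, 2 ≤ k₀ ∧ 2 ≤ s₀ ∧ ∀ k s : ℕ, k₀ ≤ k → s₀ ≤ s →
      ∀ (lam : ℝ) (b : ℝ → ℝ) (σ₁ σ₂ θ₁ : ℝ × ℝ → ℝ),
        0 < lam → IsCoriolis b → IsWind k s σ₁ σ₂ →
        GradIntBound b σ₁ σ₂ (lam / 4) → MemH 2 θ₁ →
      ∀ (u : ℝ → Velocity) (θ : ℝ → (ℝ × ℝ) × ℝ → ℝ)
        (θbar : (ℝ × ℝ) × ℝ → ℝ) (θBL : ℝ → ℝ × ℝ → ℝ → ℝ),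
        (∀ ε : ℝ, 0 < ε → IsStationaryFlow b σ₁ σ₂ ε (u ε)) →
        (∀ ε : ℝ, 0 < ε → IsTemperature lam ε (u ε) θ₁ (θ ε)) →
        IsInteriorTemperature lam (uInt b σ₁ σ₂) θ₁ θbar →
        (∀ ε : ℝ, 0 < ε → IsLayerTemperature lam ε (uBL b σ₁ σ₂ ε) θ₁ (θBL ε)) →
      ∃ D : ℝ → (ℝ × ℝ) × ℝ → ℝ,
        (∀ ε : ℝ, 0 < ε →
          IsWeakDz (fun P => θ ε P - approxTemperature ε θbar (θBL ε) P) (D ε)) ∧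
        Tendsto
          (fun ε : ℝ =>
            eLpNorm (fun P => θ ε P - approxTemperature ε θbar (θBL ε) P) 2 muO
              + eLpNorm (D ε) 2 muO)
          (𝓝[>] 0) (𝓝 0) := by
  refine ⟨10, 4, by norm_num, by norm_num, fun k s hk hs lam b σ₁ σ₂ θ₁ hlam hb hwind hG hθ₁ u θ θbar
    θBL hu hT hbar hBL => ?_⟩
  obtain ⟨c, hc⟩ := hb.exists_bound
  obtain ⟨K, hw⟩ := hwind.exists_bound hk (by omega)
  obtain ⟨M, hlip⟩ := isLipField_int hb hc hw hwind.compat (by positivity) hG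
  obtain ⟨M₁, hM₁, bθ₁⟩ := hθ₁.exists_ae_bound
  obtain ⟨m₁, gx, gy, wx, wy, mx, my⟩ := id hθ₁
  replace mx := mx.memLp
  replace my := my.memLp
  choose! g₁ g₂ hg hu₁ hu₂ hu₃ using hu
  choose! Tx Ty Tz mTx mTy hTz wTx wTy tT hTeq using hT
  obtain ⟨θz, hθz, tθ, heq⟩ := hbar
  have hB := fun (ε : ℝ) (hε : 0 < ε) => isBoundaryField_layer hb hc hw hε (hg ε hε)
  set m := majorant b c σ₁ σ₂
  have mm : MemLp m 2 muH := memLp_majorant hb hc hw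
  have he0 : Tendsto (fun ε : ℝ => ε) (𝓝[>] 0) (𝓝 0) := tendsto_id.mono_left nhdsWithin_le_nhds
  have hη : Tendsto (fun ε : ℝ => ε ^ (1 / 4 : ℝ) + ε) (𝓝[>] 0) (𝓝 0) := by
    have := (Real.continuousAt_rpow_const 0 (1 / 4 : ℝ) (Or.inr (by norm_num))).tendsto
    rw [Real.zero_rpow (by norm_num)] at this
    simpa using (this.mono_left nhdsWithin_le_nhds).add he0
  have hz : ∀ᵐ P : (ℝ × ℝ) × ℝ ∂muO, P.2 ∈ Ioo (0:ℝ) 1 := ae_muO_mem.mono fun P hP => hP.2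
  have hy : ∀ᵐ P : (ℝ × ℝ) × ℝ ∂muO, P.1.2 ≠ 0 := ae_comp_fst ae_snd_ne_zero
  have main := tendsto_difference ⟨hlip, hlam, m₁, mx, my, wx.eq, wy.eq, bθ₁, hM₁,
    memLp_majorant_mul hb hc hw mx, memLp_majorant_mul hb hc hw my, mm, hθz, tθ, heq⟩ (fun ε hε => (hB ε hε).1) hη
    (squeeze_zero' (.of_forall fun _ => nrm_nonneg _)
      (eventually_mem_nhdsWithin.mono fun ε hε => (hB ε hε).2.1)
      (by simpa using he0.mul_const (nrm muH m)))
    (squeeze_zero' (g := fun ε => 4 * ε * nrm muH m)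
      (eventually_mem_nhdsWithin.mono fun ε hε =>
        div_nonneg (add_nonneg (nrm_nonneg _) (nrm_nonneg _)) (le_of_lt hε))
      (eventually_mem_nhdsWithin.mono fun ε hε => by
        rw [div_le_iff₀ hε]
        exact (hB ε hε).2.2.trans_eq (by ring))
      (by simpa using (he0.const_mul 4).mul_const (nrm muH m)))
    (D := 2 * (7680 * c * (6 * (K * (1 + c ^ 4)))))
    (fun ε hε => hz.mono fun P hP => by
      have h1 := abs_layVert_le hb hc hw hε (Nat.zero_le 2) hP
      have h2 := majorant_le hc hw (Nat.zero_le 5) P.1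
      simp only [pow_zero, one_mul, mul_one] at h1 h2
      linarith)
    (hz.mono fun P hP => by
      refine squeeze_zero_norm' (eventually_mem_nhdsWithin.mono fun ε hε =>
        abs_layVert_le hb hc hw hε one_le_two hP) ?_
      simpa using ((he0.div_const (1 - P.2)).pow 1).mul_const (2 * majorant b c σ₁ σ₂ P.1))
    fun ε hε => ⟨hTz ε hε, mTx ε hε, mTy ε hε, wTx ε hε, wTy ε hε, tT ε hε, fun φ hφ h1 => by
      rw [← hTeq ε hε φ hφ h1]
      refine integral_congr_ae (hy.mono fun P hP => ?_)
      obtain ⟨e1, e2⟩ := layer_horizontal_eq (ε := ε) hb hw P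
      have e3 := layer_vertical_eq (gx := g₁ ε) (gy := g₂ ε) hb hw hε hP
      simp only [hu₁ ε hε, hu₂ ε hε, hu₃ ε hε, ← e1, ← e2, ← e3, vInt, uInt]
      ring⟩
  have hdiff := fun (ε : ℝ) (hε : 0 < ε) => (hTz ε hε).sub hθz
  have trace : ∀ ε, 0 < ε → HasTopTrace (fun P => θ ε P - θbar P) (fun P => Tz ε P - θz P) 0 :=
    fun ε hε => by
      have := HasTopTrace.sub (hTz ε hε).memLp (hTz ε hε).memLp' hθz.memLp hθz.memLp' m₁ m₁
        (tT ε hε) tθ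
      simp only [sub_self] at this
      exact this
  have hL := fun (ε : ℝ) (hε : 0 < ε) => isWeakDz_layTemp hb hc hw hlam hε mx my
  have e : ∀ ε, 0 < ε → (fun P => (θ ε P - θbar P)
      - ε * layTemp b lam σ₁ σ₂ gx gy 3 P.1 ((1 - P.2) / ε))
      =ᵐ[muO] fun P => θ ε P - approxTemperature ε θbar (θBL ε) P := fun ε hε =>
    (ae_eq_layTemp hb hc hw hlam hε (hBL ε hε) mx my wx.eq wy.eq).mono fun P hP => by
      simp only [approxTemperature, hP]; ring
  refine ⟨fun ε P => (Tz ε P - θz P) - layTemp b lam σ₁ σ₂ gx gy 2 P.1 ((1 - P.2) / ε),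
    fun ε hε => ((hdiff ε hε).sub (hL ε hε)).congr (e ε hε), ?_⟩
  have l1 : Tendsto (fun ε => eLpNorm (fun P => Tz ε P - θz P) 2 muO) (𝓝[>] 0) (𝓝 0) := by
    have := (ENNReal.tendsto_ofReal main)
    rw [ENNReal.ofReal_zero] at this
    refine this.congr' (eventually_mem_nhdsWithin.mono fun ε hε => ?_)
    exact ENNReal.ofReal_toReal (hdiff ε hε).memLp'.2.ne
  have l3 := tendsto_layTemp hb hc hw hlam (j := 3) le_rfl mx my
  have l2 := tendsto_layTemp hb hc hw hlam (j := 2) (by norm_num) mx my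
  have tot := (l1.add l3).add (l1.add l2)
  simp only [add_zero] at tot
  refine tendsto_of_tendsto_of_tendsto_of_le_of_le' tendsto_const_nhds tot
    (.of_forall fun _ => zero_le) ?_
  filter_upwards [Ioo_mem_nhdsGT (zero_lt_one' ℝ)] with ε hε
  have d1 := hdiff ε hε.1
  have d2 := hL ε hε.1
  refine add_le_add ?_ ((eLpNorm_sub_le d1.memLp'.1 d2.memLp'.1 one_le_two))
  rw [← eLpNorm_congr_ae (e ε hε.1)]
  refine (eLpNorm_sub_le d1.memLp.1 d2.memLp.1 one_le_two).trans (add_le_add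
    (nrm_le_of_topTrace d1.memLp d1.memLp' (trace ε hε.1)) (eLpNorm_mono fun P => ?_))
  rw [norm_mul, Real.norm_of_nonneg hε.1.le]
  exact mul_le_of_le_one_left (norm_nonneg _) hε.2.le
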